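/- **Setting.** Let $n\ge 3$. Write points of $\mathbb R^{n+1}$ as $(x,z)$ with $x=(x',x_n)\in\mathbb R^{n-1}\times\mathbb R$, and put $\mathbb R^{n+1}_+=\{z\ge 0\}$, $\Pi=\{z=0\}$. The group $\mathrm O(n-1)$ acts on the coordinates $x'$. For $\theta\in(0,\frac{\pi}{2}]$, a *capillary minimal cone with contact angle $\theta$* is a closed cone $\mathbf C\subset\mathbb R^{n+1}_+$ with vertex $0$, $\mathbf C\ne\{0\}$, which is the graph $z=u(x)$ of a function on a subset of $\mathbb R^n$, and such that $\mathbf C\setminus\{0\}$ is a smooth embedded minimal hypersurface with boundary $(\mathbf C\cap\Pi)\setminus\{0\}$ (the boundary may be empty), whose upward unit normal $\nu$ satisfies $\langle\nu,e_z\rangle=\cos\theta$ along this boundary. Here, where the tangent hyperplane is vertical, either unit normal is allowed. It is *flat* if it is contained in a hyperplane through $0$. The *axisymmetric cone* $\mathbf C_{n,1,\theta}$ is $$\mathbf C_{n,1,\theta}=\Bigl\{(x,z): |x_n|\le T|x|,\ z=|x|\,f\bigl(\tfrac{x_n}{|x|}\bigr)\Bigr\}$$ (containing the origin), where $0<T<1$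 and $f\in C^0([-T,T])\cap C^\infty((-T,T))$ is a solution of $$f''+(f-tf')\Bigl(\frac{n-1}{1-t^2}+(n-2)\frac{(f')^2}{1+f^2}\Bigr)=0\quad\text{on }(-T,T)$$ with $f'(0)=0$, $f>0$ on $(-T,T)$, $f(\pm T)=0$, and $\arctan\bigl(\sqrt{1-t^2}\,|f'(t)|\bigr)\to\theta$ as $t\uparrow T$. **Theorem.** (1) For every $\theta\in(0,\frac{\pi}{2}]$ the cone $\mathbf C_{n,1,\theta}$ exists and is uniquely determined by these conditions, and it is the unique $\mathrm O(n-1)$-invariant non-flat capillary minimal cone in $\mathbb R^{n+1}_+$ with contact angle $\theta$. (2) The nonempty closed (that is, compact without boundary) smooth embedded minimal hypersurfaces of $\mathbb S^n\subset\mathbb R^{n+1}$ that are invariant under $\mathrm O(n-1)$ are exactly the Clifford torus $$\mathbb S^{n-2}\Bigl(\sqrt{\tfrac{n-2}{n-1}}\Bigr)\times\mathbb S^1\Bigl(\sqrt{\tfrac1{n-1}}\Bigr)=\Bigl\{|x'|=\sqrt{\tfrac{n-2}{n-1}},\ \sqrt{x_n^2+z^2}=\sqrt{\tfrac1{n-1}}\Bigr\}$$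 and the equatorial spheres $\mathbb S^n\cap\{a x_n+b z=0\}$ with $a^2+b^2=1$, that is, the equator $\mathbb S^n\cap\{z=0\}$ and its rotations in the $(x_n,z)$-plane. -/

import Mathlib

open Set Filter Topology
open scoped ContDiff RealInnerProductSpace

noncomputable section

namespace CapillaryCone

/-- The Euclidean space `ℝⁿ⁺¹ = ℝⁿ⁻¹ × ℝ × ℝ`, whose points are written `(x', xₙ, z)`. -/
abbrev Ambient (n : ℕ) : Type := EuclideanSpace ℝ (Fin (n + 1))

/-- The last coordinate `z` of a point `(x', xₙ, z)`. -/
def height {n : ℕ} (p : Ambient n) : ℝ := p (Fin.last n)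

/-- The coordinate `xₙ` of a point `(x', xₙ, z)`. -/
def axial {n : ℕ} (p : Ambient n) : ℝ := p ⟨n - 1, by omega⟩

/-- The projection `(x', xₙ, z) ↦ (x', xₙ)` onto `ℝⁿ`. -/
def base {n : ℕ} (p : Ambient n) : EuclideanSpace ℝ (Fin n) :=
  WithLp.toLp 2 (fun i => p i.castSucc)

/-- Invariance under the group `O(n-1)` of linear isometries of `ℝⁿ⁺¹` that act on the
coordinates `x'` only. -/
def IsAxisymmetric {n : ℕ} (C : Set (Ambient n)) : Prop :=
  ∀ A : Ambient n ≃ₗᵢ[ℝ] Ambient n,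
    (∀ p, axial (A p) = axial p) → (∀ p, height (A p) = height p) → A '' C = C

/-- A set is flat if it lies in a hyperplane through the origin. -/
def IsFlat {n : ℕ} (C : Set (Ambient n)) : Prop :=
  ∃ v : Ambient n, v ≠ 0 ∧ ∀ p ∈ C, ⟪v, p⟫ = 0

/-! ### Hypersurfaces of Euclidean space and capillary cones -/

/-- The unit normal field `∇F / |∇F|` of the level sets of `F`. -/
def unitNormal {n : ℕ} (F : Ambient n → ℝ) (q : Ambient n) : Ambient n :=
  ‖gradient F q‖⁻¹ • gradient F q

/-- The mean curvature `div (∇F / |∇F|)` at `q` of the level set of `F` through `q`. -/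
def meanCurvature {n : ℕ} (F : Ambient n → ℝ) (q : Ambient n) : ℝ :=
  LinearMap.trace ℝ (Ambient n) (fderiv ℝ (unitNormal F) q).toLinearMap

/-- `C` is a capillary minimal cone in the half-space `{z ≥ 0}` with contact angle `θ` along
`Π = {z = 0}`: a closed cone which is the graph `z = u(x', xₙ)` of a function on a subset of `ℝⁿ`
and which, away from the origin, is a smooth embedded minimal hypersurface with boundary
`C ∩ Π`, meeting `Π` at the angle `θ` there.

Near each of its nonzero points `C` is the part in `{z ≥ 0}` of a regular level set `{F = 0}`.
The upward unit normal of the graph is `± ∇F / |∇F|`, and its inner product with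
`e_z` is `cos θ` on the boundary. For `0 < θ ≤ π / 2` the level set is therefore transverse to
`Π`, so that every nonzero point of `C ∩ Π` is a boundary point. -/
structure IsCapillaryMinimalCone (n : ℕ) (θ : ℝ) (C : Set (Ambient n)) : Prop where
  isClosed : IsClosed C
  exists_ne_zero : ∃ p ∈ C, p ≠ 0
  smul_mem : ∀ r : ℝ, 0 ≤ r → ∀ p ∈ C, r • p ∈ C
  height_nonneg : ∀ p ∈ C, 0 ≤ height p
  isGraph : ∃ (D : Set (EuclideanSpace ℝ (Fin n))) (u : EuclideanSpace ℝ (Fin n) → ℝ),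
    C = {p | base p ∈ D ∧ height p = u (base p)}
  isMinimal : ∀ p ∈ C, p ≠ 0 → ∃ (U : Set (Ambient n)) (F : Ambient n → ℝ),
    IsOpen U ∧ p ∈ U ∧ ContDiffOn ℝ ∞ F U ∧
    C ∩ U = {q | q ∈ U ∧ 0 ≤ height q ∧ F q = 0} ∧
    (∀ q ∈ C ∩ U, gradient F q ≠ 0 ∧ meanCurvature F q = 0) ∧
    (∀ q ∈ C ∩ U, height q = 0 → |height (unitNormal F q)| = Real.cos θ)

/-! ### The axisymmetric cones -/

/-- `f` is the profile on `[-T, T]` of the axisymmetric capillary cone of angle `θ`: the positive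
solution of the axisymmetric minimal cone equation
`f'' + (f - t f') ((n-1)/(1-t²) + (n-2) f'²/(1+f²)) = 0` on `(-T, T)` with `f'(0) = 0`, which
vanishes at `±T` with `√(1-t²) |f'(t)| → tan θ` (that is, `→ ∞` if `θ = π / 2`). -/
structure IsAxisymmetricProfile (n : ℕ) (θ T : ℝ) (f : ℝ → ℝ) : Prop where
  T_pos : 0 < T
  T_lt_one : T < 1
  continuousOn : ContinuousOn f (Icc (-T) T)
  contDiffOn : ContDiffOn ℝ ∞ f (Ioo (-T) T)
  pos : ∀ t ∈ Ioo (-T) T, 0 < f t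
  deriv_zero : deriv f 0 = 0
  equation : ∀ t ∈ Ioo (-T) T,
    deriv (deriv f) t + (f t - t * deriv f t) *
      (((n : ℝ) - 1) / (1 - t ^ 2) + ((n : ℝ) - 2) * (deriv f t) ^ 2 / (1 + f t ^ 2)) = 0
  left_zero : f (-T) = 0
  right_zero : f T = 0
  angle : Tendsto (fun t => Real.arctan (√(1 - t ^ 2) * |deriv f t|)) (𝓝[<] T) (𝓝 θ)

/-- The cone `z = |x| f(xₙ / |x|)` over `{x ∈ ℝⁿ : |xₙ| ≤ T |x|}`, where `x = (x', xₙ)`. -/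
def profileCone (n : ℕ) (T : ℝ) (f : ℝ → ℝ) : Set (Ambient n) :=
  {p | |axial p| ≤ T * ‖base p‖ ∧ height p = ‖base p‖ * f (axial p / ‖base p‖)}

/-- `C` is the axisymmetric cone `C_{n,1,θ}`. -/
def IsAxisymmetricCone (n : ℕ) (θ : ℝ) (C : Set (Ambient n)) : Prop :=
  ∃ (T : ℝ) (f : ℝ → ℝ), IsAxisymmetricProfile n θ T f ∧ C = profileCone n T f

/-! ### Hypersurfaces of the sphere -/

/-- The component of `∇F` orthogonal to the position vector; at points of the unit sphere this
is the gradient on the sphere of the restriction of `F`. -/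
def sphereGradient {n : ℕ} (F : Ambient n → ℝ) (q : Ambient n) : Ambient n :=
  gradient F q - ⟪gradient F q, q⟫ • q

/-- The unit normal field `∇ˢF / |∇ˢF|`, tangent to the sphere, of the level sets of `F` in the
sphere. -/
def sphereNormal {n : ℕ} (F : Ambient n → ℝ) (q : Ambient n) : Ambient n :=
  ‖sphereGradient F q‖⁻¹ • sphereGradient F q

/-- The mean curvature in the unit sphere `𝕊ⁿ`, at `q ∈ 𝕊ⁿ`, of the level set of `F`: the
divergence along `T_q 𝕊ⁿ = q^⊥` of the unit normal field, which is the full trace of its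
derivative minus the contribution of the unit vector `q`. -/
def sphereMeanCurvature {n : ℕ} (F : Ambient n → ℝ) (q : Ambient n) : ℝ :=
  LinearMap.trace ℝ (Ambient n) (fderiv ℝ (sphereNormal F) q).toLinearMap
    - ⟪fderiv ℝ (sphereNormal F) q q, q⟫

/-- `S` is a nonempty closed (compact without boundary) smooth embedded minimal hypersurface of
the unit sphere `𝕊ⁿ ⊆ ℝⁿ⁺¹`. -/
structure IsClosedMinimalHypersurface (n : ℕ) (S : Set (Ambient n)) : Prop where
  isCompact : IsCompact S
  nonempty : S.Nonempty
  norm_eq_one : ∀ p ∈ S, ‖p‖ = 1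
  isMinimal : ∀ p ∈ S, ∃ (U : Set (Ambient n)) (F : Ambient n → ℝ),
    IsOpen U ∧ p ∈ U ∧ ContDiffOn ℝ ∞ F U ∧
    S ∩ U = {q | q ∈ U ∧ ‖q‖ = 1 ∧ F q = 0} ∧
    (∀ q ∈ S ∩ U, sphereGradient F q ≠ 0 ∧ sphereMeanCurvature F q = 0)

/-- The Clifford torus `𝕊ⁿ⁻²(√((n-2)/(n-1))) × 𝕊¹(√(1/(n-1)))`. -/
def cliffordTorus (n : ℕ) : Set (Ambient n) :=
  {p | √(∑ i ∈ Finset.univ.filter (fun i : Fin (n + 1) => (i : ℕ) < n - 1), p i ^ 2)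
        = √(((n : ℝ) - 2) / ((n : ℝ) - 1)) ∧
      √(axial p ^ 2 + height p ^ 2) = √(1 / ((n : ℝ) - 1))}

/-- The equatorial sphere `𝕊ⁿ ∩ {a xₙ + b z = 0}`; for `(a, b) = (0, 1)` it is the equator
`𝕊ⁿ ∩ {z = 0}`, and the others are its rotations in the `(xₙ, z)`-plane. -/
def equatorialSphere (n : ℕ) (a b : ℝ) : Set (Ambient n) :=
  {p | ‖p‖ = 1 ∧ a * axial p + b * height p = 0}

end CapillaryCone

end

open CapillaryCone

/-!
Write `ρ = |x'|` and `(xₙ, z) = r (sin φ, cos φ)`. Off the axes an axisymmetric cone is described by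
the ratio `ρ / r` as a function of the angle `φ`, and the cone `ρ = r u(φ)` is minimal exactly when,
with `m = n - 2`,
`u'' + u = m (1 + u² + u'²) / (u (1 + u²))` (`IsAxiCone.meanCurvature_eq_zero_iff`).
A first integral keeps `u` away from `0` and `∞`, so positive solutions are global
(`exists_isOrbit`), and the theorem becomes a question about this autonomous equation.

*Solutions.* The linearised equation has the solution `u'`. The stretchings of the coordinates `xₙ`
and `z`, and a shear in the `(xₙ, z)`-plane, solve it up to an error term whose sign is known, which
makes comparison through Wronskians possible. For the even solution with `u(0) = a > √m` this gives
that `u' < 0` on `(0, π / 2]` and, differentiating in `a`, that the slope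
`-u' / √(1 + u²)` at `π / 2` is strictly increasing in `a` (`IsOrbit.variation_slope_neg`,
`strictMonoOn_slope`). It vanishes at `a = √m` and is unbounded (`exists_slope_ge`),
and so takes each value `cos θ / sin θ ≥ 0` exactly once. Dividing `u'` by `(u / √(1 + u²))ᵐ` turns
the linearised equation into `y'' + (1 + W) y = 0` with a potential `W > 0`; by Sturm comparison
consecutive zeros of `u'` have a distance less than `π`, while a comparison of `y` with its
reflection controls the distance of consecutive maxima. Hence a solution with the same contact
angle at `-π / 2` and `π / 2` is even (`IsOrbit.even_of_contact`), and a `2π`-periodic solution is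
the constant `√m` (`IsOrbit.eq_const_of_periodic`), whose cone is the cone over the Clifford torus.

*Geometry.* Let `C` be an axisymmetric minimal cone. Near a point off the axes at which `C` is
not tangent to the radial direction of `x'`, `C` is an arc `ρ = r u(φ)`, and it then contains the
whole arc of the global solution, as far as the ambient open set reaches
(`IsMinimalConeIn.arc_mem`). At the other points, provided that the slopes of the arcs are bounded,
`C` contains the full half-plane `φ = const` (`IsMinimalConeIn.ray_mem`), which is called a ray
below, and rays cannot coexist with an arc
(`IsMinimalConeIn.false_of_arc_of_ray`). A capillary cone without arcs is flat; otherwise it is the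
closure of the cone over a single arc, since it is a graph, and the contact angle prescribes the slopes at
`±π / 2` up to sign, with the signs again determined by the graph property
(`IsCapillaryMinimalCone.exists_contactOrbit`). The cone over a closed minimal hypersurface of the
sphere has no boundary, so an arc in it closes up with period `2π` and is the constant solution,
while without arcs it is a single hyperplane containing the `x'`-space
(`IsClosedMinimalHypersurface.eq_cliffordTorus_or`).

*The profile.* Along an arc put `t = sin φ / √(u² + sin² φ)` and `f = cos φ / √(u² + sin² φ)`. These
are `xₙ / |x|` and `z / |x|` on the cone, and this change of variables identifies the profiles `f`
with the even solutions of the prescribed contact angle, in both directions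
(`IsContactOrbit.exists_profile`, `IsAxisymmetricProfile.exists_contactOrbit`).
-/

open Set Filter Topology
open scoped ContDiff RealInnerProductSpace

noncomputable section

namespace CapillaryCone

/-! ### Global solutions of ordinary differential equations -/

/-- Uniqueness on a compact interval for the initial value problem, the initial time being any
point of the interval. -/
theorem ode_eqOn_Icc {E : Type*} [NormedAddCommGroup E] [NormedSpace ℝ E] {v : ℝ → E → E}
    {s : Set E} {K : NNReal} {a b t₀ : ℝ} {f g : ℝ → E}
    (hv : ∀ t ∈ Icc a b, LipschitzOnWith K (v t) s) (ht₀ : t₀ ∈ Icc a b)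
    (hf : ∀ t ∈ Icc a b, HasDerivWithinAt f (v t (f t)) (Icc a b) t) (hfs : ∀ t ∈ Icc a b, f t ∈ s)
    (hg : ∀ t ∈ Icc a b, HasDerivWithinAt g (v t (g t)) (Icc a b) t) (hgs : ∀ t ∈ Icc a b, g t ∈ s)
    (h0 : f t₀ = g t₀) : EqOn f g (Icc a b) := by
  have hfc : ContinuousOn f (Icc a b) := fun t ht => (hf t ht).continuousWithinAt
  have hgc : ContinuousOn g (Icc a b) := fun t ht => (hg t ht).continuousWithinAt
  have hr : ∀ t ∈ Ico t₀ b, t ∈ Icc a b := fun t ht => ⟨ht₀.1.trans ht.1, ht.2.le⟩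
  have hl : ∀ t ∈ Ioc a t₀, t ∈ Icc a b := fun t ht => ⟨ht.1.le, ht.2.trans ht₀.2⟩
  have hrm : ∀ t ∈ Ico t₀ b, Icc a b ∈ 𝓝[≥] t := fun t ht =>
    mem_of_superset (Icc_mem_nhdsGE ht.2) (Icc_subset_Icc (ht₀.1.trans ht.1) le_rfl)
  have hlm : ∀ t ∈ Ioc a t₀, Icc a b ∈ 𝓝[≤] t := fun t ht =>
    mem_of_superset (Icc_mem_nhdsLE ht.1) (Icc_subset_Icc le_rfl (ht.2.trans ht₀.2))
  rw [← Icc_union_Icc_eq_Icc ht₀.1 ht₀.2]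
  refine EqOn.union ?_ ?_
  · exact ODE_solution_unique_of_mem_Icc_left (s := fun _ => s) (fun t ht => hv t (hl t ht))
      (hfc.mono (Icc_subset_Icc_right ht₀.2))
      (fun t ht => (hf t (hl t ht)).mono_of_mem_nhdsWithin (hlm t ht))
      (fun t ht => hfs t (hl t ht)) (hgc.mono (Icc_subset_Icc_right ht₀.2))
      (fun t ht => (hg t (hl t ht)).mono_of_mem_nhdsWithin (hlm t ht))
      (fun t ht => hgs t (hl t ht)) h0
  · exact ODE_solution_unique_of_mem_Icc_right (s := fun _ => s) (fun t ht => hv t (hr t ht))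
      (hfc.mono (Icc_subset_Icc_left ht₀.1))
      (fun t ht => (hf t (hr t ht)).mono_of_mem_nhdsWithin (hrm t ht))
      (fun t ht => hfs t (hr t ht)) (hgc.mono (Icc_subset_Icc_left ht₀.1))
      (fun t ht => (hg t (hr t ht)).mono_of_mem_nhdsWithin (hrm t ht))
      (fun t ht => hgs t (hr t ht)) h0

/-- Coordinatewise truncation of a vector of the plane to the square of half-side `R`. -/
def clampPair (R : ℝ) (x : ℝ × ℝ) : ℝ × ℝ := (max (-R) (min R x.1), max (-R) (min R x.2))

theorem lipschitzWith_clampPair (R : ℝ) : LipschitzWith 1 (clampPair R) := by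
  have h : LipschitzWith 1 fun r : ℝ => max (-R) (min R r) :=
    (LipschitzWith.id.const_min R).const_max (-R)
  have h2 := (h.comp LipschitzWith.prod_fst).prodMk (h.comp LipschitzWith.prod_snd)
  rw [max_self, one_mul] at h2
  exact h2

theorem norm_clampPair_le {R : ℝ} (hR : 0 ≤ R) (x : ℝ × ℝ) : ‖clampPair R x‖ ≤ R := by
  have h : ∀ r : ℝ, |max (-R) (min R r)| ≤ R := fun r => by
    rw [abs_le]; constructor
    · exact le_max_left _ _
    · exact max_le (by linarith) (min_le_left _ _)
  simpa [clampPair, Prod.norm_def] using ⟨h _, h _⟩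

theorem norm_clampPair_le_norm {R : ℝ} (hR : 0 ≤ R) (x : ℝ × ℝ) : ‖clampPair R x‖ ≤ ‖x‖ := by
  have h : ∀ r : ℝ, |max (-R) (min R r)| ≤ |r| := fun r => by
    rw [abs_le]; constructor
    · rcases le_total R r with h | h
      · rw [min_eq_left h]
        exact le_trans (by linarith [abs_nonneg r]) (le_max_right _ _)
      · rw [min_eq_right h]; exact (neg_abs_le r).trans (le_max_right _ _)
    · exact max_le (by linarith [abs_nonneg r]) ((min_le_right _ _).trans (le_abs_self r))
  have h1 := h x.1
  have h2 := h x.2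
  rw [Prod.norm_def, Prod.norm_def]
  exact max_le_max h1 h2

theorem clampPair_eq_self {R : ℝ} {x : ℝ × ℝ} (hx : ‖x‖ ≤ R) : clampPair R x = x := by
  rw [Prod.norm_def, max_le_iff, Real.norm_eq_abs, Real.norm_eq_abs, abs_le, abs_le] at hx
  ext
  · simp [clampPair, hx.1.2, hx.1.1]
  · simp [clampPair, hx.2.2, hx.2.1]

/-- A vector field which is globally Lipschitz in space has solutions on every compact interval.
The truncated field is bounded, so that Picard-Lindelöf applies on the whole interval, and
Grönwall's inequality bounds its solution independently of the truncation. -/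
theorem exists_solution_Icc {v : ℝ → ℝ × ℝ → ℝ × ℝ} {K : NNReal}
    (hv : ∀ t, LipschitzWith K (v t)) (hc : ∀ x, Continuous fun t => v t x) (x₀ : ℝ × ℝ)
    {L : ℝ} (hL : 0 < L) :
    ∃ x : ℝ → ℝ × ℝ, x 0 = x₀ ∧
      ∀ t ∈ Icc (-L) L, HasDerivWithinAt x (v t (x t)) (Icc (-L) L) t := by
  obtain ⟨C, hC⟩ := (isCompact_Icc (a := -L) (b := L)).exists_bound_of_continuousOn
    (hc 0).continuousOn
  have hC0 : 0 ≤ C := (norm_nonneg _).trans (hC 0 ⟨by linarith, hL.le⟩)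
  have hgrow : ∀ t ∈ Icc (-L) L, ∀ y, ‖v t y‖ ≤ K * ‖y‖ + C := fun t ht y => by
    have h1 := (hv t).dist_le_mul y 0
    rw [dist_eq_norm, dist_zero_right] at h1
    calc ‖v t y‖ = ‖(v t y - v t 0) + v t 0‖ := by congr 1; abel
      _ ≤ ‖v t y - v t 0‖ + ‖v t 0‖ := norm_add_le _ _
      _ ≤ _ := add_le_add h1 (hC t ht)
  set R : ℝ := gronwallBound ‖x₀‖ K C L with hR
  have hmono : ∀ t ∈ Icc 0 L, gronwallBound ‖x₀‖ K C t ≤ R := fun t ht =>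
    gronwallBound_mono (norm_nonneg _) hC0 K.2 ht.2
  have hR0 : 0 ≤ R := by
    refine le_trans (norm_nonneg x₀) ?_
    have := hmono 0 ⟨le_rfl, hL.le⟩
    rwa [gronwallBound_x0] at this
  set B : ℝ := K * R + C with hB
  have hB0 : 0 ≤ B := add_nonneg (mul_nonneg K.2 hR0) hC0
  let A : ℝ := B * L
  have hA0 : 0 ≤ A := mul_nonneg hB0 hL.le
  have hpl : IsPicardLindelof (fun t y => v t (clampPair R y)) (tmin := -L) (tmax := L)
      ⟨0, by constructor <;> linarith⟩ x₀ ⟨A, hA0⟩ 0 ⟨B, hB0⟩ K := by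
    refine ⟨fun t _ => ?_, fun y _ => (hc _).continuousOn, fun t ht y _ => ?_, ?_⟩
    · have := (hv t).comp (lipschitzWith_clampPair R)
      rw [mul_one] at this
      exact this.lipschitzOnWith
    · refine (hgrow t ht _).trans ?_
      exact add_le_add (mul_le_mul_of_nonneg_left (norm_clampPair_le hR0 y) K.2) le_rfl
    · simp only [sub_zero, zero_sub, neg_neg, max_self, NNReal.coe_zero]
      exact le_rfl
  obtain ⟨x, hx0, hx⟩ := hpl.exists_eq_forall_mem_Icc_hasDerivWithinAt₀
  refine ⟨x, hx0, ?_⟩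
  have hxc : ContinuousOn x (Icc (-L) L) := fun t ht => (hx t ht).continuousWithinAt
  have hbd : ∀ t ∈ Icc (-L) L, ‖v t (clampPair R (x t))‖ ≤ K * ‖x t‖ + C := fun t ht =>
    (hgrow t ht _).trans
      (add_le_add (mul_le_mul_of_nonneg_left (norm_clampPair_le_norm hR0 _) K.2) le_rfl)
  have hpos : ∀ t ∈ Icc 0 L, ‖x t‖ ≤ R := fun t ht => by
    refine le_trans ?_ (hmono t ht)
    have := norm_le_gronwallBound_of_norm_deriv_right_le (f := x)
      (f' := fun t => v t (clampPair R (x t))) (δ := ‖x₀‖) (K := K) (ε := C) (a := 0) (b := L)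
      (hxc.mono (Icc_subset_Icc_left (by linarith)))
      (fun s hs => (hx s ⟨by linarith [hs.1], hs.2.le⟩).mono_of_mem_nhdsWithin
        (mem_of_superset (Icc_mem_nhdsGE hs.2) (Icc_subset_Icc (by linarith [hs.1]) le_rfl)))
      (by simp at hx0; rw [hx0]) (fun s hs => hbd s ⟨by linarith [hs.1], hs.2.le⟩) t ht
    simpa using this
  have hneg : ∀ t ∈ Icc 0 L, ‖x (-t)‖ ≤ R := fun t ht => by
    refine le_trans ?_ (hmono t ht)
    have := norm_le_gronwallBound_of_norm_deriv_right_le (f := fun s => x (-s))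
      (f' := fun t => -v (-t) (clampPair R (x (-t)))) (δ := ‖x₀‖) (K := K) (ε := C)
      (a := 0) (b := L)
      (hxc.comp continuousOn_neg (fun s hs => ⟨by linarith [hs.2], by linarith [hs.1]⟩))
      (fun s hs => by
        have h1 : HasDerivWithinAt x (v (-s) (clampPair R (x (-s)))) (Iic (-s)) (-s) :=
          (hx (-s) ⟨by linarith [hs.2], by linarith [hs.1]⟩).mono_of_mem_nhdsWithin
            (mem_of_superset (Icc_mem_nhdsLE (by linarith [hs.2] : -L < -s))
              (Icc_subset_Icc le_rfl (by linarith [hs.1])))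
        have h2 := h1.scomp s (hasDerivAt_neg s).hasDerivWithinAt
          (show MapsTo (fun r : ℝ => -r) (Ici s) (Iic (-s)) from
            fun r hr => neg_le_neg (mem_Ici.1 hr))
        simpa [Function.comp_def] using h2)
      (by simp at hx0; simp [hx0])
      (fun s hs => by
        rw [norm_neg]; exact hbd (-s) ⟨by linarith [hs.2], by linarith [hs.1]⟩) t ht
    simpa using this
  intro t ht
  have hxt : ‖x t‖ ≤ R := by
    rcases le_total 0 t with h | h
    · exact hpos t ⟨h, ht.2⟩
    · simpa using hneg (-t) ⟨by linarith, by linarith [ht.1]⟩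
  have := hx t ht
  simp only [clampPair_eq_self hxt] at this
  exact this

/-- A vector field which is globally Lipschitz in space has global solutions. -/
theorem exists_global_solution {v : ℝ → ℝ × ℝ → ℝ × ℝ} {K : NNReal}
    (hv : ∀ t, LipschitzWith K (v t)) (hc : ∀ x, Continuous fun t => v t x) (x₀ : ℝ × ℝ) :
    ∃ x : ℝ → ℝ × ℝ, x 0 = x₀ ∧ ∀ t, HasDerivAt x (v t (x t)) t := by
  have hex := fun k : ℕ => exists_solution_Icc hv hc x₀ (L := (k : ℝ) + 1) (by positivity)
  choose y hy0 hy using hex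
  have hmono : ∀ j k : ℕ, j ≤ k → EqOn (y j) (y k) (Icc (-((j : ℝ) + 1)) (j + 1)) := by
    intro j k hjk
    have hsub : Icc (-((j : ℝ) + 1)) (j + 1) ⊆ Icc (-((k : ℝ) + 1)) (k + 1) := by
      have : (j : ℝ) ≤ k := by exact_mod_cast hjk
      exact Icc_subset_Icc (by linarith) (by linarith)
    have hj : (0 : ℝ) ≤ j := j.cast_nonneg
    exact ode_eqOn_Icc (s := univ) (v := v) (t₀ := 0) (fun t _ => (hv t).lipschitzOnWith)
      ⟨by linarith, by linarith⟩ (hy j) (fun _ _ => trivial)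
      (fun t ht => (hy k t (hsub ht)).mono hsub) (fun _ _ => trivial) (by rw [hy0, hy0])
  refine ⟨fun t => y ⌈|t|⌉₊ t, by simp [hy0], fun t => ?_⟩
  set k := ⌈|t|⌉₊ with hk
  have htk : |t| ≤ k := Nat.le_ceil _
  have hmem : Icc (-(((k + 1 : ℕ) : ℝ) + 1)) ((k + 1 : ℕ) + 1) ∈ 𝓝 t := by
    push_cast
    exact Icc_mem_nhds (by linarith [neg_abs_le t]) (by linarith [le_abs_self t])
  have h1 := (hy (k + 1) t (mem_of_mem_nhds hmem)).hasDerivAt hmem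
  have hev : (fun s => y ⌈|s|⌉₊ s) =ᶠ[𝓝 t] y (k + 1) := by
    have : ∀ᶠ s : ℝ in 𝓝 t, |s| < (k : ℝ) + 1 :=
      continuous_abs.continuousAt.eventually_lt continuousAt_const (by linarith)
    filter_upwards [this] with s hs
    have hle : ⌈|s|⌉₊ ≤ k + 1 := Nat.ceil_le.2 (by push_cast; exact hs.le)
    refine hmono _ _ hle ?_
    have := Nat.le_ceil |s|
    exact ⟨by linarith [neg_abs_le s], by linarith [le_abs_self s]⟩
  have heq := hev.eq_of_nhds
  rw [← heq] at h1
  exact h1.congr_of_eventuallyEq hev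

/-! ### The profile equation in polar coordinates -/

/-- The right-hand side of the minimal cone equation `u'' + u = force m u u'` for the cone
`|x'| = r u(φ)` in `ℝᵐ⁺¹ × ℝ²`, where `(xₙ, z) = r (sin φ, cos φ)`. -/
def force (m : ℕ) (u v : ℝ) : ℝ := m * (1 + u ^ 2 + v ^ 2) / (u * (1 + u ^ 2))

/-- A positive global solution `u`, with derivative `v`, of the polar minimal cone equation. -/
structure IsOrbit (m : ℕ) (u v : ℝ → ℝ) : Prop where
  pos : ∀ s, 0 < u s
  hasDerivAt_fst : ∀ s, HasDerivAt u (v s) s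
  hasDerivAt_snd : ∀ s, HasDerivAt v (force m (u s) (v s) - u s) s

/-- The integrating factor of the linearised equation; it equals `ρ ^ (-2m)`, where `ρ = |x'|` is
evaluated on the unit sphere. -/
def weight (m : ℕ) (u : ℝ) : ℝ := ((1 + u ^ 2) / u ^ 2) ^ m

theorem weight_pos (m : ℕ) {u : ℝ} (hu : 0 < u) : 0 < weight m u := by
  unfold weight; positivity

theorem hasDerivAt_weight (m : ℕ) {u : ℝ → ℝ} {v s : ℝ} (hu : 0 < u s) (h : HasDerivAt u v s) :
    HasDerivAt (fun s => weight m (u s)) (-(2 * m * v / (u s * (1 + u s ^ 2))) * weight m (u s))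
      s := by
  unfold weight
  have h1 : HasDerivAt (fun s => (1 + u s ^ 2) / u s ^ 2)
      (((2 * u s * v) * u s ^ 2 - (1 + u s ^ 2) * (2 * u s * v)) / (u s ^ 2) ^ 2) s := by
    have h2 : HasDerivAt (fun s => u s ^ 2) (2 * u s * v) s := by simpa using h.fun_pow 2
    exact (h2.const_add 1).div h2 (by positivity)
  rcases m with _ | k
  · simpa using hasDerivAt_const s (1 : ℝ)
  · have h3 := h1.fun_pow (k + 1)
    refine h3.congr_deriv ?_
    have hne : u s ≠ 0 := hu.ne'
    have hne2 : (1 + u s ^ 2) ≠ 0 := by positivity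
    rw [Nat.add_sub_cancel, pow_succ ((1 + u s ^ 2) / u s ^ 2) k]
    generalize ((1 + u s ^ 2) / u s ^ 2) ^ k = P
    push_cast
    field_simp
    ring

/-- The first integral of the polar equation, the Clairaut integral of the underlying
rotationally symmetric geodesic problem. -/
def energy (m : ℕ) (u v : ℝ) : ℝ := (1 + u ^ 2 + v ^ 2) * weight m u

theorem IsOrbit.hasDerivAt_energy {m : ℕ} {u v : ℝ → ℝ} (h : IsOrbit m u v) (s : ℝ) :
    HasDerivAt (fun s => energy m (u s) (v s)) 0 s := by
  have hw := hasDerivAt_weight m (h.pos s) (h.hasDerivAt_fst s)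
  have h1 : HasDerivAt (fun s => 1 + u s ^ 2 + v s ^ 2)
      (2 * u s * v s + 2 * v s * (force m (u s) (v s) - u s)) s := by
    have ha : HasDerivAt (fun s => u s ^ 2) (2 * u s * v s) s := by
      simpa using (h.hasDerivAt_fst s).fun_pow 2
    have hb : HasDerivAt (fun s => v s ^ 2) (2 * v s * (force m (u s) (v s) - u s)) s := by
      simpa using (h.hasDerivAt_snd s).fun_pow 2
    exact (ha.const_add 1).add hb
  refine (h1.mul hw).congr_deriv ?_
  have hne : u s ≠ 0 := (h.pos s).ne'
  have hne2 : (1 + u s ^ 2) ≠ 0 := by positivity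
  unfold force
  field_simp
  ring

theorem IsOrbit.energy_eq {m : ℕ} {u v : ℝ → ℝ} (h : IsOrbit m u v) (s t : ℝ) :
    energy m (u s) (v s) = energy m (u t) (v t) :=
  is_const_of_deriv_eq_zero (fun s => (h.hasDerivAt_energy s).differentiableAt)
    (fun s => (h.hasDerivAt_energy s).deriv) s t

theorem IsOrbit.continuous_fst {m : ℕ} {u v : ℝ → ℝ} (h : IsOrbit m u v) : Continuous u :=
  continuous_iff_continuousAt.2 fun s => (h.hasDerivAt_fst s).continuousAt

theorem IsOrbit.continuous_snd {m : ℕ} {u v : ℝ → ℝ} (h : IsOrbit m u v) : Continuous v :=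
  continuous_iff_continuousAt.2 fun s => (h.hasDerivAt_snd s).continuousAt

theorem IsOrbit.shift {m : ℕ} {u v : ℝ → ℝ} (h : IsOrbit m u v) (d : ℝ) :
    IsOrbit m (fun s => u (s + d)) (fun s => v (s + d)) :=
  ⟨fun _ => h.pos _, fun s => (h.hasDerivAt_fst (s + d)).comp_add_const s d,
    fun s => (h.hasDerivAt_snd (s + d)).comp_add_const s d⟩

theorem IsOrbit.reflect {m : ℕ} {u v : ℝ → ℝ} (h : IsOrbit m u v) (d : ℝ) :
    IsOrbit m (fun s => u (d - s)) (fun s => -v (d - s)) := by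
  refine ⟨fun _ => h.pos _, fun s => (h.hasDerivAt_fst (d - s)).comp_const_sub d s, fun s => ?_⟩
  have := ((h.hasDerivAt_snd (d - s)).comp_const_sub d s).neg
  refine this.congr_deriv ?_
  simp [force]

/-- Smoothness of solutions, by bootstrapping. -/
theorem IsOrbit.contDiff {m : ℕ} {u v : ℝ → ℝ} (h : IsOrbit m u v) :
    ContDiff ℝ ∞ u ∧ ContDiff ℝ ∞ v := by
  have key : ∀ k : ℕ, ContDiff ℝ k u ∧ ContDiff ℝ k v := by
    intro k
    induction k with
    | zero => exact ⟨contDiff_zero.2 h.continuous_fst, contDiff_zero.2 h.continuous_snd⟩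
    | succ k ih =>
      have hu : deriv u = v := funext fun s => (h.hasDerivAt_fst s).deriv
      have hv : deriv v = fun s => force m (u s) (v s) - u s :=
        funext fun s => (h.hasDerivAt_snd s).deriv
      refine ⟨?_, ?_⟩
      · push_cast
        rw [contDiff_succ_iff_deriv, hu]
        exact ⟨fun s => (h.hasDerivAt_fst s).differentiableAt, by simp, ih.2⟩
      · push_cast
        rw [contDiff_succ_iff_deriv, hv]
        refine ⟨fun s => (h.hasDerivAt_snd s).differentiableAt, by simp, ?_⟩
        unfold force
        refine ContDiff.sub (ContDiff.div ?_ ?_ fun s => ?_) ih.1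
        · exact contDiff_const.mul ((contDiff_const.add (ih.1.pow 2)).add (ih.2.pow 2))
        · exact ih.1.mul (contDiff_const.add (ih.1.pow 2))
        · have := h.pos s
          positivity
  exact ⟨contDiff_infty.2 fun k => (key k).1, contDiff_infty.2 fun k => (key k).2⟩

theorem IsOrbit.one_add_sq_le_energy {m : ℕ} {u v : ℝ → ℝ} (h : IsOrbit m u v) (s : ℝ) :
    1 + u s ^ 2 + v s ^ 2 ≤ energy m (u s) (v s) := by
  have hu := h.pos s
  have : 1 ≤ weight m (u s) := by
    unfold weight
    refine one_le_pow₀ ?_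
    rw [one_le_div (by positivity)]
    linarith
  unfold energy
  nlinarith [sq_nonneg (u s), sq_nonneg (v s)]

theorem IsOrbit.one_le_energy_mul_sq {m : ℕ} (hm : 1 ≤ m) {u v : ℝ → ℝ} (h : IsOrbit m u v)
    (s : ℝ) : 1 ≤ energy m (u s) (v s) * u s ^ 2 := by
  have hu := h.pos s
  have h1 : (1 + u s ^ 2) / u s ^ 2 ≤ weight m (u s) := by
    unfold weight
    refine le_self_pow₀ ?_ (by omega)
    rw [one_le_div (by positivity)]
    linarith
  rw [div_le_iff₀ (by positivity)] at h1
  have h2 : 0 < weight m (u s) := weight_pos m hu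
  unfold energy
  nlinarith [mul_nonneg (mul_nonneg h2.le (sq_nonneg (u s))) (sq_nonneg (u s)),
    mul_nonneg (mul_nonneg h2.le (sq_nonneg (u s))) (sq_nonneg (v s)), sq_nonneg (u s)]

/-- The region of phase space in which a solution of energy at most `κ` moves. -/
def phaseBox (κ : ℝ) : Set (ℝ × ℝ) := Icc (κ⁻¹) κ ×ˢ Icc (-κ) κ

theorem IsOrbit.mem_phaseBox {m : ℕ} (hm : 1 ≤ m) {u v : ℝ → ℝ} (h : IsOrbit m u v) {κ s t : ℝ}
    (hκ : energy m (u t) (v t) ≤ κ) : (u s, v s) ∈ phaseBox κ := by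
  rw [h.energy_eq t s] at hκ
  have h1 := h.one_add_sq_le_energy s
  have h2 := h.one_le_energy_mul_sq hm s
  have hu := h.pos s
  set e := energy m (u s) (v s)
  have he : 1 ≤ e := by nlinarith [sq_nonneg (u s), sq_nonneg (v s)]
  have hκ1 : 1 ≤ κ := he.trans hκ
  have h3 : u s ≤ κ := by nlinarith [sq_nonneg (v s), sq_nonneg (u s - 1)]
  have h4 : |v s| ≤ κ := by
    nlinarith [sq_nonneg (u s), sq_nonneg (|v s| - 1), sq_abs (v s)]
  refine ⟨⟨?_, h3⟩, abs_le.1 h4⟩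
  rw [inv_le_iff_one_le_mul₀ (by linarith)]
  have h5 : 1 ≤ κ * u s ^ 2 := h2.trans (mul_le_mul_of_nonneg_right hκ (sq_nonneg _))
  change 1 ≤ u s * κ
  by_contra hlt
  push Not at hlt
  have h6 : u s < 1 := by nlinarith
  nlinarith [mul_pos hu (by linarith : 0 < κ)]

/-- The vector field on phase space of the polar equation. -/
def orbitField (m : ℕ) (x : ℝ × ℝ) : ℝ × ℝ := (x.2, force m x.1 x.2 - x.1)

theorem contDiffOn_orbitField (m : ℕ) : ContDiffOn ℝ ∞ (orbitField m) {x | 0 < x.1} := by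
  unfold orbitField force
  refine contDiffOn_snd.prodMk (ContDiffOn.sub (ContDiffOn.div ?_ ?_ ?_) contDiffOn_fst)
  · exact contDiffOn_const.mul
      ((contDiffOn_const.add (contDiffOn_fst.pow 2)).add (contDiffOn_snd.pow 2))
  · exact contDiffOn_fst.mul (contDiffOn_const.add (contDiffOn_fst.pow 2))
  · intro x hx
    have : (0 : ℝ) < x.1 := hx
    positivity

theorem exists_lipschitzOnWith_orbitField (m : ℕ) {δ M : ℝ} (hδ : 0 < δ) :
    ∃ K, LipschitzOnWith K (orbitField m) (Icc δ M ×ˢ Icc (-M) M) := by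
  refine ContDiffOn.exists_lipschitzOnWith (n := ∞) ((contDiffOn_orbitField m).mono ?_) (by simp)
    ((convex_Icc _ _).prod (convex_Icc _ _)) (isCompact_Icc.prod isCompact_Icc)
  intro x hx
  exact hδ.trans_le hx.1.1

/-- Two positive solutions of the polar equation, traversed with the same speed `σ`, which agree at
one point of a compact interval are equal. -/
theorem orbit_eqOn_Icc_of_speed (m : ℕ) {a b t₀ : ℝ} (ht₀ : t₀ ∈ Icc a b) {σ u v p q : ℝ → ℝ}
    (hσ : ContinuousOn σ (Icc a b))
    (hu0 : ∀ t ∈ Icc a b, 0 < u t) (hp0 : ∀ t ∈ Icc a b, 0 < p t)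
    (hu : ∀ t ∈ Icc a b, HasDerivWithinAt u (σ t * v t) (Icc a b) t)
    (hv : ∀ t ∈ Icc a b, HasDerivWithinAt v (σ t * (force m (u t) (v t) - u t)) (Icc a b) t)
    (hp : ∀ t ∈ Icc a b, HasDerivWithinAt p (σ t * q t) (Icc a b) t)
    (hq : ∀ t ∈ Icc a b, HasDerivWithinAt q (σ t * (force m (p t) (q t) - p t)) (Icc a b) t)
    (h0 : u t₀ = p t₀) (h1 : v t₀ = q t₀) :
    ∀ t ∈ Icc a b, u t = p t ∧ v t = q t := by
  have hc : ∀ {f g : ℝ → ℝ}, (∀ t ∈ Icc a b, HasDerivWithinAt f (g t) (Icc a b) t) →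
      ContinuousOn f (Icc a b) := fun hf t ht => (hf t ht).continuousWithinAt
  have hne : (Icc a b).Nonempty := ⟨t₀, ht₀⟩
  obtain ⟨t1, ht1, hmin1⟩ := isCompact_Icc.exists_isMinOn hne (hc hu)
  obtain ⟨t2, ht2, hmin2⟩ := isCompact_Icc.exists_isMinOn hne (hc hp)
  obtain ⟨M1, hM1⟩ := isCompact_Icc.exists_bound_of_continuousOn (hc hu)
  obtain ⟨M2, hM2⟩ := isCompact_Icc.exists_bound_of_continuousOn (hc hp)
  obtain ⟨M3, hM3⟩ := isCompact_Icc.exists_bound_of_continuousOn (hc hv)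
  obtain ⟨M4, hM4⟩ := isCompact_Icc.exists_bound_of_continuousOn (hc hq)
  obtain ⟨M5, hM5⟩ := isCompact_Icc.exists_bound_of_continuousOn hσ
  set δ := min (u t1) (p t2)
  set M := max (max M1 M2) (max M3 M4)
  have hδ : 0 < δ := lt_min (hu0 t1 ht1) (hp0 t2 ht2)
  obtain ⟨K, hK⟩ := exists_lipschitzOnWith_orbitField m (M := M) hδ
  have hL : ∀ t ∈ Icc a b, LipschitzOnWith (M5.toNNReal * K) (fun x => σ t • orbitField m x)
      (Icc δ M ×ˢ Icc (-M) M) := by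
    intro t ht
    refine LipschitzOnWith.of_dist_le_mul fun x hx y hy => ?_
    have h5 := hM5 t ht
    have h6 : (0 : ℝ) ≤ M5 := (norm_nonneg _).trans h5
    rw [dist_eq_norm, ← smul_sub, norm_smul, NNReal.coe_mul, Real.coe_toNNReal _ h6, mul_assoc,
      ← dist_eq_norm (orbitField m x)]
    exact mul_le_mul h5 (hK.dist_le_mul x hx y hy) dist_nonneg h6
  have := ode_eqOn_Icc (v := fun t x => σ t • orbitField m x) (f := fun t => (u t, v t))
    (g := fun t => (p t, q t)) hL ht₀
    (fun t ht => (hu t ht).prodMk (hv t ht)) (fun t ht => ?_)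
    (fun t ht => (hp t ht).prodMk (hq t ht)) (fun t ht => ?_) (by simp [h0, h1])
  · intro t ht
    exact Prod.ext_iff.1 (this ht)
  · refine ⟨⟨(min_le_left _ _).trans (hmin1 ht), ?_⟩, ?_⟩
    · exact (le_abs_self _).trans ((hM1 t ht).trans ((le_max_left _ _).trans (le_max_left _ _)))
    · exact abs_le.1 ((hM3 t ht).trans ((le_max_left _ _).trans (le_max_right _ _)))
  · refine ⟨⟨(min_le_right _ _).trans (hmin2 ht), ?_⟩, ?_⟩
    · exact (le_abs_self _).trans ((hM2 t ht).trans ((le_max_right _ _).trans (le_max_left _ _)))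
    · exact abs_le.1 ((hM4 t ht).trans ((le_max_right _ _).trans (le_max_right _ _)))

/-- Two positive solutions of the polar equation on a compact interval which agree to first order
at one of its points are equal. -/
theorem orbit_eqOn_Icc (m : ℕ) {a b t₀ : ℝ} (ht₀ : t₀ ∈ Icc a b) {u v p q : ℝ → ℝ}
    (hu0 : ∀ t ∈ Icc a b, 0 < u t) (hp0 : ∀ t ∈ Icc a b, 0 < p t)
    (hu : ∀ t ∈ Icc a b, HasDerivWithinAt u (v t) (Icc a b) t)
    (hv : ∀ t ∈ Icc a b, HasDerivWithinAt v (force m (u t) (v t) - u t) (Icc a b) t)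
    (hp : ∀ t ∈ Icc a b, HasDerivWithinAt p (q t) (Icc a b) t)
    (hq : ∀ t ∈ Icc a b, HasDerivWithinAt q (force m (p t) (q t) - p t) (Icc a b) t)
    (h0 : u t₀ = p t₀) (h1 : v t₀ = q t₀) :
    ∀ t ∈ Icc a b, u t = p t ∧ v t = q t :=
  orbit_eqOn_Icc_of_speed m ht₀ (σ := fun _ => 1) continuousOn_const hu0 hp0
    (by simpa only [one_mul] using hu) (by simpa only [one_mul] using hv)
    (by simpa only [one_mul] using hp) (by simpa only [one_mul] using hq) h0 h1

theorem IsOrbit.eq_of_eq {m : ℕ} {u v p q : ℝ → ℝ} (h : IsOrbit m u v) (h' : IsOrbit m p q)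
    {s : ℝ} (h0 : u s = p s) (h1 : v s = q s) (t : ℝ) : u t = p t ∧ v t = q t :=
  orbit_eqOn_Icc m (a := min s t) (b := max s t) (t₀ := s) ⟨min_le_left _ _, le_max_left _ _⟩
    (fun t _ => h.pos t) (fun t _ => h'.pos t)
    (fun t _ => (h.hasDerivAt_fst t).hasDerivWithinAt)
    (fun t _ => (h.hasDerivAt_snd t).hasDerivWithinAt)
    (fun t _ => (h'.hasDerivAt_fst t).hasDerivWithinAt)
    (fun t _ => (h'.hasDerivAt_snd t).hasDerivWithinAt) h0 h1 t
    ⟨min_le_right _ _, le_max_right _ _⟩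

/-- A solution with `u'(s) = 0` is symmetric about `s`. -/
theorem IsOrbit.symm_of_snd_eq_zero {m : ℕ} {u v : ℝ → ℝ} (h : IsOrbit m u v) {s : ℝ}
    (hs : v s = 0) (t : ℝ) : u (2 * s - t) = u t ∧ -v (2 * s - t) = v t :=
  (h.reflect (2 * s)).eq_of_eq h (s := s) (by ring_nf) (by simp [two_mul, hs]) t

/-- The constant solution, whose cone is the cone over the Clifford torus. -/
theorem isOrbit_const {m : ℕ} (hm : 1 ≤ m) : IsOrbit m (fun _ => √m) fun _ => 0 := by
  have hm' : (0 : ℝ) < m := by exact_mod_cast hm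
  have hs : √(m : ℝ) ^ 2 = m := Real.sq_sqrt hm'.le
  refine ⟨fun _ => Real.sqrt_pos.2 hm', fun s => hasDerivAt_const s _, fun s => ?_⟩
  have hne : √(m : ℝ) ≠ 0 := (Real.sqrt_pos.2 hm').ne'
  refine (hasDerivAt_const s (0 : ℝ)).congr_deriv ?_
  unfold force
  have : (1 + √(m : ℝ) ^ 2) ≠ 0 := by positivity
  field_simp
  rw [hs]; ring

theorem lipschitzWith_neg_add_mul_pow_div (c : ℝ) (k : ℕ) :
    ∃ K, LipschitzWith K fun r : ℝ => -r + c * (r ^ (2 * k + 1) / (1 + r ^ 2) ^ (k + 2)) := by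
  have hd : ∀ r : ℝ, HasDerivAt
      (fun r : ℝ => -r + c * (r ^ (2 * k + 1) / (1 + r ^ 2) ^ (k + 2)))
      (-1 + c * ((((2 * k + 1 : ℕ) : ℝ) * r ^ (2 * k) * (1 + r ^ 2) ^ (k + 2) -
        r ^ (2 * k + 1) * (((k + 2 : ℕ) : ℝ) * (1 + r ^ 2) ^ (k + 1) * (2 * r))) /
          ((1 + r ^ 2) ^ (k + 2)) ^ 2)) r := by
    intro r
    have h1 : HasDerivAt (fun r : ℝ => r ^ (2 * k + 1)) (((2 * k + 1 : ℕ) : ℝ) * r ^ (2 * k)) r := by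
      simpa using hasDerivAt_pow (2 * k + 1) r
    have h2 : HasDerivAt (fun r : ℝ => (1 + r ^ 2) ^ (k + 2))
        (((k + 2 : ℕ) : ℝ) * (1 + r ^ 2) ^ (k + 1) * (2 * r)) r := by
      have : HasDerivAt (fun r : ℝ => 1 + r ^ 2) (2 * r) r := by
        simpa using (hasDerivAt_pow 2 r).const_add 1
      simpa using this.fun_pow (k + 2)
    exact (hasDerivAt_neg r).add ((h1.fun_div h2 (by positivity)).const_mul c)
  refine ⟨Real.toNNReal (1 + |c| * (4 * k + 5)), lipschitzWith_of_nnnorm_deriv_le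
    (fun r => (hd r).differentiableAt) fun r => ?_⟩
  rw [(hd r).deriv, ← NNReal.coe_le_coe, coe_nnnorm, Real.norm_eq_abs, Real.coe_toNNReal _ (by positivity)]
  refine (abs_add_le _ _).trans ?_
  rw [abs_neg, abs_one, abs_mul]
  gcongr
  have he : (1 : ℝ) ≤ 1 + r ^ 2 := by nlinarith [sq_nonneg r]
  have hr : r ^ 2 ≤ 1 + r ^ 2 := by linarith
  rw [abs_div, abs_of_pos (show (0 : ℝ) < ((1 + r ^ 2) ^ (k + 2)) ^ 2 by positivity),
    div_le_iff₀ (by positivity)]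
  have h1 : r ^ (2 * k) ≤ (1 + r ^ 2) ^ k := by
    rw [pow_mul]; gcongr
  have h2 : r ^ (2 * k + 2) ≤ (1 + r ^ 2) ^ (k + 1) := by
    rw [show 2 * k + 2 = 2 * (k + 1) by ring, pow_mul]; gcongr
  have h0 : 0 ≤ r ^ (2 * k) := by rw [pow_mul]; positivity
  have h0' : 0 ≤ r ^ (2 * k + 2) := by rw [show 2 * k + 2 = 2 * (k + 1) by ring, pow_mul]; positivity
  set E := (1 + r ^ 2) with hE
  have e1 : (E ^ k) * E ^ (k + 2) ≤ (E ^ (k + 2)) ^ 2 := by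
    rw [← pow_add, ← pow_mul]; exact pow_le_pow_right₀ he (by omega)
  have e2 : (E ^ (k + 1)) * E ^ (k + 1) ≤ (E ^ (k + 2)) ^ 2 := by
    rw [← pow_add, ← pow_mul]; exact pow_le_pow_right₀ he (by omega)
  have a1 : r ^ (2 * k) * E ^ (k + 2) ≤ (E ^ (k + 2)) ^ 2 :=
    (mul_le_mul_of_nonneg_right h1 (by positivity)).trans e1
  have a2 : r ^ (2 * k + 2) * E ^ (k + 1) ≤ (E ^ (k + 2)) ^ 2 :=
    (mul_le_mul_of_nonneg_right h2 (by positivity)).trans e2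
  have a1' : 0 ≤ r ^ (2 * k) * E ^ (k + 2) := by positivity
  have a2' : 0 ≤ r ^ (2 * k + 2) * E ^ (k + 1) := by positivity
  have hk : (0 : ℝ) ≤ k := k.cast_nonneg
  rw [show ((2 * k + 1 : ℕ) : ℝ) * r ^ (2 * k) * E ^ (k + 2) -
      r ^ (2 * k + 1) * (((k + 2 : ℕ) : ℝ) * E ^ (k + 1) * (2 * r)) =
      (2 * k + 1) * (r ^ (2 * k) * E ^ (k + 2)) -
        (2 * k + 4) * (r ^ (2 * k + 2) * E ^ (k + 1)) by push_cast; ring, abs_le]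
  constructor <;> nlinarith [mul_nonneg hk a1', mul_nonneg hk a2',
    mul_le_mul_of_nonneg_left a1 hk, mul_le_mul_of_nonneg_left a2 hk]

/-- Global existence for the polar equation. On the level set of the first integral through the
initial point the equation reads `u'' = -u + κ m u ^ (2m-1) / (1 + u ^ 2) ^ (m+1)`, and this
right-hand side is smooth and globally Lipschitz; conservation of the first integral then prevents
`u` from vanishing. -/
theorem exists_isOrbit {m : ℕ} (hm : 1 ≤ m) (s₀ : ℝ) {u₀ : ℝ} (hu₀ : 0 < u₀) (v₀ : ℝ) :
    ∃ u v : ℝ → ℝ, IsOrbit m u v ∧ u s₀ = u₀ ∧ v s₀ = v₀ := by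
  suffices H : ∃ u v : ℝ → ℝ, IsOrbit m u v ∧ u 0 = u₀ ∧ v 0 = v₀ by
    obtain ⟨u, v, h, h0, h1⟩ := H
    exact ⟨_, _, h.shift (-s₀), by simp [h0], by simp [h1]⟩
  obtain ⟨k, rfl⟩ : ∃ k, m = k + 1 := ⟨m - 1, by omega⟩
  set κ := energy (k + 1) u₀ v₀ with hκ
  obtain ⟨K, hK⟩ := lipschitzWith_neg_add_mul_pow_div (κ * (k + 1)) k
  obtain ⟨x, hx0, hx⟩ := exists_global_solution
    (v := fun _ y => (y.2, -y.1 + κ * (k + 1) * (y.1 ^ (2 * k + 1) / (1 + y.1 ^ 2) ^ (k + 2))))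
    (K := max (1 : NNReal) (K * 1))
    (fun _ => LipschitzWith.prod_snd.prodMk (hK.comp LipschitzWith.prod_fst))
    (fun _ => continuous_const) (u₀, v₀)
  set u := fun s => (x s).1
  set v := fun s => (x s).2
  have hu : ∀ s, HasDerivAt u (v s) s := fun s => (hx s).fst
  have hv : ∀ s, HasDerivAt v
      (-u s + κ * (k + 1) * (u s ^ (2 * k + 1) / (1 + u s ^ 2) ^ (k + 2))) s := fun s => (hx s).snd
  have hu0 : u 0 = u₀ := by simp [u, hx0]
  have hv0 : v 0 = v₀ := by simp [v, hx0]
  have hI : ∀ s, HasDerivAt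
      (fun s => 1 + u s ^ 2 + v s ^ 2 - κ * (u s ^ 2 / (1 + u s ^ 2)) ^ (k + 1)) 0 s := by
    intro s
    have ha : HasDerivAt (fun s => u s ^ 2) (2 * u s * v s) s := by simpa using (hu s).fun_pow 2
    have hb := (hv s).fun_pow 2
    have hc := ((ha.fun_div (ha.const_add 1) (by positivity)).pow (k + 1)).const_mul κ
    refine (((ha.const_add 1).add hb).sub hc).congr_deriv ?_
    have hne : (1 + u s ^ 2) ≠ 0 := by positivity
    rw [Nat.add_sub_cancel]
    push_cast
    rw [div_pow, ← pow_mul]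
    simp only [pow_succ, pow_mul]
    field_simp
    ring
  have hconst : ∀ s, 1 + u s ^ 2 + v s ^ 2 = κ * (u s ^ 2 / (1 + u s ^ 2)) ^ (k + 1) := by
    intro s
    have h1 := is_const_of_deriv_eq_zero (fun s => (hI s).differentiableAt)
      (fun s => (hI s).deriv) s 0
    simp only [hu0, hv0] at h1
    have h2 : κ * (u₀ ^ 2 / (1 + u₀ ^ 2)) ^ (k + 1) = 1 + u₀ ^ 2 + v₀ ^ 2 := by
      rw [hκ, energy, weight, mul_assoc, ← mul_pow, div_mul_div_comm, mul_comm (u₀ ^ 2), div_self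
        (by positivity), one_pow, mul_one]
    linarith
  have hne : ∀ s, u s ≠ 0 := by
    intro s h
    have := hconst s
    rw [h] at this
    simp at this
    nlinarith [sq_nonneg (v s)]
  have hcu : Continuous u := continuous_iff_continuousAt.2 fun s => (hu s).continuousAt
  have hpos : ∀ s, 0 < u s := by
    intro s
    by_contra hle
    push Not at hle
    have h1 : (0 : ℝ) ∈ uIcc (u s) (u 0) := by
      rw [hu0, uIcc_of_le (hle.trans hu₀.le)]; exact ⟨hle, hu₀.le⟩
    obtain ⟨t, _, ht⟩ := intermediate_value_uIcc hcu.continuousOn h1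
    exact hne t ht
  refine ⟨u, v, ⟨hpos, hu, fun s => (hv s).congr_deriv ?_⟩, hu0, hv0⟩
  have h1 := hne s
  have h2 : (1 + u s ^ 2) ≠ 0 := by positivity
  unfold force
  rw [hconst s, div_pow, ← pow_mul]
  push_cast
  simp only [pow_succ, pow_mul]
  field_simp
  ring

/-! ### The linearised equation and its explicit super- and subsolutions -/

/-- The partial derivative of `force` with respect to `u`. -/
def forceU (m : ℕ) (u v : ℝ) : ℝ := -(m / u ^ 2 + m * v ^ 2 * (1 + 3 * u ^ 2) / (u * (1 + u ^ 2)) ^ 2)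

/-- The partial derivative of `force` with respect to `u'`. -/
def forceV (m : ℕ) (u v : ℝ) : ℝ := 2 * m * v / (u * (1 + u ^ 2))

theorem force_pos {m : ℕ} (hm : 1 ≤ m) {u : ℝ} (hu : 0 < u) (v : ℝ) : 0 < force m u v := by
  have : (0 : ℝ) < m := by exact_mod_cast hm
  unfold force; positivity

theorem hasDerivAt_force (m : ℕ) {u v : ℝ → ℝ} {u' v' s : ℝ} (hpos : 0 < u s)
    (hu : HasDerivAt u u' s) (hv : HasDerivAt v v' s) :
    HasDerivAt (fun s => force m (u s) (v s))
      (forceU m (u s) (v s) * u' + forceV m (u s) (v s) * v') s := by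
  have ha : HasDerivAt (fun s => u s ^ 2) (2 * u s * u') s := by simpa using hu.fun_pow 2
  have hb : HasDerivAt (fun s => v s ^ 2) (2 * v s * v') s := by simpa using hv.fun_pow 2
  have h := (((ha.const_add 1).fun_add hb).const_mul (m : ℝ)).fun_div
    (hu.fun_mul (ha.const_add 1)) (by positivity)
  refine h.congr_deriv ?_
  have hne : u s ≠ 0 := hpos.ne'
  have hne2 : (1 + u s ^ 2) ≠ 0 := by positivity
  unfold forceU forceV
  field_simp
  ring

/-- `f`, with derivative `f₁`, solves the polar equation linearised at `(u, v)` with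
inhomogeneity `r`. -/
def LinearizedEq (m : ℕ) (u v f f₁ r : ℝ → ℝ) : Prop :=
  ∀ s, HasDerivAt f (f₁ s) s ∧
    HasDerivAt f₁ (-f s + forceU m (u s) (v s) * f s + forceV m (u s) (v s) * f₁ s + r s) s

/-- The Wronskian identity for the linearised equation. -/
theorem LinearizedEq.hasDerivAt_wronskian {m : ℕ} {u v f f₁ r g g₁ q : ℝ → ℝ}
    (h : IsOrbit m u v) (hf : LinearizedEq m u v f f₁ r) (hg : LinearizedEq m u v g g₁ q) (s : ℝ) :
    HasDerivAt (fun s => weight m (u s) * (f s * g₁ s - g s * f₁ s))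
      (weight m (u s) * (f s * q s - g s * r s)) s := by
  have hw := hasDerivAt_weight m (h.pos s) (h.hasDerivAt_fst s)
  refine (hw.fun_mul (((hf s).1.fun_mul (hg s).2).fun_sub
    ((hg s).1.fun_mul (hf s).2))).congr_deriv ?_
  unfold forceV
  ring

theorem LinearizedEq.const_mul_sub {m : ℕ} {u v f f₁ r g g₁ q : ℝ → ℝ}
    (hf : LinearizedEq m u v f f₁ r) (hg : LinearizedEq m u v g g₁ q) (b : ℝ) :
    LinearizedEq m u v (fun s => b * f s - g s) (fun s => b * f₁ s - g₁ s)
      (fun s => b * r s - q s) := fun s =>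
  ⟨((hf s).1.const_mul b).fun_sub (hg s).1,
    (((hf s).2.const_mul b).fun_sub (hg s).2).congr_deriv (by ring)⟩

/-- The rotation field of the `(xₙ, z)`-plane: `u'` solves the linearised equation. -/
theorem IsOrbit.linearizedEq_snd {m : ℕ} {u v : ℝ → ℝ} (h : IsOrbit m u v) :
    LinearizedEq m u v v (fun s => force m (u s) (v s) - u s) 0 := fun s =>
  ⟨h.hasDerivAt_snd s, ((hasDerivAt_force m (h.pos s) (h.hasDerivAt_fst s)
    (h.hasDerivAt_snd s)).fun_sub (h.hasDerivAt_fst s)).congr_deriv (by simp; ring)⟩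

/-- The derivative of `r u(φ)` with respect to `xₙ = r sin φ`. -/
def gradY (u v : ℝ → ℝ) (s : ℝ) : ℝ := u s * Real.sin s + v s * Real.cos s

/-- The derivative of `r u(φ)` with respect to `z = r cos φ`. -/
def gradZ (u v : ℝ → ℝ) (s : ℝ) : ℝ := u s * Real.cos s - v s * Real.sin s

/-- A positive multiple of the derivative of `xₙ` along the profile curve on the unit sphere. -/
def velY (u v : ℝ → ℝ) (s : ℝ) : ℝ := (1 + u s ^ 2) * Real.cos s - u s * v s * Real.sin s

/-- The negative of the same multiple of the derivative of `z` along the profile curve. -/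
def velZ (u v : ℝ → ℝ) (s : ℝ) : ℝ := (1 + u s ^ 2) * Real.sin s + u s * v s * Real.cos s

/-- The coefficient of the inhomogeneities of the stretching and shearing variations. Its positivity
determines their signs. -/
def secondFF (m : ℕ) (u : ℝ) : ℝ := 2 * m / (u * (1 + u ^ 2) ^ 2)

theorem IsOrbit.hasDerivAt_gradY {m : ℕ} {u v : ℝ → ℝ} (h : IsOrbit m u v) (s : ℝ) :
    HasDerivAt (gradY u v) (Real.cos s * force m (u s) (v s)) s := by
  refine (((h.hasDerivAt_fst s).fun_mul (Real.hasDerivAt_sin s)).fun_add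
    ((h.hasDerivAt_snd s).fun_mul (Real.hasDerivAt_cos s))).congr_deriv ?_
  ring

theorem IsOrbit.hasDerivAt_gradZ {m : ℕ} {u v : ℝ → ℝ} (h : IsOrbit m u v) (s : ℝ) :
    HasDerivAt (gradZ u v) (-(Real.sin s * force m (u s) (v s))) s := by
  refine (((h.hasDerivAt_fst s).fun_mul (Real.hasDerivAt_cos s)).fun_sub
    ((h.hasDerivAt_snd s).fun_mul (Real.hasDerivAt_sin s))).congr_deriv ?_
  ring

theorem IsOrbit.hasDerivAt_force {m : ℕ} {u v : ℝ → ℝ} (h : IsOrbit m u v) (s : ℝ) :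
    HasDerivAt (fun s => force m (u s) (v s)) (forceU m (u s) (v s) * v s +
      forceV m (u s) (v s) * (force m (u s) (v s) - u s)) s :=
  CapillaryCone.hasDerivAt_force m (h.pos s) (h.hasDerivAt_fst s) (h.hasDerivAt_snd s)

/-- The variation of the cone under dilations in the direction of `xₙ`. -/
theorem IsOrbit.linearizedEq_stretchY {m : ℕ} {u v : ℝ → ℝ} (h : IsOrbit m u v) :
    LinearizedEq m u v (fun s => Real.sin s * gradY u v s)
      (fun s => Real.cos s * gradY u v s +
        Real.sin s * (Real.cos s * force m (u s) (v s)))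
      (fun s => secondFF m (u s) * velY u v s ^ 2) := by
  intro s
  refine ⟨(Real.hasDerivAt_sin s).fun_mul (h.hasDerivAt_gradY s), ?_⟩
  refine (((Real.hasDerivAt_cos s).fun_mul (h.hasDerivAt_gradY s)).fun_add
    ((Real.hasDerivAt_sin s).fun_mul ((Real.hasDerivAt_cos s).fun_mul
      (h.hasDerivAt_force s)))).congr_deriv ?_
  have hne : u s ≠ 0 := (h.pos s).ne'
  have hne2 : (1 + u s ^ 2) ≠ 0 := by positivity
  unfold gradY secondFF velY forceU forceV force
  beta_reduce
  field_simp
  ring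

/-- The variation of the cone under dilations in the direction of `z`. -/
theorem IsOrbit.linearizedEq_stretchZ {m : ℕ} {u v : ℝ → ℝ} (h : IsOrbit m u v) :
    LinearizedEq m u v (fun s => Real.cos s * gradZ u v s)
      (fun s => -Real.sin s * gradZ u v s +
        Real.cos s * -(Real.sin s * force m (u s) (v s)))
      (fun s => secondFF m (u s) * velZ u v s ^ 2) := by
  intro s
  refine ⟨(Real.hasDerivAt_cos s).fun_mul (h.hasDerivAt_gradZ s), ?_⟩
  refine (((Real.hasDerivAt_sin s).fun_neg.fun_mul (h.hasDerivAt_gradZ s)).fun_add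
    ((Real.hasDerivAt_cos s).fun_mul ((Real.hasDerivAt_sin s).fun_mul
      (h.hasDerivAt_force s)).fun_neg)).congr_deriv ?_
  have hne : u s ≠ 0 := (h.pos s).ne'
  have hne2 : (1 + u s ^ 2) ≠ 0 := by positivity
  unfold gradZ secondFF velZ forceU forceV force
  beta_reduce
  field_simp
  ring

/-- The variation of the cone under the shears `z ↦ z + ε xₙ`. -/
theorem IsOrbit.linearizedEq_shear {m : ℕ} {u v : ℝ → ℝ} (h : IsOrbit m u v) :
    LinearizedEq m u v (fun s => Real.sin s * gradZ u v s)
      (fun s => Real.cos s * gradZ u v s +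
        Real.sin s * -(Real.sin s * force m (u s) (v s)))
      (fun s => -(secondFF m (u s) * velZ u v s * velY u v s)) := by
  intro s
  refine ⟨(Real.hasDerivAt_sin s).fun_mul (h.hasDerivAt_gradZ s), ?_⟩
  refine (((Real.hasDerivAt_cos s).fun_mul (h.hasDerivAt_gradZ s)).fun_add
    ((Real.hasDerivAt_sin s).fun_mul ((Real.hasDerivAt_sin s).fun_mul
      (h.hasDerivAt_force s)).fun_neg)).congr_deriv ?_
  have hne : u s ≠ 0 := (h.pos s).ne'
  have hne2 : (1 + u s ^ 2) ≠ 0 := by positivity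
  unfold gradZ secondFF velZ velY forceU forceV force
  beta_reduce
  field_simp
  ring

theorem secondFF_pos {m : ℕ} (hm : 1 ≤ m) {u : ℝ} (hu : 0 < u) : 0 < secondFF m u := by
  have : (0 : ℝ) < m := by exact_mod_cast hm
  unfold secondFF; positivity

/-- The direction of the profile curve in the `(xₙ, z)`-plane turns monotonically. -/
theorem IsOrbit.hasDerivAt_velZ_div_velY {m : ℕ} {u v : ℝ → ℝ} (h : IsOrbit m u v) {s : ℝ}
    (hs : velY u v s ≠ 0) :
    HasDerivAt (fun s => velZ u v s / velY u v s)
      ((m + 1) * (1 + u s ^ 2 + v s ^ 2) / velY u v s ^ 2) s := by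
  have ha : HasDerivAt (fun s => 1 + u s ^ 2) (2 * u s * v s) s := by
    simpa using ((h.hasDerivAt_fst s).fun_pow 2).const_add 1
  have hb := (h.hasDerivAt_fst s).fun_mul (h.hasDerivAt_snd s)
  have hz := (ha.fun_mul (Real.hasDerivAt_sin s)).fun_add (hb.fun_mul (Real.hasDerivAt_cos s))
  have hy := (ha.fun_mul (Real.hasDerivAt_cos s)).fun_sub (hb.fun_mul (Real.hasDerivAt_sin s))
  refine (hz.fun_div hy hs).congr_deriv ?_
  congr 1
  have hne : u s ≠ 0 := (h.pos s).ne'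
  have hne2 : (1 + u s ^ 2) ≠ 0 := by positivity
  have hsc := Real.sin_sq_add_cos_sq s
  unfold force
  generalize Real.sin s = a at *
  generalize Real.cos s = b at *
  field_simp
  have hb2 : b ^ 2 = 1 - a ^ 2 := by linarith
  ring_nf
  simp only [hb2]
  ring

/-! ### Zeros of `u'` -/

theorem exists_first_zero {f : ℝ → ℝ} (hf : Continuous f) {a b : ℝ} (hab : a < b)
    (hneg : ∀ᶠ t in 𝓝[>] a, f t < 0) (hb : 0 ≤ f b) :
    ∃ s ∈ Ioc a b, f s = 0 ∧ ∀ t ∈ Ioo a s, f t < 0 := by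
  obtain ⟨c, hc, hcn⟩ := mem_nhdsGT_iff_exists_Ioo_subset.1 hneg
  have hac : a < c := hc
  obtain ⟨d, hd1, hd2⟩ := exists_between (lt_min hac hab)
  have hdc : d < c := hd2.trans_le (min_le_left _ _)
  have hdb : d < b := hd2.trans_le (min_le_right _ _)
  set A : Set ℝ := Icc d b ∩ f ⁻¹' Ici 0
  have hA : IsCompact A := isCompact_Icc.inter_right (isClosed_Ici.preimage hf)
  obtain ⟨s, hs⟩ := hA.exists_isLeast ⟨b, ⟨hdb.le, le_rfl⟩, hb⟩
  have hlt : ∀ t ∈ Ioo a s, f t < 0 := by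
    intro t ht
    rcases lt_or_ge t c with h | h
    · exact hcn ⟨ht.1, h⟩
    · by_contra hge
      push Not at hge
      exact absurd (hs.2 ⟨⟨hdc.le.trans h, ht.2.le.trans hs.1.1.2⟩, hge⟩) (not_le.2 ht.2)
  have hsa : a < s := hd1.trans_le hs.1.1.1
  refine ⟨s, ⟨hsa, hs.1.1.2⟩, le_antisymm ?_ hs.1.2, hlt⟩
  refine le_of_tendsto (hf.continuousAt.mono_left nhdsWithin_le_nhds : Tendsto f (𝓝[<] s) _) ?_
  filter_upwards [Ioo_mem_nhdsLT hsa] with t ht using (hlt t ht).le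

theorem deriv_nonneg_of_le_left {f : ℝ → ℝ} {f' s a : ℝ} (hf : HasDerivAt f f' s) (has : a < s)
    (h : ∀ t ∈ Ioo a s, f t ≤ f s) : 0 ≤ f' := by
  have h1 := hasDerivWithinAt_iff_tendsto_slope.1 (hf.hasDerivWithinAt (s := Iio s))
  rw [sdiff_singleton_eq_self (by simp)] at h1
  refine ge_of_tendsto h1 ?_
  filter_upwards [Ioo_mem_nhdsLT has] with t ht
  rw [slope_def_field]
  exact div_nonneg_of_nonpos (sub_nonpos.2 (h t ht)) (sub_nonpos.2 ht.2.le)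

theorem IsOrbit.force_sub_of_snd_eq_zero {m : ℕ} {u v : ℝ → ℝ} (h : IsOrbit m u v) {s : ℝ}
    (hs : v s = 0) : force m (u s) (v s) - u s = (m - u s ^ 2) / u s := by
  have hne : u s ≠ 0 := (h.pos s).ne'
  have hne2 : (1 + u s ^ 2) ≠ 0 := by positivity
  rw [hs]
  unfold force
  field_simp
  ring

/-- Just after a maximum of `u` above the equilibrium value, `u' < 0`. -/
theorem IsOrbit.eventually_snd_neg {m : ℕ} {u v : ℝ → ℝ} (h : IsOrbit m u v) {s : ℝ}
    (hs : v s = 0) (hu : (m : ℝ) < u s ^ 2) : ∀ᶠ t in 𝓝[>] s, v t < 0 := by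
  have h1 := h.hasDerivAt_snd s
  rw [h.force_sub_of_snd_eq_zero hs] at h1
  have h2 : (m - u s ^ 2) / u s < 0 := div_neg_of_neg_of_pos (by linarith) (h.pos s)
  have h3 := hasDerivWithinAt_iff_tendsto_slope.1 (h1.hasDerivWithinAt (s := Ioi s))
  rw [sdiff_singleton_eq_self (by simp)] at h3
  filter_upwards [h3.eventually_lt_const h2, self_mem_nhdsWithin] with t ht hts
  rw [slope_def_field, hs, sub_zero] at ht
  have : (0 : ℝ) < t - s := sub_pos.2 hts
  by_contra hge
  push Not at hge
  exact absurd ht (not_lt.2 (div_nonneg hge this.le))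

theorem IsOrbit.continuous_velY {m : ℕ} {u v : ℝ → ℝ} (h : IsOrbit m u v) :
    Continuous (velY u v) := by
  have := h.continuous_fst; have := h.continuous_snd
  unfold velY; fun_prop

theorem IsOrbit.continuous_velZ {m : ℕ} {u v : ℝ → ℝ} (h : IsOrbit m u v) :
    Continuous (velZ u v) := by
  have := h.continuous_fst; have := h.continuous_snd
  unfold velZ; fun_prop

theorem IsOrbit.velY_pos {m : ℕ} {u v : ℝ → ℝ} (h : IsOrbit m u v) {t : ℝ} (h0 : 0 ≤ t)
    (h1 : t < Real.pi / 2) (hv : v t ≤ 0) : 0 < velY u v t := by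
  have hc := Real.cos_pos_of_mem_Ioo ⟨by linarith, h1⟩
  have hs := Real.sin_nonneg_of_nonneg_of_le_pi h0 (by linarith [Real.pi_pos])
  have hu := h.pos t
  unfold velY
  nlinarith [mul_pos (show 0 < 1 + u t ^ 2 by positivity) hc,
    mul_nonneg (mul_nonneg hu.le (neg_nonneg.2 hv)) hs]

theorem IsOrbit.velZ_pos {m : ℕ} {u v : ℝ → ℝ} (h : IsOrbit m u v) (h0 : v 0 = 0) {t : ℝ}
    (ht0 : 0 < t) (ht1 : t < Real.pi / 2) (hv : ∀ r ∈ Ioc 0 t, v r < 0) : 0 < velZ u v t := by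
  have hY : ∀ r ∈ Icc 0 t, 0 < velY u v r := fun r hr => by
    refine h.velY_pos hr.1 (hr.2.trans_lt ht1) ?_
    rcases hr.1.eq_or_lt with h1 | h1
    · rw [← h1, h0]
    · exact (hv r ⟨h1, hr.2⟩).le
  have hmono : StrictMonoOn (fun s => velZ u v s / velY u v s) (Icc 0 t) := by
    refine strictMonoOn_of_deriv_pos (convex_Icc _ _) ?_ ?_
    · exact h.continuous_velZ.continuousOn.div h.continuous_velY.continuousOn
        fun r hr => (hY r hr).ne'
    · intro r hr
      rw [interior_Icc] at hr
      have := hY r (Ioo_subset_Icc_self hr)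
      rw [(h.hasDerivAt_velZ_div_velY this.ne').deriv]
      positivity
  have h1 := hmono ⟨le_rfl, ht0.le⟩ ⟨ht0.le, le_rfl⟩ ht0
  have h2 : velZ u v 0 = 0 := by simp [velZ, h0]
  simp only [h2, zero_div] at h1
  exact (div_pos_iff_of_pos_right (hY t ⟨ht0.le, le_rfl⟩)).1 h1

/-- The Wronskian of `u'` and the shear variation is positive as long as `u' < 0`. -/
theorem IsOrbit.shear_wronskian_pos {m : ℕ} (hm : 1 ≤ m) {u v : ℝ → ℝ} (h : IsOrbit m u v)
    (h0 : v 0 = 0) {s : ℝ} (hs0 : 0 < s) (hs : s ≤ Real.pi / 2) (hneg : ∀ t ∈ Ioo 0 s, v t < 0) :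
    0 < v s * (Real.cos s * gradZ u v s + Real.sin s * -(Real.sin s * force m (u s) (v s))) -
      Real.sin s * gradZ u v s * (force m (u s) (v s) - u s) := by
  have hW := LinearizedEq.hasDerivAt_wronskian h h.linearizedEq_snd h.linearizedEq_shear
  have hmono := strictMonoOn_of_deriv_pos (convex_Icc 0 s)
    (fun t _ => (hW t).continuousAt.continuousWithinAt) (fun t ht => by
      rw [interior_Icc] at ht
      rw [(hW t).deriv]
      have h1 := hneg t ht
      have h2 : t < Real.pi / 2 := ht.2.trans_le hs
      have h3 := h.velY_pos ht.1.le h2 h1.le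
      have h4 := h.velZ_pos h0 ht.1 h2 fun r hr => hneg r ⟨hr.1, hr.2.trans_lt ht.2⟩
      have h5 := secondFF_pos hm (h.pos t)
      have h6 := weight_pos m (h.pos t)
      have h7 : 0 < secondFF m (u t) * velZ u v t * velY u v t := by positivity
      simp only [Pi.zero_apply, mul_zero, sub_zero]
      have := mul_pos (neg_pos.2 h1) h7
      exact mul_pos h6 (by linarith))
  have h1 := hmono ⟨le_rfl, hs0.le⟩ ⟨hs0.le, le_rfl⟩ hs0
  simp only [h0, Real.sin_zero, zero_mul, sub_zero, mul_zero] at h1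
  exact (mul_pos_iff_of_pos_left (weight_pos m (h.pos s))).1 h1

/-- After a maximum of `u`, the function `u` decreases over a quarter turn at least. -/
theorem IsOrbit.snd_neg {m : ℕ} (hm : 1 ≤ m) {u v : ℝ → ℝ} (h : IsOrbit m u v) (h0 : v 0 = 0)
    (hu0 : (m : ℝ) < u 0 ^ 2) {t : ℝ} (ht0 : 0 < t) (ht : t ≤ Real.pi / 2) : v t < 0 := by
  by_contra hge
  push Not at hge
  obtain ⟨s, hs, hvs, hneg⟩ := exists_first_zero h.continuous_snd ht0
    (h.eventually_snd_neg h0 hu0) hge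
  have hsp : s ≤ Real.pi / 2 := hs.2.trans ht
  have h1 := h.shear_wronskian_pos hm h0 hs.1 hsp hneg
  have h2 := deriv_nonneg_of_le_left (h.hasDerivAt_snd s) hs.1
    fun r hr => by rw [hvs]; exact (hneg r hr).le
  have h3 : 0 ≤ Real.sin s * gradZ u v s := by
    have hc := Real.cos_nonneg_of_mem_Icc (x := s) ⟨by linarith [hs.1, Real.pi_pos], hsp⟩
    have hsn := Real.sin_nonneg_of_nonneg_of_le_pi hs.1.le (by linarith [Real.pi_pos])
    unfold gradZ
    rw [hvs, zero_mul, sub_zero]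
    exact mul_nonneg hsn (mul_nonneg (h.pos s).le hc)
  rw [hvs] at h1 h2
  nlinarith [mul_nonneg h3 h2]

/-- The Liouville normal form of `u'`, proportional to the sine of the angle between the profile
curve and the circles `r = const`. -/
def liouville (m : ℕ) (u v : ℝ → ℝ) (s : ℝ) : ℝ := v s * √(weight m (u s))

/-- The derivative of `liouville`. -/
def liouville' (m : ℕ) (u : ℝ → ℝ) (s : ℝ) : ℝ := (m - u s ^ 2) / u s * √(weight m (u s))

/-- The potential of the Liouville normal form, in excess of `1`. -/
def potential (m : ℕ) (u : ℝ) : ℝ := m * (m + 1) / (u ^ 2 * (1 + u ^ 2))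

theorem IsOrbit.hasDerivAt_sqrt_weight {m : ℕ} {u v : ℝ → ℝ} (h : IsOrbit m u v) (s : ℝ) :
    HasDerivAt (fun s => √(weight m (u s)))
      (-(m * v s / (u s * (1 + u s ^ 2))) * √(weight m (u s))) s := by
  have hw := weight_pos m (h.pos s)
  refine ((hasDerivAt_weight m (h.pos s) (h.hasDerivAt_fst s)).sqrt hw.ne').congr_deriv ?_
  have h1 : √(weight m (u s)) ≠ 0 := (Real.sqrt_pos.2 hw).ne'
  have hne : u s ≠ 0 := (h.pos s).ne'
  have hne2 : (1 + u s ^ 2) ≠ 0 := by positivity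
  have h2 := Real.sq_sqrt hw.le
  generalize √(weight m (u s)) = w at *
  rw [← h2]
  field_simp

theorem IsOrbit.hasDerivAt_liouville {m : ℕ} {u v : ℝ → ℝ} (h : IsOrbit m u v) (s : ℝ) :
    HasDerivAt (liouville m u v) (liouville' m u s) s := by
  refine ((h.hasDerivAt_snd s).fun_mul (h.hasDerivAt_sqrt_weight s)).congr_deriv ?_
  have hne : u s ≠ 0 := (h.pos s).ne'
  have hne2 : (1 + u s ^ 2) ≠ 0 := by positivity
  unfold liouville' force
  field_simp
  ring

theorem IsOrbit.hasDerivAt_liouville' {m : ℕ} {u v : ℝ → ℝ} (h : IsOrbit m u v) (s : ℝ) :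
    HasDerivAt (liouville' m u) (-(1 + potential m (u s)) * liouville m u v s) s := by
  have hne : u s ≠ 0 := (h.pos s).ne'
  have ha : HasDerivAt (fun s => u s ^ 2) (2 * u s * v s) s := by
    simpa using (h.hasDerivAt_fst s).fun_pow 2
  refine (((ha.const_sub (m : ℝ)).fun_div (h.hasDerivAt_fst s) hne).fun_mul
    (h.hasDerivAt_sqrt_weight s)).congr_deriv ?_
  have hne2 : (1 + u s ^ 2) ≠ 0 := by positivity
  unfold potential liouville
  field_simp
  ring

theorem liouville_neg_iff {m : ℕ} {u v : ℝ → ℝ} {s : ℝ} (hu : 0 < u s) :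
    liouville m u v s < 0 ↔ v s < 0 := by
  have := Real.sqrt_pos.2 (weight_pos m hu)
  unfold liouville
  constructor
  · intro h1; by_contra hge; push Not at hge; exact absurd h1 (not_lt.2 (by positivity))
  · intro h1; exact mul_neg_of_neg_of_pos h1 this

theorem potential_pos {m : ℕ} (hm : 1 ≤ m) {u : ℝ} (hu : 0 < u) : 0 < potential m u := by
  have : (0 : ℝ) < m := by exact_mod_cast hm
  unfold potential; positivity

/-- Sturm comparison of the normal form with `sin`. -/
theorem IsOrbit.liouville_compare_sin {m : ℕ} (hm : 1 ≤ m) {u v : ℝ → ℝ} (h : IsOrbit m u v)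
    (h0 : v 0 = 0) {s : ℝ} (hs0 : 0 < s) (hs : s ≤ Real.pi) (hneg : ∀ t ∈ Ioo 0 s, v t < 0) :
    0 < liouville' m u s * Real.sin s - liouville m u v s * Real.cos s := by
  have hD : ∀ t, HasDerivAt
      (fun t => liouville' m u t * Real.sin t - liouville m u v t * Real.cos t)
      (-(potential m (u t) * liouville m u v t * Real.sin t)) t := fun t =>
    (((h.hasDerivAt_liouville' t).fun_mul (Real.hasDerivAt_sin t)).fun_sub
      ((h.hasDerivAt_liouville t).fun_mul (Real.hasDerivAt_cos t))).congr_deriv (by ring)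
  have hmono := strictMonoOn_of_deriv_pos (convex_Icc 0 s)
    (fun t _ => (hD t).continuousAt.continuousWithinAt) (fun t ht => by
      rw [interior_Icc] at ht
      rw [(hD t).deriv]
      have h1 := (liouville_neg_iff (m := m) (h.pos t)).2 (hneg t ht)
      have h2 := Real.sin_pos_of_pos_of_lt_pi ht.1 (ht.2.trans_le hs)
      have := mul_pos (mul_pos (potential_pos hm (h.pos t)) (neg_pos.2 h1)) h2
      linarith)
  have h1 := hmono ⟨le_rfl, hs0.le⟩ ⟨hs0.le, le_rfl⟩ hs0
  simpa [liouville, h0] using h1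

/-- A quarter turn after a maximum, `u` lies below the equilibrium value. -/
theorem IsOrbit.sq_lt_at_pi_div_two {m : ℕ} (hm : 1 ≤ m) {u v : ℝ → ℝ} (h : IsOrbit m u v)
    (h0 : v 0 = 0) (hu0 : (m : ℝ) < u 0 ^ 2) : u (Real.pi / 2) ^ 2 < m := by
  have h1 := h.liouville_compare_sin hm h0 (s := Real.pi / 2) (by positivity)
    (by linarith [Real.pi_pos]) fun t ht => h.snd_neg hm h0 hu0 ht.1 ht.2.le
  simp only [Real.sin_pi_div_two, Real.cos_pi_div_two, mul_one, mul_zero, sub_zero] at h1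
  unfold liouville' at h1
  rw [mul_pos_iff_of_pos_right (Real.sqrt_pos.2 (weight_pos m (h.pos _))),
    div_pos_iff_of_pos_right (h.pos _)] at h1
  linarith

/-- The first critical point of `u` after a maximum comes later than a quarter turn and earlier
than a half turn; the function `u` increases after it as long as it has decreased before. -/
theorem IsOrbit.exists_half_period {m : ℕ} (hm : 1 ≤ m) {u v : ℝ → ℝ} (h : IsOrbit m u v)
    (h0 : v 0 = 0) (hu0 : (m : ℝ) < u 0 ^ 2) :
    ∃ H, Real.pi / 2 < H ∧ H < Real.pi ∧ v H = 0 ∧ (∀ t ∈ Ioo 0 H, v t < 0) ∧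
      ∀ t ∈ Ioo H (2 * H), 0 < v t := by
  have hnot : ∃ t ∈ Ioo 0 Real.pi, 0 ≤ v t := by
    by_contra hcon
    push Not at hcon
    have h1 := h.liouville_compare_sin hm h0 Real.pi_pos le_rfl hcon
    have h2 : v Real.pi ≤ 0 := by
      refine le_of_tendsto (h.continuous_snd.continuousAt.mono_left nhdsWithin_le_nhds :
        Tendsto v (𝓝[<] Real.pi) _) ?_
      filter_upwards [Ioo_mem_nhdsLT Real.pi_pos] with t ht using (hcon t ht).le
    simp only [Real.sin_pi, Real.cos_pi, mul_zero, mul_neg, mul_one, zero_sub, neg_neg] at h1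
    exact absurd h1 (not_lt.2 (mul_nonpos_of_nonpos_of_nonneg h2 (Real.sqrt_nonneg _)))
  obtain ⟨t, ht, hvt⟩ := hnot
  obtain ⟨H, hH, hvH, hneg⟩ := exists_first_zero h.continuous_snd ht.1
    (h.eventually_snd_neg h0 hu0) hvt
  refine ⟨H, ?_, hH.2.trans_lt ht.2, hvH, hneg, ?_⟩
  · by_contra hle
    push Not at hle
    have := h.snd_neg hm h0 hu0 hH.1 hle
    exact this.ne hvH
  · intro r hr
    have h1 := (h.symm_of_snd_eq_zero hvH r).2
    have h2 := hneg (2 * H - r) ⟨by linarith [hr.2], by linarith [hr.1]⟩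
    linarith

/-! ### Symmetry of capillary profiles and periodic profiles -/

/-- If `u` has a maximum at `0`, then `u'`, normalised, is smaller in absolute value at
`π / 2 + δ` than at `π / 2 - δ`, since the potential is larger where `u` is smaller. -/
theorem IsOrbit.liouville_reflect_lt {m : ℕ} (hm : 1 ≤ m) {u v : ℝ → ℝ} (h : IsOrbit m u v)
    (h0 : v 0 = 0) (hu0 : (m : ℝ) < u 0 ^ 2) {δ : ℝ} (hδ0 : 0 < δ) (hδ : δ < Real.pi / 2)
    (hneg : ∀ t ∈ Ioo 0 (Real.pi / 2 + δ), v t < 0) :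
    liouville m u v (Real.pi / 2 - δ) < liouville m u v (Real.pi / 2 + δ) := by
  set c := Real.pi / 2 with hc
  have hm0 : (0 : ℝ) < m := by exact_mod_cast hm
  have hcpos : 0 < c := by positivity
  have hanti : StrictAntiOn u (Icc 0 (c + δ)) :=
    strictAntiOn_of_deriv_neg (convex_Icc _ _) h.continuous_fst.continuousOn fun t ht => by
      rw [interior_Icc] at ht
      rw [(h.hasDerivAt_fst t).deriv]; exact hneg t ht
  have hp : ∀ t, HasDerivAt (fun t => liouville m u v (c + t)) (liouville' m u (c + t)) t :=
    fun t => (h.hasDerivAt_liouville (c + t)).comp_const_add c t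
  have hp' : ∀ t, HasDerivAt (fun t => liouville' m u (c + t))
      (-(1 + potential m (u (c + t))) * liouville m u v (c + t)) t :=
    fun t => (h.hasDerivAt_liouville' (c + t)).comp_const_add c t
  have hq : ∀ t, HasDerivAt (fun t => liouville m u v (c - t)) (-liouville' m u (c - t)) t :=
    fun t => (h.hasDerivAt_liouville (c - t)).comp_const_sub c t
  have hq' : ∀ t, HasDerivAt (fun t => liouville' m u (c - t))
      (-(-(1 + potential m (u (c - t))) * liouville m u v (c - t))) t :=
    fun t => (h.hasDerivAt_liouville' (c - t)).comp_const_sub c t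
  -- the Wronskian of the two branches
  set Z := fun t => liouville' m u (c + t) * liouville m u v (c - t) +
    liouville m u v (c + t) * liouville' m u (c - t) with hZ
  have hZd : ∀ t, HasDerivAt Z ((potential m (u (c - t)) - potential m (u (c + t))) *
      (liouville m u v (c + t) * liouville m u v (c - t))) t := fun t =>
    (((hp' t).fun_mul (hq t)).fun_add ((hp t).fun_mul (hq' t))).congr_deriv (by ring)
  have hpn : ∀ t ∈ Ico 0 δ, liouville m u v (c + t) < 0 := fun t ht =>
    (liouville_neg_iff (h.pos _)).2 (hneg _ ⟨by linarith [ht.1], by linarith [ht.2]⟩)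
  have hqn : ∀ t ∈ Icc 0 δ, liouville m u v (c - t) < 0 := fun t ht =>
    (liouville_neg_iff (h.pos _)).2 (hneg _ ⟨by linarith [ht.2], by linarith [ht.1]⟩)
  have hZanti : AntitoneOn Z (Icc 0 δ) := by
    refine antitoneOn_of_deriv_nonpos (convex_Icc _ _)
      (fun t _ => (hZd t).continuousAt.continuousWithinAt)
      (fun t _ => (hZd t).differentiableAt.differentiableWithinAt) fun t ht => ?_
    rw [interior_Icc] at ht
    rw [(hZd t).deriv]
    refine mul_nonpos_of_nonpos_of_nonneg ?_
      (mul_pos_of_neg_of_neg (hpn t ⟨ht.1.le, ht.2⟩) (hqn t ⟨ht.1.le, ht.2.le⟩)).le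
    have h1 : u (c + t) ≤ u (c - t) :=
      (hanti ⟨by linarith [ht.2], by linarith [ht.1]⟩ ⟨by linarith [ht.1], by linarith [ht.2]⟩
        (by linarith [ht.1])).le
    have h2 := h.pos (c + t)
    rw [sub_nonpos]
    unfold potential
    gcongr
  have hZ0 : Z 0 < 0 := by
    have h1 : liouville m u v c < 0 :=
      (liouville_neg_iff (h.pos _)).2 (hneg c ⟨hcpos, by linarith⟩)
    have h2 : 0 < liouville' m u c := mul_pos
      (div_pos (sub_pos.2 (h.sq_lt_at_pi_div_two hm h0 hu0)) (h.pos _))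
      (Real.sqrt_pos.2 (weight_pos m (h.pos _)))
    simp only [hZ, add_zero, sub_zero]
    nlinarith
  have hratio : ∀ t ∈ Icc 0 δ, HasDerivAt
      (fun t => liouville m u v (c + t) / liouville m u v (c - t))
      (Z t / liouville m u v (c - t) ^ 2) t := fun t ht =>
    ((hp t).fun_div (hq t) (hqn t ht).ne).congr_deriv (by simp only [hZ]; ring)
  have hR := strictAntiOn_of_deriv_neg (convex_Icc 0 δ)
    (fun t ht => (hratio t ht).continuousAt.continuousWithinAt) (fun t ht => by
      rw [interior_Icc] at ht
      have ht' : t ∈ Icc 0 δ := Ioo_subset_Icc_self ht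
      rw [(hratio t ht').deriv]
      exact div_neg_of_neg_of_pos ((hZanti ⟨le_rfl, hδ0.le⟩ ht' ht.1.le).trans_lt hZ0)
        (sq_pos_of_neg (hqn t ht')))
  have h1 := hR ⟨le_rfl, hδ0.le⟩ ⟨hδ0.le, le_rfl⟩ hδ0
  simp only [add_zero, sub_zero] at h1
  have h2 : liouville m u v c ≠ 0 := by simpa using (hqn 0 ⟨le_rfl, hδ0.le⟩).ne
  rw [div_self h2, div_lt_one_of_neg (hqn δ ⟨hδ0.le, le_rfl⟩)] at h1
  exact h1

theorem IsOrbit.false_of_asymmetric {m : ℕ} (hm : 1 ≤ m) {u v : ℝ → ℝ} (h : IsOrbit m u v)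
    (h0 : v 0 = 0) (hu0 : (m : ℝ) < u 0 ^ 2) {δ : ℝ} (hδ0 : 0 < δ) (hδ : δ ≤ Real.pi / 2)
    (hv : v (Real.pi / 2 + δ) ≤ 0)
    (heq : liouville m u v (Real.pi / 2 + δ) = liouville m u v (Real.pi / 2 - δ)) : False := by
  obtain ⟨H, hH1, hH2, _, hHneg, hHpos⟩ := h.exists_half_period hm h0 hu0
  have hH : Real.pi / 2 + δ ≤ H := by
    by_contra hlt
    push Not at hlt
    exact absurd (hHpos _ ⟨hlt, by linarith⟩) (not_lt.2 hv)
  have hδ' : δ < Real.pi / 2 := by linarith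
  exact (h.liouville_reflect_lt hm h0 hu0 hδ0 hδ' fun t ht =>
    hHneg t ⟨ht.1, ht.2.trans_le hH⟩).ne heq.symm

theorem IsOrbit.eq_const_of_sq_eq {m : ℕ} (hm : 1 ≤ m) {u v : ℝ → ℝ} (h : IsOrbit m u v) {s : ℝ}
    (hv : v s = 0) (hu : u s ^ 2 = m) (t : ℝ) : u t = √m ∧ v t = 0 :=
  h.eq_of_eq (isOrbit_const hm) (s := s) (by rw [← hu, Real.sqrt_sq (h.pos s).le]) hv t

/-- A solution which meets the half-space `z ≥ 0` at the same angle on both sides is even. -/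
theorem IsOrbit.even_of_contact {m : ℕ} (hm : 1 ≤ m) {u v : ℝ → ℝ} (h : IsOrbit m u v) {k : ℝ}
    (hk : 0 ≤ k) (hr : v (Real.pi / 2) = -(k * √(1 + u (Real.pi / 2) ^ 2)))
    (hl : v (-(Real.pi / 2)) = k * √(1 + u (-(Real.pi / 2)) ^ 2)) :
    v 0 = 0 ∧ (m : ℝ) ≤ u 0 ^ 2 := by
  have hpi : 0 < Real.pi / 2 := by positivity
  set c := Real.pi / 2 with hc
  have hvr : v c ≤ 0 := by rw [hr]; exact neg_nonpos.2 (by positivity)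
  have hvl : 0 ≤ v (-c) := by rw [hl]; positivity
  -- the first integral turns the two contact conditions into an equality of normalised slopes
  have hsq : ∀ t, v t ^ 2 = k ^ 2 * (1 + u t ^ 2) →
      liouville m u v t ^ 2 = k ^ 2 / (1 + k ^ 2) * energy m (u 0) (v 0) := by
    intro t ht
    rw [← h.energy_eq t 0]
    unfold liouville energy
    rw [mul_pow, Real.sq_sqrt (weight_pos m (h.pos t)).le, ht,
      show 1 + u t ^ 2 + k ^ 2 * (1 + u t ^ 2) = (1 + k ^ 2) * (1 + u t ^ 2) by ring]
    field_simp
  have hLr := hsq c (by rw [hr, neg_sq, mul_pow, Real.sq_sqrt (by positivity)])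
  have hLl := hsq (-c) (by rw [hl, mul_pow, Real.sq_sqrt (by positivity)])
  have hLeq : liouville m u v c = -liouville m u v (-c) := by
    have h1 : liouville m u v c ≤ 0 :=
      mul_nonpos_of_nonpos_of_nonneg hvr (Real.sqrt_nonneg _)
    have h2 : 0 ≤ liouville m u v (-c) := mul_nonneg hvl (Real.sqrt_nonneg _)
    have h3 := hLr.trans hLl.symm
    rw [sq_eq_sq_iff_eq_or_eq_neg] at h3
    rcases h3 with h3 | h3
    · linarith
    · exact h3
  obtain ⟨φ, hφ, hmax⟩ := isCompact_Icc.exists_isMaxOn (s := Icc (-c) c)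
    ⟨0, by constructor <;> linarith⟩ h.continuous_fst.continuousOn
  have hvφ : v φ = 0 := by
    rcases hφ.1.eq_or_lt with h1 | h1
    · refine le_antisymm ?_ (h1 ▸ hvl)
      have h2 := deriv_nonneg_of_le_left (f := fun t => u (-c - t + φ)) (f' := -v φ) (s := -c)
        (a := -c - 1) ?_ (by linarith) ?_
      · linarith
      · have := ((h.shift φ).hasDerivAt_fst (-c - -c)).comp_const_sub (-c) (-c)
        simpa using this
      · intro t ht
        have : -c - t + φ ∈ Icc (-c) c := ⟨by linarith [ht.2], by linarith [ht.1, Real.pi_gt_three]⟩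
        simpa using hmax this
    · rcases hφ.2.eq_or_lt with h2 | h2
      · refine le_antisymm (h2 ▸ hvr) ?_
        exact deriv_nonneg_of_le_left (h.hasDerivAt_fst φ) h1
          fun t ht => hmax ⟨ht.1.le, ht.2.le.trans hφ.2⟩
      · exact (hmax.isLocalMax (Icc_mem_nhds h1 h2)).hasDerivAt_eq_zero (h.hasDerivAt_fst φ)
  rcases lt_trichotomy (u φ ^ 2) (m : ℝ) with hlt | heq | hgt
  · -- below the equilibrium value a critical point is a strict minimum
    exfalso
    have hd := h.hasDerivAt_snd φ
    rw [h.force_sub_of_snd_eq_zero hvφ] at hd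
    have hdpos : 0 < (m - u φ ^ 2) / u φ := div_pos (by linarith) (h.pos φ)
    have hs := hasDerivAt_iff_tendsto_slope.1 hd
    have hev := hs.eventually_const_lt hdpos
    rw [eventually_nhdsWithin_iff, Metric.eventually_nhds_iff_ball] at hev
    obtain ⟨ε, hε, hball⟩ := hev
    have hsign : ∀ t, |t - φ| < ε → t ≠ φ → 0 < (t - φ) * v t := by
      intro t ht hne
      have h1 := hball t (by rwa [Metric.mem_ball, Real.dist_eq]) hne
      rw [slope_def_field, hvφ, sub_zero] at h1
      rcases lt_or_gt_of_ne hne with h2 | h2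
      · exact mul_pos_of_neg_of_neg (sub_neg.2 h2)
          (by by_contra hge; push Not at hge
              exact absurd h1 (not_lt.2 (div_nonpos_of_nonneg_of_nonpos hge (by linarith))))
      · exact mul_pos (sub_pos.2 h2)
          (by by_contra hge; push Not at hge
              exact absurd h1 (not_lt.2 (div_nonpos_of_nonpos_of_nonneg hge (by linarith))))
    rcases hφ.2.eq_or_lt with h2 | h2
    · set t := φ - min (ε / 2) c
      have hmin : 0 < min (ε / 2) c := lt_min (by linarith) hpi
      have hm1 : StrictAntiOn u (Icc t φ) :=
        strictAntiOn_of_deriv_neg (convex_Icc _ _) h.continuous_fst.continuousOn fun r hr => by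
          rw [interior_Icc] at hr
          rw [(h.hasDerivAt_fst r).deriv]
          have h3 := hsign r (by
            rw [abs_lt]; constructor
            · have := min_le_left (ε / 2) c
              simp only [t] at hr; linarith [hr.1]
            · linarith [hr.2]) hr.2.ne
          have h4 : r - φ < 0 := sub_neg.2 hr.2
          by_contra hge; push Not at hge
          exact absurd h3 (not_lt.2 (mul_nonpos_of_nonpos_of_nonneg h4.le hge))
      have h3 := hm1 ⟨le_rfl, by simp only [t]; linarith⟩ ⟨by simp only [t]; linarith, le_rfl⟩
        (by simp only [t]; linarith)
      have h4 : t ∈ Icc (-c) c := by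
        have := min_le_right (ε / 2) c
        constructor <;> simp only [t] <;> linarith
      exact absurd (hmax h4) (not_le.2 h3)
    · set t := φ + min (ε / 2) (c - φ)
      have hmin : 0 < min (ε / 2) (c - φ) := lt_min (by linarith) (by linarith)
      have hm1 : StrictMonoOn u (Icc φ t) :=
        strictMonoOn_of_deriv_pos (convex_Icc _ _) h.continuous_fst.continuousOn fun r hr => by
          rw [interior_Icc] at hr
          rw [(h.hasDerivAt_fst r).deriv]
          have h3 := hsign r (by
            rw [abs_lt]; constructor
            · linarith [hr.1]
            · have := min_le_left (ε / 2) (c - φ)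
              simp only [t] at hr; linarith [hr.2]) hr.1.ne'
          exact (pos_iff_pos_of_mul_pos h3).1 (sub_pos.2 hr.1)
      have h3 := hm1 ⟨le_rfl, by simp only [t]; linarith⟩ ⟨by simp only [t]; linarith, le_rfl⟩
        (by simp only [t]; linarith)
      have h4 : t ∈ Icc (-c) c := by
        have := min_le_right (ε / 2) (c - φ)
        constructor <;> simp only [t] <;> linarith [hφ.1]
      exact absurd (hmax h4) (not_le.2 h3)
  · have hcst := h.eq_const_of_sq_eq hm hvφ heq 0
    exact ⟨hcst.2, by rw [hcst.1, Real.sq_sqrt (Nat.cast_nonneg m)]⟩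
  · have hφ0 : φ = 0 := by
      rcases lt_trichotomy φ 0 with hn | hz | hp
      · exfalso
        have h1 := h.shift φ
        refine h1.false_of_asymmetric hm (by simpa using hvφ) (by simpa using hgt)
          (δ := -φ) (by linarith) (by linarith [hφ.1]) (by simpa using hvr) ?_
        have h2 := h.symm_of_snd_eq_zero hvφ (-c)
        have h3 : liouville m u v (2 * φ - -c) = -liouville m u v (-c) := by
          unfold liouville
          rw [h2.1, show v (2 * φ - -c) = -v (-c) by linarith [h2.2]]
          ring
        have h4 : ∀ s, liouville m (fun s => u (s + φ)) (fun s => v (s + φ)) s =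
            liouville m u v (s + φ) := fun s => rfl
        rw [h4, h4, show c + -φ + φ = c by ring, show c - -φ + φ = 2 * φ - -c by ring, h3, hLeq]
      · exact hz
      · exfalso
        have h1 := h.reflect φ
        refine h1.false_of_asymmetric hm (by simpa using hvφ) (by simpa using hgt)
          (δ := φ) hp (by linarith [hφ.2]) ?_ ?_
        · rw [show φ - (c + φ) = -c by ring]; linarith
        have h2 := h.symm_of_snd_eq_zero hvφ c
        have h4 : ∀ s, liouville m (fun s => u (φ - s)) (fun s => -v (φ - s)) s =
            -liouville m u v (φ - s) := fun s => by unfold liouville; ring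
        have h3 : liouville m u v (2 * φ - c) = -liouville m u v c := by
          unfold liouville
          rw [h2.1, show v (2 * φ - c) = -v c by linarith [h2.2]]
          ring
        rw [h4, h4, show φ - (c + φ) = -c by ring, show φ - (c - φ) = 2 * φ - c by ring, h3, hLeq]
        ring
    subst hφ0
    exact ⟨hvφ, hgt.le⟩

/-- The only `2π`-periodic solution is the constant one: the period `2H` of a nonconstant solution
satisfies `π < 2H < 2π`. -/
theorem IsOrbit.eq_const_of_periodic {m : ℕ} (hm : 1 ≤ m) {u v : ℝ → ℝ} (h : IsOrbit m u v)
    (hper : ∀ s, u (s + 2 * Real.pi) = u s) (t : ℝ) : u t = √m ∧ v t = 0 := by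
  have hpi := Real.pi_pos
  obtain ⟨φ, hφ, hmax⟩ := isCompact_Icc.exists_isMaxOn (s := Icc 0 (4 * Real.pi))
    ⟨0, by constructor <;> linarith⟩ h.continuous_fst.continuousOn
  have hmaxall : ∀ s, u s ≤ u φ := by
    have hp : Function.Periodic u (2 * Real.pi) := hper
    intro s
    obtain ⟨y, hy, hys⟩ := hp.exists_mem_Ico₀ (by positivity) s
    rw [hys]
    exact hmax ⟨hy.1, by linarith [hy.2]⟩
  have hvφ : v φ = 0 :=
    (IsLocalMax.hasDerivAt_eq_zero (Eventually.of_forall hmaxall) (h.hasDerivAt_fst φ))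
  have hge : (m : ℝ) ≤ u φ ^ 2 := by
    by_contra hlt
    push Not at hlt
    have hd := h.hasDerivAt_snd φ
    rw [h.force_sub_of_snd_eq_zero hvφ] at hd
    have hdpos : 0 < (m - u φ ^ 2) / u φ := div_pos (by linarith) (h.pos φ)
    have hs := hasDerivAt_iff_tendsto_slope.1 hd
    have hev := (hs.mono_left (nhdsWithin_mono φ (fun x hx => (mem_Ioi.1 hx).ne'))).eventually_const_lt
      (u := 0) hdpos
    obtain ⟨b, hb, hbs⟩ := mem_nhdsGT_iff_exists_Ioo_subset.1 hev
    have hm1 : StrictMonoOn u (Icc φ b) :=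
      strictMonoOn_of_deriv_pos (convex_Icc _ _) h.continuous_fst.continuousOn fun r hr => by
        rw [interior_Icc] at hr
        rw [(h.hasDerivAt_fst r).deriv]
        have h3 := hbs hr
        simp only [mem_ofPred_eq, slope_def_field, hvφ, sub_zero] at h3
        exact (div_pos_iff_of_pos_right (sub_pos.2 hr.1)).1 h3
    exact absurd (hmaxall b) (not_le.2 (hm1 ⟨le_rfl, (mem_Ioi.1 hb).le⟩
      ⟨(mem_Ioi.1 hb).le, le_rfl⟩ hb))
  rcases hge.eq_or_lt with heq | hgt
  · exact h.eq_const_of_sq_eq hm hvφ heq.symm t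
  · exfalso
    have hs := h.shift φ
    obtain ⟨H, hH1, hH2, hvH, hneg, _⟩ := hs.exists_half_period hm (by simpa using hvφ)
      (by simpa using hgt)
    have hanti : StrictAntiOn (fun s => u (s + φ)) (Icc 0 H) :=
      strictAntiOn_of_deriv_neg (convex_Icc _ _) hs.continuous_fst.continuousOn fun r hr => by
        rw [interior_Icc] at hr
        rw [(hs.hasDerivAt_fst r).deriv]; exact hneg r hr
    -- `u` returns to its maximum after `2π - 2H`, which lies in `(0, π)`
    have h2 := hs.symm_of_snd_eq_zero hvH
    have h3 : u (2 * H + φ) = u φ := by simpa using (h2 0).1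
    have h4 : u ((2 * Real.pi - 2 * H) + φ) = u φ := by
      have h5 := (hs.symm_of_snd_eq_zero (s := 0) (by simpa using hvφ) (2 * H)).1
      simp only [mul_zero, zero_sub] at h5
      rw [h3] at h5
      rw [← h5, ← hper (-(2 * H) + φ)]
      congr 1; ring
    rcases le_or_gt (2 * Real.pi - 2 * H) H with hle | hgt'
    · have := hanti ⟨le_rfl, by linarith⟩ ⟨by linarith, hle⟩ (by linarith)
      simp only [zero_add] at this
      linarith
    · have h6 := (h2 (2 * Real.pi - 2 * H)).1
      have := hanti (a := 0) ⟨le_rfl, by linarith⟩ (b := 2 * H - (2 * Real.pi - 2 * H))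
        ⟨by linarith, by linarith⟩ (by linarith)
      simp only [zero_add] at this
      rw [h6, h4] at this
      exact lt_irrefl _ this

/-! ### Dependence on the initial value -/

/-- Second order Taylor estimate on a compact convex subset of an open set. -/
theorem exists_taylor_bound {E F : Type*} [NormedAddCommGroup E] [NormedSpace ℝ E]
    [NormedAddCommGroup F] [NormedSpace ℝ F] {f : E → F} {O B : Set E} (hO : IsOpen O)
    (hf : ContDiffOn ℝ ∞ f O) (hBO : B ⊆ O) (hB : IsCompact B) (hconv : Convex ℝ B) :
    ∃ K : ℝ, 0 ≤ K ∧ ∀ x ∈ B, ∀ y ∈ B,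
      ‖f y - f x - fderiv ℝ f x (y - x)‖ ≤ K * ‖y - x‖ ^ 2 := by
  have h1 : ContDiffOn ℝ ∞ (fderiv ℝ f) B :=
    (hf.fderiv_of_isOpen hO (m := ∞) (by simp)).mono hBO
  obtain ⟨K, hK⟩ := h1.exists_lipschitzOnWith (by simp) hconv hB
  refine ⟨K, K.2, fun x hx y hy => ?_⟩
  have hseg : segment ℝ x y ⊆ B := hconv.segment_subset hx hy
  have h2 := (convex_segment x y).norm_image_sub_le_of_norm_hasFDerivWithin_le'
    (f := f) (f' := fderiv ℝ f) (φ := fderiv ℝ f x) (C := K * ‖y - x‖)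
    (fun z hz => ((hf.differentiableOn (by simp)).differentiableAt
      (hO.mem_nhds (hBO (hseg hz)))).hasFDerivAt.hasFDerivWithinAt)
    (fun z hz => by
      have h3 := hK.dist_le_mul z (hseg hz) x hx
      rw [dist_eq_norm, dist_eq_norm] at h3
      refine h3.trans (mul_le_mul_of_nonneg_left ?_ K.2)
      have := norm_sub_le_of_mem_segment hz
      simpa [norm_sub_rev] using this)
    (left_mem_segment ℝ x y) (right_mem_segment ℝ x y)
  rw [pow_two, ← mul_assoc]
  exact h2

theorem fderiv_orbitField_apply (m : ℕ) {x : ℝ × ℝ} (hx : 0 < x.1) (y : ℝ × ℝ) :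
    fderiv ℝ (orbitField m) x y =
      (y.2, forceU m x.1 x.2 * y.1 + forceV m x.1 x.2 * y.2 - y.1) := by
  have hd : DifferentiableAt ℝ (orbitField m) x :=
    ((contDiffOn_orbitField m).differentiableOn (by simp)).differentiableAt
      ((isOpen_lt continuous_const continuous_fst).mem_nhds hx)
  have hline : HasDerivAt (fun s : ℝ => x + s • y) y 0 := by
    simpa using ((hasDerivAt_id (0 : ℝ)).smul_const y).const_add x
  have h1 : HasDerivAt (fun s : ℝ => orbitField m (x + s • y)) (fderiv ℝ (orbitField m) x y) 0 := by
    have h0 : HasFDerivAt (orbitField m) (fderiv ℝ (orbitField m) x) (x + (0 : ℝ) • y) := by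
      simpa using hd.hasFDerivAt
    exact h0.comp_hasDerivAt (0 : ℝ) hline
  have ha : HasDerivAt (fun s : ℝ => (x + s • y).1) y.1 0 := hline.fst
  have hb : HasDerivAt (fun s : ℝ => (x + s • y).2) y.2 0 := hline.snd
  have h2 := hb.prodMk ((hasDerivAt_force m (by simpa using hx) ha hb).fun_sub ha)
  simpa using h1.unique h2

/-- The solutions with `u'(0) = 0` depend differentiably on `u(0)`, and their derivative solves the
linearised equation. -/
theorem exists_variation {m : ℕ} (hm : 1 ≤ m) {U V : ℝ → ℝ → ℝ}
    (hUV : ∀ a, 0 < a → IsOrbit m (U a) (V a) ∧ U a 0 = a ∧ V a 0 = 0) {a₀ L : ℝ} (ha₀ : 0 < a₀)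
    (hL : 0 ≤ L) :
    ∃ f f₁ : ℝ → ℝ, LinearizedEq m (U a₀) (V a₀) f f₁ 0 ∧ f 0 = 1 ∧ f₁ 0 = 0 ∧
      HasDerivAt (fun a => U a L) (f L) a₀ ∧ HasDerivAt (fun a => V a L) (f₁ L) a₀ := by
  obtain ⟨h₀, hU0, hV0⟩ := hUV a₀ ha₀
  set O : Set (ℝ × ℝ) := {x | 0 < x.1}
  have hO : IsOpen O := isOpen_lt continuous_const continuous_fst
  set κ := energy m a₀ 0 + 1 with hκ
  have hκpos : 0 < κ := by
    have := h₀.one_add_sq_le_energy 0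
    rw [hU0, hV0] at this
    nlinarith [sq_nonneg a₀]
  have hcompact : IsCompact (phaseBox κ) := isCompact_Icc.prod isCompact_Icc
  have hconvex : Convex ℝ (phaseBox κ) := (convex_Icc _ _).prod (convex_Icc _ _)
  have hsub : phaseBox κ ⊆ O := fun x hx => (inv_pos.2 hκpos).trans_le hx.1.1
  have hbox₀ : ∀ t, (U a₀ t, V a₀ t) ∈ phaseBox κ := fun t =>
    h₀.mem_phaseBox hm (t := 0) (by rw [hU0, hV0]; linarith)
  have hev : ∀ᶠ a in 𝓝 a₀, 0 < a ∧ energy m a 0 ≤ κ := by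
    have hc : ContinuousAt (fun a => energy m a 0) a₀ := by
      unfold energy weight
      have : a₀ ^ 2 ≠ 0 := by positivity
      fun_prop (disch := assumption)
    exact (lt_mem_nhds ha₀).and ((hc.eventually_lt continuousAt_const
      (by show energy m a₀ 0 < κ; linarith)).mono fun _ h => h.le)
  obtain ⟨K, hK⟩ := ContDiffOn.exists_lipschitzOnWith ((contDiffOn_orbitField m).mono hsub)
    (by simp) hconvex hcompact
  obtain ⟨T, hT0, hT⟩ := exists_taylor_bound hO (contDiffOn_orbitField m) hsub hcompact hconvex
  have hfc : ContinuousOn (fderiv ℝ (orbitField m)) O :=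
    (contDiffOn_orbitField m).continuousOn_fderiv_of_isOpen hO (by simp)
  obtain ⟨D, hD⟩ := hcompact.exists_bound_of_continuousOn (hfc.mono hsub)
  have hD0 : 0 ≤ D := (norm_nonneg _).trans (hD _ (hbox₀ 0))
  set x : ℝ → ℝ × ℝ := fun t => (U a₀ t, V a₀ t) with hx
  have hxc : Continuous x := h₀.continuous_fst.prodMk h₀.continuous_snd
  have hxO : ∀ t, x t ∈ O := fun t => h₀.pos t
  -- the solution of the linearised equation
  obtain ⟨Y, hY0, hY⟩ := exists_global_solution (v := fun t y => fderiv ℝ (orbitField m) (x t) y)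
    (K := D.toNNReal)
    (fun t => ((fderiv ℝ (orbitField m) (x t)).lipschitz).weaken (by
      rw [← NNReal.coe_le_coe, Real.coe_toNNReal D hD0]; exact hD _ (hbox₀ t)))
    (fun y => (hfc.comp_continuous hxc hxO).clm_apply continuous_const) (1, 0)
  refine ⟨fun t => (Y t).1, fun t => (Y t).2, fun t => ⟨?_, ?_⟩, by simp [hY0], by simp [hY0], ?_⟩
  · have := (hY t).fst
    rwa [fderiv_orbitField_apply m (hxO t)] at this
  · have : HasDerivAt (fun t => (Y t).2) (fderiv ℝ (orbitField m) (x t) (Y t)).2 t := (hY t).snd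
    rw [fderiv_orbitField_apply m (hxO t)] at this
    refine this.congr_deriv ?_
    simp [hx]; ring
  -- the remainder of the first order expansion is quadratic
  set C : ℝ := gronwallBound 0 (D + 1) (T * Real.exp (K * L) ^ 2) L with hC
  have key : ∀ᶠ a in 𝓝 a₀,
      ‖((U a L, V a L) : ℝ × ℝ) - x L - (a - a₀) • Y L‖ ≤ C * ‖a - a₀‖ ^ 2 := by
    filter_upwards [hev] with a ha
    obtain ⟨h, hu0, hv0⟩ := hUV a ha.1
    have hbox : ∀ t, (U a t, V a t) ∈ phaseBox κ := fun t =>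
      h.mem_phaseBox hm (t := 0) (by rw [hu0, hv0]; exact ha.2)
    set z : ℝ → ℝ × ℝ := fun t => (U a t, V a t) with hz
    have hzc : Continuous z := h.continuous_fst.prodMk h.continuous_snd
    have hxd : ∀ t, HasDerivAt x (orbitField m (x t)) t := fun t =>
      (h₀.hasDerivAt_fst t).prodMk (h₀.hasDerivAt_snd t)
    have hzd : ∀ t, HasDerivAt z (orbitField m (z t)) t := fun t =>
      (h.hasDerivAt_fst t).prodMk (h.hasDerivAt_snd t)
    have hlip : ∀ t ∈ Icc 0 L, ‖z t - x t‖ ≤ ‖a - a₀‖ * Real.exp (K * L) := by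
      intro t ht
      have h1 := dist_le_of_trajectories_ODE_of_mem (v := fun _ => orbitField m)
        (s := fun _ => phaseBox κ) (K := K) (a := 0) (b := L) (δ := ‖a - a₀‖) (fun _ _ => hK)
        hzc.continuousOn (fun t _ => (hzd t).hasDerivWithinAt) (fun t _ => hbox t)
        hxc.continuousOn (fun t _ => (hxd t).hasDerivWithinAt) (fun t _ => hbox₀ t)
        (by simp [hz, hx, hu0, hv0, hU0, hV0, Prod.dist_eq, Real.dist_eq]) t ht
      rw [dist_eq_norm, sub_zero] at h1
      refine h1.trans (mul_le_mul_of_nonneg_left (Real.exp_le_exp.2 ?_) (norm_nonneg _))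
      exact mul_le_mul_of_nonneg_left ht.2 K.2
    have h2 := norm_le_gronwallBound_of_norm_deriv_right_le
      (f := fun t => z t - x t - (a - a₀) • Y t)
      (f' := fun t => orbitField m (z t) - orbitField m (x t) -
        (a - a₀) • fderiv ℝ (orbitField m) (x t) (Y t))
      (δ := 0) (K := D + 1) (ε := T * Real.exp (K * L) ^ 2 * ‖a - a₀‖ ^ 2) (a := 0) (b := L)
      (fun t _ => (((hzd t).sub (hxd t)).sub
        ((hY t).const_smul (a - a₀))).continuousAt.continuousWithinAt)
      (fun t _ => (((hzd t).sub (hxd t)).sub ((hY t).const_smul (a - a₀))).hasDerivWithinAt)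
      (by simp [hz, hx, hu0, hv0, hU0, hV0, hY0])
      (fun t ht => by
        have e : orbitField m (z t) - orbitField m (x t) -
            (a - a₀) • fderiv ℝ (orbitField m) (x t) (Y t) =
            fderiv ℝ (orbitField m) (x t) (z t - x t - (a - a₀) • Y t) +
            (orbitField m (z t) - orbitField m (x t) -
              fderiv ℝ (orbitField m) (x t) (z t - x t)) := by
          simp only [map_sub, map_smul]; abel
        rw [e]
        refine (norm_add_le _ _).trans (add_le_add ?_ ?_)
        · refine (ContinuousLinearMap.le_opNorm _ _).trans ?_
          exact mul_le_mul_of_nonneg_right ((hD _ (hbox₀ t)).trans (by linarith)) (norm_nonneg _)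
        · refine (hT _ (hbox₀ t) _ (hbox t)).trans ?_
          rw [mul_assoc]
          refine mul_le_mul_of_nonneg_left ?_ hT0
          rw [← mul_pow, mul_comm (Real.exp _)]
          exact pow_le_pow_left₀ (norm_nonneg _) (hlip t ⟨ht.1, ht.2.le⟩) 2)
      L ⟨hL, le_rfl⟩
    refine h2.trans (le_of_eq ?_)
    rw [hC, gronwallBound_of_K_ne_0 (by linarith), gronwallBound_of_K_ne_0 (by linarith)]
    simp only [zero_mul, zero_add, sub_zero]
    ring
  have hO2 : (fun a => ((U a L, V a L) : ℝ × ℝ) - x L - (a - a₀) • Y L) =O[𝓝 a₀]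
      fun a => ‖a - a₀‖ ^ 2 := by
    refine Asymptotics.IsBigO.of_bound C (key.mono fun a ha => ?_)
    rwa [Real.norm_of_nonneg (sq_nonneg ‖a - a₀‖)]
  have hd := hO2.hasFDerivAt (by norm_num) |>.hasDerivAt
  have hd2 : HasDerivAt (fun a => ((U a L, V a L) : ℝ × ℝ)) (Y L) a₀ := by
    have h3 : HasDerivAt (fun a : ℝ => x L + (a - a₀) • Y L) (Y L) a₀ := by
      simpa using (((hasDerivAt_id a₀).sub_const a₀).smul_const (Y L)).const_add (x L)
    have h4 := hd.add h3
    simp only [zero_apply, zero_add] at h4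
    refine h4.congr_of_eventuallyEq (Eventually.of_forall fun a => ?_)
    simp
  exact ⟨hd2.fst, hd2.snd⟩

/-! ### Monotonicity of the contact angle -/

theorem IsOrbit.gradY_pos {m : ℕ} (hm : 1 ≤ m) {u v : ℝ → ℝ} (h : IsOrbit m u v) (h0 : v 0 = 0)
    {t : ℝ} (ht0 : 0 < t) (ht : t ≤ Real.pi / 2) : 0 < gradY u v t := by
  have hmono := strictMonoOn_of_deriv_pos (convex_Icc 0 t)
    (fun s _ => (h.hasDerivAt_gradY s).continuousAt.continuousWithinAt) (fun s hs => by
      rw [interior_Icc] at hs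
      rw [(h.hasDerivAt_gradY s).deriv]
      exact mul_pos (Real.cos_pos_of_mem_Ioo ⟨by linarith [hs.1, Real.pi_pos], by linarith [hs.2]⟩)
        (force_pos hm (h.pos s) _))
  have := hmono ⟨le_rfl, ht0.le⟩ ⟨ht0.le, le_rfl⟩ ht0
  simpa [gradY, h0] using this

theorem IsOrbit.gradZ_pos {m : ℕ} {u v : ℝ → ℝ} (h : IsOrbit m u v) {t : ℝ} (ht0 : 0 ≤ t)
    (ht : t < Real.pi / 2) (hv : v t ≤ 0) : 0 < gradZ u v t := by
  have hc := Real.cos_pos_of_mem_Ioo ⟨by linarith, ht⟩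
  have hs := Real.sin_nonneg_of_nonneg_of_le_pi ht0 (by linarith [Real.pi_pos])
  unfold gradZ
  nlinarith [mul_pos (h.pos t) hc, mul_nonneg (neg_nonneg.2 hv) hs]

set_option maxHeartbeats 1000000 in
/-- The key sign: along the family of even solutions the slope of the cone at `{z = 0}`, that is
`-u' / √(1 + u²)` at `φ = π / 2`, has positive derivative with respect to `u(0)`. The variation `f`
of the family is compared with the variation under the linear maps
`(xₙ, z) ↦ ((1 - ε) xₙ, (1 + b ε) z)`, where `b` is chosen such that this variation vanishes exactly
where its image under the linearised operator changes sign. -/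
theorem IsOrbit.variation_slope_neg {m : ℕ} (hm : 1 ≤ m) {u v : ℝ → ℝ} (h : IsOrbit m u v)
    (h0 : v 0 = 0) (hu0 : (m : ℝ) < u 0 ^ 2) {f f₁ : ℝ → ℝ} (hf : LinearizedEq m u v f f₁ 0)
    (hf0 : f 0 = 1) (hf1 : f₁ 0 = 0) :
    (1 + u (Real.pi / 2) ^ 2) * f₁ (Real.pi / 2) -
      u (Real.pi / 2) * v (Real.pi / 2) * f (Real.pi / 2) < 0 := by
  set P := Real.pi / 2 with hP
  have hP0 : 0 < P := by positivity
  have hPpi : P < Real.pi := by simp only [hP]; linarith [Real.pi_pos]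
  have hvneg : ∀ t ∈ Ioc 0 P, v t < 0 := fun t ht => h.snd_neg hm h0 hu0 ht.1 ht.2
  have hvle : ∀ t ∈ Icc 0 P, v t ≤ 0 := fun t ht => by
    rcases ht.1.eq_or_lt with h1 | h1
    · rw [← h1, h0]
    · exact (hvneg t ⟨h1, ht.2⟩).le
  have hcos : ∀ t ∈ Ico 0 P, 0 < Real.cos t := fun t ht =>
    Real.cos_pos_of_mem_Ioo ⟨by linarith [ht.1], ht.2⟩
  have hsin : ∀ t ∈ Ioc 0 P, 0 < Real.sin t := fun t ht =>
    Real.sin_pos_of_pos_of_lt_pi ht.1 (ht.2.trans_lt hPpi)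
  have hgY : ∀ t ∈ Ioc 0 P, 0 < gradY u v t := fun t ht => h.gradY_pos hm h0 ht.1 ht.2
  have hgZ : ∀ t ∈ Ico 0 P, 0 < gradZ u v t := fun t ht =>
    h.gradZ_pos ht.1 ht.2 (hvle t ⟨ht.1, ht.2.le⟩)
  have hY : ∀ t ∈ Ico 0 P, 0 < velY u v t := fun t ht =>
    h.velY_pos ht.1 ht.2 (hvle t ⟨ht.1, ht.2.le⟩)
  have hZ : ∀ t ∈ Ioo 0 P, 0 < velZ u v t := fun t ht =>
    h.velZ_pos h0 ht.1 ht.2 fun r hr => hvneg r ⟨hr.1, hr.2.trans ht.2.le⟩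
  have hcf : Continuous f := continuous_iff_continuousAt.2 fun s => (hf s).1.continuousAt
  have hcY : Continuous (gradY u v) :=
    continuous_iff_continuousAt.2 fun s => (h.hasDerivAt_gradY s).continuousAt
  have hcZ : Continuous (gradZ u v) :=
    continuous_iff_continuousAt.2 fun s => (h.hasDerivAt_gradZ s).continuousAt
  have hcy := h.continuous_velY
  have hcz := h.continuous_velZ
  -- the choice of the linear map
  obtain ⟨s₁, hs₁, hΘ⟩ : ∃ s ∈ Ioo 0 P, Real.sin s * gradY u v s * velZ u v s ^ 2 -
      Real.cos s * gradZ u v s * velY u v s ^ 2 = 0 := by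
    refine intermediate_value_Ioo hP0.le (f := fun s => Real.sin s * gradY u v s * velZ u v s ^ 2 -
      Real.cos s * gradZ u v s * velY u v s ^ 2) (by fun_prop) ⟨?_, ?_⟩
    · have : 0 < u 0 * (1 + u 0 ^ 2) ^ 2 := by have := h.pos 0; positivity
      simp [gradZ, velY, this]
    · have : 0 < u P * (1 + u P ^ 2) ^ 2 := by have := h.pos P; positivity
      simp [gradY, velZ, hP]
      simpa [hP] using this
  have hs₁' : s₁ ∈ Ico 0 P := ⟨hs₁.1.le, hs₁.2⟩
  have hvz1 : 0 < Real.cos s₁ * gradZ u v s₁ := mul_pos (hcos s₁ hs₁') (hgZ s₁ hs₁')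
  have hvy1 : 0 < Real.sin s₁ * gradY u v s₁ :=
    mul_pos (hsin s₁ ⟨hs₁.1, hs₁.2.le⟩) (hgY s₁ ⟨hs₁.1, hs₁.2.le⟩)
  set b := Real.sin s₁ * gradY u v s₁ / (Real.cos s₁ * gradZ u v s₁) with hb
  have hbpos : 0 < b := div_pos hvy1 hvz1
  have hbeq : b * velZ u v s₁ ^ 2 = velY u v s₁ ^ 2 := by
    rw [hb, div_mul_eq_mul_div, div_eq_iff hvz1.ne']; linarith
  have hg := h.linearizedEq_stretchZ.const_mul_sub h.linearizedEq_stretchY b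
  set g := fun s => b * (Real.cos s * gradZ u v s) - Real.sin s * gradY u v s with hgdef
  set g₁ := fun s => b * (-Real.sin s * gradZ u v s +
    Real.cos s * -(Real.sin s * force m (u s) (v s))) - (Real.cos s * gradY u v s +
        Real.sin s * (Real.cos s * force m (u s) (v s))) with hg₁def
  set r := fun s => b * (secondFF m (u s) * velZ u v s ^ 2) -
    secondFF m (u s) * velY u v s ^ 2 with hrdef
  have hganti : StrictAntiOn g (Icc 0 P) := by
    refine strictAntiOn_of_deriv_neg (convex_Icc _ _)
      (fun t _ => (hg t).1.continuousAt.continuousWithinAt) fun t ht => ?_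
    rw [interior_Icc] at ht
    rw [(hg t).1.deriv]
    have a1 := hsin t ⟨ht.1, ht.2.le⟩
    have a2 := hcos t ⟨ht.1.le, ht.2⟩
    have a3 := hgY t ⟨ht.1, ht.2.le⟩
    have a4 := hgZ t ⟨ht.1.le, ht.2⟩
    have a5 := force_pos hm (h.pos t) (v t)
    have b1 := mul_pos hbpos (mul_pos a1 a4)
    have b2 := mul_pos hbpos (mul_pos a2 (mul_pos a1 a5))
    have b3 := mul_pos a2 a3
    have b4 := mul_pos a1 (mul_pos a2 a5)
    linarith
  have hg_s₁ : g s₁ = 0 := by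
    rw [hgdef]
    simp only
    rw [hb, div_mul_cancel₀ _ hvz1.ne', sub_self]
  have hquot : StrictMonoOn (fun s => velZ u v s / velY u v s) (Ico 0 P) := by
    refine strictMonoOn_of_deriv_pos (convex_Ico _ _) ?_ ?_
    · exact hcz.continuousOn.div hcy.continuousOn fun t ht => (hY t ht).ne'
    · intro t ht
      rw [interior_Ico] at ht
      have := hY t ⟨ht.1.le, ht.2⟩
      rw [(h.hasDerivAt_velZ_div_velY this.ne').deriv]
      positivity
  have hS : ∀ t, 0 < secondFF m (u t) := fun t => secondFF_pos hm (h.pos t)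
  have hrneg : ∀ t ∈ Ioo 0 s₁, r t < 0 := by
    intro t ht
    have htP : t ∈ Ioo 0 P := ⟨ht.1, ht.2.trans hs₁.2⟩
    have h1 := hquot ⟨htP.1.le, htP.2⟩ hs₁' ht.2
    simp only at h1
    rw [div_lt_div_iff₀ (hY t ⟨htP.1.le, htP.2⟩) (hY s₁ hs₁')] at h1
    have h2 : (velZ u v t * velY u v s₁) ^ 2 < (velZ u v s₁ * velY u v t) ^ 2 :=
      pow_lt_pow_left₀ h1 (mul_pos (hZ t htP) (hY s₁ hs₁')).le (by norm_num)
    rw [mul_pow, mul_pow, ← hbeq] at h2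
    have h3 : b * velZ u v t ^ 2 < velY u v t ^ 2 := by
      have := hZ s₁ hs₁
      have h4 : 0 < velZ u v s₁ ^ 2 := by positivity
      nlinarith
    have := mul_lt_mul_of_pos_left h3 (hS t)
    simp only [hrdef]; linarith
  have hrpos : ∀ t ∈ Ioo s₁ P, 0 < r t := by
    intro t ht
    have htP : t ∈ Ioo 0 P := ⟨hs₁.1.trans ht.1, ht.2⟩
    have h1 := hquot hs₁' ⟨htP.1.le, htP.2⟩ ht.1
    simp only at h1
    rw [div_lt_div_iff₀ (hY s₁ hs₁') (hY t ⟨htP.1.le, htP.2⟩)] at h1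
    have h2 : (velZ u v s₁ * velY u v t) ^ 2 < (velZ u v t * velY u v s₁) ^ 2 :=
      pow_lt_pow_left₀ h1 (mul_pos (hZ s₁ hs₁) (hY t ⟨htP.1.le, htP.2⟩)).le (by norm_num)
    rw [mul_pow, mul_pow, ← hbeq] at h2
    have h3 : velY u v t ^ 2 < b * velZ u v t ^ 2 := by
      have := hZ s₁ hs₁
      have h4 : 0 < velZ u v s₁ ^ 2 := by positivity
      nlinarith
    have := mul_lt_mul_of_pos_left h3 (hS t)
    simp only [hrdef]; linarith
  have hW := LinearizedEq.hasDerivAt_wronskian h hf hg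
  have hw : ∀ t, 0 < weight m (u t) := fun t => weight_pos m (h.pos t)
  have hfev : ∀ᶠ t in 𝓝[>] (0 : ℝ), -f t < 0 := by
    have : ∀ᶠ t in 𝓝 (0 : ℝ), 0 < f t :=
      hcf.continuousAt.eventually (lt_mem_nhds (by rw [hf0]; norm_num))
    exact (this.filter_mono nhdsWithin_le_nhds).mono fun t ht => by linarith
  -- a zero `s₀` of `f` exists, by comparison with dilations in `z`
  have hW2 := LinearizedEq.hasDerivAt_wronskian h hf h.linearizedEq_stretchZ
  have hstretch : (∀ t ∈ Ioo 0 P, -f t < 0) → f P < 0 := by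
    intro hpos
    have hmono := strictMonoOn_of_deriv_pos (convex_Icc 0 P)
      (fun t _ => (hW2 t).continuousAt.continuousWithinAt) (fun t ht => by
        rw [interior_Icc] at ht
        rw [(hW2 t).deriv]
        have h1 := hpos t ht
        have h2 := hZ t ht
        have h3 := mul_pos (neg_lt_zero.1 h1) (mul_pos (hS t) (pow_pos h2 2))
        simp only [Pi.zero_apply, mul_zero, sub_zero]
        exact mul_pos (hw t) h3)
    have h1 := hmono ⟨le_rfl, hP0.le⟩ ⟨hP0.le, le_rfl⟩ hP0
    have hcP : Real.cos P = 0 := Real.cos_pi_div_two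
    have hsP : Real.sin P = 1 := Real.sin_pi_div_two
    simp only [hf1, Real.sin_zero, neg_zero, zero_mul, mul_zero, add_zero, sub_zero, hcP, hsP] at h1
    have h2 := (mul_pos_iff_of_pos_left (hw P)).1 h1
    have h3 : gradZ u v P = -v P := by simp [gradZ, hcP, hsP]
    rw [h3] at h2
    have h4 := hvneg P ⟨hP0, le_rfl⟩
    by_contra hge
    push Not at hge
    have h5 := mul_nonneg hge (neg_pos.2 h4).le
    linarith
  obtain ⟨s₀, hs₀, hfs₀, hfneg⟩ : ∃ s ∈ Ioc 0 P, -f s = 0 ∧ ∀ t ∈ Ioo 0 s, -f t < 0 := by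
    by_cases hex : ∃ t ∈ Ioc 0 P, 0 ≤ -f t
    · obtain ⟨t, ht, hft⟩ := hex
      obtain ⟨s, hs, h1, h2⟩ := exists_first_zero hcf.neg ht.1 hfev hft
      exact ⟨s, ⟨hs.1, hs.2.trans ht.2⟩, h1, h2⟩
    · push Not at hex
      have h1 := hstretch fun t ht => hex t ⟨ht.1, ht.2.le⟩
      have h2 := hex P ⟨hP0, le_rfl⟩
      linarith
  replace hfs₀ : f s₀ = 0 := by linarith
  have hs₀P : s₀ < P := by
    rcases hs₀.2.eq_or_lt with h1 | h1
    · have := hstretch (h1 ▸ hfneg)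
      rw [h1] at hfs₀
      linarith
    · exact h1
  -- at its zeros in `(0, π / 2]` the variation `f` decreases strictly
  have hW3 := LinearizedEq.hasDerivAt_wronskian h hf h.linearizedEq_snd
  have hzero : ∀ t ∈ Ioc 0 P, f t = 0 → f₁ t < 0 := by
    intro t ht hft
    have hconst := is_const_of_deriv_eq_zero (fun s => (hW3 s).differentiableAt)
      (fun s => by rw [(hW3 s).deriv]; simp) t 0
    simp only [hft, hf0, hf1, h0, zero_mul, one_mul, sub_zero, zero_sub, mul_zero] at hconst
    have h1 : force m (u 0) 0 - u 0 < 0 := by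
      have := h.force_sub_of_snd_eq_zero h0
      rw [h0] at this
      rw [this]
      exact div_neg_of_neg_of_pos (by linarith) (h.pos 0)
    have h2 : weight m (u t) * -(v t * f₁ t) < 0 := by
      rw [hconst]; exact mul_neg_of_pos_of_neg (hw 0) h1
    have h3 : 0 < v t * f₁ t := by
      by_contra hle
      push Not at hle
      exact absurd h2 (not_lt.2 (mul_nonneg (hw t).le (by linarith)))
    exact (neg_iff_neg_of_mul_pos h3).1 (hvneg t ht)
  have hs₁s₀ : s₁ < s₀ := by
    by_contra hle
    push Not at hle
    have hanti := strictAntiOn_of_deriv_neg (convex_Icc 0 s₀)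
      (fun t _ => (hW t).continuousAt.continuousWithinAt) (fun t ht => by
        rw [interior_Icc] at ht
        rw [(hW t).deriv]
        have h1 := hfneg t ht
        have h2 := hrneg t ⟨ht.1, ht.2.trans_le hle⟩
        simp only [Pi.zero_apply, mul_zero, sub_zero]
        exact mul_neg_of_pos_of_neg (hw t) (mul_neg_of_pos_of_neg (by linarith) h2))
    have h1 := hanti ⟨le_rfl, hs₀.1.le⟩ ⟨hs₀.1.le, le_rfl⟩ hs₀.1
    have e0 : f 0 * g₁ 0 - g 0 * f₁ 0 = 0 := by simp [hg₁def, hf1, gradY, h0]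
    simp only [e0, mul_zero, hfs₀, zero_mul, zero_sub] at h1
    have h2 := hzero s₀ hs₀ hfs₀
    have h3 : 0 ≤ g s₀ := by
      rw [← hg_s₁]
      exact hganti.antitoneOn ⟨hs₀.1.le, hs₀.2⟩ ⟨hs₁.1.le, hs₁.2.le⟩ hle
    have h4 : 0 ≤ -(g s₀ * f₁ s₀) := by
      rw [← mul_neg]; exact mul_nonneg h3 (neg_pos.2 h2).le
    exact absurd h1 (not_lt.2 (mul_nonneg (hw s₀).le h4))
  have hf₁s₀ := hzero s₀ hs₀ hfs₀
  have hfafter : ∀ t ∈ Ioc s₀ P, f t < 0 := by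
    intro t ht
    by_contra hge
    push Not at hge
    have hev : ∀ᶠ t in 𝓝[>] s₀, f t < 0 := by
      have h3 := hasDerivWithinAt_iff_tendsto_slope.1 ((hf s₀).1.hasDerivWithinAt (s := Ioi s₀))
      rw [sdiff_singleton_eq_self (by simp)] at h3
      filter_upwards [h3.eventually_lt_const hf₁s₀, self_mem_nhdsWithin] with r hr hrs
      rw [slope_def_field, hfs₀, sub_zero] at hr
      by_contra hge
      push Not at hge
      exact absurd hr (not_lt.2 (div_nonneg hge (sub_pos.2 (mem_Ioi.1 hrs)).le))
    obtain ⟨z, hz, hfz, hzneg⟩ := exists_first_zero hcf ht.1 hev hge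
    have h1 := hzero z ⟨hs₀.1.trans hz.1, hz.2.trans ht.2⟩ hfz
    have h2 := deriv_nonneg_of_le_left (hf z).1 hz.1 fun r hr => by rw [hfz]; exact (hzneg r hr).le
    linarith
  have hanti := strictAntiOn_of_deriv_neg (convex_Icc s₀ P)
    (fun t _ => (hW t).continuousAt.continuousWithinAt) (fun t ht => by
      rw [interior_Icc] at ht
      rw [(hW t).deriv]
      have h1 := hfafter t ⟨ht.1, ht.2.le⟩
      have h2 := hrpos t ⟨hs₁s₀.trans ht.1, ht.2⟩
      simp only [Pi.zero_apply, mul_zero, sub_zero]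
      exact mul_neg_of_pos_of_neg (hw t) (mul_neg_of_neg_of_pos h1 h2))
  have h1 := hanti ⟨le_rfl, hs₀P.le⟩ ⟨hs₀P.le, le_rfl⟩ hs₀P
  have hgs₀ : g s₀ < 0 := by
    rw [← hg_s₁]
    exact hganti ⟨hs₁.1.le, hs₁.2.le⟩ ⟨hs₀.1.le, hs₀.2⟩ hs₁s₀
  have h2 : weight m (u s₀) * (f s₀ * g₁ s₀ - g s₀ * f₁ s₀) < 0 := by
    rw [hfs₀]
    exact mul_neg_of_pos_of_neg (hw s₀) (by linarith [mul_pos_of_neg_of_neg hgs₀ hf₁s₀])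
  have h3 : f P * g₁ P - g P * f₁ P < 0 := by
    have := h1.trans h2
    by_contra hge
    push Not at hge
    exact absurd this (not_lt.2 (mul_nonneg (hw P).le hge))
  have hcP : Real.cos P = 0 := Real.cos_pi_div_two
  have hsP : Real.sin P = 1 := Real.sin_pi_div_two
  have eg : g P = -u P := by simp [hgdef, gradY, hcP, hsP]
  have eg₁ : g₁ P = b * v P := by simp [hg₁def, gradZ, hcP, hsP]
  rw [eg, eg₁] at h3
  have h4 := hvneg P ⟨hP0, le_rfl⟩
  have h5 := hfafter P ⟨hs₀P, le_rfl⟩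
  have h6 := h.pos P
  have h7 : 0 < f P * v P := mul_pos_of_neg_of_neg h5 h4
  have h8 : u P * f₁ P < 0 := by linarith [mul_pos hbpos h7]
  have h9 : f₁ P < 0 := by
    by_contra hge; push Not at hge
    exact absurd h8 (not_lt.2 (mul_nonneg h6.le hge))
  linarith [mul_pos h6 h7, mul_pos (show 0 < 1 + u P ^ 2 by positivity) (neg_pos.2 h9)]

/-! ### Steep cones -/

/-- The quotient of the rotation field `u'` by the shear field `sin φ (u cos φ - u' sin φ)`
decreases, so it stays below its limit at `φ = 0`. -/
theorem IsOrbit.snd_mul_sq_le {m : ℕ} (hm : 1 ≤ m) {u v : ℝ → ℝ} (h : IsOrbit m u v) (h0 : v 0 = 0)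
    (hu0 : (m : ℝ) < u 0 ^ 2) {t : ℝ} (ht0 : 0 < t) (ht : t ≤ Real.pi / 2) :
    v t * u 0 ^ 2 ≤ (m - u 0 ^ 2) * (Real.sin t * gradZ u v t) := by
  have hneg : ∀ s ∈ Ioc 0 t, v s < 0 := fun s hs => h.snd_neg hm h0 hu0 hs.1 (hs.2.trans ht)
  have hg : ∀ s ∈ Ioc 0 t, 0 < Real.sin s * gradZ u v s := by
    intro s hs
    have h1 := Real.sin_pos_of_pos_of_lt_pi hs.1 (by linarith [hs.2, Real.pi_pos])
    have h2 := Real.cos_nonneg_of_mem_Icc (x := s) ⟨by linarith [hs.1, Real.pi_pos], hs.2.trans ht⟩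
    have h3 := mul_nonneg (h.pos s).le h2
    have h4 := mul_pos (neg_pos.2 (hneg s hs)) h1
    refine mul_pos h1 ?_
    unfold gradZ
    linarith
  have hder := fun s => (h.linearizedEq_shear s).1
  have hanti : StrictAntiOn (fun s => v s / (Real.sin s * gradZ u v s)) (Ioc 0 t) := by
    refine strictAntiOn_of_deriv_neg (convex_Ioc _ _) ?_ ?_
    · exact h.continuous_snd.continuousOn.div
        (fun s _ => (hder s).continuousAt.continuousWithinAt) fun s hs => (hg s hs).ne'
    · intro s hs
      rw [interior_Ioc] at hs
      have hs' : s ∈ Ioc 0 t := ⟨hs.1, hs.2.le⟩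
      rw [((h.hasDerivAt_snd s).fun_div (hder s) (hg s hs').ne').deriv]
      have h1 := h.shear_wronskian_pos hm h0 hs.1 (hs.2.le.trans ht)
        fun r hr => hneg r ⟨hr.1, hr.2.le.trans hs.2.le⟩
      exact div_neg_of_neg_of_pos (by linarith) (pow_pos (hg s hs') 2)
  have hu := h.pos 0
  have hlim : Tendsto (fun s => v s / (Real.sin s * gradZ u v s)) (𝓝[>] 0)
      (𝓝 ((m - u 0 ^ 2) / u 0 / u 0)) := by
    have h1 := h.hasDerivAt_snd 0
    rw [h.force_sub_of_snd_eq_zero h0] at h1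
    have h2 := hder 0
    have h1' := hasDerivWithinAt_iff_tendsto_slope.1 (h1.hasDerivWithinAt (s := Ioi 0))
    have h2' := hasDerivWithinAt_iff_tendsto_slope.1 (h2.hasDerivWithinAt (s := Ioi 0))
    rw [sdiff_singleton_eq_self (by simp)] at h1' h2'
    have h3 := h1'.div h2' (by simp [gradZ, hu.ne'])
    have e : Real.cos 0 * gradZ u v 0 +
        Real.sin 0 * -(Real.sin 0 * force m (u 0) (v 0)) = u 0 := by simp [gradZ]
    simp only [e] at h3
    refine h3.congr' ?_
    filter_upwards [self_mem_nhdsWithin] with s hs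
    simp only [Pi.div_apply, slope_def_field, h0, Real.sin_zero, zero_mul, sub_zero]
    rw [div_div_div_cancel_right₀ (mem_Ioi.1 hs).ne']
  have hle : v t / (Real.sin t * gradZ u v t) ≤ (m - u 0 ^ 2) / u 0 / u 0 := by
    refine ge_of_tendsto hlim ?_
    filter_upwards [Ioo_mem_nhdsGT ht0] with s hs
    exact (hanti ⟨hs.1, hs.2.le⟩ ⟨ht0, le_rfl⟩ hs.2).le
  rw [div_div, ← pow_two, div_le_div_iff₀ (hg t ⟨ht0, le_rfl⟩) (by positivity)] at hle
  exact hle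

/-- The barrier of the upper bound is the quadratic cone with the same value at `φ = 0`. -/
theorem IsOrbit.sq_le {m : ℕ} (hm : 1 ≤ m) {u v : ℝ → ℝ} (h : IsOrbit m u v) (h0 : v 0 = 0)
    (hu0 : (m : ℝ) < u 0 ^ 2) {t : ℝ} (ht0 : 0 ≤ t) (ht : t ≤ Real.pi / 2) :
    u t ^ 2 ≤ u 0 ^ 2 * Real.cos t ^ 2 + m * Real.sin t ^ 2 := by
  set a := u 0
  have hm' : (0 : ℝ) < m := by exact_mod_cast hm
  have ha := h.pos 0
  have hD : ∀ s, 0 < a ^ 2 * Real.cos s ^ 2 + m * Real.sin s ^ 2 := by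
    intro s
    have := Real.sin_sq_add_cos_sq s
    nlinarith [sq_nonneg (Real.sin s), sq_nonneg (Real.cos s)]
  have hDd : ∀ s, HasDerivAt (fun s => a ^ 2 * Real.cos s ^ 2 + m * Real.sin s ^ 2)
      (2 * (m - a ^ 2) * Real.sin s * Real.cos s) s := by
    intro s
    have h1 := ((Real.hasDerivAt_cos s).fun_pow 2).const_mul (a ^ 2)
    have h2 := ((Real.hasDerivAt_sin s).fun_pow 2).const_mul (m : ℝ)
    refine (h1.fun_add h2).congr_deriv ?_
    simp; ring
  have hanti := antitoneOn_of_deriv_nonpos (convex_Icc 0 t)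
    (f := fun s => u s ^ 2 / (a ^ 2 * Real.cos s ^ 2 + m * Real.sin s ^ 2))
    (fun s _ => (((h.hasDerivAt_fst s).fun_pow 2).fun_div (hDd s) (hD s).ne').continuousAt.continuousWithinAt)
    (fun s _ => (((h.hasDerivAt_fst s).fun_pow 2).fun_div (hDd s)
      (hD s).ne').differentiableAt.differentiableWithinAt)
    (fun s hs => by
      rw [interior_Icc] at hs
      rw [(((h.hasDerivAt_fst s).fun_pow 2).fun_div (hDd s) (hD s).ne').deriv]
      refine div_nonpos_of_nonpos_of_nonneg ?_ (sq_nonneg _)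
      have h1 := h.snd_mul_sq_le hm h0 hu0 hs.1 (hs.2.le.trans ht)
      have h2 : v s * (a ^ 2 * Real.cos s ^ 2 + m * Real.sin s ^ 2) ≤
          (m - a ^ 2) * Real.sin s * Real.cos s * u s := by
        have e := Real.cos_sq' s
        have : (m - u 0 ^ 2) * (Real.sin s * gradZ u v s) = (m - a ^ 2) *
          Real.sin s * Real.cos s * u s - (m - a ^ 2) * Real.sin s ^ 2 * v s := by
          unfold gradZ; ring
        rw [this] at h1
        rw [e]
        linarith
      have h3 := mul_le_mul_of_nonneg_left h2 (h.pos s).le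
      norm_num
      linarith)
  have h1 := hanti ⟨le_rfl, ht0⟩ ⟨ht0, le_rfl⟩ ht0
  simp only [Real.cos_zero, Real.sin_zero, one_pow, mul_one, ne_eq, OfNat.ofNat_ne_zero,
    not_false_eq_true, zero_pow, mul_zero, add_zero] at h1
  have e : u 0 ^ 2 / a ^ 2 = 1 := div_self (by positivity)
  rw [e, div_le_one (hD t)] at h1
  exact h1

theorem IsOrbit.mul_cos_le {m : ℕ} (hm : 1 ≤ m) {u v : ℝ → ℝ} (h : IsOrbit m u v) (h0 : v 0 = 0)
    {t : ℝ} (ht0 : 0 ≤ t) (ht : t < Real.pi / 2) : u 0 * Real.cos t ≤ u t := by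
  have hc : ∀ s ∈ Icc 0 t, 0 < Real.cos s := fun s hs =>
    Real.cos_pos_of_mem_Ioo ⟨by linarith [hs.1, Real.pi_pos], by linarith [hs.2]⟩
  have hmono := monotoneOn_of_deriv_nonneg (convex_Icc 0 t) (f := fun s => u s / Real.cos s)
    (fun s hs => ((h.hasDerivAt_fst s).fun_div (Real.hasDerivAt_cos s)
      (hc s hs).ne').continuousAt.continuousWithinAt)
    (fun s hs => ((h.hasDerivAt_fst s).fun_div (Real.hasDerivAt_cos s)
      (hc s (interior_subset hs)).ne').differentiableAt.differentiableWithinAt)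
    (fun s hs => by
      rw [((h.hasDerivAt_fst s).fun_div (Real.hasDerivAt_cos s)
        (hc s (interior_subset hs)).ne').deriv]
      rw [interior_Icc] at hs
      have := h.gradY_pos hm h0 hs.1 (hs.2.le.trans ht.le)
      unfold gradY at this
      exact div_nonneg (by linarith) (sq_nonneg _))
  have h1 := hmono ⟨le_rfl, ht0⟩ ⟨ht0, le_rfl⟩ ht0
  simp only [Real.cos_zero, div_one] at h1
  rwa [le_div_iff₀ (hc t ⟨ht0, le_rfl⟩)] at h1

/-- However steep the cone, its boundary radius is bounded below: on the short interval where
`1 / u(0) ≤ cos φ ≤ 2 / u(0)` the quantity `u sin φ + u' cos φ`, which increases from `0`, gains a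
definite amount. -/
theorem IsOrbit.le_at_pi_div_two {m : ℕ} (hm : 1 ≤ m) {u v : ℝ → ℝ} (h : IsOrbit m u v)
    (h0 : v 0 = 0) (ha4 : 4 ≤ u 0) (ham : 2 * (m : ℝ) ≤ u 0 ^ 2) :
    1 / (16 * (4 + (m : ℝ)) ^ 2 * (5 + m)) ≤ u (Real.pi / 2) := by
  set a := u 0
  have hm' : (1 : ℝ) ≤ m := by exact_mod_cast hm
  have hu0 : (m : ℝ) < u 0 ^ 2 := by linarith
  have hapos : 0 < a := by linarith
  set φ₁ := Real.arccos (2 / a) with hφ₁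
  set φ₂ := Real.arccos (1 / a) with hφ₂
  have h2a : 2 / a ≤ 1 / 2 := by rw [div_le_div_iff₀ hapos (by norm_num)]; linarith
  have h1a : 1 / a ≤ 2 / a := by gcongr; norm_num
  have h0a : 0 < 1 / a := by positivity
  have hc₁ : Real.cos φ₁ = 2 / a := Real.cos_arccos (by linarith) (by linarith)
  have hc₂ : Real.cos φ₂ = 1 / a := Real.cos_arccos (by linarith) (by linarith)
  have hφ₁0 : 0 < φ₁ := Real.arccos_pos.2 (by linarith)
  have hφ₂P : φ₂ < Real.pi / 2 := Real.arccos_lt_pi_div_two.2 h0a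
  have hlt : φ₁ < φ₂ := Real.arccos_lt_arccos (by linarith)
    (by rw [div_lt_div_iff_of_pos_right hapos]; norm_num) (by linarith)
  have hlen : 1 / a ≤ φ₂ - φ₁ := by
    have h1 := Real.abs_cos_sub_cos_le φ₁ φ₂
    rw [hc₁, hc₂, abs_sub_comm φ₁, abs_of_pos (sub_pos.2 hlt)] at h1
    refine le_trans ?_ h1
    refine le_trans (le_of_eq ?_) (le_abs_self _)
    ring
  set δ := a / (16 * (4 + (m : ℝ)) ^ 2 * (5 + m)) with hδ
  have hder : ∀ s ∈ Icc φ₁ φ₂, δ ≤ Real.cos s * force m (u s) (v s) := by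
    intro s hs
    have hs0 : 0 < s := hφ₁0.trans_le hs.1
    have hsP : s < Real.pi / 2 := hs.2.trans_lt hφ₂P
    have hpi := Real.pi_pos
    have hcs : 1 / a ≤ Real.cos s := by
      rw [← hc₂]
      exact Real.cos_le_cos_of_nonneg_of_le_pi hs0.le (by linarith) hs.2
    have hcs2 : Real.cos s ≤ 2 / a := by
      rw [← hc₁]
      exact Real.cos_le_cos_of_nonneg_of_le_pi hφ₁0.le (by linarith) hs.1
    have hcpos : 0 < Real.cos s := h0a.trans_le hcs
    have hspos : 0 < Real.sin s := Real.sin_pos_of_pos_of_lt_pi hs0 (by linarith)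
    have hac : a * Real.cos s ≤ 2 := by
      rw [le_div_iff₀ hapos] at hcs2; linarith
    have hac1 : 1 ≤ a * Real.cos s := by
      rw [div_le_iff₀ hapos] at hcs; linarith
    have hac2 : a ^ 2 * Real.cos s ^ 2 ≤ 4 := by
      rw [← mul_pow]
      calc (a * Real.cos s) ^ 2 ≤ 2 ^ 2 := pow_le_pow_left₀ (by linarith) hac 2
        _ = 4 := by norm_num
    have hsc := Real.sin_sq_add_cos_sq s
    have hs1 : Real.sin s ^ 2 ≤ 1 := by linarith [sq_nonneg (Real.cos s)]
    have hshalf : 1 / 2 ≤ Real.sin s := by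
      have h1 : Real.cos s ≤ 1 / 2 := hcs2.trans h2a
      have h2 : Real.cos s ^ 2 ≤ (1 / 2) ^ 2 := pow_le_pow_left₀ hcpos.le h1 2
      refine le_of_sq_le_sq ?_ hspos.le
      linarith
    have hu1 : 1 ≤ u s := hac1.trans (h.mul_cos_le hm h0 hs0.le hsP)
    have hu4 : u s ^ 2 ≤ 4 + m := by
      have h1 := h.sq_le hm h0 hu0 hs0.le hsP.le
      have h2 : (m : ℝ) * Real.sin s ^ 2 ≤ m * 1 := mul_le_mul_of_nonneg_left hs1 (by linarith)
      linarith
    -- the slope is of order `a`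
    have hv : a * u s ≤ 4 * (4 + m) * (-v s) := by
      have h1 := h.snd_mul_sq_le hm h0 hu0 hs0 hsP.le
      have h2 : (a ^ 2 - m) * (Real.sin s * Real.cos s * u s) ≤
          (-v s) * (a ^ 2 * Real.cos s ^ 2 + m * Real.sin s ^ 2) := by
        have : (m - u 0 ^ 2) * (Real.sin s * gradZ u v s) = -((a ^ 2 - m) *
          (Real.sin s * Real.cos s * u s)) - (m - a ^ 2) * Real.sin s ^ 2 * v s := by
          unfold gradZ; ring
        rw [this] at h1
        have e := Real.cos_sq' s
        rw [e]
        linarith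
      have hvn : 0 < -v s := neg_pos.2 (h.snd_neg hm h0 hu0 hs0 hsP.le)
      have h3 : (-v s) * (a ^ 2 * Real.cos s ^ 2 + m * Real.sin s ^ 2) ≤ (-v s) * (4 + m) := by
        refine mul_le_mul_of_nonneg_left ?_ hvn.le
        have h2 : (m : ℝ) * Real.sin s ^ 2 ≤ m * 1 := mul_le_mul_of_nonneg_left hs1 (by linarith)
        linarith
      have h4 : a ^ 2 / 2 * (1 / 2 * Real.cos s * u s) ≤
          (a ^ 2 - m) * (Real.sin s * Real.cos s * u s) := by
        refine mul_le_mul (by linarith) ?_ (by positivity) (by linarith)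
        gcongr
      have h5 : a * u s ≤ a * u s * (a * Real.cos s) :=
        le_mul_of_one_le_right (by positivity) hac1
      linarith
    have hv2 : a ^ 2 * u s ^ 2 ≤ 16 * (4 + m) ^ 2 * v s ^ 2 := by
      have := pow_le_pow_left₀ (by positivity) hv 2
      linarith
    have hF : a ^ 2 / (16 * (4 + (m : ℝ)) ^ 2 * (5 + m)) ≤ force m (u s) (v s) := by
      unfold force
      rw [div_le_div_iff₀ (by positivity) (by positivity)]
      have h6 : a ^ 2 * (u s * (1 + u s ^ 2)) ≤ a ^ 2 * (u s ^ 2 * (5 + m)) := by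
        refine mul_le_mul_of_nonneg_left ?_ (sq_nonneg a)
        have : u s ≤ u s ^ 2 := by nlinarith
        exact mul_le_mul this (by linarith) (by positivity) (by positivity)
      have h7 : v s ^ 2 ≤ m * (1 + u s ^ 2 + v s ^ 2) := by
        have : 1 * (1 + u s ^ 2 + v s ^ 2) ≤ m * (1 + u s ^ 2 + v s ^ 2) :=
          mul_le_mul_of_nonneg_right hm' (by positivity)
        linarith [sq_nonneg (u s)]
      have h8 : a ^ 2 * u s ^ 2 * (5 + m) ≤ 16 * (4 + m) ^ 2 * v s ^ 2 * (5 + m) :=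
        mul_le_mul_of_nonneg_right hv2 (by linarith)
      have h9 : v s ^ 2 * (16 * (4 + (m : ℝ)) ^ 2 * (5 + m)) ≤
          m * (1 + u s ^ 2 + v s ^ 2) * (16 * (4 + (m : ℝ)) ^ 2 * (5 + m)) :=
        mul_le_mul_of_nonneg_right h7 (by positivity)
      linarith
    calc δ = 1 / a * (a ^ 2 / (16 * (4 + (m : ℝ)) ^ 2 * (5 + m))) := by
          rw [hδ]; field_simp
      _ ≤ _ := mul_le_mul hcs hF (by positivity) hcpos.le
  have hcont : Continuous (gradY u v) :=
    continuous_iff_continuousAt.2 fun s => (h.hasDerivAt_gradY s).continuousAt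
  have hgain : δ * (φ₂ - φ₁) ≤ gradY u v φ₂ - gradY u v φ₁ :=
    (convex_Icc φ₁ φ₂).mul_sub_le_image_sub_of_le_deriv hcont.continuousOn
      (fun s _ => (h.hasDerivAt_gradY s).differentiableAt.differentiableWithinAt)
      (fun s hs => by
        rw [(h.hasDerivAt_gradY s).deriv]; exact hder s (interior_subset hs))
      φ₁ (left_mem_Icc.2 hlt.le) φ₂ (right_mem_Icc.2 hlt.le) hlt.le
  have hrest : gradY u v φ₂ ≤ gradY u v (Real.pi / 2) := by
    refine monotoneOn_of_deriv_nonneg (convex_Icc φ₂ (Real.pi / 2)) hcont.continuousOn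
      (fun s _ => (h.hasDerivAt_gradY s).differentiableAt.differentiableWithinAt)
      (fun s hs => ?_) (left_mem_Icc.2 hφ₂P.le) (right_mem_Icc.2 hφ₂P.le) hφ₂P.le
    rw [interior_Icc] at hs
    rw [(h.hasDerivAt_gradY s).deriv]
    exact mul_nonneg (Real.cos_nonneg_of_mem_Icc ⟨by linarith [hs.1, Real.pi_pos], hs.2.le⟩)
      (force_pos hm (h.pos s) _).le
  have hstart := h.gradY_pos hm h0 hφ₁0 (hlt.le.trans hφ₂P.le)
  have e : gradY u v (Real.pi / 2) = u (Real.pi / 2) := by simp [gradY]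
  have h10 : δ * (1 / a) ≤ δ * (φ₂ - φ₁) := mul_le_mul_of_nonneg_left hlen (by positivity)
  have e2 : δ * (1 / a) = 1 / (16 * (4 + (m : ℝ)) ^ 2 * (5 + m)) := by
    rw [hδ]; field_simp
  linarith

theorem weight_anti (m : ℕ) {x y : ℝ} (hx : 0 < x) (hxy : x ≤ y) : weight m y ≤ weight m x := by
  have hy := hx.trans_le hxy
  unfold weight
  refine pow_le_pow_left₀ (by positivity) ?_ m
  rw [div_le_div_iff₀ (by positivity) (by positivity)]
  nlinarith [pow_le_pow_left₀ hx.le hxy 2]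

theorem one_le_weight (m : ℕ) {x : ℝ} (hx : 0 < x) : 1 ≤ weight m x := by
  unfold weight
  refine one_le_pow₀ ?_
  rw [one_le_div (by positivity)]
  linarith

theorem exists_slope_ge {m : ℕ} (hm : 1 ≤ m) (k : ℝ) : ∃ A : ℝ, √m < A ∧ ∀ u v : ℝ → ℝ,
    IsOrbit m u v → v 0 = 0 → u 0 = A →
      k * √(1 + u (Real.pi / 2) ^ 2) ≤ -v (Real.pi / 2) := by
  have hm' : (1 : ℝ) ≤ m := by exact_mod_cast hm
  set δ := 1 / (16 * (4 + (m : ℝ)) ^ 2 * (5 + m)) with hδ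
  have hδpos : 0 < δ := by positivity
  set W := weight m δ with hW
  have hW1 : 1 ≤ W := one_le_weight m hδpos
  set A := 4 + 2 * m + W * ((1 + m) * (1 + k ^ 2)) with hA
  have hk : 0 < W * ((1 + m) * (1 + k ^ 2)) := by positivity
  have hA4 : 4 ≤ A := by linarith
  have hAA : A ≤ A ^ 2 := by nlinarith
  refine ⟨A, ?_, fun u v h h0 hu => ?_⟩
  · have : √(m : ℝ) ≤ m := by
      rw [Real.sqrt_le_left (by linarith)]; nlinarith
    linarith
  have hδu : δ ≤ u (Real.pi / 2) :=
    h.le_at_pi_div_two hm h0 (by rw [hu]; exact hA4) (by rw [hu]; linarith)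
  have hu0 : (m : ℝ) < u 0 ^ 2 := by rw [hu]; linarith
  have hle := h.sq_lt_at_pi_div_two hm h0 hu0
  have hE := h.energy_eq (Real.pi / 2) 0
  unfold energy at hE
  have hw0 : 1 + A ^ 2 ≤ (1 + u 0 ^ 2 + v 0 ^ 2) * weight m (u 0) := by
    rw [h0, hu]
    have : (1 + A ^ 2) * 1 ≤ (1 + A ^ 2) * weight m A :=
      mul_le_mul_of_nonneg_left (one_le_weight m (by linarith)) (by positivity)
    simpa using this
  set x := u (Real.pi / 2)
  set y := v (Real.pi / 2) with hy
  have hw1 : (1 + x ^ 2 + y ^ 2) * weight m x ≤ (1 + x ^ 2 + y ^ 2) * W :=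
    mul_le_mul_of_nonneg_left (weight_anti m hδpos hδu) (by positivity)
  have h1 : W * ((1 + m) * (1 + k ^ 2)) ≤ W * (1 + x ^ 2 + y ^ 2) := by linarith
  have h2 := le_of_mul_le_mul_left h1 (by linarith)
  have h3 : k ^ 2 * (1 + x ^ 2) ≤ k ^ 2 * (1 + m) :=
    mul_le_mul_of_nonneg_left (by linarith) (sq_nonneg k)
  have hyneg : y < 0 := h.snd_neg hm h0 hu0 (by positivity) le_rfl
  refine le_of_sq_le_sq ?_ (neg_pos.2 hyneg).le
  rw [mul_pow, Real.sq_sqrt (by positivity)]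
  linarith

/-! ### Existence and uniqueness of the even solution with prescribed contact angle -/

theorem exists_even_family {m : ℕ} (hm : 1 ≤ m) : ∃ U V : ℝ → ℝ → ℝ,
    ∀ a, 0 < a → IsOrbit m (U a) (V a) ∧ U a 0 = a ∧ V a 0 = 0 := by
  have : ∀ a : ℝ, ∃ u v : ℝ → ℝ, 0 < a → IsOrbit m u v ∧ u 0 = a ∧ v 0 = 0 := by
    intro a
    by_cases ha : 0 < a
    · obtain ⟨u, v, h⟩ := exists_isOrbit hm 0 ha 0
      exact ⟨u, v, fun _ => h⟩
    · exact ⟨0, 0, fun h => absurd h ha⟩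
  choose U V h using this
  exact ⟨U, V, h⟩

theorem strictMonoOn_slope {m : ℕ} (hm : 1 ≤ m) {U V : ℝ → ℝ → ℝ}
    (hUV : ∀ a, 0 < a → IsOrbit m (U a) (V a) ∧ U a 0 = a ∧ V a 0 = 0) :
    ContinuousOn (fun a => -V a (Real.pi / 2) / √(1 + U a (Real.pi / 2) ^ 2)) (Ici √m) ∧
    StrictMonoOn (fun a => -V a (Real.pi / 2) / √(1 + U a (Real.pi / 2) ^ 2)) (Ici √m) := by
  have hm' : (0 : ℝ) < m := by exact_mod_cast hm
  have hs : 0 < √(m : ℝ) := Real.sqrt_pos.2 hm'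
  set P := Real.pi / 2 with hP
  have hP0 : 0 ≤ P := by positivity
  have key : ∀ a, 0 < a → ∃ d, HasDerivAt (fun a => -V a P / √(1 + U a P ^ 2)) d a ∧
      ((m : ℝ) < a ^ 2 → 0 < d) := by
    intro a ha
    obtain ⟨h, hu, hv⟩ := hUV a ha
    obtain ⟨f, f₁, hf, hf0, hf1, hdU, hdV⟩ := exists_variation hm hUV ha hP0
    have he : 0 < 1 + U a P ^ 2 := by positivity
    have hsq : √(1 + U a P ^ 2) ^ 2 = 1 + U a P ^ 2 := Real.sq_sqrt he.le
    have hsp : 0 < √(1 + U a P ^ 2) := Real.sqrt_pos.2 he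
    have hd := hdV.fun_neg.fun_div (((hdU.fun_pow 2).const_add 1).sqrt he.ne') hsp.ne'
    refine ⟨_, hd, fun ham => ?_⟩
    have h1 := h.variation_slope_neg hm hv (by rw [hu]; exact ham) hf hf0 hf1
    rw [← hP] at h1
    refine div_pos ?_ (by positivity)
    have e : -f₁ P * √(1 + U a P ^ 2) -
        -V a P * (((2 : ℕ) : ℝ) * U a P ^ (2 - 1) * f P / (2 * √(1 + U a P ^ 2))) =
        -((1 + U a P ^ 2) * f₁ P - U a P * V a P * f P) / √(1 + U a P ^ 2) := by
      rw [← hsq]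
      field_simp
      norm_num
      ring
    rw [e]
    exact div_pos (neg_pos.2 h1) hsp
  have hc : ContinuousOn (fun a => -V a P / √(1 + U a P ^ 2)) (Ici √m) := fun a ha => by
    obtain ⟨d, hd, _⟩ := key a (hs.trans_le ha)
    exact hd.continuousAt.continuousWithinAt
  refine ⟨hc, strictMonoOn_of_deriv_pos (convex_Ici _) hc fun a ha => ?_⟩
  rw [interior_Ici] at ha
  obtain ⟨d, hd, hpos⟩ := key a (hs.trans ha)
  rw [hd.deriv]
  refine hpos ?_
  have := pow_lt_pow_left₀ ha hs.le (n := 2) (by norm_num)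
  rwa [Real.sq_sqrt hm'.le] at this

theorem exists_orbit_of_slope {m : ℕ} (hm : 1 ≤ m) {k : ℝ} (hk : 0 ≤ k) : ∃ u v : ℝ → ℝ,
    IsOrbit m u v ∧ v 0 = 0 ∧ (m : ℝ) ≤ u 0 ^ 2 ∧
      v (Real.pi / 2) = -(k * √(1 + u (Real.pi / 2) ^ 2)) := by
  obtain ⟨U, V, hUV⟩ := exists_even_family hm
  have hm' : (0 : ℝ) < m := by exact_mod_cast hm
  have hs : 0 < √(m : ℝ) := Real.sqrt_pos.2 hm'
  obtain ⟨A, hA, hAk⟩ := exists_slope_ge hm k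
  obtain ⟨hc, -⟩ := strictMonoOn_slope hm hUV
  have hpos : ∀ a, 0 < √(1 + U a (Real.pi / 2) ^ 2) := fun a => Real.sqrt_pos.2 (by positivity)
  obtain ⟨a, ha, hak⟩ := intermediate_value_Icc hA.le (hc.mono Icc_subset_Ici_self)
    (show k ∈ Icc _ _ by
      constructor
      · obtain ⟨h, hu, hv⟩ := hUV _ hs
        have := (h.eq_of_eq (isOrbit_const hm) hu hv (Real.pi / 2)).2
        simp [this, hk]
      · obtain ⟨h, hu, hv⟩ := hUV _ (hs.trans hA)
        rw [le_div_iff₀ (hpos A)]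
        exact hAk _ _ h hv hu)
  obtain ⟨h, hu, hv⟩ := hUV a (hs.trans_le ha.1)
  refine ⟨U a, V a, h, hv, ?_, ?_⟩
  · rw [hu, ← Real.sq_sqrt hm'.le]
    exact pow_le_pow_left₀ hs.le ha.1 2
  · simp only at hak
    rw [div_eq_iff (hpos a).ne'] at hak
    linarith

theorem IsOrbit.eq_of_slope_eq {m : ℕ} (hm : 1 ≤ m) {k : ℝ} {u v p q : ℝ → ℝ} (h : IsOrbit m u v)
    (h' : IsOrbit m p q) (hv : v 0 = 0) (hq : q 0 = 0) (hu : (m : ℝ) ≤ u 0 ^ 2)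
    (hp : (m : ℝ) ≤ p 0 ^ 2) (hvk : v (Real.pi / 2) = -(k * √(1 + u (Real.pi / 2) ^ 2)))
    (hqk : q (Real.pi / 2) = -(k * √(1 + p (Real.pi / 2) ^ 2))) (t : ℝ) :
    u t = p t ∧ v t = q t := by
  obtain ⟨U, V, hUV⟩ := exists_even_family hm
  obtain ⟨-, hmono⟩ := strictMonoOn_slope hm hUV
  have key : ∀ {f g : ℝ → ℝ}, IsOrbit m f g → g 0 = 0 → (m : ℝ) ≤ f 0 ^ 2 →
      g (Real.pi / 2) = -(k * √(1 + f (Real.pi / 2) ^ 2)) → f 0 ∈ Ici √(m : ℝ) ∧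
      -V (f 0) (Real.pi / 2) / √(1 + U (f 0) (Real.pi / 2) ^ 2) = k := by
    intro f g hf hg hfm hk
    refine ⟨(Real.sqrt_le_left (hf.pos 0).le).2 hfm, ?_⟩
    obtain ⟨h1, h2, h3⟩ := hUV _ (hf.pos 0)
    obtain ⟨e1, e2⟩ := h1.eq_of_eq hf h2 (h3.trans hg.symm) (Real.pi / 2)
    rw [e1, e2, hk, neg_neg, mul_div_cancel_right₀]
    exact (Real.sqrt_pos.2 (by positivity)).ne'
  obtain ⟨hu1, hu2⟩ := key h hv hu hvk
  obtain ⟨hp1, hp2⟩ := key h' hq hp hqk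
  exact h.eq_of_eq h' (hmono.injOn hu1 hp1 (hu2.trans hp2.symm)) (hv.trans hq.symm) t

/-! ### Cylindrical coordinates -/

/-- The point with first coordinate `ρ` of `x'`, the other coordinates of `x'` being `0`, and with
`xₙ = y`. It represents all points with `|x'| = |ρ|` and the same `xₙ` and `z`. -/
def cyl (n : ℕ) (ρ y z : ℝ) : Ambient n :=
  ρ • EuclideanSpace.single 0 1 + y • EuclideanSpace.single ⟨n - 1, by omega⟩ 1 +
    z • EuclideanSpace.single (Fin.last n) 1

theorem inner_cyl (n : ℕ) (ρ y z : ℝ) (p : Ambient n) :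
    ⟪cyl n ρ y z, p⟫ = ρ * p 0 + y * axial p + z * height p := by
  simp [cyl, inner_add_left, inner_smul_left, EuclideanSpace.inner_single_left, axial, height]

theorem cyl_apply {n : ℕ} (hn : 3 ≤ n) (ρ y z : ℝ) (i : Fin (n + 1)) : cyl n ρ y z i =
    if i = 0 then ρ else if i = ⟨n - 1, by omega⟩ then y else if i = Fin.last n then z else 0 := by
  have h1 : (⟨n - 1, by omega⟩ : Fin (n + 1)) ≠ 0 := by simp [Fin.ext_iff]; omega
  have h2 : (Fin.last n : Fin (n + 1)) ≠ 0 := by simp [Fin.ext_iff]; omega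
  have h3 : (⟨n - 1, by omega⟩ : Fin (n + 1)) ≠ Fin.last n := by simp [Fin.ext_iff]; omega
  unfold cyl
  by_cases ha : i = 0
  · subst ha; simp [h1.symm, h2.symm]
  · by_cases hb : i = ⟨n - 1, by omega⟩
    · subst hb; simp [h1, h3]
    · by_cases hc : i = Fin.last n
      · subst hc; simp [h2, h3.symm]
      · simp [ha, hb, hc]

theorem cyl_apply_zero {n : ℕ} (hn : 3 ≤ n) (ρ y z : ℝ) : cyl n ρ y z 0 = ρ := by
  simp [cyl_apply hn]

theorem axial_cyl {n : ℕ} (hn : 3 ≤ n) (ρ y z : ℝ) : axial (cyl n ρ y z) = y := by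
  have h1 : (⟨n - 1, by omega⟩ : Fin (n + 1)) ≠ 0 := by simp [Fin.ext_iff]; omega
  simp [axial, cyl_apply hn, h1]

theorem height_cyl {n : ℕ} (hn : 3 ≤ n) (ρ y z : ℝ) : height (cyl n ρ y z) = z := by
  have h2 : (Fin.last n : Fin (n + 1)) ≠ 0 := by simp [Fin.ext_iff]; omega
  have h3 : (Fin.last n : Fin (n + 1)) ≠ ⟨n - 1, by omega⟩ := by simp [Fin.ext_iff]; omega
  simp [height, cyl_apply hn, h2, h3]

theorem inner_cyl_cyl {n : ℕ} (hn : 3 ≤ n) (ρ y z a b c : ℝ) :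
    ⟪cyl n ρ y z, cyl n a b c⟫ = ρ * a + y * b + z * c := by
  rw [inner_cyl, cyl_apply_zero hn, axial_cyl hn, height_cyl hn]

theorem norm_cyl_sq {n : ℕ} (hn : 3 ≤ n) (ρ y z : ℝ) :
    ‖cyl n ρ y z‖ ^ 2 = ρ ^ 2 + y ^ 2 + z ^ 2 := by
  rw [← real_inner_self_eq_norm_sq, inner_cyl_cyl hn]; ring

theorem smul_cyl (n : ℕ) (r ρ y z : ℝ) : r • cyl n ρ y z = cyl n (r * ρ) (r * y) (r * z) := by
  simp only [cyl, smul_add, smul_smul]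

theorem cyl_add (n : ℕ) (ρ y z a b c : ℝ) :
    cyl n ρ y z + cyl n a b c = cyl n (ρ + a) (y + b) (z + c) := by
  simp only [cyl, add_smul]; abel

theorem cyl_inj {n : ℕ} (hn : 3 ≤ n) {ρ y z a b c : ℝ} :
    cyl n ρ y z = cyl n a b c ↔ ρ = a ∧ y = b ∧ z = c := by
  refine ⟨fun h => ⟨?_, ?_, ?_⟩, by rintro ⟨rfl, rfl, rfl⟩; rfl⟩
  · rw [← cyl_apply_zero hn ρ y z, h, cyl_apply_zero hn]
  · rw [← axial_cyl hn ρ y z, h, axial_cyl hn]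
  · rw [← height_cyl hn ρ y z, h, height_cyl hn]

theorem cyl_zero (n : ℕ) : cyl n 0 0 0 = 0 := by simp [cyl]

theorem HasDerivWithinAt.cyl (n : ℕ) {ρ y z : ℝ → ℝ} {ρ' y' z' t : ℝ} {S : Set ℝ}
    (hρ : HasDerivWithinAt ρ ρ' S t) (hy : HasDerivWithinAt y y' S t)
    (hz : HasDerivWithinAt z z' S t) :
    HasDerivWithinAt (fun t => cyl n (ρ t) (y t) (z t)) (cyl n ρ' y' z') S t :=
  ((hρ.smul_const _).add (hy.smul_const _)).add (hz.smul_const _)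

theorem HasDerivAt.cyl (n : ℕ) {ρ y z : ℝ → ℝ} {ρ' y' z' t : ℝ}
    (hρ : HasDerivAt ρ ρ' t) (hy : HasDerivAt y y' t) (hz : HasDerivAt z z' t) :
    HasDerivAt (fun t => cyl n (ρ t) (y t) (z t)) (cyl n ρ' y' z') t :=
  ((hρ.smul_const _).add (hy.smul_const _)).add (hz.smul_const _)

theorem continuous_cyl (n : ℕ) : Continuous fun x : ℝ × ℝ × ℝ => cyl n x.1 x.2.1 x.2.2 := by
  unfold CapillaryCone.cyl
  fun_prop

theorem contDiff_cyl (n : ℕ) : ContDiff ℝ ∞ fun x : ℝ × ℝ × ℝ => cyl n x.1 x.2.1 x.2.2 := by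
  unfold CapillaryCone.cyl
  fun_prop

/-- The distance `|x'|` to the plane `{x' = 0}`. -/
def radius {n : ℕ} (p : Ambient n) : ℝ :=
  √(∑ i ∈ Finset.univ.filter (fun i : Fin (n + 1) => (i : ℕ) < n - 1), p i ^ 2)

theorem radius_nonneg {n : ℕ} (p : Ambient n) : 0 ≤ radius p := Real.sqrt_nonneg _

theorem radius_sq {n : ℕ} (hn : 3 ≤ n) (p : Ambient n) :
    radius p ^ 2 = ‖p‖ ^ 2 - axial p ^ 2 - height p ^ 2 := by
  rw [radius, Real.sq_sqrt (Finset.sum_nonneg fun i _ => sq_nonneg _), EuclideanSpace.real_norm_sq_eq]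
  have h3 : (⟨n - 1, by omega⟩ : Fin (n + 1)) ≠ Fin.last n := by simp [Fin.ext_iff]; omega
  have hsplit := Finset.sum_filter_add_sum_filter_not Finset.univ
    (fun i : Fin (n + 1) => (i : ℕ) < n - 1) (fun i => p i ^ 2)
  have hrest : Finset.univ.filter (fun i : Fin (n + 1) => ¬ (i : ℕ) < n - 1) =
      {⟨n - 1, by omega⟩, Fin.last n} := by
    ext i
    simp only [Finset.mem_filter, Finset.mem_univ, true_and, Finset.mem_insert,
      Finset.mem_singleton, Fin.ext_iff, Fin.val_last]
    omega
  rw [hrest, Finset.sum_pair h3] at hsplit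
  unfold axial height
  linarith

theorem norm_base_sq {n : ℕ} (hn : 3 ≤ n) (p : Ambient n) :
    ‖base p‖ ^ 2 = radius p ^ 2 + axial p ^ 2 := by
  rw [radius_sq hn, EuclideanSpace.real_norm_sq_eq, EuclideanSpace.real_norm_sq_eq,
    Fin.sum_univ_castSucc]
  simp only [base, height]
  ring

theorem radius_cyl {n : ℕ} (hn : 3 ≤ n) (ρ y z : ℝ) : radius (cyl n ρ y z) = |ρ| := by
  rw [← abs_of_nonneg (radius_nonneg _), ← sq_eq_sq_iff_abs_eq_abs, radius_sq hn, norm_cyl_sq hn,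
    axial_cyl hn, height_cyl hn]
  ring

theorem norm_cyl_radius {n : ℕ} (hn : 3 ≤ n) (p : Ambient n) :
    ‖cyl n (radius p) (axial p) (height p)‖ = ‖p‖ := by
  rw [← abs_norm, ← abs_norm p, ← sq_eq_sq_iff_abs_eq_abs, norm_cyl_sq hn, radius_sq hn]; ring

theorem continuous_axial {n : ℕ} : Continuous (axial : Ambient n → ℝ) := by
  unfold axial; fun_prop

theorem continuous_height {n : ℕ} : Continuous (height : Ambient n → ℝ) := by
  unfold height; fun_prop

theorem continuous_radius {n : ℕ} : Continuous (radius : Ambient n → ℝ) := by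
  unfold radius; fun_prop

theorem axial_smul {n : ℕ} (r : ℝ) (p : Ambient n) : axial (r • p) = r * axial p := rfl

theorem height_smul {n : ℕ} (r : ℝ) (p : Ambient n) : height (r • p) = r * height p := rfl

theorem axial_add {n : ℕ} (p q : Ambient n) : axial (p + q) = axial p + axial q := rfl

theorem height_add {n : ℕ} (p q : Ambient n) : height (p + q) = height p + height q := rfl

theorem radius_smul {n : ℕ} (hn : 3 ≤ n) {r : ℝ} (hr : 0 ≤ r) (p : Ambient n) :
    radius (r • p) = r * radius p := by
  rw [← abs_of_nonneg (radius_nonneg (r • p)), ← abs_of_nonneg (mul_nonneg hr (radius_nonneg p)),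
    ← sq_eq_sq_iff_abs_eq_abs, mul_pow, radius_sq hn, radius_sq hn, norm_smul, axial_smul,
    height_smul, Real.norm_of_nonneg hr]
  ring

theorem eq_zero_of_coordinates {n : ℕ} (hn : 3 ≤ n) {p : Ambient n} (h0 : radius p = 0)
    (h1 : axial p = 0) (h2 : height p = 0) : p = 0 := by
  have := radius_sq hn p
  rw [h0, h1, h2] at this
  have h3 : ‖p‖ ^ 2 = 0 := by linarith
  exact norm_eq_zero.1 (pow_eq_zero_iff (by norm_num) |>.1 h3)

/-- Two points with the same invariants differ by an element of `O(n-1)`. -/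
theorem exists_isometry {n : ℕ} {p q : Ambient n} (hnorm : ‖q‖ = ‖p‖) (ha : axial q = axial p)
    (hh : height q = height p) : ∃ A : Ambient n ≃ₗᵢ[ℝ] Ambient n,
      (∀ x, axial (A x) = axial x) ∧ (∀ x, height (A x) = height x) ∧ A p = q := by
  set A := (ℝ ∙ (p - q))ᗮ.reflection
  have key : ∀ e : Ambient n, ⟪e, p - q⟫ = 0 → ∀ x, ⟪e, A x⟫ = ⟪e, x⟫ := by
    intro e he x
    have hAe : A e = e := Submodule.reflection_mem_subspace_eq_self
      (Submodule.mem_orthogonal_singleton_iff_inner_right.2 (by rwa [real_inner_comm]))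
    conv_lhs => rw [← hAe]
    exact A.inner_map_map e x
  have hax : ∀ x : Ambient n, ⟪(EuclideanSpace.single ⟨n - 1, by omega⟩ 1 : Ambient n), x⟫ =
      axial x := fun x => by simp [axial, EuclideanSpace.inner_single_left]
  have hhe : ∀ x : Ambient n, ⟪(EuclideanSpace.single (Fin.last n) 1 : Ambient n), x⟫ =
      height x := fun x => by simp [height, EuclideanSpace.inner_single_left]
  refine ⟨A, fun x => ?_, fun x => ?_, Submodule.reflection_sub hnorm.symm⟩
  · rw [← hax, ← hax x]
    exact key _ (by rw [inner_sub_right, hax, hax, ha, sub_self]) x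
  · rw [← hhe, ← hhe x]
    exact key _ (by rw [inner_sub_right, hhe, hhe, hh, sub_self]) x

/-- An axisymmetric set contains every point with the same `|x'|`, `xₙ` and `z` as one of its
points. -/
theorem IsAxisymmetric.mem_of_eq {n : ℕ} {C : Set (Ambient n)} (hC : IsAxisymmetric C)
    {p q : Ambient n} (hp : p ∈ C) (hnorm : ‖q‖ = ‖p‖) (ha : axial q = axial p)
    (hh : height q = height p) : q ∈ C := by
  obtain ⟨A, hA1, hA2, rfl⟩ := exists_isometry hnorm ha hh
  rw [← hC A hA1 hA2]
  exact mem_image_of_mem A hp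

theorem isAxisymmetric_of_mem_of_eq {n : ℕ} {C : Set (Ambient n)}
    (h : ∀ p ∈ C, ∀ q : Ambient n, ‖q‖ = ‖p‖ → axial q = axial p → height q = height p → q ∈ C) :
    IsAxisymmetric C := by
  intro A ha hh
  ext q
  constructor
  · rintro ⟨p, hp, rfl⟩
    exact h p hp _ (A.norm_map p) (ha p) (hh p)
  · intro hq
    refine ⟨A.symm q, h q hq _ (A.symm.norm_map q) ?_ ?_, by simp⟩
    · rw [← ha, A.apply_symm_apply]
    · rw [← hh, A.apply_symm_apply]

/-! ### First and second order contact with a level set -/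

/-- A set which is invariant under positive dilations and under the rotations of `x'`. -/
structure IsAxiCone {n : ℕ} (X : Set (Ambient n)) : Prop where
  rot : ∀ p ∈ X, ∀ q : Ambient n, ‖q‖ = ‖p‖ → axial q = axial p → height q = height p → q ∈ X
  smul : ∀ r : ℝ, 0 < r → ∀ p ∈ X, r • p ∈ X

theorem IsAxiCone.cyl_radius_mem {n : ℕ} (hn : 3 ≤ n) {X : Set (Ambient n)} (hX : IsAxiCone X)
    {p : Ambient n} : cyl n (radius p) (axial p) (height p) ∈ X ↔ p ∈ X :=
  ⟨fun h => hX.rot _ h p (norm_cyl_radius hn p).symm (axial_cyl hn _ _ _).symm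
    (height_cyl hn _ _ _).symm, fun h => hX.rot p h _ (norm_cyl_radius hn p) (axial_cyl hn _ _ _)
    (height_cyl hn _ _ _)⟩

theorem inner_gradient {n : ℕ} (F : Ambient n → ℝ) (q h : Ambient n) :
    ⟪gradient F q, h⟫ = fderiv ℝ F q h := InnerProductSpace.toDual_symm_apply

theorem inner_gradient_eq_zero {n : ℕ} {F : Ambient n → ℝ} {γ : ℝ → Ambient n} {w : Ambient n}
    {S : Set ℝ} {t : ℝ} (hF : DifferentiableAt ℝ F (γ t)) (hS : UniqueDiffWithinAt ℝ S t)
    (hγ : HasDerivWithinAt γ w S t) (hz : ∀ᶠ s in 𝓝[S] t, F (γ s) = 0) (h0 : F (γ t) = 0) :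
    ⟪gradient F (γ t), w⟫ = 0 := by
  rw [inner_gradient]
  have h1 : HasDerivWithinAt (fun s => F (γ s)) (fderiv ℝ F (γ t) w) S t :=
    hF.hasFDerivAt.comp_hasDerivWithinAt t hγ
  have h2 : HasDerivWithinAt (fun s => F (γ s)) 0 S t :=
    (hasDerivWithinAt_const t S (0 : ℝ)).congr_of_eventuallyEq hz h0
  exact hS.eq_deriv S h1 h2

theorem IsAxiCone.orbit_mem {n : ℕ} (hn : 3 ≤ n) {X : Set (Ambient n)} (hX : IsAxiCone X)
    {ρ y z : ℝ} (hq : cyl n ρ y z ∈ X) {i : Fin (n + 1)} (h0 : i ≠ 0) (h1 : i ≠ ⟨n - 1, by omega⟩)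
    (h2 : i ≠ Fin.last n) (t : ℝ) :
    cyl n (ρ * Real.cos t) y z + (ρ * Real.sin t) • EuclideanSpace.single i 1 ∈ X := by
  set e : Ambient n := EuclideanSpace.single i 1 with he
  refine hX.rot _ hq _ ?_ ?_ ?_
  · rw [← abs_norm, ← abs_norm (cyl n ρ y z), ← sq_eq_sq_iff_abs_eq_abs, norm_cyl_sq hn,
      norm_add_sq_real, norm_cyl_sq hn, norm_smul, inner_smul_right, real_inner_comm, he,
      EuclideanSpace.inner_single_left]
    have : cyl n (ρ * Real.cos t) y z i = 0 := by simp [cyl_apply hn, h0, h1, h2]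
    rw [this]
    simp only [map_one, mul_zero, add_zero, mul_pow, PiLp.norm_single, norm_one,
      mul_one, Real.norm_eq_abs, sq_abs]
    linear_combination ρ ^ 2 * Real.sin_sq_add_cos_sq t
  · have h3 : axial e = 0 := by simp [axial, he, h1.symm]
    rw [axial_add, axial_smul, h3, axial_cyl hn, axial_cyl hn, mul_zero, add_zero]
  · have h3 : height e = 0 := by simp [height, he, h2.symm]
    rw [height_add, height_smul, h3, height_cyl hn, height_cyl hn, mul_zero, add_zero]

/-- Off the plane `{x' = 0}` the gradient of a function which vanishes on an axisymmetric cone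
depends on its components in the three cylindrical directions only. -/
theorem IsAxiCone.gradient_eq {n : ℕ} (hn : 3 ≤ n) {X : Set (Ambient n)} (hX : IsAxiCone X)
    {F : Ambient n → ℝ} {ρ y z : ℝ} (hρ : ρ ≠ 0) (hq : cyl n ρ y z ∈ X)
    (hF : DifferentiableAt ℝ F (cyl n ρ y z)) (hv : ∀ᶠ x in 𝓝 (cyl n ρ y z), x ∈ X → F x = 0) :
    ∃ a b c, gradient F (cyl n ρ y z) = cyl n a b c ∧ ρ * a + y * b + z * c = 0 := by
  have hq0 := hv.self_of_nhds hq
  have hoth : ∀ i : Fin (n + 1), i ≠ 0 → i ≠ ⟨n - 1, by omega⟩ → i ≠ Fin.last n →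
      gradient F (cyl n ρ y z) i = 0 := by
    intro i h0 h1 h2
    set e : Ambient n := EuclideanSpace.single i 1 with he
    set γ : ℝ → Ambient n := fun t => cyl n (ρ * Real.cos t) y z + (ρ * Real.sin t) • e with hγ
    have hγ0 : γ 0 = cyl n ρ y z := by simp [hγ]
    have hγd : HasDerivAt γ (ρ • e) 0 := by
      have h3 := HasDerivAt.cyl n ((Real.hasDerivAt_cos 0).const_mul ρ) (hasDerivAt_const 0 y)
        (hasDerivAt_const 0 z)
      have h4 := ((Real.hasDerivAt_sin 0).const_mul ρ).smul_const e
      refine (h3.fun_add h4).congr_deriv ?_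
      simp [cyl_zero]
    have hmem : ∀ t, γ t ∈ X := hX.orbit_mem hn hq h0 h1 h2
    have hev : ∀ᶠ t in 𝓝 (0 : ℝ), F (γ t) = 0 := by
      have := hγd.continuousAt.eventually (hγ0 ▸ hv)
      exact this.mono fun t ht => ht (hmem t)
    have h5 := inner_gradient_eq_zero (S := univ) (t := 0) (hγ0 ▸ hF) uniqueDiffWithinAt_univ
      hγd.hasDerivWithinAt (by rwa [nhdsWithin_univ]) (hγ0 ▸ hq0)
    rw [hγ0, inner_smul_right, real_inner_comm, he, EuclideanSpace.inner_single_left] at h5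
    simpa [hρ] using h5
  have hform : gradient F (cyl n ρ y z) = cyl n (gradient F (cyl n ρ y z) 0)
      (axial (gradient F (cyl n ρ y z))) (height (gradient F (cyl n ρ y z))) := by
    ext i
    rw [cyl_apply hn]
    split_ifs with h0 h1 h2
    · rw [h0]
    · rw [h1]; rfl
    · rw [h2]; rfl
    · exact hoth i h0 h1 h2
  refine ⟨_, _, _, hform, ?_⟩
  rw [← inner_cyl_cyl hn, ← hform, real_inner_comm]
  have h1 : HasDerivAt (fun t : ℝ => t • cyl n ρ y z) (cyl n ρ y z) 1 := by
    simpa using (hasDerivAt_id (1 : ℝ)).smul_const (cyl n ρ y z)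
  have h2 := inner_gradient_eq_zero (F := F) (γ := fun t : ℝ => t • cyl n ρ y z) (S := univ) (t := 1)
    (by simpa using hF) uniqueDiffWithinAt_univ h1.hasDerivWithinAt
    (by
      rw [nhdsWithin_univ]
      have := h1.continuousAt.eventually (by simpa using hv)
      filter_upwards [this, lt_mem_nhds (zero_lt_one' ℝ)] with t ht ht0
      exact ht (hX.smul t ht0 _ hq)) (by simpa using hq0)
  simpa using h2

theorem differentiableAt_gradient {n : ℕ} {F : Ambient n → ℝ} {q : Ambient n}
    (hF : ContDiffAt ℝ 2 F q) : DifferentiableAt ℝ (gradient F) q :=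
  ((InnerProductSpace.toDual ℝ (Ambient n)).symm.toContinuousLinearEquiv.differentiableAt).comp q
    ((hF.fderiv_right (m := 1) (by norm_num)).differentiableAt (by norm_num))

theorem differentiableAt_unitNormal {n : ℕ} {F : Ambient n → ℝ} {q : Ambient n}
    (hF : ContDiffAt ℝ 2 F q) (hg : gradient F q ≠ 0) : DifferentiableAt ℝ (unitNormal F) q := by
  have h := differentiableAt_gradient hF
  exact ((h.norm ℝ hg).inv (norm_ne_zero_iff.2 hg)).smul h

/-- The second fundamental form of a level set along a curve in it. -/
theorem inner_fderiv_unitNormal {n : ℕ} {F : Ambient n → ℝ} {γ γ₁ : ℝ → Ambient n}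
    {w : Ambient n} {t : ℝ} (hF : ContDiffAt ℝ 2 F (γ t)) (hg : gradient F (γ t) ≠ 0)
    (hγ : ∀ᶠ s in 𝓝 t, HasDerivAt γ (γ₁ s) s) (hγ₁ : HasDerivAt γ₁ w t)
    (hz : ∀ᶠ s in 𝓝 t, F (γ s) = 0) :
    ⟪γ₁ t, fderiv ℝ (unitNormal F) (γ t) (γ₁ t)⟫ = -⟪unitNormal F (γ t), w⟫ := by
  have hFev : ∀ᶠ x in 𝓝 (γ t), DifferentiableAt ℝ F x :=
    (hF.eventually (by norm_num)).mono fun x hx => hx.differentiableAt (by norm_num)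
  have hc : ContinuousAt γ t := hγ.self_of_nhds.continuousAt
  have h0 : ∀ᶠ s in 𝓝 t, ⟪unitNormal F (γ s), γ₁ s⟫ = 0 := by
    filter_upwards [hγ, hz.eventually_nhds, hc.eventually hFev] with s h1 h2 h3
    rw [unitNormal, inner_smul_left, inner_gradient_eq_zero (S := univ) h3 uniqueDiffWithinAt_univ
      h1.hasDerivWithinAt (by rwa [nhdsWithin_univ]) h2.self_of_nhds, mul_zero]
  have h1 : HasDerivAt (fun s => unitNormal F (γ s)) (fderiv ℝ (unitNormal F) (γ t) (γ₁ t)) t :=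
    (differentiableAt_unitNormal hF hg).hasFDerivAt.comp_hasDerivAt t hγ.self_of_nhds
  have h2 := h1.inner ℝ hγ₁
  have h3 : HasDerivAt (fun s => ⟪unitNormal F (γ s), γ₁ s⟫) 0 t :=
    (hasDerivAt_const t (0 : ℝ)).congr_of_eventuallyEq h0
  have h4 := h2.unique h3
  rw [real_inner_comm]
  linarith

theorem norm_unitNormal {n : ℕ} {F : Ambient n → ℝ} {q : Ambient n} (hg : gradient F q ≠ 0) :
    ‖unitNormal F q‖ = 1 := by
  rw [unitNormal, norm_smul, norm_inv, norm_norm, inv_mul_cancel₀ (norm_ne_zero_iff.2 hg)]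

theorem inner_unitNormal_fderiv_unitNormal {n : ℕ} {F : Ambient n → ℝ} {q : Ambient n}
    (hF : ContDiffAt ℝ 2 F q) (hg : gradient F q ≠ 0) (h : Ambient n) :
    ⟪unitNormal F q, fderiv ℝ (unitNormal F) q h⟫ = 0 := by
  have hev : ∀ᶠ x in 𝓝 q, gradient F x ≠ 0 :=
    (differentiableAt_gradient hF).continuousAt.eventually_ne hg
  have hline : HasDerivAt (fun t : ℝ => q + t • h) h 0 := by
    simpa using ((hasDerivAt_id (0 : ℝ)).smul_const h).const_add q
  have hN : HasFDerivAt (unitNormal F) (fderiv ℝ (unitNormal F) q) (q + (0 : ℝ) • h) := by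
    simpa using (differentiableAt_unitNormal hF hg).hasFDerivAt
  have h1 := hN.comp_hasDerivAt (0 : ℝ) hline
  have h2 := h1.inner ℝ h1
  have hev' : ∀ᶠ t in 𝓝 (0 : ℝ), gradient F (q + t • h) ≠ 0 :=
    hline.continuousAt.eventually (by simpa using hev)
  have h3 : HasDerivAt (fun t : ℝ => ⟪unitNormal F (q + t • h), unitNormal F (q + t • h)⟫) 0 0 := by
    refine (hasDerivAt_const (0 : ℝ) (1 : ℝ)).congr_of_eventuallyEq (hev'.mono fun t ht => ?_)
    simp only
    rw [real_inner_self_eq_norm_sq, norm_unitNormal ht, one_pow]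
  have h4 := h2.unique h3
  simp only [Function.comp, zero_smul, add_zero] at h4
  rw [real_inner_comm] at h4
  have h5 : ⟪unitNormal F q, fderiv ℝ (unitNormal F) q h⟫ =
    ⟪fderiv ℝ (unitNormal F) q h, unitNormal F q⟫ := real_inner_comm _ _
  linarith

/-! ### The minimal cone equation in polar coordinates -/

/-- The normal direction of an axisymmetric cone along an arc `|x'| = u(φ)`,
`(xₙ, z) = (sin φ, cos φ)`, whose parameter may be restricted to a set `S` ending at `φ`. -/
theorem IsAxiCone.gradient_arc {n : ℕ} (hn : 3 ≤ n) {X : Set (Ambient n)} (hX : IsAxiCone X)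
    {F : Ambient n → ℝ} {u : ℝ → ℝ} {v φ : ℝ} {S : Set ℝ} (hu0 : 0 < u φ)
    (hS : UniqueDiffWithinAt ℝ S φ) (hu : HasDerivWithinAt u v S φ)
    (hq : cyl n (u φ) (Real.sin φ) (Real.cos φ) ∈ X)
    (hmem : ∀ᶠ s in 𝓝[S] φ, cyl n (u s) (Real.sin s) (Real.cos s) ∈ X)
    (hF : DifferentiableAt ℝ F (cyl n (u φ) (Real.sin φ) (Real.cos φ)))
    (hz : ∀ᶠ x in 𝓝 (cyl n (u φ) (Real.sin φ) (Real.cos φ)), x ∈ X → F x = 0) :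
    ∃ b : ℝ, gradient F (cyl n (u φ) (Real.sin φ) (Real.cos φ)) =
      b • cyl n 1 (-(u φ * Real.sin φ + v * Real.cos φ))
        (-(u φ * Real.cos φ - v * Real.sin φ)) := by
  obtain ⟨a, b, c, hg, h1⟩ := hX.gradient_eq hn hu0.ne' hq hF hz
  have hw := HasDerivWithinAt.cyl n hu (Real.hasDerivAt_sin φ).hasDerivWithinAt
    (Real.hasDerivAt_cos φ).hasDerivWithinAt
  have h2 := inner_gradient_eq_zero (γ := fun s => cyl n (u s) (Real.sin s) (Real.cos s)) hF hS hw
    (by filter_upwards [hmem, hw.continuousWithinAt.eventually hz] with s hs hs2 using hs2 hs)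
    (hz.self_of_nhds hq)
  rw [hg, inner_cyl_cyl hn] at h2
  refine ⟨a, ?_⟩
  rw [hg, smul_cyl, cyl_inj hn]
  have hsc := Real.sin_sq_add_cos_sq φ
  refine ⟨by ring, ?_, ?_⟩
  · linear_combination Real.sin φ * h1 + Real.cos φ * h2 - b * hsc
  · linear_combination Real.cos φ * h1 - Real.sin φ * h2 - c * hsc

/-- The orthonormal basis which consists of the directions of `q`, `τ`, `N` and of the coordinate
directions of `x'` other than the first. -/
theorem exists_adapted_basis {n : ℕ} {q τ N : Ambient n} (hq : ‖q‖ ≠ 0) (hτ : ‖τ‖ ≠ 0)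
    (hN : ‖N‖ = 1) (hqτ : ⟪q, τ⟫ = 0) (hNq : ⟪N, q⟫ = 0) (hNτ : ⟪N, τ⟫ = 0)
    (hqi : ∀ i : Fin (n + 1), i ≠ 0 → i ≠ ⟨n - 1, by omega⟩ → i ≠ Fin.last n →
      ⟪q, (EuclideanSpace.single i 1 : Ambient n)⟫ = 0)
    (hτi : ∀ i : Fin (n + 1), i ≠ 0 → i ≠ ⟨n - 1, by omega⟩ → i ≠ Fin.last n →
      ⟪τ, (EuclideanSpace.single i 1 : Ambient n)⟫ = 0)
    (hNi : ∀ i : Fin (n + 1), i ≠ 0 → i ≠ ⟨n - 1, by omega⟩ → i ≠ Fin.last n →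
      ⟪N, (EuclideanSpace.single i 1 : Ambient n)⟫ = 0) :
    ∃ B : OrthonormalBasis (Fin (n + 1)) ℝ (Ambient n), ∀ i, B i =
      if i = 0 then ‖q‖⁻¹ • q else if i = ⟨n - 1, by omega⟩ then ‖τ‖⁻¹ • τ else
      if i = Fin.last n then N else EuclideanSpace.single i 1 := by
  set f : Fin (n + 1) → Ambient n := fun i => if i = 0 then ‖q‖⁻¹ • q else
    if i = ⟨n - 1, by omega⟩ then ‖τ‖⁻¹ • τ else
    if i = Fin.last n then N else EuclideanSpace.single i 1 with hf
  have hfo : Orthonormal ℝ f := by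
    refine ⟨fun i => ?_, fun i j hij => ?_⟩
    · simp only [hf]
      split_ifs
      · rw [norm_smul, norm_inv, norm_norm, inv_mul_cancel₀ hq]
      · rw [norm_smul, norm_inv, norm_norm, inv_mul_cancel₀ hτ]
      · exact hN
      · simp
    · have hτq : ⟪τ, q⟫ = 0 := by rw [real_inner_comm]; exact hqτ
      have hqN : ⟪q, N⟫ = 0 := by rw [real_inner_comm]; exact hNq
      have hτN : ⟪τ, N⟫ = 0 := by rw [real_inner_comm]; exact hNτ
      have hiq := fun i h0 h1 h2 => (real_inner_comm _ _).trans (hqi i h0 h1 h2)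
      have hiτ := fun i h0 h1 h2 => (real_inner_comm _ _).trans (hτi i h0 h1 h2)
      have hiN := fun i h0 h1 h2 => (real_inner_comm _ _).trans (hNi i h0 h1 h2)
      simp only [hf]
      split_ifs <;>
        try simp only [inner_smul_left, inner_smul_right, hqτ, hτq, hqN, hNq, hτN, hNτ, mul_zero]
      all_goals first
        | exact absurd (Eq.trans (b := (0 : Fin (n + 1))) ‹_› (Eq.symm ‹_›)) hij
        | exact absurd (Eq.trans (b := (⟨n - 1, by omega⟩ : Fin (n + 1))) ‹_› (Eq.symm ‹_›)) hij
        | exact absurd (Eq.trans (b := Fin.last n) ‹_› (Eq.symm ‹_›)) hij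
        | (rw [hqi _ ‹_› ‹_› ‹_›, mul_zero])
        | (rw [hτi _ ‹_› ‹_› ‹_›, mul_zero])
        | exact hNi _ ‹_› ‹_› ‹_›
        | (rw [hiq _ ‹_› ‹_› ‹_›, mul_zero])
        | (rw [hiτ _ ‹_› ‹_› ‹_›, mul_zero])
        | exact hiN _ ‹_› ‹_› ‹_›
        | simp [EuclideanSpace.inner_single_left, hij]
  obtain ⟨B, hB⟩ := Orthonormal.exists_orthonormalBasis_extension_of_card_eq
    (v := f) (s := univ) (by simp) (hfo.comp _ Subtype.val_injective)
  exact ⟨B, fun i => hB i (mem_univ i)⟩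

/-- The mean curvature of an axisymmetric cone, computed in the orthonormal basis which consists of
the radial direction, the direction of the arc, the normal and the directions of the orbits. -/
theorem IsAxiCone.meanCurvature_arc {n : ℕ} (hn : 3 ≤ n) {X : Set (Ambient n)} (hX : IsAxiCone X)
    {F : Ambient n → ℝ} {u v : ℝ → ℝ} {a φ : ℝ} (hu0 : 0 < u φ)
    (hu : ∀ᶠ s in 𝓝 φ, HasDerivAt u (v s) s) (hv : HasDerivAt v a φ)
    (hmem : ∀ᶠ s in 𝓝 φ, cyl n (u s) (Real.sin s) (Real.cos s) ∈ X)
    (hF : ContDiffAt ℝ 2 F (cyl n (u φ) (Real.sin φ) (Real.cos φ)))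
    (hg : gradient F (cyl n (u φ) (Real.sin φ) (Real.cos φ)) ≠ 0)
    (hz : ∀ᶠ x in 𝓝 (cyl n (u φ) (Real.sin φ) (Real.cos φ)), x ∈ X → F x = 0) :
    ∃ b, b ≠ 0 ∧ meanCurvature F (cyl n (u φ) (Real.sin φ) (Real.cos φ)) =
      b * (((n : ℝ) - 2) / u φ -
        (u φ + a) * (1 + u φ ^ 2) / (1 + u φ ^ 2 + v φ ^ 2)) := by
  set q := cyl n (u φ) (Real.sin φ) (Real.cos φ) with hqdef
  have hq : q ∈ X := hmem.self_of_nhds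
  obtain ⟨b₀, hb₀⟩ := hX.gradient_arc hn hu0 (S := univ) uniqueDiffWithinAt_univ
    hu.self_of_nhds.hasDerivWithinAt hq (by rwa [nhdsWithin_univ])
    (hF.differentiableAt (by norm_num)) hz
  have hsc := Real.sin_sq_add_cos_sq φ
  set s := Real.sin φ with hs
  set c := Real.cos φ with hc
  set x := u φ with hx
  set y := v φ with hy
  set N := unitNormal F q with hN
  obtain ⟨b, hb⟩ : ∃ b : ℝ, N = b • cyl n 1 (-(x * s + y * c)) (-(x * c - y * s)) := by
    refine ⟨‖gradient F q‖⁻¹ * b₀, ?_⟩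
    rw [hN, unitNormal, hb₀, smul_smul]
  have hNnorm : ‖N‖ = 1 := norm_unitNormal hg
  have hbne : b ≠ 0 := by
    rintro rfl
    rw [hb, zero_smul, norm_zero] at hNnorm
    exact zero_ne_one hNnorm
  refine ⟨b, hbne, ?_⟩
  have hDN : DifferentiableAt ℝ (unitNormal F) q := differentiableAt_unitNormal hF hg
  set A := fderiv ℝ (unitNormal F) q with hA
  have hNin : ∀ α β γ, ⟪N, cyl n α β γ⟫ =
      b * (α - (x * s + y * c) * β - (x * c - y * s) * γ) := by
    intro α β γ
    rw [hb, inner_smul_left, inner_cyl_cyl hn]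
    simp only [conj_trivial]; ring
  -- the radial direction
  have hqA : ⟪q, A q⟫ = 0 := by
    have h1 : ∀ t : ℝ, HasDerivAt (fun t : ℝ => t • q) q t := fun t => by
      simpa using (hasDerivAt_id t).smul_const q
    have h2 := inner_fderiv_unitNormal (F := F) (γ := fun t : ℝ => t • q) (γ₁ := fun _ => q) (w := 0)
      (t := 1) (by simpa using hF) (by simpa using hg) (Eventually.of_forall h1)
      (hasDerivAt_const _ _) (by
        have := (h1 1).continuousAt.eventually (by simpa using hz)
        filter_upwards [this, lt_mem_nhds (zero_lt_one' ℝ)] with t ht ht0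
        exact ht (hX.smul t ht0 _ hq))
    simpa using h2
  -- the direction of the arc
  have he : 0 < 1 + x ^ 2 := by positivity
  set κ := -(x * y) / (1 + x ^ 2) with hκ
  have hκe : κ * (1 + x ^ 2) = -(x * y) := div_mul_cancel₀ _ he.ne'
  set τ := cyl n (κ * x + y) (κ * s + c) (κ * c - s) with hτ
  have hτA : ⟪τ, A τ⟫ = -(b * (x + a)) := by
    set l : ℝ → ℝ := fun r => 1 + κ * (r - φ) with hl
    have hld : ∀ r, HasDerivAt l κ r := fun r =>
      ((((hasDerivAt_id r).sub_const φ).const_mul κ).const_add 1).congr_deriv (mul_one κ)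
    have hlφ : l φ = 1 := by simp [hl]
    have hγ : ∀ᶠ r in 𝓝 φ, HasDerivAt
        (fun r => cyl n (l r * u r) (l r * Real.sin r) (l r * Real.cos r))
        (cyl n (κ * u r + l r * v r) (κ * Real.sin r + l r * Real.cos r)
          (κ * Real.cos r + l r * -Real.sin r)) r := by
      filter_upwards [hu] with r hr
      exact HasDerivAt.cyl n ((hld r).fun_mul hr) ((hld r).fun_mul (Real.hasDerivAt_sin r))
        ((hld r).fun_mul (Real.hasDerivAt_cos r))
    have hγ₁ : HasDerivAt (fun r => cyl n (κ * u r + l r * v r) (κ * Real.sin r + l r * Real.cos r)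
          (κ * Real.cos r + l r * -Real.sin r))
        (cyl n (κ * y + (κ * y + a)) (κ * c + (κ * c - s)) (-(κ * s) + (-(κ * s) - c))) φ := by
      refine (HasDerivAt.cyl n ((hu.self_of_nhds.const_mul κ).fun_add ((hld φ).fun_mul hv))
        (((Real.hasDerivAt_sin φ).const_mul κ).fun_add ((hld φ).fun_mul (Real.hasDerivAt_cos φ)))
        (((Real.hasDerivAt_cos φ).const_mul κ).fun_add
          ((hld φ).fun_mul (Real.hasDerivAt_sin φ).fun_neg))).congr_deriv ?_
      rw [cyl_inj hn, hlφ]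
      refine ⟨by simp [hy], by simp [hs, hc]; ring, by simp [hs, hc]; ring⟩
    have hγφ : cyl n (l φ * u φ) (l φ * Real.sin φ) (l φ * Real.cos φ) = q := by
      rw [hlφ, one_mul, one_mul, one_mul]
    have hlpos : ∀ᶠ r in 𝓝 φ, 0 < l r :=
      (hld φ).continuousAt.eventually (lt_mem_nhds (by rw [hlφ]; norm_num))
    have h1 := inner_fderiv_unitNormal (F := F)
      (γ := fun r => cyl n (l r * u r) (l r * Real.sin r) (l r * Real.cos r)) (t := φ)
      (by simpa only [hγφ] using hF) (by simpa only [hγφ] using hg) hγ hγ₁ (by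
        have hc1 := hγ.self_of_nhds.continuousAt.eventually (by simpa only [hγφ] using hz)
        filter_upwards [hc1, hmem, hlpos] with r h1 h2 h3
        refine h1 ?_
        rw [← smul_cyl]
        exact hX.smul _ h3 _ h2)
    simp only [hγφ] at h1
    have e1 : cyl n (κ * u φ + l φ * v φ) (κ * Real.sin φ + l φ * Real.cos φ)
          (κ * Real.cos φ + l φ * -Real.sin φ) = τ := by
      rw [hτ, cyl_inj hn, hlφ]
      refine ⟨by ring, by ring, by ring⟩
    rw [e1, ← hA, ← hN, hNin] at h1
    rw [h1]
    linear_combination (-(b * (x - 2 * κ * y))) * hsc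
  -- the directions of the orbits
  have horb : ∀ i : Fin (n + 1), i ≠ 0 → i ≠ ⟨n - 1, by omega⟩ → i ≠ Fin.last n →
      ⟪(EuclideanSpace.single i 1 : Ambient n), A (EuclideanSpace.single i 1)⟫ = b / x := by
    intro i h0 h1 h2
    set e : Ambient n := EuclideanSpace.single i 1 with hedef
    have hd : ∀ t, HasDerivAt
        (fun t => cyl n (x * Real.cos t) s c + (x * Real.sin t) • e)
        (cyl n (x * -Real.sin t) 0 0 + (x * Real.cos t) • e) t := fun t =>
      (HasDerivAt.cyl n ((Real.hasDerivAt_cos t).const_mul x) (hasDerivAt_const t s)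
        (hasDerivAt_const t c)).fun_add (((Real.hasDerivAt_sin t).const_mul x).smul_const e)
    have hd2 : HasDerivAt (fun t => cyl n (x * -Real.sin t) 0 0 + (x * Real.cos t) • e)
        (cyl n (-x) 0 0) 0 := by
      refine ((HasDerivAt.cyl n ((Real.hasDerivAt_sin 0).fun_neg.const_mul x) (hasDerivAt_const 0 0)
        (hasDerivAt_const 0 0)).fun_add
          (((Real.hasDerivAt_cos 0).const_mul x).smul_const e)).congr_deriv ?_
      simp
    have e0 : cyl n (x * Real.cos 0) s c + (x * Real.sin 0) • e = q := by simp [hqdef]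
    have h3 := inner_fderiv_unitNormal (F := F) (γ := fun t => cyl n (x * Real.cos t) s c +
      (x * Real.sin t) • e) (t := 0) (by simpa only [e0] using hF) (by simpa only [e0] using hg)
      (Eventually.of_forall hd) hd2 (by
        have hc1 := (hd 0).continuousAt.eventually (by simpa only [e0] using hz)
        filter_upwards [hc1] with t ht
        exact ht (hX.orbit_mem hn hq h0 h1 h2 t))
    simp only [e0] at h3
    rw [← hA, ← hN, hNin] at h3
    simp only [Real.sin_zero, neg_zero, mul_zero, cyl_zero, zero_add, Real.cos_zero, mul_one,
      map_smul, inner_smul_left, inner_smul_right, conj_trivial, sub_zero] at h3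
    rw [eq_div_iff hu0.ne']
    have : x * (⟪e, A e⟫ * x - b) = 0 := by linear_combination h3
    rcases mul_eq_zero.1 this with h4 | h4
    · exact absurd h4 hu0.ne'
    · linarith
  -- the orthonormal basis
  have hqn : ‖q‖ ^ 2 = 1 + x ^ 2 := by rw [hqdef, norm_cyl_sq hn]; linear_combination hsc
  have hτn : ‖τ‖ ^ 2 = (1 + x ^ 2 + y ^ 2) / (1 + x ^ 2) := by
    rw [hτ, norm_cyl_sq hn, eq_div_iff he.ne']
    linear_combination (1 + x ^ 2) * (κ ^ 2 + 1) * hsc + (κ * (1 + x ^ 2) + x * y) * hκe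
  have hqne : ‖q‖ ≠ 0 := fun h => by rw [h] at hqn; nlinarith
  have hτne : ‖τ‖ ≠ 0 := fun h => by
    rw [h] at hτn
    have : 0 < (1 + x ^ 2 + y ^ 2) / (1 + x ^ 2) := by positivity
    norm_num at hτn
    linarith
  have hqτ : ⟪q, τ⟫ = 0 := by
    rw [hqdef, hτ, inner_cyl_cyl hn]
    linear_combination κ * hsc + hκe
  have hNq : ⟪N, q⟫ = 0 := by
    rw [hqdef, hNin]
    linear_combination (-(b * x)) * hsc
  have hNτ : ⟪N, τ⟫ = 0 := by
    rw [hτ, hNin]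
    linear_combination (-(b * (κ * x + y))) * hsc
  have h1 : (⟨n - 1, by omega⟩ : Fin (n + 1)) ≠ 0 := by simp [Fin.ext_iff]; omega
  have h2 : (Fin.last n : Fin (n + 1)) ≠ 0 := by simp [Fin.ext_iff]; omega
  have h3 : (Fin.last n : Fin (n + 1)) ≠ ⟨n - 1, by omega⟩ := by simp [Fin.ext_iff]; omega
  have hcoord : ∀ i : Fin (n + 1), i ≠ 0 → i ≠ ⟨n - 1, by omega⟩ → i ≠ Fin.last n →
      ∀ α β γ, ⟪cyl n α β γ, (EuclideanSpace.single i 1 : Ambient n)⟫ = 0 := by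
    intro i h0 h1 h2 α β γ
    rw [real_inner_comm, EuclideanSpace.inner_single_left, cyl_apply hn]
    simp [h0, h1, h2]
  have hNi : ∀ i : Fin (n + 1), i ≠ 0 → i ≠ ⟨n - 1, by omega⟩ → i ≠ Fin.last n →
      ⟪N, (EuclideanSpace.single i 1 : Ambient n)⟫ = 0 := by
    intro i h0 h1 h2
    rw [hb, inner_smul_left, hcoord i h0 h1 h2, mul_zero]
  obtain ⟨B, hB⟩ := exists_adapted_basis hqne hτne hNnorm hqτ hNq hNτ
    (fun i h0 h1 h2 => hcoord i h0 h1 h2 _ _ _) (fun i h0 h1 h2 => hcoord i h0 h1 h2 _ _ _) hNi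
  have hT : ∀ i, ⟪B i, A (B i)⟫ = b / x + (if i = 0 then -(b / x) else 0) +
      (if i = ⟨n - 1, by omega⟩ then
        -(b * (x + a)) * (1 + x ^ 2) / (1 + x ^ 2 + y ^ 2) - b / x else 0) +
      (if i = Fin.last n then -(b / x) else 0) := by
    intro i
    rw [hB i]
    by_cases i0 : i = 0
    · rw [if_pos i0, if_pos i0, if_neg (i0 ▸ h1.symm), if_neg (i0 ▸ h2.symm), map_smul,
        inner_smul_left, inner_smul_right, hqA]
      simp
    rw [if_neg i0, if_neg i0]
    by_cases i1 : i = ⟨n - 1, by omega⟩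
    · rw [if_pos i1, if_pos i1, if_neg (i1 ▸ h3.symm), map_smul, inner_smul_left,
        inner_smul_right, hτA, conj_trivial, ← mul_assoc, ← mul_inv, ← pow_two, hτn]
      have : 0 < 1 + x ^ 2 + y ^ 2 := by positivity
      field_simp
      ring
    rw [if_neg i1, if_neg i1]
    by_cases i2 : i = Fin.last n
    · rw [if_pos i2, if_pos i2, inner_unitNormal_fderiv_unitNormal hF hg]; ring
    · rw [if_neg i2, if_neg i2, horb i i0 i1 i2]; ring
  rw [meanCurvature, LinearMap.trace_eq_sum_inner _ B]
  have hsum : ∑ i, ⟪B i, A.toLinearMap (B i)⟫ = ∑ i, ⟪B i, A (B i)⟫ := rfl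
  rw [hsum, Finset.sum_congr rfl fun i _ => hT i]
  simp only [Finset.sum_add_distrib, Finset.sum_ite_eq', Finset.mem_univ, if_true, Finset.sum_const,
    Finset.card_univ, Fintype.card_fin, nsmul_eq_mul]
  push_cast
  have hne : 1 + x ^ 2 + y ^ 2 ≠ 0 := by positivity
  have hxne : x ≠ 0 := hu0.ne'
  field_simp
  ring

/-- Along an arc an axisymmetric cone is minimal if and only if the arc solves the polar minimal
cone equation. -/
theorem IsAxiCone.meanCurvature_eq_zero_iff {n : ℕ} (hn : 3 ≤ n) {X : Set (Ambient n)}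
    (hX : IsAxiCone X) {F : Ambient n → ℝ} {u v : ℝ → ℝ} {a φ : ℝ} (hu0 : 0 < u φ)
    (hu : ∀ᶠ s in 𝓝 φ, HasDerivAt u (v s) s) (hv : HasDerivAt v a φ)
    (hmem : ∀ᶠ s in 𝓝 φ, cyl n (u s) (Real.sin s) (Real.cos s) ∈ X)
    (hF : ContDiffAt ℝ 2 F (cyl n (u φ) (Real.sin φ) (Real.cos φ)))
    (hg : gradient F (cyl n (u φ) (Real.sin φ) (Real.cos φ)) ≠ 0)
    (hz : ∀ᶠ x in 𝓝 (cyl n (u φ) (Real.sin φ) (Real.cos φ)), x ∈ X → F x = 0) :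
    meanCurvature F (cyl n (u φ) (Real.sin φ) (Real.cos φ)) = 0 ↔
      a = force (n - 2) (u φ) (v φ) - u φ := by
  obtain ⟨b, hb, h⟩ := hX.meanCurvature_arc hn hu0 hu hv hmem hF hg hz
  rw [h, mul_eq_zero, or_iff_right hb, force]
  have h1 : 0 < 1 + u φ ^ 2 := by positivity
  have h2 : 0 < 1 + u φ ^ 2 + v φ ^ 2 := by positivity
  have hcast : ((n - 2 : ℕ) : ℝ) = n - 2 := by
    rw [Nat.cast_sub (by omega)]; norm_num
  rw [hcast, sub_eq_zero, div_eq_div_iff hu0.ne' h2.ne', eq_sub_iff_add_eq,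
    eq_div_iff (by positivity)]
  constructor <;> intro h3 <;> linear_combination -h3

/-! ### Arcs and rays in axisymmetric minimal cones -/

theorem two_le_infty : (2 : WithTop ℕ∞) ≤ ∞ := by
  norm_cast

theorem ContinuousAt.cyl (n : ℕ) {ρ y z : ℝ → ℝ} {t : ℝ} (hρ : ContinuousAt ρ t)
    (hy : ContinuousAt y t) (hz : ContinuousAt z t) :
    ContinuousAt (fun t => cyl n (ρ t) (y t) (z t)) t := by
  unfold CapillaryCone.cyl
  fun_prop

theorem exists_implicit {G : ℝ × ℝ → ℝ} {a b : ℝ} (hG : ContDiffAt ℝ ∞ G (a, b))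
    (h0 : G (a, b) = 0) (h2 : fderiv ℝ G (a, b) (0, 1) ≠ 0) :
    ∃ ψ : ℝ → ℝ, ψ a = b ∧ ContDiffAt ℝ ∞ ψ a ∧ ∀ᶠ s in 𝓝 a, G (s, ψ s) = 0 := by
  have hinv : (fderiv ℝ G (a, b) ∘SL ContinuousLinearMap.inr ℝ ℝ ℝ).IsInvertible := by
    refine ⟨ContinuousLinearEquiv.unitsEquivAut ℝ (Units.mk0 _ h2), ?_⟩
    ext
    simp
  refine ⟨hG.implicitFunction (by simp) hinv, hG.implicitFunction_apply_self (by simp) hinv,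
    hG.contDiffAt_implicitFunction (by simp) hinv, ?_⟩
  have := hG.eventually_apply_implicitFunction (by simp) hinv
  rwa [h0] at this

/-- In the open set `U` the set `C` is the regular level set `{F = 0}`, and it is minimal. -/
structure IsDefining {n : ℕ} (C U : Set (Ambient n)) (F : Ambient n → ℝ) : Prop where
  isOpen : IsOpen U
  contDiffOn : ContDiffOn ℝ ∞ F U
  inter_eq : C ∩ U = {q | q ∈ U ∧ F q = 0}
  gradient_ne_zero : ∀ q ∈ C ∩ U, gradient F q ≠ 0
  meanCurvature_eq_zero : ∀ q ∈ C ∩ U, meanCurvature F q = 0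

/-- An axisymmetric cone which is a minimal hypersurface without boundary of the open set `Ω`. The
interior of a capillary cone and the cone over a minimal hypersurface of the sphere are of this
kind. -/
structure IsMinimalConeIn {n : ℕ} (Ω C : Set (Ambient n)) : Prop extends IsAxiCone C where
  mem_of_closure : ∀ p ∈ Ω, p ∈ closure C → p ∈ C
  exists_isDefining : ∀ p ∈ C, p ∈ Ω → ∃ (U : Set (Ambient n)) (F : Ambient n → ℝ),
    p ∈ U ∧ IsDefining C U F

section Defining

variable {n : ℕ} {C U : Set (Ambient n)} {F : Ambient n → ℝ} {q : Ambient n}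

theorem IsDefining.contDiffAt (h : IsDefining C U F) (hq : q ∈ U) : ContDiffAt ℝ ∞ F q :=
  h.contDiffOn.contDiffAt (h.isOpen.mem_nhds hq)

theorem IsDefining.differentiableAt (h : IsDefining C U F) (hq : q ∈ U) :
    DifferentiableAt ℝ F q := (h.contDiffAt hq).differentiableAt (by simp)

theorem IsDefining.mem_iff (h : IsDefining C U F) (hq : q ∈ U) : q ∈ C ↔ F q = 0 :=
  ⟨fun hC => (h.inter_eq.subset ⟨hC, hq⟩).2, fun h0 => (h.inter_eq.superset ⟨hq, h0⟩).1⟩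

theorem IsDefining.eventually_mem_iff (h : IsDefining C U F) (hq : q ∈ U) :
    ∀ᶠ x in 𝓝 q, x ∈ C ↔ F x = 0 :=
  (h.isOpen.mem_nhds hq |> fun hU => Filter.eventually_of_mem hU fun _ hx => h.mem_iff hx)

theorem IsDefining.eventually_eq_zero (h : IsDefining C U F) (hq : q ∈ U) :
    ∀ᶠ x in 𝓝 q, x ∈ C → F x = 0 := (h.eventually_mem_iff hq).mono fun _ hx => hx.1

theorem IsDefining.continuousAt_gradient (h : IsDefining C U F) (hq : q ∈ U) :
    ContinuousAt (gradient F) q :=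
  (differentiableAt_gradient ((h.contDiffAt hq).of_le two_le_infty)).continuousAt

end Defining

theorem hasDerivAt_cyl_sin_cos (n : ℕ) {u : ℝ → ℝ} {v s : ℝ} (hu : HasDerivAt u v s) :
    HasDerivAt (fun s => cyl n (u s) (Real.sin s) (Real.cos s))
      (cyl n v (Real.cos s) (-Real.sin s)) s :=
  HasDerivAt.cyl n hu (Real.hasDerivAt_sin s) (Real.hasDerivAt_cos s)

/-- If an orbit is tangent to an axisymmetric minimal cone at a point, the cone contains a piece of
the orbit: by the implicit function theorem it contains an arc tangent to the orbit, which solves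
the same differential equation. -/
theorem IsDefining.eventually_arc_mem {n : ℕ} (hn : 3 ≤ n) {C U : Set (Ambient n)}
    {F : Ambient n → ℝ} (hC : IsAxiCone C) (h : IsDefining C U F) {u v : ℝ → ℝ}
    (ho : IsOrbit (n - 2) u v) {φ : ℝ} (hqC : cyl n (u φ) (Real.sin φ) (Real.cos φ) ∈ C)
    (hqU : cyl n (u φ) (Real.sin φ) (Real.cos φ) ∈ U)
    (ht : ⟪gradient F (cyl n (u φ) (Real.sin φ) (Real.cos φ)),
      cyl n (v φ) (Real.cos φ) (-Real.sin φ)⟫ = 0) :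
    ∀ᶠ s in 𝓝 φ, cyl n (u s) (Real.sin s) (Real.cos s) ∈ C := by
  have hsc := Real.sin_sq_add_cos_sq φ
  have hg0 := h.gradient_ne_zero _ ⟨hqC, hqU⟩
  obtain ⟨a, b, c, hg, h1⟩ := hC.gradient_eq hn (ho.pos φ).ne' hqC (h.differentiableAt hqU)
    (h.eventually_eq_zero hqU)
  have ht' := ht
  rw [hg, inner_cyl_cyl hn] at ht'
  have ha : a ≠ 0 := by
    rintro rfl
    refine hg0 ?_
    have hb : b = 0 := by linear_combination Real.sin φ * h1 + Real.cos φ * ht' - b * hsc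
    have hc : c = 0 := by linear_combination Real.cos φ * h1 - Real.sin φ * ht' - c * hsc
    rw [hg, hb, hc, cyl_zero]
  set W : ℝ × ℝ → Ambient n := fun x => cyl n x.2 (Real.sin x.1) (Real.cos x.1) with hW
  have hWc : ContDiff ℝ ∞ W := (contDiff_cyl n).comp (contDiff_snd.prodMk
    ((Real.contDiff_sin.comp contDiff_fst).prodMk (Real.contDiff_cos.comp contDiff_fst)))
  have hGc : ContDiffAt ℝ ∞ (F ∘ W) (φ, u φ) :=
    ContDiffAt.comp (φ, u φ) (h.contDiffAt hqU) hWc.contDiffAt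
  obtain ⟨ψ, hψ0, hψc, hψ⟩ := exists_implicit hGc ((h.mem_iff hqU).1 hqC) (by
    have hline : HasDerivAt (fun t : ℝ => (φ, u φ) + t • ((0, 1) : ℝ × ℝ)) (0, 1) 0 := by
      simpa using ((hasDerivAt_id (0 : ℝ)).smul_const ((0, 1) : ℝ × ℝ)).const_add (φ, u φ)
    have h2 : HasFDerivAt (F ∘ W) (fderiv ℝ (F ∘ W) (φ, u φ))
        ((φ, u φ) + (0 : ℝ) • ((0, 1) : ℝ × ℝ)) := by
      simpa using (hGc.differentiableAt (by simp)).hasFDerivAt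
    have h3 := h2.comp_hasDerivAt (0 : ℝ) hline
    have h4 : HasDerivAt (fun t : ℝ => cyl n (u φ + t) (Real.sin φ) (Real.cos φ)) (cyl n 1 0 0) 0 :=
      HasDerivAt.cyl n ((hasDerivAt_id (0 : ℝ)).const_add (u φ)) (hasDerivAt_const _ _)
        (hasDerivAt_const _ _)
    have h5 : HasFDerivAt F (fderiv ℝ F (cyl n (u φ) (Real.sin φ) (Real.cos φ)))
        (cyl n (u φ + 0) (Real.sin φ) (Real.cos φ)) := by
      simpa using (h.differentiableAt hqU).hasFDerivAt
    have h6 := h5.comp_hasDerivAt (0 : ℝ) h4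
    have h7 : fderiv ℝ (F ∘ W) (φ, u φ) (0, 1) =
        fderiv ℝ F (cyl n (u φ) (Real.sin φ) (Real.cos φ)) (cyl n 1 0 0) := by
      refine h3.unique (h6.congr_of_eventuallyEq (Eventually.of_forall fun t => ?_))
      simp [hW]
    rw [h7, ← inner_gradient, hg, inner_cyl_cyl hn]
    simpa using ha)
  have hψ2 : ContDiffAt ℝ 2 ψ φ := hψc.of_le two_le_infty
  have hψev : ∀ᶠ s in 𝓝 φ, ContDiffAt ℝ 2 ψ s := hψ2.eventually (by norm_num)
  have hd1 : ∀ᶠ s in 𝓝 φ, HasDerivAt ψ (deriv ψ s) s :=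
    hψev.mono fun s hs => (hs.differentiableAt (by norm_num)).hasDerivAt
  have hd2 : ∀ᶠ s in 𝓝 φ, HasDerivAt (deriv ψ) (deriv (deriv ψ) s) s :=
    hψev.mono fun s hs => by
      have h2 : ContDiffAt ℝ 1 (deriv ψ) s := by
        have h3 := hs.fderiv_right (m := 1) (by norm_num)
        exact h3.clm_apply contDiffAt_const
      exact (h2.differentiableAt (by norm_num)).hasDerivAt
  have hcont : ContinuousAt (fun s => cyl n (ψ s) (Real.sin s) (Real.cos s)) φ :=
    (hasDerivAt_cyl_sin_cos n hd1.self_of_nhds).continuousAt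
  have hUev : ∀ᶠ s in 𝓝 φ, cyl n (ψ s) (Real.sin s) (Real.cos s) ∈ U :=
    hcont.eventually (by simp only [hψ0]; exact h.isOpen.mem_nhds hqU)
  have hCev : ∀ᶠ s in 𝓝 φ, cyl n (ψ s) (Real.sin s) (Real.cos s) ∈ C := by
    filter_upwards [hUev, hψ] with s hs hs0
    exact (h.mem_iff hs).2 hs0
  have hpos : ∀ᶠ s in 𝓝 φ, 0 < ψ s :=
    hψc.continuousAt.eventually (lt_mem_nhds (by rw [hψ0]; exact ho.pos φ))
  have hode : ∀ᶠ s in 𝓝 φ, HasDerivAt (deriv ψ) (force (n - 2) (ψ s) (deriv ψ s) - ψ s) s := by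
    filter_upwards [hd1.eventually_nhds, hd2, hUev, hCev.eventually_nhds, hpos] with s e1 e2 e3 e4 e5
    have e6 : _ ∈ C ∩ U := ⟨e4.self_of_nhds, e3⟩
    have := (hC.meanCurvature_eq_zero_iff hn e5 e1 e2 e4
      ((h.contDiffAt e3).of_le two_le_infty) (h.gradient_ne_zero _ e6)
      (h.eventually_eq_zero e3)).1 (h.meanCurvature_eq_zero _ e6)
    rwa [← this]
  -- the arc is tangent to the orbit
  have hslope : deriv ψ φ = v φ := by
    obtain ⟨b', hb'⟩ := hC.gradient_arc hn (F := F) (u := ψ) (S := univ) (φ := φ)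
      (by rw [hψ0]; exact ho.pos φ) uniqueDiffWithinAt_univ hd1.self_of_nhds.hasDerivWithinAt
      (by rw [hψ0]; exact hqC) (by rwa [nhdsWithin_univ]) (by rw [hψ0]; exact h.differentiableAt hqU)
      (by rw [hψ0]; exact h.eventually_eq_zero hqU)
    rw [hψ0] at hb'
    have hb0 : b' ≠ 0 := by
      rintro rfl
      rw [zero_smul] at hb'
      exact hg0 hb'
    rw [hb', inner_smul_left, inner_cyl_cyl hn] at ht
    have h8 := (mul_eq_zero.1 ht).resolve_left (by simpa using hb0)
    linear_combination (-deriv ψ φ) * hsc - h8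
  obtain ⟨ε, hε, hball⟩ := Metric.eventually_nhds_iff_ball.1 (hd1.and (hode.and (hpos.and hCev)))
  have hsub : ∀ t ∈ Icc (φ - ε / 2) (φ + ε / 2), t ∈ Metric.ball φ ε := fun t ht => by
    rw [Metric.mem_ball, Real.dist_eq, abs_lt]
    constructor <;> linarith [ht.1, ht.2]
  have hφ : φ ∈ Icc (φ - ε / 2) (φ + ε / 2) := ⟨by linarith, by linarith⟩
  have heq := orbit_eqOn_Icc (n - 2) hφ (fun t ht => (hball t (hsub t ht)).2.2.1)
    (fun t _ => ho.pos t)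
    (fun t ht => (hball t (hsub t ht)).1.hasDerivWithinAt)
    (fun t ht => (hball t (hsub t ht)).2.1.hasDerivWithinAt)
    (fun t _ => (ho.hasDerivAt_fst t).hasDerivWithinAt)
    (fun t _ => (ho.hasDerivAt_snd t).hasDerivWithinAt) hψ0 hslope
  filter_upwards [Icc_mem_nhds (a := φ - ε / 2) (b := φ + ε / 2) (by linarith) (by linarith)]
    with t ht
  rw [← (heq t ht).1]
  exact (hball t (hsub t ht)).2.2.2

/-- An orbit which is tangent to an axisymmetric minimal cone at one point stays in the cone. -/
theorem IsMinimalConeIn.arc_mem {n : ℕ} (hn : 3 ≤ n) {Ω C : Set (Ambient n)}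
    (hC : IsMinimalConeIn Ω C) {O : Set ℝ} (hO : IsPreconnected O)
    (hΩ : ∀ s ∈ O, ∀ x : ℝ, 0 < x → cyl n x (Real.sin s) (Real.cos s) ∈ Ω) {u v : ℝ → ℝ}
    (ho : IsOrbit (n - 2) u v) {φ : ℝ} (hφ : φ ∈ O)
    (hev : ∀ᶠ s in 𝓝 φ, cyl n (u s) (Real.sin s) (Real.cos s) ∈ C) {s : ℝ} (hs : s ∈ O) :
    cyl n (u s) (Real.sin s) (Real.cos s) ∈ C := by
  set q : ℝ → Ambient n := fun s => cyl n (u s) (Real.sin s) (Real.cos s) with hq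
  have hqd : ∀ s, HasDerivAt q (cyl n (v s) (Real.cos s) (-Real.sin s)) s := fun s =>
    hasDerivAt_cyl_sin_cos n (ho.hasDerivAt_fst s)
  set J : Set ℝ := {s | ∀ᶠ r in 𝓝 s, q r ∈ C} with hJ
  have hJopen : IsOpen J := isOpen_iff_mem_nhds.2 fun s hs => (eventually_eventually_nhds.2 hs)
  have hsub : O ⊆ J := by
    refine hO.subset_of_closure_inter_subset hJopen ⟨φ, hφ, hev⟩ ?_
    rintro s ⟨hsJ, hsO⟩
    have hsC : q s ∈ C := by
      refine hC.mem_of_closure _ (hΩ s hsO _ (ho.pos s)) ?_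
      refine closure_mono ?_ ((hqd s).continuousAt.continuousWithinAt.mem_closure_image hsJ)
      rintro _ ⟨r, hr, rfl⟩
      exact (show ∀ᶠ r in 𝓝 r, q r ∈ C from hr).self_of_nhds
    obtain ⟨U, F, hqU, hF⟩ := hC.exists_isDefining _ hsC (hΩ s hsO _ (ho.pos s))
    refine hF.eventually_arc_mem hn hC.toIsAxiCone ho hsC hqU ?_
    have hcT : ContinuousAt (fun r => ⟪gradient F (q r), cyl n (v r) (Real.cos r) (-Real.sin r)⟫) s := by
      refine ((hF.continuousAt_gradient hqU).comp (hqd s).continuousAt).inner ?_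
      exact ContinuousAt.cyl n ho.continuous_snd.continuousAt Real.continuous_cos.continuousAt
        Real.continuous_sin.neg.continuousAt
    have hUev : ∀ᶠ r in 𝓝 s, q r ∈ U := (hqd s).continuousAt.eventually (hF.isOpen.mem_nhds hqU)
    have hfr : ∃ᶠ r in 𝓝 s, ⟪gradient F (q r), cyl n (v r) (Real.cos r) (-Real.sin r)⟫ = 0 := by
      refine ((mem_closure_iff_frequently.1 hsJ).and_eventually hUev).mono ?_
      rintro r ⟨hr, hrU⟩
      have hr' : ∀ᶠ t in 𝓝 r, q t ∈ C := hr
      refine inner_gradient_eq_zero (γ := q) (S := univ) (hF.differentiableAt hrU)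
        uniqueDiffWithinAt_univ (hqd r).hasDerivWithinAt ?_ ((hF.mem_iff hrU).1 hr'.self_of_nhds)
      rw [nhdsWithin_univ]
      filter_upwards [hr', (hqd r).continuousAt.eventually (hF.isOpen.mem_nhds hrU)] with t h1 h2
      exact (hF.mem_iff h2).1 h1
    by_contra hne
    exact hfr ((hcT.eventually_ne hne).mono fun r hr => hr)
  exact (show ∀ᶠ r in 𝓝 s, q r ∈ C from hsub hs).self_of_nhds

/-- At a point where the cone is not tangent to the radial direction of `x'` the cone contains an
orbit. -/
theorem IsDefining.exists_orbit {n : ℕ} (hn : 3 ≤ n) {C U : Set (Ambient n)}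
    {F : Ambient n → ℝ} (hC : IsAxiCone C) (h : IsDefining C U F) {x φ : ℝ} (hx : 0 < x)
    (hqC : cyl n x (Real.sin φ) (Real.cos φ) ∈ C) (hqU : cyl n x (Real.sin φ) (Real.cos φ) ∈ U)
    (ht : gradient F (cyl n x (Real.sin φ) (Real.cos φ)) 0 ≠ 0) :
    ∃ u v : ℝ → ℝ, IsOrbit (n - 2) u v ∧ u φ = x ∧
      ⟪gradient F (cyl n x (Real.sin φ) (Real.cos φ)),
        cyl n (v φ) (Real.cos φ) (-Real.sin φ)⟫ = 0 ∧
      ∀ᶠ s in 𝓝 φ, cyl n (u s) (Real.sin s) (Real.cos s) ∈ C := by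
  obtain ⟨a, b, c, hg, -⟩ := hC.gradient_eq hn hx.ne' hqC (h.differentiableAt hqU)
    (h.eventually_eq_zero hqU)
  rw [hg, cyl_apply_zero hn] at ht
  obtain ⟨u, v, ho, hu, hv⟩ := exists_isOrbit (m := n - 2) (by omega) φ hx
    (-(b * Real.cos φ - c * Real.sin φ) / a)
  have htan : ⟪gradient F (cyl n x (Real.sin φ) (Real.cos φ)),
      cyl n (v φ) (Real.cos φ) (-Real.sin φ)⟫ = 0 := by
    rw [hg, inner_cyl_cyl hn, hv]
    field_simp
    ring
  refine ⟨u, v, ho, hu, htan, ?_⟩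
  subst hu
  exact h.eventually_arc_mem hn hC ho hqC hqU htan

/-- If the slopes of the orbits in the cone are bounded, then the points where the cone is tangent
to the radial direction of `x'` are not isolated in this direction. -/
theorem IsDefining.eventually_ray_mem {n : ℕ} (hn : 3 ≤ n) {C U : Set (Ambient n)}
    {F : Ambient n → ℝ} (hC : IsAxiCone C) (h : IsDefining C U F) {M : ℝ}
    (hM : ∀ x s, 0 < x → cyl n x (Real.sin s) (Real.cos s) ∈ C →
      cyl n x (Real.sin s) (Real.cos s) ∈ U →
      gradient F (cyl n x (Real.sin s) (Real.cos s)) 0 ≠ 0 →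
      |⟪gradient F (cyl n x (Real.sin s) (Real.cos s)), cyl n 0 (Real.cos s) (-Real.sin s)⟫| ≤
        M * |gradient F (cyl n x (Real.sin s) (Real.cos s)) 0|)
    {x₀ φ : ℝ} (hx₀ : 0 < x₀) (hqC : cyl n x₀ (Real.sin φ) (Real.cos φ) ∈ C)
    (hqU : cyl n x₀ (Real.sin φ) (Real.cos φ) ∈ U)
    (ht : gradient F (cyl n x₀ (Real.sin φ) (Real.cos φ)) 0 = 0) :
    ∀ᶠ x in 𝓝 x₀, cyl n x (Real.sin φ) (Real.cos φ) ∈ C := by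
  have hsc := Real.sin_sq_add_cos_sq φ
  have hg0 := h.gradient_ne_zero _ ⟨hqC, hqU⟩
  obtain ⟨a, b, c, hg, h1⟩ := hC.gradient_eq hn hx₀.ne' hqC (h.differentiableAt hqU)
    (h.eventually_eq_zero hqU)
  have ha : a = 0 := by rwa [hg, cyl_apply_zero hn] at ht
  subst ha
  have hD : ⟪gradient F (cyl n x₀ (Real.sin φ) (Real.cos φ)),
      cyl n 0 (Real.cos φ) (-Real.sin φ)⟫ ≠ 0 := by
    rw [hg, inner_cyl_cyl hn]
    intro h2
    refine hg0 ?_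
    have hb : b = 0 := by linear_combination Real.sin φ * h1 + Real.cos φ * h2 - b * hsc
    have hc : c = 0 := by linear_combination Real.cos φ * h1 - Real.sin φ * h2 - c * hsc
    rw [hg, hb, hc, cyl_zero]
  set W : ℝ × ℝ → Ambient n := fun x => cyl n x.1 (Real.sin x.2) (Real.cos x.2) with hW
  have hWc : ContDiff ℝ ∞ W := (contDiff_cyl n).comp (contDiff_fst.prodMk
    ((Real.contDiff_sin.comp contDiff_snd).prodMk (Real.contDiff_cos.comp contDiff_snd)))
  have hGc : ContDiffAt ℝ ∞ (F ∘ W) (x₀, φ) :=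
    ContDiffAt.comp (x₀, φ) (h.contDiffAt hqU) hWc.contDiffAt
  obtain ⟨ψ, hψ0, hψc, hψ⟩ := exists_implicit hGc ((h.mem_iff hqU).1 hqC) (by
    have hline : HasDerivAt (fun t : ℝ => (x₀, t)) ((0, 1) : ℝ × ℝ) φ :=
      (hasDerivAt_const φ x₀).prodMk (hasDerivAt_id φ)
    have h3 := (hGc.differentiableAt (by simp)).hasFDerivAt.comp_hasDerivAt φ hline
    have h4 : HasDerivAt (fun t : ℝ => cyl n x₀ (Real.sin t) (Real.cos t))
      (cyl n 0 (Real.cos φ) (-Real.sin φ)) φ := hasDerivAt_cyl_sin_cos n (hasDerivAt_const φ x₀)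
    have h6 := (h.differentiableAt hqU).hasFDerivAt.comp_hasDerivAt φ h4
    rw [h3.unique h6, ← inner_gradient]
    exact hD)
  have hψev : ∀ᶠ x in 𝓝 x₀, HasDerivAt ψ (deriv ψ x) x := by
    have hψ1 : ContDiffAt ℝ 1 ψ x₀ := hψc.of_le (by simp)
    exact (hψ1.eventually (by norm_num)).mono fun s hs =>
      (hs.differentiableAt (by norm_num)).hasDerivAt
  set q : ℝ → Ambient n := fun x => cyl n x (Real.sin (ψ x)) (Real.cos (ψ x)) with hq
  have hq0 : q x₀ = cyl n x₀ (Real.sin φ) (Real.cos φ) := by simp only [hq, hψ0]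
  have hqd : ∀ᶠ x in 𝓝 x₀, HasDerivAt q (cyl n 1 (Real.cos (ψ x) * deriv ψ x)
      (-Real.sin (ψ x) * deriv ψ x)) x := by
    filter_upwards [hψev] with x hx
    exact HasDerivAt.cyl n (hasDerivAt_id x) hx.sin hx.cos
  have hqc : ContinuousAt q x₀ := hqd.self_of_nhds.continuousAt
  have hUev : ∀ᶠ x in 𝓝 x₀, q x ∈ U :=
    hqc.eventually (by rw [hq0]; exact h.isOpen.mem_nhds hqU)
  have hgc : ContinuousAt (fun x => gradient F (q x)) x₀ :=
    (h.continuousAt_gradient hqU).comp_of_eq hqc hq0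
  have hsteep : ∀ᶠ x in 𝓝 x₀, M * |gradient F (q x) 0| <
      |⟪gradient F (q x), cyl n 0 (Real.cos (ψ x)) (-Real.sin (ψ x))⟫| := by
    have hl : ContinuousAt (fun x => M * |gradient F (q x) 0|) x₀ := by
      refine continuousAt_const.mul (ContinuousAt.abs ?_)
      exact (EuclideanSpace.proj (𝕜 := ℝ) (0 : Fin (n + 1))).continuous.continuousAt.comp hgc
    have hr : ContinuousAt (fun x =>
        |⟪gradient F (q x), cyl n 0 (Real.cos (ψ x)) (-Real.sin (ψ x))⟫|) x₀ := by
      refine (hgc.inner ?_).abs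
      exact ContinuousAt.cyl n continuousAt_const
        (Real.continuous_cos.continuousAt.comp hψc.continuousAt)
        (Real.continuous_sin.continuousAt.comp hψc.continuousAt).neg
    refine hl.eventually_lt hr ?_
    rw [hψ0, hq0]
    rw [ht, abs_zero, mul_zero]
    exact abs_pos.2 hD
  have hpos : ∀ᶠ x in 𝓝 x₀, 0 < x := lt_mem_nhds hx₀
  have hzero : ∀ᶠ x in 𝓝 x₀, HasDerivAt ψ 0 x := by
    filter_upwards [hψev, hqd, hUev, hsteep, hpos, hψ.eventually_nhds] with x e1 e2 e3 e4 e5 e6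
    have hxC : q x ∈ C := (h.mem_iff e3).2 e6.self_of_nhds
    have hg1 : gradient F (q x) 0 = 0 := by
      by_contra hne
      exact absurd (hM x (ψ x) e5 hxC e3 hne) (not_le.2 e4)
    have h2 := inner_gradient_eq_zero (γ := q) (S := univ) (h.differentiableAt e3)
      uniqueDiffWithinAt_univ e2.hasDerivWithinAt (by rw [nhdsWithin_univ]; exact e6)
      e6.self_of_nhds
    obtain ⟨a', b', c', hg', -⟩ := hC.gradient_eq hn e5.ne' hxC (h.differentiableAt e3)
      (h.eventually_eq_zero e3)
    have hqx : q x = cyl n x (Real.sin (ψ x)) (Real.cos (ψ x)) := rfl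
    rw [hqx] at hg1 h2 e4
    rw [hg'] at hg1 h2 e4
    rw [cyl_apply_zero hn] at hg1
    rw [inner_cyl_cyl hn] at h2 e4
    rw [cyl_apply_zero hn, hg1, abs_zero, mul_zero, abs_pos] at e4
    have h3 : deriv ψ x * (0 * 0 + b' * Real.cos (ψ x) + c' * -Real.sin (ψ x)) = 0 := by
      linear_combination h2 - hg1
    have h4 := (mul_eq_zero.1 h3).resolve_right e4
    rwa [h4] at e1
  obtain ⟨ε, hε, hball⟩ := Metric.eventually_nhds_iff_ball.1 hzero
  filter_upwards [Metric.ball_mem_nhds x₀ hε, hUev, hψ] with x hx hxU hx0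
  have hconst : ψ x = ψ x₀ :=
    Metric.isOpen_ball.is_const_of_deriv_eq_zero (convex_ball x₀ ε).isPreconnected
      (fun y hy => (hball y hy).differentiableAt.differentiableWithinAt)
      (fun y hy => (hball y hy).deriv) hx (Metric.mem_ball_self hε)
  have := (h.mem_iff hxU).2 hx0
  simp only [hq] at this
  rwa [hconst, hψ0] at this

/-- If the slopes of the orbits in the cone are bounded, then the cone contains the whole half-plane
through a point where it is tangent to the radial direction of `x'`. -/
theorem IsMinimalConeIn.ray_mem {n : ℕ} (hn : 3 ≤ n) {Ω C : Set (Ambient n)}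
    (hC : IsMinimalConeIn Ω C) {M : ℝ}
    (hM : ∀ U F, IsDefining C U F → ∀ x s, 0 < x → cyl n x (Real.sin s) (Real.cos s) ∈ C →
      cyl n x (Real.sin s) (Real.cos s) ∈ U →
      gradient F (cyl n x (Real.sin s) (Real.cos s)) 0 ≠ 0 →
      |⟪gradient F (cyl n x (Real.sin s) (Real.cos s)), cyl n 0 (Real.cos s) (-Real.sin s)⟫| ≤
        M * |gradient F (cyl n x (Real.sin s) (Real.cos s)) 0|)
    {U : Set (Ambient n)} {F : Ambient n → ℝ} (hF : IsDefining C U F)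
    {x₀ φ : ℝ} (hΩ : ∀ x : ℝ, 0 < x → cyl n x (Real.sin φ) (Real.cos φ) ∈ Ω)
    (hx₀ : 0 < x₀) (hqC : cyl n x₀ (Real.sin φ) (Real.cos φ) ∈ C)
    (hqU : cyl n x₀ (Real.sin φ) (Real.cos φ) ∈ U)
    (ht : gradient F (cyl n x₀ (Real.sin φ) (Real.cos φ)) 0 = 0) {x : ℝ} (hx : 0 < x) :
    cyl n x (Real.sin φ) (Real.cos φ) ∈ C := by
  set q : ℝ → Ambient n := fun x => cyl n x (Real.sin φ) (Real.cos φ) with hq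
  have hqd : ∀ x, HasDerivAt q (cyl n 1 0 0) x := fun x =>
    HasDerivAt.cyl n (hasDerivAt_id x) (hasDerivAt_const _ _) (hasDerivAt_const _ _)
  set J : Set ℝ := {s | ∀ᶠ r in 𝓝 s, q r ∈ C} with hJ
  have hJopen : IsOpen J := isOpen_iff_mem_nhds.2 fun s hs => (eventually_eventually_nhds.2 hs)
  have hsub : Ioi 0 ⊆ J := by
    refine isPreconnected_Ioi.subset_of_closure_inter_subset hJopen
      ⟨x₀, hx₀, hF.eventually_ray_mem hn hC.toIsAxiCone (hM U F hF) hx₀ hqC hqU ht⟩ ?_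
    rintro s ⟨hsJ, hsO⟩
    have hsC : q s ∈ C := by
      refine hC.mem_of_closure _ (hΩ s hsO) ?_
      refine closure_mono ?_ ((hqd s).continuousAt.continuousWithinAt.mem_closure_image hsJ)
      rintro _ ⟨r, hr, rfl⟩
      exact (show ∀ᶠ r in 𝓝 r, q r ∈ C from hr).self_of_nhds
    obtain ⟨U', F', hqU', hF'⟩ := hC.exists_isDefining _ hsC (hΩ s hsO)
    refine hF'.eventually_ray_mem hn hC.toIsAxiCone (hM U' F' hF') hsO hsC hqU' ?_
    have hcT : ContinuousAt (fun r => gradient F' (q r) 0) s :=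
      (EuclideanSpace.proj (𝕜 := ℝ) (0 : Fin (n + 1))).continuous.continuousAt.comp
        ((hF'.continuousAt_gradient hqU').comp (hqd s).continuousAt)
    have hUev : ∀ᶠ r in 𝓝 s, q r ∈ U' := (hqd s).continuousAt.eventually (hF'.isOpen.mem_nhds hqU')
    have hfr : ∃ᶠ r in 𝓝 s, gradient F' (q r) 0 = 0 := by
      refine ((mem_closure_iff_frequently.1 hsJ).and_eventually hUev).mono ?_
      rintro r ⟨hr, hrU⟩
      have hr' : ∀ᶠ t in 𝓝 r, q t ∈ C := hr
      have h1 := inner_gradient_eq_zero (F := F') (γ := q) (S := univ) (hF'.differentiableAt hrU)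
        uniqueDiffWithinAt_univ (hqd r).hasDerivWithinAt (by
          rw [nhdsWithin_univ]
          filter_upwards [hr', (hqd r).continuousAt.eventually (hF'.isOpen.mem_nhds hrU)] with t h1 h2
          exact (hF'.mem_iff h2).1 h1) ((hF'.mem_iff hrU).1 hr'.self_of_nhds)
      rw [real_inner_comm, inner_cyl] at h1
      linarith
    by_contra hne
    exact hfr ((hcT.eventually_ne hne).mono fun r hr => hr)
  exact (show ∀ᶠ r in 𝓝 x, q r ∈ C from hsub hx).self_of_nhds

/-- Two orbits in an axisymmetric minimal cone which meet coincide, since the cone has only one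
tangent plane at the common point. -/
theorem IsDefining.snd_eq {n : ℕ} (hn : 3 ≤ n) {C U : Set (Ambient n)}
    {F : Ambient n → ℝ} (hC : IsAxiCone C) (h : IsDefining C U F) {x φ v w : ℝ} (hx : x ≠ 0)
    (hqC : cyl n x (Real.sin φ) (Real.cos φ) ∈ C) (hqU : cyl n x (Real.sin φ) (Real.cos φ) ∈ U)
    (hv : ⟪gradient F (cyl n x (Real.sin φ) (Real.cos φ)),
      cyl n v (Real.cos φ) (-Real.sin φ)⟫ = 0)
    (hw : ⟪gradient F (cyl n x (Real.sin φ) (Real.cos φ)),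
      cyl n w (Real.cos φ) (-Real.sin φ)⟫ = 0) : v = w := by
  obtain ⟨a, b, c, hg, h1⟩ := hC.gradient_eq hn hx hqC (h.differentiableAt hqU)
    (h.eventually_eq_zero hqU)
  have hsc := Real.sin_sq_add_cos_sq φ
  rw [hg, inner_cyl_cyl hn] at hv hw
  have h2 : a * (v - w) = 0 := by linear_combination hv - hw
  rcases mul_eq_zero.1 h2 with ha | h3
  · subst ha
    have hb : b = 0 := by linear_combination Real.sin φ * h1 + Real.cos φ * hv - b * hsc
    have hc : c = 0 := by linear_combination Real.cos φ * h1 - Real.sin φ * hv - c * hsc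
    exact absurd (by rw [hg, hb, hc, cyl_zero]) (h.gradient_ne_zero _ ⟨hqC, hqU⟩)
  · linarith

theorem IsDefining.inner_arc_eq_zero {n : ℕ} {C U : Set (Ambient n)} {F : Ambient n → ℝ}
    (h : IsDefining C U F) {u : ℝ → ℝ} {v φ : ℝ} (hu : HasDerivAt u v φ)
    (hqU : cyl n (u φ) (Real.sin φ) (Real.cos φ) ∈ U)
    (hev : ∀ᶠ s in 𝓝 φ, cyl n (u s) (Real.sin s) (Real.cos s) ∈ C) :
    ⟪gradient F (cyl n (u φ) (Real.sin φ) (Real.cos φ)),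
      cyl n v (Real.cos φ) (-Real.sin φ)⟫ = 0 := by
  have hd := hasDerivAt_cyl_sin_cos n hu
  refine inner_gradient_eq_zero (γ := fun s => cyl n (u s) (Real.sin s) (Real.cos s)) (S := univ)
    (h.differentiableAt hqU) uniqueDiffWithinAt_univ hd.hasDerivWithinAt ?_
    ((h.mem_iff hqU).1 hev.self_of_nhds)
  rw [nhdsWithin_univ]
  filter_upwards [hev, hd.continuousAt.eventually (h.isOpen.mem_nhds hqU)] with t h1 h2
  exact (h.mem_iff h2).1 h1

/-- Every tangent vector of a regular level set is realised by points of the level set, up to a small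
multiple of the normal. -/
theorem eventually_exists_zero {n : ℕ} {F : Ambient n → ℝ} {U : Set (Ambient n)} {p τ : Ambient n}
    (hU : IsOpen U) (hp : p ∈ U) (hF : ContinuousOn F U) (hFd : DifferentiableAt ℝ F p)
    (h0 : F p = 0) (hg : gradient F p ≠ 0) (hτ : ⟪gradient F p, τ⟫ = 0) {ε : ℝ} (hε : 0 < ε) :
    ∀ᶠ δ in 𝓝[>] (0 : ℝ), ∃ s : ℝ, |s| ≤ ε * δ ∧ p + δ • τ + s • gradient F p ∈ U ∧
      F (p + δ • τ + s • gradient F p) = 0 := by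
  set g := gradient F p with hgdef
  have hgpos : 0 < ‖g‖ ^ 2 := by have := norm_pos_iff.2 hg; positivity
  have hdir : ∀ k : ℝ, HasDerivAt (fun t : ℝ => F (p + t • (τ + k • g))) (k * ‖g‖ ^ 2) 0 := by
    intro k
    have h1 : HasDerivAt (fun t : ℝ => p + t • (τ + k • g)) (τ + k • g) 0 := by
      simpa using ((hasDerivAt_id (0 : ℝ)).smul_const (τ + k • g)).const_add p
    have h2 : HasFDerivAt F (fderiv ℝ F p) (p + (0 : ℝ) • (τ + k • g)) := by
      simpa using hFd.hasFDerivAt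
    refine (h2.comp_hasDerivAt (0 : ℝ) h1).congr_deriv ?_
    rw [← inner_gradient, ← hgdef, inner_add_right, hτ, inner_smul_right,
      real_inner_self_eq_norm_sq, zero_add]
  have hslope : ∀ k : ℝ, Tendsto (fun t : ℝ => F (p + t • (τ + k • g)) / t) (𝓝[>] 0)
      (𝓝 (k * ‖g‖ ^ 2)) := by
    intro k
    have h3 := hasDerivWithinAt_iff_tendsto_slope.1 ((hdir k).hasDerivWithinAt (s := Ioi 0))
    rw [sdiff_singleton_eq_self (by simp)] at h3
    refine h3.congr fun t => ?_
    rw [slope_def_field]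
    simp [h0]
  obtain ⟨r, hr, hball⟩ := Metric.isOpen_iff.1 hU p hp
  have hsmall : ∀ᶠ δ in 𝓝[>] (0 : ℝ), δ * (‖τ‖ + ε * ‖g‖) < r := by
    have : Tendsto (fun δ : ℝ => δ * (‖τ‖ + ε * ‖g‖)) (𝓝[>] 0) (𝓝 (0 * (‖τ‖ + ε * ‖g‖))) :=
      ((continuous_id.mul continuous_const).tendsto 0).mono_left nhdsWithin_le_nhds
    rw [zero_mul] at this
    exact this.eventually_lt_const hr
  filter_upwards [(hslope ε).eventually_const_lt (by positivity : 0 < ε * ‖g‖ ^ 2),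
    (hslope (-ε)).eventually_lt_const (by nlinarith : -ε * ‖g‖ ^ 2 < 0), hsmall,
    self_mem_nhdsWithin] with δ h1 h2 h3 hδ
  have hδ0 : 0 < δ := hδ
  have hmemU : ∀ s ∈ Icc (-(ε * δ)) (ε * δ), p + δ • τ + s • g ∈ U := by
    intro s hs
    refine hball ?_
    rw [Metric.mem_ball, dist_eq_norm, show p + δ • τ + s • g - p = δ • τ + s • g by abel]
    refine lt_of_le_of_lt (norm_add_le _ _) (lt_of_le_of_lt ?_ h3)
    rw [norm_smul, norm_smul, Real.norm_of_nonneg hδ0.le, Real.norm_eq_abs]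
    have := mul_le_mul_of_nonneg_right (abs_le.2 hs) (norm_nonneg g)
    linarith
  have hcont : ContinuousOn (fun s : ℝ => F (p + δ • τ + s • g)) (Icc (-(ε * δ)) (ε * δ)) :=
    hF.comp (by fun_prop) hmemU
  have e1 : F (p + δ • τ + (ε * δ) • g) = F (p + δ • (τ + ε • g)) := by
    congr 1; rw [smul_add, smul_smul, mul_comm δ]; abel
  have e2 : F (p + δ • τ + (-(ε * δ)) • g) = F (p + δ • (τ + (-ε) • g)) := by
    congr 1; rw [smul_add, smul_smul, mul_neg, mul_comm δ]; abel
  obtain ⟨s, hs, hs0⟩ := intermediate_value_Icc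
    (by have := mul_pos hε hδ0; linarith : -(ε * δ) ≤ ε * δ) hcont
    (show (0 : ℝ) ∈ Icc _ _ by
      simp only [e1, e2]
      refine ⟨?_, ?_⟩
      · by_contra hge
        push Not at hge
        exact absurd h2 (not_lt.2 (div_nonneg hge.le hδ0.le))
      · by_contra hge
        push Not at hge
        exact absurd h1 (not_lt.2 (div_nonpos_of_nonpos_of_nonneg hge.le hδ0.le)))
  exact ⟨s, abs_le.2 hs, hmemU s hs, hs0⟩

/-! ### Polar coordinates -/

/-- The pair `(xₙ, z)` as the complex number `z + i xₙ`, so that the angle is measured from the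
`z`-axis. -/
def planar {n : ℕ} (p : Ambient n) : ℂ := Complex.equivRealProdCLM.symm (height p, axial p)

/-- The distance `√(xₙ² + z²)` to the plane `{xₙ = z = 0}`. -/
def polarRadius {n : ℕ} (p : Ambient n) : ℝ := ‖planar p‖

/-- The angle between the `z`-axis and `(xₙ, z)`. -/
def polarAngle {n : ℕ} (p : Ambient n) : ℝ := Complex.arg (planar p)

section Polar

variable {n : ℕ}

theorem re_planar (p : Ambient n) : (planar p).re = height p := rfl

theorem im_planar (p : Ambient n) : (planar p).im = axial p := rfl

theorem contDiff_planar : ContDiff ℝ ∞ (planar : Ambient n → ℂ) := by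
  refine Complex.equivRealProdCLM.symm.contDiff.comp (ContDiff.prodMk ?_ ?_)
  · unfold height; fun_prop
  · unfold axial; fun_prop

theorem continuous_polarRadius : Continuous (polarRadius : Ambient n → ℝ) :=
  contDiff_planar.continuous.norm

theorem continuousAt_polarAngle {p : Ambient n} (hp : 0 < height p ∨ axial p ≠ 0) :
    ContinuousAt polarAngle p :=
  (Complex.continuousAt_arg (show planar p ∈ Complex.slitPlane from hp)).comp
    contDiff_planar.continuous.continuousAt

theorem polarRadius_nonneg (p : Ambient n) : 0 ≤ polarRadius p := norm_nonneg _

theorem axial_eq (p : Ambient n) : axial p = polarRadius p * Real.sin (polarAngle p) := by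
  rw [polarRadius, polarAngle, Complex.norm_mul_sin_arg, im_planar]

theorem height_eq (p : Ambient n) : height p = polarRadius p * Real.cos (polarAngle p) := by
  rw [polarRadius, polarAngle, Complex.norm_mul_cos_arg, re_planar]

theorem polarRadius_sq (p : Ambient n) : polarRadius p ^ 2 = axial p ^ 2 + height p ^ 2 := by
  rw [polarRadius, Complex.sq_norm, Complex.normSq_apply, re_planar, im_planar]; ring

theorem norm_sq_eq (hn : 3 ≤ n) (p : Ambient n) : ‖p‖ ^ 2 = radius p ^ 2 + polarRadius p ^ 2 := by
  rw [radius_sq hn, polarRadius_sq]; ring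

theorem polarRadius_pos_of_height_pos {p : Ambient n} (hp : 0 < height p) : 0 < polarRadius p := by
  have := polarRadius_sq p
  have h1 : 0 < polarRadius p ^ 2 := by rw [this]; positivity
  exact (polarRadius_nonneg p).lt_of_ne fun h => by rw [← h] at h1; norm_num at h1

theorem polarRadius_eq_zero {p : Ambient n} : polarRadius p = 0 ↔ axial p = 0 ∧ height p = 0 := by
  have := polarRadius_sq p
  constructor
  · intro h
    rw [h] at this
    constructor <;> nlinarith [sq_nonneg (axial p), sq_nonneg (height p)]
  · rintro ⟨h1, h2⟩
    rw [h1, h2] at this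
    exact pow_eq_zero_iff two_ne_zero |>.1 (by linarith)

theorem polarAngle_mem_Ioo {p : Ambient n} (hp : 0 < height p) :
    polarAngle p ∈ Ioo (-(Real.pi / 2)) (Real.pi / 2) :=
  abs_lt.1 (Complex.abs_arg_lt_pi_div_two_iff.2 (Or.inl hp))

theorem polarRadius_smul {r : ℝ} (hr : 0 ≤ r) (p : Ambient n) :
    polarRadius (r • p) = r * polarRadius p := by
  rw [← abs_of_nonneg (polarRadius_nonneg (r • p)),
    ← abs_of_nonneg (mul_nonneg hr (polarRadius_nonneg p)),
    ← sq_eq_sq_iff_abs_eq_abs, mul_pow, polarRadius_sq, polarRadius_sq, axial_smul, height_smul]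
  ring

theorem polarAngle_smul {r : ℝ} (hr : 0 < r) (p : Ambient n) :
    polarAngle (r • p) = polarAngle p := by
  have : planar (r • p) = (r : ℂ) * planar p := by
    apply Complex.ext
    · simp [re_planar, height_smul]
    · simp [im_planar, axial_smul]
  rw [polarAngle, this, Complex.arg_real_mul _ hr, polarAngle]

theorem planar_cyl (hn : 3 ≤ n) (ρ r φ : ℝ) :
    planar (cyl n ρ (r * Real.sin φ) (r * Real.cos φ)) =
      r * (Complex.cos φ + Complex.sin φ * Complex.I) := by
  apply Complex.ext
  · rw [re_planar, height_cyl hn]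
    simp [Complex.cos_ofReal_re, Complex.sin_ofReal_im]
  · rw [im_planar, axial_cyl hn]
    simp [Complex.sin_ofReal_re, Complex.cos_ofReal_im]

theorem polarAngle_cyl (hn : 3 ≤ n) (ρ : ℝ) {φ : ℝ} (hφ : φ ∈ Ioc (-Real.pi) Real.pi) :
    polarAngle (cyl n ρ (Real.sin φ) (Real.cos φ)) = φ := by
  have := planar_cyl hn ρ 1 φ
  rw [one_mul, one_mul] at this
  rw [polarAngle, this]
  exact Complex.arg_mul_cos_add_sin_mul_I one_pos hφ

theorem polarRadius_cyl (hn : 3 ≤ n) (ρ φ : ℝ) :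
    polarRadius (cyl n ρ (Real.sin φ) (Real.cos φ)) = 1 := by
  have h := polarRadius_sq (cyl n ρ (Real.sin φ) (Real.cos φ))
  rw [axial_cyl hn, height_cyl hn, Real.sin_sq_add_cos_sq] at h
  exact (pow_eq_one_iff_of_nonneg (polarRadius_nonneg _) two_ne_zero).1 h

theorem IsAxiCone.smul_mem_iff {X : Set (Ambient n)} (hX : IsAxiCone X) {r : ℝ} (hr : 0 < r)
    {p : Ambient n} : r • p ∈ X ↔ p ∈ X :=
  ⟨fun h => by
    have := hX.smul r⁻¹ (inv_pos.2 hr) _ h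
    rwa [smul_smul, inv_mul_cancel₀ hr.ne', one_smul] at this, hX.smul r hr p⟩

theorem IsAxiCone.mem_iff_polar (hn : 3 ≤ n) {X : Set (Ambient n)} (hX : IsAxiCone X)
    {p : Ambient n} (hp : 0 < polarRadius p) : p ∈ X ↔
      cyl n (radius p / polarRadius p) (Real.sin (polarAngle p)) (Real.cos (polarAngle p)) ∈ X := by
  rw [← hX.smul_mem_iff hp (p := cyl n _ _ _), smul_cyl, ← axial_eq, ← height_eq,
    mul_div_cancel₀ _ hp.ne', hX.cyl_radius_mem hn]

end Polar

/-! ### Points off the axes -/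

theorem IsDefining.exists_near {n : ℕ} {C U : Set (Ambient n)} {F : Ambient n → ℝ}
    (h : IsDefining C U F) {p τ : Ambient n} (hpC : p ∈ C) (hpU : p ∈ U)
    (hτ : ⟪gradient F p, τ⟫ = 0) {r : ℝ} (hr : 0 < r) :
    ∃ δ s : ℝ, 0 < δ ∧ p + δ • τ + s • gradient F p ∈ C ∧
      dist (p + δ • τ + s • gradient F p) p < r := by
  have h1 := eventually_exists_zero h.isOpen hpU h.contDiffOn.continuousOn
    (h.differentiableAt hpU) ((h.mem_iff hpU).1 hpC) (h.gradient_ne_zero p ⟨hpC, hpU⟩) hτ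
    (ε := 1) one_pos
  have h2 : ∀ᶠ δ in 𝓝[>] (0 : ℝ), δ * (‖τ‖ + ‖gradient F p‖) < r := by
    have : Tendsto (fun δ : ℝ => δ * (‖τ‖ + ‖gradient F p‖)) (𝓝[>] 0)
        (𝓝 (0 * (‖τ‖ + ‖gradient F p‖))) :=
      ((continuous_id.mul continuous_const).tendsto 0).mono_left nhdsWithin_le_nhds
    rw [zero_mul] at this
    exact this.eventually_lt_const hr
  obtain ⟨δ, ⟨s, hs, hsU, hs0⟩, h3, h4⟩ := (h1.and (h2.and self_mem_nhdsWithin)).exists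
  have h4' : 0 < δ := h4
  refine ⟨δ, s, h4, (h.mem_iff hsU).2 hs0, ?_⟩
  rw [dist_eq_norm, show p + δ • τ + s • gradient F p - p = δ • τ + s • gradient F p by abel]
  refine lt_of_le_of_lt (norm_add_le _ _) (lt_of_le_of_lt ?_ h3)
  rw [norm_smul, norm_smul, Real.norm_of_nonneg h4'.le, Real.norm_eq_abs, mul_add]
  have := mul_le_mul_of_nonneg_right hs (norm_nonneg (gradient F p))
  linarith

/-- A regular level set is not contained in a linear subspace of codimension two. -/
theorem IsDefining.exists_near_coord_ne_zero {n : ℕ} {C U : Set (Ambient n)} {F : Ambient n → ℝ}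
    (h : IsDefining C U F) {p : Ambient n} (hpC : p ∈ C) (hpU : p ∈ U) {i j : Fin (n + 1)}
    (hij : i ≠ j) (hi : p i = 0) (hj : p j = 0) {r : ℝ} (hr : 0 < r) :
    ∃ x ∈ C, dist x p < r ∧ (x i ≠ 0 ∨ x j ≠ 0) := by
  set g := gradient F p with hg
  obtain ⟨a, b, hab, hτ⟩ : ∃ a b : ℝ, 0 < a ^ 2 + b ^ 2 ∧ a * g i + b * g j = 0 := by
    by_cases h0 : g i = 0 ∧ g j = 0
    · exact ⟨1, 0, by norm_num, by rw [h0.1, h0.2]; ring⟩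
    · refine ⟨g j, -g i, ?_, by ring⟩
      rw [not_and_or] at h0
      rcases h0 with h0 | h0
      · have : 0 < g i ^ 2 := by positivity
        linarith [sq_nonneg (g j), neg_sq (g i)]
      · have : 0 < g j ^ 2 := by positivity
        linarith [sq_nonneg (-g i)]
  set τ : Ambient n := a • EuclideanSpace.single i 1 + b • EuclideanSpace.single j 1 with hτdef
  have hτg : ⟪g, τ⟫ = 0 := by
    rw [real_inner_comm, hτdef, inner_add_left, inner_smul_left, inner_smul_left,
      EuclideanSpace.inner_single_left, EuclideanSpace.inner_single_left]
    simpa using hτ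
  obtain ⟨δ, s, hδ, hx, hd⟩ := h.exists_near hpC hpU hτg hr
  refine ⟨_, hx, hd, ?_⟩
  by_contra hne
  push Not at hne
  have hτi : τ i = a := by simp [hτdef, hij]
  have hτj : τ j = b := by simp [hτdef, hij.symm]
  simp only [PiLp.add_apply, PiLp.smul_apply, smul_eq_mul, hi, hj, hτi, hτj, zero_add] at hne
  have h3 : δ * (a ^ 2 + b ^ 2) = 0 := by
    linear_combination a * hne.1 + b * hne.2 - s * hτ
  exact absurd h3 (mul_pos hδ hab).ne'

theorem coord_eq_zero_of_radius_eq_zero {n : ℕ} {p : Ambient n} (hp : radius p = 0)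
    {i : Fin (n + 1)} (hi : (i : ℕ) < n - 1) : p i = 0 := by
  rw [radius, Real.sqrt_eq_zero (Finset.sum_nonneg fun i _ => sq_nonneg _),
    Finset.sum_eq_zero_iff_of_nonneg fun i _ => sq_nonneg _] at hp
  exact pow_eq_zero_iff two_ne_zero |>.1 (hp i (by simpa using hi))

theorem IsMinimalConeIn.mem_closure_radius_pos {n : ℕ} (hn : 3 ≤ n) {Ω C : Set (Ambient n)}
    (hC : IsMinimalConeIn Ω C) {p : Ambient n} (hp : p ∈ C) (hpΩ : p ∈ Ω) :
    p ∈ closure (C ∩ {x | 0 < radius x}) := by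
  rcases (radius_nonneg p).eq_or_lt with h0 | h0
  · obtain ⟨U, F, hpU, hF⟩ := hC.exists_isDefining p hp hpΩ
    rw [Metric.mem_closure_iff]
    intro ε hε
    have h1 : ((0 : Fin (n + 1)) : ℕ) < n - 1 := by rw [Fin.val_zero]; omega
    have h2 : (((⟨1, by omega⟩ : Fin (n + 1))) : ℕ) < n - 1 := by simp; omega
    obtain ⟨x, hx, hd, hne⟩ := hF.exists_near_coord_ne_zero hp hpU (i := 0) (j := ⟨1, by omega⟩)
      (by simp [Fin.ext_iff]) (coord_eq_zero_of_radius_eq_zero h0.symm h1)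
      (coord_eq_zero_of_radius_eq_zero h0.symm h2) hε
    refine ⟨x, ⟨hx, ?_⟩, by rwa [dist_comm]⟩
    refine (radius_nonneg x).lt_of_ne fun h3 => ?_
    rcases hne with hne | hne
    · exact hne (coord_eq_zero_of_radius_eq_zero h3.symm h1)
    · exact hne (coord_eq_zero_of_radius_eq_zero h3.symm h2)
  · exact subset_closure ⟨hp, h0⟩

theorem IsMinimalConeIn.mem_closure_polarRadius_pos {n : ℕ} (hn : 3 ≤ n) {Ω C : Set (Ambient n)}
    (hC : IsMinimalConeIn Ω C) {p : Ambient n} (hp : p ∈ C) (hpΩ : p ∈ Ω) :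
    p ∈ closure (C ∩ {x | 0 < polarRadius x}) := by
  rcases (polarRadius_nonneg p).eq_or_lt with h0 | h0
  · obtain ⟨U, F, hpU, hF⟩ := hC.exists_isDefining p hp hpΩ
    rw [Metric.mem_closure_iff]
    intro ε hε
    obtain ⟨h1, h2⟩ := polarRadius_eq_zero.1 h0.symm
    obtain ⟨x, hx, hd, hne⟩ := hF.exists_near_coord_ne_zero hp hpU (i := ⟨n - 1, by omega⟩)
      (j := Fin.last n) (by simp [Fin.ext_iff]; omega) h1 h2 hε
    refine ⟨x, ⟨hx, ?_⟩, by rwa [dist_comm]⟩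
    refine (polarRadius_nonneg x).lt_of_ne fun h3 => ?_
    obtain ⟨h4, h5⟩ := polarRadius_eq_zero.1 h3.symm
    exact hne.elim (fun h => h h4) (fun h => h h5)
  · exact subset_closure ⟨hp, h0⟩

theorem le_of_mem_closure {X : Type*} [TopologicalSpace X] {S : Set X} {f g : X → ℝ} {p : X}
    (hp : p ∈ closure S) (hf : ContinuousAt f p) (hg : ContinuousAt g p)
    (h : ∀ x ∈ S, f x ≤ g x) : f p ≤ g p := by
  by_contra hlt
  push Not at hlt
  obtain ⟨x, hx, hxS⟩ := ((mem_closure_iff_frequently.1 hp).and_eventually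
    (hg.eventually_lt hf hlt)).exists
  exact absurd (h x hx) (not_le.2 hxS)

theorem eq_of_mem_closure {X : Type*} [TopologicalSpace X] {S : Set X} {f g : X → ℝ} {p : X}
    (hp : p ∈ closure S) (hf : ContinuousAt f p) (hg : ContinuousAt g p)
    (h : ∀ x ∈ S, f x = g x) : f p = g p :=
  le_antisymm (le_of_mem_closure hp hf hg fun x hx => (h x hx).le)
    (le_of_mem_closure hp hg hf fun x hx => (h x hx).ge)

/-- The solutions have positive lower and upper bounds, and bounded slopes. -/
theorem IsOrbit.exists_bounds {m : ℕ} (hm : 1 ≤ m) {u v : ℝ → ℝ} (h : IsOrbit m u v) :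
    ∃ κ : ℝ, 0 < κ ∧ ∀ s, κ⁻¹ ≤ u s ∧ u s ≤ κ ∧ |v s| ≤ κ := by
  refine ⟨energy m (u 0) (v 0), ?_, fun s => ?_⟩
  · have h1 := h.one_add_sq_le_energy 0
    have := sq_nonneg (u 0)
    have := sq_nonneg (v 0)
    linarith
  · have := h.mem_phaseBox hm (t := 0) (κ := energy m (u 0) (v 0)) le_rfl (s := s)
    exact ⟨this.1.1, this.1.2, abs_le.2 this.2⟩

/-! ### The alternative between arcs and rays -/

section Alternative

variable {n : ℕ} {Ω C : Set (Ambient n)} {O : Set ℝ}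

theorem IsMinimalConeIn.eq_of_arc_meet (hn : 3 ≤ n) (hC : IsMinimalConeIn Ω C) (hO : IsOpen O)
    (hΩ : ∀ s ∈ O, ∀ x : ℝ, 0 < x → cyl n x (Real.sin s) (Real.cos s) ∈ Ω) {u v p q : ℝ → ℝ}
    (h : IsOrbit (n - 2) u v) (h' : IsOrbit (n - 2) p q)
    (harc : ∀ s ∈ O, cyl n (u s) (Real.sin s) (Real.cos s) ∈ C)
    (harc' : ∀ s ∈ O, cyl n (p s) (Real.sin s) (Real.cos s) ∈ C) {s : ℝ} (hs : s ∈ O)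
    (heq : u s = p s) (t : ℝ) : u t = p t ∧ v t = q t := by
  obtain ⟨U, F, hU, hF⟩ := hC.exists_isDefining _ (harc s hs) (hΩ s hs _ (h.pos s))
  refine h.eq_of_eq h' heq ?_ t
  refine hF.snd_eq hn hC.toIsAxiCone (h.pos s).ne' (harc s hs) hU
    (hF.inner_arc_eq_zero (h.hasDerivAt_fst s) hU (Filter.eventually_of_mem (hO.mem_nhds hs) harc)) ?_
  rw [heq] at hU ⊢
  exact hF.inner_arc_eq_zero (h'.hasDerivAt_fst s) hU
    (Filter.eventually_of_mem (hO.mem_nhds hs) harc')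

theorem IsMinimalConeIn.false_of_arc_of_ray (hn : 3 ≤ n) (hC : IsMinimalConeIn Ω C) (hO : IsOpen O)
    (hΩ : ∀ s ∈ O, ∀ x : ℝ, 0 < x → cyl n x (Real.sin s) (Real.cos s) ∈ Ω) {u v : ℝ → ℝ}
    (h : IsOrbit (n - 2) u v) (harc : ∀ s ∈ O, cyl n (u s) (Real.sin s) (Real.cos s) ∈ C)
    {s : ℝ} (hs : s ∈ O) (hray : ∀ x : ℝ, 0 < x → cyl n x (Real.sin s) (Real.cos s) ∈ C) :
    False := by
  obtain ⟨U, F, hU, hF⟩ := hC.exists_isDefining _ (harc s hs) (hΩ s hs _ (h.pos s))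
  have h1 := hF.inner_arc_eq_zero (h.hasDerivAt_fst s) hU
    (Filter.eventually_of_mem (hO.mem_nhds hs) harc)
  have hd : HasDerivAt (fun x => cyl n x (Real.sin s) (Real.cos s)) (cyl n 1 0 0) (u s) :=
    HasDerivAt.cyl n (hasDerivAt_id (u s)) (hasDerivAt_const _ _) (hasDerivAt_const _ _)
  have h2 := inner_gradient_eq_zero (F := F) (S := univ) (t := u s)
    (γ := fun x => cyl n x (Real.sin s) (Real.cos s)) (hF.differentiableAt hU)
    uniqueDiffWithinAt_univ hd.hasDerivWithinAt (by
      rw [nhdsWithin_univ]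
      filter_upwards [lt_mem_nhds (h.pos s), hd.continuousAt.eventually (hF.isOpen.mem_nhds hU)]
        with x hx hxU
      exact (hF.mem_iff hxU).1 (hray x hx)) ((hF.mem_iff hU).1 (harc s hs))
  have h3 : ⟪gradient F (cyl n (u s) (Real.sin s) (Real.cos s)),
      cyl n (v s + 1) (Real.cos s) (-Real.sin s)⟫ = 0 := by
    have : cyl n (v s + 1) (Real.cos s) (-Real.sin s) =
        cyl n (v s) (Real.cos s) (-Real.sin s) + cyl n 1 0 0 := by
      rw [cyl_add, add_zero, add_zero]
    rw [this, inner_add_right, h1, h2, add_zero]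
  have := hF.snd_eq hn hC.toIsAxiCone (h.pos s).ne' (harc s hs) hU h1 h3
  linarith

theorem IsMinimalConeIn.arc_or_ray (hn : 3 ≤ n) (hC : IsMinimalConeIn Ω C) (hO : IsPreconnected O)
    (hΩ : ∀ s ∈ O, ∀ x : ℝ, 0 < x → cyl n x (Real.sin s) (Real.cos s) ∈ Ω)
    (hred : ∀ x s : ℝ, 0 < x → cyl n x (Real.sin s) (Real.cos s) ∈ C →
      ∃ r ∈ O, Real.sin r = Real.sin s ∧ Real.cos r = Real.cos s) {M : ℝ}
    (hM : ∀ u v, IsOrbit (n - 2) u v → (∀ s ∈ O, cyl n (u s) (Real.sin s) (Real.cos s) ∈ C) →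
      ∀ s, |v s| ≤ M) {x φ : ℝ} (hφ : φ ∈ O) (hx : 0 < x)
    (hxC : cyl n x (Real.sin φ) (Real.cos φ) ∈ C) :
    (∃ u v, IsOrbit (n - 2) u v ∧ u φ = x ∧
      ∀ s ∈ O, cyl n (u s) (Real.sin s) (Real.cos s) ∈ C) ∨
    ∀ y : ℝ, 0 < y → cyl n y (Real.sin φ) (Real.cos φ) ∈ C := by
  obtain ⟨U, F, hU, hF⟩ := hC.exists_isDefining _ hxC (hΩ φ hφ x hx)
  by_cases hg : gradient F (cyl n x (Real.sin φ) (Real.cos φ)) 0 = 0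
  · refine Or.inr fun y hy => hC.ray_mem hn (M := M) ?_ hF (hΩ φ hφ) hx hxC hU hg hy
    intro U' F' hF' x' s' hx' hC' hU' hg'
    obtain ⟨s, hs, hs1, hs2⟩ := hred x' s' hx' hC'
    rw [← hs1, ← hs2] at hC' hU' hg' ⊢
    obtain ⟨u, v, ho, hu, ht, hev⟩ := hF'.exists_orbit hn hC.toIsAxiCone hx' hC' hU' hg'
    have hv := hM u v ho (fun r hr => hC.arc_mem hn hO hΩ ho hs hev hr) s
    have e : cyl n (v s) (Real.cos s) (-Real.sin s) =
        cyl n (v s) 0 0 + cyl n 0 (Real.cos s) (-Real.sin s) := by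
      rw [cyl_add]; simp
    rw [e, inner_add_right, real_inner_comm, inner_cyl] at ht
    set g := gradient F' (cyl n x' (Real.sin s) (Real.cos s))
    have e2 : ⟪g, cyl n 0 (Real.cos s) (-Real.sin s)⟫ = -(v s * g 0) := by linarith
    rw [e2, abs_neg, abs_mul]
    exact mul_le_mul_of_nonneg_right hv (abs_nonneg _)
  · obtain ⟨u, v, ho, hu, ht, hev⟩ := hF.exists_orbit hn hC.toIsAxiCone hx hxC hU hg
    exact Or.inl ⟨u, v, ho, hu, fun s hs => hC.arc_mem hn hO hΩ ho hφ hev hs⟩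

end Alternative

theorem pole_mem_closure {n : ℕ} {X : Set (Ambient n)} (hX : IsAxiCone X) {φ : ℝ}
    (hray : ∀ x : ℝ, 0 < x → cyl n x (Real.sin φ) (Real.cos φ) ∈ X) :
    cyl n 1 0 0 ∈ closure X ∧
      ∀ t : ℝ, 0 < t → cyl n 1 (t * Real.sin φ) (t * Real.cos φ) ∈ X := by
  have h1 : ∀ t : ℝ, 0 < t → cyl n 1 (t * Real.sin φ) (t * Real.cos φ) ∈ X := by
    intro t ht
    have := hX.smul t ht _ (hray t⁻¹ (inv_pos.2 ht))
    rwa [smul_cyl, mul_inv_cancel₀ ht.ne'] at this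
  refine ⟨?_, h1⟩
  have hc : Continuous fun t : ℝ => cyl n 1 (t * Real.sin φ) (t * Real.cos φ) :=
    (continuous_cyl n).comp (continuous_const.prodMk
      ((continuous_id.mul continuous_const).prodMk (continuous_id.mul continuous_const)))
  have h2 : Tendsto (fun t : ℝ => cyl n 1 (t * Real.sin φ) (t * Real.cos φ)) (𝓝[>] 0)
      (𝓝 (cyl n 1 0 0)) := by
    have := (hc.tendsto 0).mono_left (nhdsWithin_le_nhds (s := Ioi 0))
    simpa using this
  refine mem_closure_of_tendsto h2 ?_
  filter_upwards [self_mem_nhdsWithin] with t ht using h1 t ht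

/-- At a pole the cone is tangent to all the half-planes that it contains. -/
theorem IsAxiCone.inner_pole_eq_zero {n : ℕ} {X : Set (Ambient n)} (hX : IsAxiCone X)
    {F : Ambient n → ℝ} (hp : cyl n 1 0 0 ∈ X) (hF : DifferentiableAt ℝ F (cyl n 1 0 0))
    (hz : ∀ᶠ x in 𝓝 (cyl n 1 0 0), x ∈ X → F x = 0) {φ : ℝ}
    (hray : ∀ x : ℝ, 0 < x → cyl n x (Real.sin φ) (Real.cos φ) ∈ X) :
    ⟪gradient F (cyl n 1 0 0), cyl n 0 (Real.sin φ) (Real.cos φ)⟫ = 0 := by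
  obtain ⟨-, h1⟩ := pole_mem_closure hX hray
  set γ : ℝ → Ambient n := fun t => cyl n 1 (t * Real.sin φ) (t * Real.cos φ) with hγ
  have h0 : γ 0 = cyl n 1 0 0 := by simp [hγ]
  have hd : HasDerivAt γ (cyl n 0 (Real.sin φ) (Real.cos φ)) 0 := by
    refine (HasDerivAt.cyl n (hasDerivAt_const _ _) ((hasDerivAt_id (0 : ℝ)).mul_const _)
      ((hasDerivAt_id (0 : ℝ)).mul_const _)).congr_deriv ?_
    rw [one_mul, one_mul]
  have h2 := inner_gradient_eq_zero (F := F) (γ := γ) (S := Ici 0) (t := 0) (by rwa [h0])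
    (uniqueDiffWithinAt_Ici 0) hd.hasDerivWithinAt (by
      have h3 : ∀ᶠ t in 𝓝[Ici 0] (0 : ℝ), γ t ∈ X → F (γ t) = 0 :=
        (hd.continuousAt.eventually (by rwa [h0])).filter_mono nhdsWithin_le_nhds
      filter_upwards [h3, self_mem_nhdsWithin] with t ht ht0
      rcases (mem_Ici.1 ht0).eq_or_lt with h4 | h4
      · exact ht (by rw [← h4, h0]; exact hp)
      · exact ht (h1 t h4)) (by rw [h0]; exact hz.self_of_nhds hp)
  rwa [h0] at h2

/-- A regular cone contains, up to opposite directions, only one half-plane. -/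
theorem IsAxiCone.sin_sub_eq_zero {n : ℕ} (hn : 3 ≤ n) {X : Set (Ambient n)} (hX : IsAxiCone X)
    {F : Ambient n → ℝ} (hp : cyl n 1 0 0 ∈ X) (hF : DifferentiableAt ℝ F (cyl n 1 0 0))
    (hg : gradient F (cyl n 1 0 0) ≠ 0) (hz : ∀ᶠ x in 𝓝 (cyl n 1 0 0), x ∈ X → F x = 0) {φ ψ : ℝ}
    (hφ : ∀ x : ℝ, 0 < x → cyl n x (Real.sin φ) (Real.cos φ) ∈ X)
    (hψ : ∀ x : ℝ, 0 < x → cyl n x (Real.sin ψ) (Real.cos ψ) ∈ X) :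
    Real.sin (φ - ψ) = 0 := by
  have h1 := hX.inner_pole_eq_zero hp hF hz hφ
  have h2 := hX.inner_pole_eq_zero hp hF hz hψ
  obtain ⟨a, b, c, hg', h3⟩ := hX.gradient_eq hn one_ne_zero hp hF hz
  rw [hg', inner_cyl_cyl hn] at h1 h2
  rw [Real.sin_sub]
  by_contra hne
  refine hg ?_
  have hb : b * (Real.sin φ * Real.cos ψ - Real.cos φ * Real.sin ψ) = 0 := by
    linear_combination Real.cos ψ * h1 - Real.cos φ * h2
  have hc : c * (Real.sin φ * Real.cos ψ - Real.cos φ * Real.sin ψ) = 0 := by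
    linear_combination Real.sin φ * h2 - Real.sin ψ * h1
  have hb' := (mul_eq_zero.1 hb).resolve_right hne
  have hc' := (mul_eq_zero.1 hc).resolve_right hne
  have ha : a = 0 := by linear_combination h3
  rw [hg', ha, hb', hc', cyl_zero]

/-! ### Capillary cones -/

/-- The cone `|x'| = r u(φ)` in the half-space `z ≥ 0`, where `(xₙ, z) = r (sin φ, cos φ)`. -/
def halfCone (n : ℕ) (u : ℝ → ℝ) : Set (Ambient n) :=
  {p | 0 ≤ height p ∧ radius p = polarRadius p * u (polarAngle p)}

/-- The even solutions whose value at `φ = 0` is at least `√m`, and whose cone meets `{z = 0}` at the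
angle `θ`. -/
structure IsContactOrbit (m : ℕ) (θ : ℝ) (u v : ℝ → ℝ) : Prop extends IsOrbit m u v where
  snd_zero : v 0 = 0
  le_sq : (m : ℝ) ≤ u 0 ^ 2
  contact : v (Real.pi / 2) = -(Real.cos θ / Real.sin θ * √(1 + u (Real.pi / 2) ^ 2))

theorem exists_isContactOrbit {m : ℕ} (hm : 1 ≤ m) {θ : ℝ} (h0 : 0 < θ) (hθ : θ ≤ Real.pi / 2) :
    ∃ u v, IsContactOrbit m θ u v := by
  have hs : 0 < Real.sin θ := Real.sin_pos_of_pos_of_lt_pi h0 (by linarith [Real.pi_pos])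
  have hc : 0 ≤ Real.cos θ := Real.cos_nonneg_of_mem_Icc ⟨by linarith, hθ⟩
  obtain ⟨u, v, h, h1, h2, h3⟩ := exists_orbit_of_slope hm (div_nonneg hc hs.le)
  exact ⟨u, v, h, h1, h2, h3⟩

theorem IsContactOrbit.eq {m : ℕ} (hm : 1 ≤ m) {θ : ℝ} {u v p q : ℝ → ℝ}
    (h : IsContactOrbit m θ u v) (h' : IsContactOrbit m θ p q) : u = p ∧ v = q := by
  have := h.toIsOrbit.eq_of_slope_eq hm h'.toIsOrbit h.snd_zero h'.snd_zero h.le_sq h'.le_sq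
    h.contact h'.contact
  exact ⟨funext fun t => (this t).1, funext fun t => (this t).2⟩

/-- The coordinate `xₙ / |x|` along an arc. -/
def graphParam (u : ℝ → ℝ) (s : ℝ) : ℝ := Real.sin s / √(u s ^ 2 + Real.sin s ^ 2)

theorem IsOrbit.hasDerivAt_graphParam {m : ℕ} {u v : ℝ → ℝ} (h : IsOrbit m u v) (s : ℝ) :
    HasDerivAt (graphParam u)
      (u s * gradZ u v s / ((u s ^ 2 + Real.sin s ^ 2) * √(u s ^ 2 + Real.sin s ^ 2))) s := by
  have hu := h.pos s
  have hpos : 0 < u s ^ 2 + Real.sin s ^ 2 := by positivity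
  have hsq : √(u s ^ 2 + Real.sin s ^ 2) ^ 2 = u s ^ 2 + Real.sin s ^ 2 := Real.sq_sqrt hpos.le
  have hsp : 0 < √(u s ^ 2 + Real.sin s ^ 2) := Real.sqrt_pos.2 hpos
  have h1 := (((h.hasDerivAt_fst s).fun_pow 2).fun_add ((Real.hasDerivAt_sin s).fun_pow 2)).sqrt
    hpos.ne'
  refine ((Real.hasDerivAt_sin s).fun_div h1 hsp.ne').congr_deriv ?_
  rw [hsq]
  unfold gradZ
  norm_num
  field_simp
  rw [hsq]
  ring

/-- If the cone is a graph, then its slope at the right end of the arc has the expected sign. -/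
theorem IsOrbit.snd_nonpos_of_injOn {m : ℕ} {u v : ℝ → ℝ} (h : IsOrbit m u v)
    (hinj : InjOn (graphParam u) (Icc (-(Real.pi / 2)) (Real.pi / 2))) : v (Real.pi / 2) ≤ 0 := by
  have hpi : -(Real.pi / 2) ≤ Real.pi / 2 := by linarith [Real.pi_pos]
  have hc : ContinuousOn (graphParam u) (Icc (-(Real.pi / 2)) (Real.pi / 2)) := fun s _ =>
    (h.hasDerivAt_graphParam s).continuousAt.continuousWithinAt
  have hsp : ∀ s, 0 < √(u s ^ 2 + Real.sin s ^ 2) := fun s => by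
    have := h.pos s
    exact Real.sqrt_pos.2 (by positivity)
  have hmono : StrictMonoOn (graphParam u) (Icc (-(Real.pi / 2)) (Real.pi / 2)) := by
    refine hc.strictMonoOn_of_injOn_Icc hpi ?_ hinj
    refine le_trans (b := 0) ?_ ?_
    · refine div_nonpos_of_nonpos_of_nonneg ?_ (hsp _).le
      simp
    · refine div_nonneg ?_ (hsp _).le
      simp
  have h1 := deriv_nonneg_of_le_left (h.hasDerivAt_graphParam (Real.pi / 2))
    (show -(Real.pi / 2) < Real.pi / 2 by linarith [Real.pi_pos])
    fun r hr => hmono.monotoneOn ⟨hr.1.le, hr.2.le⟩ ⟨hpi, le_rfl⟩ hr.2.le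
  have hu := h.pos (Real.pi / 2)
  have hg : gradZ u v (Real.pi / 2) = -v (Real.pi / 2) := by simp [gradZ]
  rw [hg] at h1
  by_contra hlt
  push Not at hlt
  have h2 : u (Real.pi / 2) * -v (Real.pi / 2) / ((u (Real.pi / 2) ^ 2 + Real.sin (Real.pi / 2) ^ 2) *
      √(u (Real.pi / 2) ^ 2 + Real.sin (Real.pi / 2) ^ 2)) < 0 := by
    refine div_neg_of_neg_of_pos (mul_neg_of_pos_of_neg hu (neg_lt_zero.2 hlt)) ?_
    exact mul_pos (by positivity) (hsp _)
  linarith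

section Capillary

variable {n : ℕ} {θ : ℝ} {C : Set (Ambient n)}

theorem IsCapillaryMinimalCone.isAxiCone (h : IsCapillaryMinimalCone n θ C)
    (hax : IsAxisymmetric C) : IsAxiCone C where
  rot _ hp _ h1 h2 h3 := hax.mem_of_eq hp h1 h2 h3
  smul r hr p hp := h.smul_mem r hr.le p hp

theorem IsCapillaryMinimalCone.isMinimalConeIn (h : IsCapillaryMinimalCone n θ C)
    (hax : IsAxisymmetric C) :
    IsMinimalConeIn {p : Ambient n | 0 < height p} (C ∩ {p | 0 < height p}) where
  rot _ hp _ h1 h2 h3 := ⟨hax.mem_of_eq hp.1 h1 h2 h3, by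
    have := hp.2; rw [mem_ofPred_eq] at this ⊢; rwa [h3]⟩
  smul r hr p hp := ⟨h.smul_mem r hr.le p hp.1, by
    have := hp.2; rw [mem_ofPred_eq] at this ⊢; rw [height_smul]; positivity⟩
  mem_of_closure p hp hpc := ⟨h.isClosed.closure_subset_iff.2 inter_subset_left hpc, hp⟩
  exists_isDefining p hp hpΩ := by
    obtain ⟨U, F, hU, hpU, hF, heq, hreg, -⟩ := h.isMinimal p hp.1 (by
      rintro rfl
      exact lt_irrefl _ (show (0 : ℝ) < height (0 : Ambient n) from hpΩ))
    have hO : IsOpen {p : Ambient n | 0 < height p} := isOpen_lt continuous_const continuous_height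
    refine ⟨U ∩ {p | 0 < height p}, F, ⟨hpU, hpΩ⟩, hU.inter hO, hF.mono inter_subset_left, ?_,
      fun q hq => (hreg q ⟨hq.1.1, hq.2.1⟩).1, fun q hq => (hreg q ⟨hq.1.1, hq.2.1⟩).2⟩
    ext q
    constructor
    · rintro ⟨⟨hqC, -⟩, hqU, hqz⟩
      exact ⟨⟨hqU, hqz⟩, (heq.subset ⟨hqC, hqU⟩).2.2⟩
    · rintro ⟨⟨hqU, hqz⟩, hq0⟩
      exact ⟨⟨(heq.superset ⟨hqU, le_of_lt hqz, hq0⟩).1, hqz⟩, hqU, hqz⟩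

theorem IsCapillaryMinimalCone.height_eq_of_base_eq (h : IsCapillaryMinimalCone n θ C)
    {p q : Ambient n} (hp : p ∈ C) (hq : q ∈ C) (hb : base p = base q) : height p = height q := by
  obtain ⟨D, u, hC⟩ := h.isGraph
  rw [hC] at hp hq
  rw [hp.2, hq.2, hb]

theorem base_cyl {n : ℕ} (hn : 3 ≤ n) (ρ y z w : ℝ) : base (cyl n ρ y z) = base (cyl n ρ y w) := by
  ext i
  simp only [base, cyl_apply hn]
  have : i.castSucc ≠ Fin.last n := (Fin.castSucc_lt_last i).ne
  simp [this]

/-- By transversality every boundary point is a limit of interior points. -/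
theorem IsCapillaryMinimalCone.mem_closure_interior (h : IsCapillaryMinimalCone n θ C)
    (h0 : 0 < θ) (hθ : θ ≤ Real.pi / 2) {p : Ambient n} (hp : p ∈ C) (hp0 : p ≠ 0) :
    p ∈ closure (C ∩ {p | 0 < height p}) := by
  rcases (h.height_nonneg p hp).eq_or_lt with hz | hz
  swap
  · exact subset_closure ⟨hp, hz⟩
  obtain ⟨U, F, hU, hpU, hF, heq, hreg, hang⟩ := h.isMinimal p hp hp0
  have hg := (hreg p ⟨hp, hpU⟩).1
  have hF0 : F p = 0 := (heq.subset ⟨hp, hpU⟩).2.2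
  have hFd : DifferentiableAt ℝ F p := (hF.contDiffAt (hU.mem_nhds hpU)).differentiableAt (by simp)
  have hcos : Real.cos θ < 1 := by
    rw [← Real.cos_zero]
    exact Real.cos_lt_cos_of_nonneg_of_le_pi le_rfl (by linarith [Real.pi_pos]) h0
  have ha := hang p ⟨hp, hpU⟩ hz.symm
  set g := gradient F p with hgdef
  have hgn : 0 < ‖g‖ := norm_pos_iff.2 hg
  have hgz : |height g| = Real.cos θ * ‖g‖ := by
    rw [unitNormal, height_smul, abs_mul, abs_inv, abs_norm, ← hgdef] at ha
    rw [← ha]; field_simp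
  have hlt : height g ^ 2 < ‖g‖ ^ 2 := by
    rw [← sq_abs, hgz]
    have hc := Real.cos_nonneg_of_mem_Icc (x := θ) ⟨by linarith, hθ⟩
    exact pow_lt_pow_left₀ (by nlinarith) (by positivity) two_ne_zero
  set e : Ambient n := EuclideanSpace.single (Fin.last n) 1 with he
  have hge : ⟪g, e⟫ = height g := by
    rw [real_inner_comm, he, EuclideanSpace.inner_single_left]; simp [height]
  set τ : Ambient n := e - (height g / ‖g‖ ^ 2) • g with hτdef
  have hτ : ⟪g, τ⟫ = 0 := by
    rw [hτdef, inner_sub_right, inner_smul_right, hge, real_inner_self_eq_norm_sq]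
    field_simp
    ring
  have hτz : height τ = 1 - height g ^ 2 / ‖g‖ ^ 2 := by
    have : height τ = height e - height g / ‖g‖ ^ 2 * height g := rfl
    rw [this]
    have he1 : height e = 1 := by simp [height, he]
    rw [he1]; ring
  have hτpos : 0 < height τ := by
    rw [hτz, sub_pos, div_lt_one (by positivity)]; exact hlt
  set ε := height τ / (2 * (|height g| + 1)) with hε
  have hεpos : 0 < ε := by positivity
  have hεlt : ε * |height g| < height τ := by
    rw [hε, div_mul_eq_mul_div, div_lt_iff₀ (by positivity)]
    have := abs_nonneg (height g)
    exact mul_lt_mul_of_pos_left (by linarith) hτpos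
  have h1 := eventually_exists_zero hU hpU hF.continuousOn hFd hF0 hg hτ hεpos
  rw [Metric.mem_closure_iff]
  intro r hr
  have h2 : ∀ᶠ δ in 𝓝[>] (0 : ℝ), δ * (‖τ‖ + ε * ‖g‖) < r := by
    have : Tendsto (fun δ : ℝ => δ * (‖τ‖ + ε * ‖g‖)) (𝓝[>] 0)
        (𝓝 (0 * (‖τ‖ + ε * ‖g‖))) :=
      ((continuous_id.mul continuous_const).tendsto 0).mono_left nhdsWithin_le_nhds
    rw [zero_mul] at this
    exact this.eventually_lt_const hr
  obtain ⟨δ, ⟨s, hs, hsU, hs0⟩, h3, h4⟩ := (h1.and (h2.and self_mem_nhdsWithin)).exists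
  have hδ : 0 < δ := h4
  have hpos : 0 < height (p + δ • τ + s • g) := by
    rw [height_add, height_add, height_smul, height_smul, ← hz, zero_add]
    have e1 := neg_abs_le (s * height g)
    rw [abs_mul] at e1
    have e2 := mul_le_mul_of_nonneg_right hs (abs_nonneg (height g))
    have e3 := mul_lt_mul_of_pos_left hεlt hδ
    linarith
  refine ⟨_, ⟨(heq.superset ⟨hsU, hpos.le, hs0⟩).1, hpos⟩, ?_⟩
  rw [dist_comm, dist_eq_norm, show p + δ • τ + s • g - p = δ • τ + s • g by abel]
  refine lt_of_le_of_lt (norm_add_le _ _) (lt_of_le_of_lt ?_ h3)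
  rw [norm_smul, norm_smul, Real.norm_of_nonneg hδ.le, Real.norm_eq_abs, mul_add]
  have := mul_le_mul_of_nonneg_right hs (norm_nonneg g)
  linarith

theorem IsCapillaryMinimalCone.mem_closure_interior_radius (hn : 3 ≤ n)
    (h : IsCapillaryMinimalCone n θ C) (hax : IsAxisymmetric C)
    (h0 : 0 < θ) (hθ : θ ≤ Real.pi / 2) {p : Ambient n} (hp : p ∈ C) (hp0 : p ≠ 0) :
    p ∈ closure ((C ∩ {p | 0 < height p}) ∩ {p | 0 < radius p}) :=
  closure_minimal (fun _ hq => (h.isMinimalConeIn hax).mem_closure_radius_pos hn hq hq.2)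
    isClosed_closure (h.mem_closure_interior h0 hθ hp hp0)

/-- A non-flat axisymmetric capillary cone contains an arc. -/
theorem IsCapillaryMinimalCone.exists_arc (hn : 3 ≤ n) (h : IsCapillaryMinimalCone n θ C)
    (hax : IsAxisymmetric C) (hflat : ¬ IsFlat C) (h0 : 0 < θ) (hθ : θ ≤ Real.pi / 2) :
    ∃ u v, IsOrbit (n - 2) u v ∧ ∀ s ∈ Ioo (-(Real.pi / 2)) (Real.pi / 2),
      cyl n (u s) (Real.sin s) (Real.cos s) ∈ C ∩ {p | 0 < height p} := by
  by_contra hno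
  push Not at hno
  have hM := h.isMinimalConeIn hax
  set C' := C ∩ {p : Ambient n | 0 < height p} with hC'
  have hcos : ∀ s ∈ Ioo (-(Real.pi / 2)) (Real.pi / 2), 0 < Real.cos s := fun s hs =>
    Real.cos_pos_of_mem_Ioo hs
  have hray : ∀ p ∈ C', 0 < radius p → ∀ x : ℝ, 0 < x →
      cyl n x (Real.sin (polarAngle p)) (Real.cos (polarAngle p)) ∈ C' := by
    intro p hp hr
    have hR := polarRadius_pos_of_height_pos hp.2
    have hA := polarAngle_mem_Ioo hp.2
    rcases hM.arc_or_ray hn (O := Ioo (-(Real.pi / 2)) (Real.pi / 2)) (M := 0) isPreconnected_Ioo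
      (fun s hs x _ => by rw [mem_ofPred_eq, height_cyl hn]; exact hcos s hs)
      (fun x s _ hxs => by
        have hc : 0 < Real.cos s := by
          have := hxs.2; rwa [mem_ofPred_eq, height_cyl hn] at this
        have h1 : Real.sin s ^ 2 < 1 := by nlinarith [Real.sin_sq_add_cos_sq s]
        have h2 := abs_lt.1 ((sq_lt_one_iff_abs_lt_one _).1 h1)
        refine ⟨Real.arcsin (Real.sin s), ⟨Real.neg_pi_div_two_lt_arcsin.2 h2.1,
          Real.arcsin_lt_pi_div_two.2 h2.2⟩, Real.sin_arcsin h2.1.le h2.2.le, ?_⟩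
        rw [Real.cos_arcsin, ← Real.cos_sq', Real.sqrt_sq hc.le])
      (fun u v ho harc => absurd harc (by
        obtain ⟨s, hs, hs'⟩ := hno u v ho
        exact fun H => hs' (H s hs))) hA
      (div_pos hr hR) ((hM.mem_iff_polar hn hR).1 hp) with ⟨u, v, ho, -, harc⟩ | h1
    · obtain ⟨s, hs, hs'⟩ := hno u v ho
      exact absurd (harc s hs) hs'
    · exact h1
  obtain ⟨q, hq, hq0⟩ := h.exists_ne_zero
  obtain ⟨p, hp, hpr⟩ := closure_nonempty_iff.1
    ⟨q, h.mem_closure_interior_radius hn hax h0 hθ hq hq0⟩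
  have hA := h.isAxiCone hax
  have hrayC : ∀ p ∈ C', 0 < radius p → ∀ x : ℝ, 0 < x →
      cyl n x (Real.sin (polarAngle p)) (Real.cos (polarAngle p)) ∈ C :=
    fun p hp hr x hx => (hray p hp hr x hx).1
  have hpole : cyl n 1 0 0 ∈ C :=
    h.isClosed.closure_subset (pole_mem_closure hA (hrayC p hp hpr)).1
  obtain ⟨U, F, hU, hpU, hF, heq, hreg, -⟩ := h.isMinimal _ hpole (by
    intro h1
    have := (cyl_inj hn (ρ := 1) (y := 0) (z := 0) (a := 0) (b := 0) (c := 0)).1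
      (by rw [h1, cyl_zero])
    exact one_ne_zero this.1)
  have hz : ∀ᶠ x in 𝓝 (cyl n 1 0 0), x ∈ C → F x = 0 :=
    Filter.eventually_of_mem (hU.mem_nhds hpU) fun x hxU hxC => (heq.subset ⟨hxC, hxU⟩).2.2
  have hFd : DifferentiableAt ℝ F (cyl n 1 0 0) :=
    (hF.contDiffAt (hU.mem_nhds hpU)).differentiableAt (by simp)
  set φ := polarAngle p with hφ
  refine hflat ⟨cyl n 0 (Real.cos φ) (-Real.sin φ), ?_, ?_⟩
  · intro h1
    have h2 := (cyl_inj hn (a := 0) (b := 0) (c := 0)).1 (by rw [h1, cyl_zero])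
    have := Real.sin_sq_add_cos_sq φ
    rw [h2.2.1, neg_eq_zero.1 h2.2.2] at this
    norm_num at this
  · intro x hx
    by_cases hx0 : x = 0
    · rw [hx0, inner_zero_right]
    refine eq_of_mem_closure (g := fun _ => (0 : ℝ))
      (h.mem_closure_interior_radius hn hax h0 hθ hx hx0)
      (continuous_const.inner continuous_id).continuousAt continuousAt_const ?_
    rintro y ⟨hy, hyr⟩
    have h3 := hA.sin_sub_eq_zero hn hpole hFd (hreg _ ⟨hpole, hpU⟩).1 hz (hrayC y hy hyr)
      (hrayC p hp hpr)
    rw [inner_cyl, axial_eq y, height_eq y]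
    rw [Real.sin_sub] at h3
    linear_combination polarRadius y * h3

/-- An axisymmetric capillary cone which contains an arc is the cone over this arc. -/
theorem IsCapillaryMinimalCone.eq_halfCone (hn : 3 ≤ n) (h : IsCapillaryMinimalCone n θ C)
    (hax : IsAxisymmetric C) (h0 : 0 < θ) (hθ : θ ≤ Real.pi / 2) {u v : ℝ → ℝ}
    (ho : IsOrbit (n - 2) u v) (harc : ∀ s ∈ Ioo (-(Real.pi / 2)) (Real.pi / 2),
      cyl n (u s) (Real.sin s) (Real.cos s) ∈ C ∩ {p | 0 < height p}) :
    C = halfCone n u := by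
  have hM := h.isMinimalConeIn hax
  have hA := h.isAxiCone hax
  set C' := C ∩ {p : Ambient n | 0 < height p} with hC'
  have hcos : ∀ s ∈ Ioo (-(Real.pi / 2)) (Real.pi / 2), 0 < Real.cos s := fun s hs =>
    Real.cos_pos_of_mem_Ioo hs
  have hΩ : ∀ s ∈ Ioo (-(Real.pi / 2)) (Real.pi / 2), ∀ x : ℝ, 0 < x →
      cyl n x (Real.sin s) (Real.cos s) ∈ {p : Ambient n | 0 < height p} := fun s hs x _ => by
    rw [mem_ofPred_eq, height_cyl hn]; exact hcos s hs
  have hzero : (0 : ℝ) ∈ Ioo (-(Real.pi / 2)) (Real.pi / 2) := by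
    constructor <;> linarith [Real.pi_pos]
  -- by the graph property there is only one arc
  have huniq : ∀ p q, IsOrbit (n - 2) p q → (∀ s ∈ Ioo (-(Real.pi / 2)) (Real.pi / 2),
      cyl n (p s) (Real.sin s) (Real.cos s) ∈ C') → ∀ t, u t = p t ∧ v t = q t := by
    intro p q ho' harc'
    refine hM.eq_of_arc_meet hn isOpen_Ioo hΩ ho ho' harc harc' hzero ?_
    have h1 := hA.smul (u 0)⁻¹ (inv_pos.2 (ho.pos 0)) _ (harc 0 hzero).1
    have h2 := hA.smul (p 0)⁻¹ (inv_pos.2 (ho'.pos 0)) _ (harc' 0 hzero).1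
    rw [smul_cyl, inv_mul_cancel₀ (ho.pos 0).ne', Real.sin_zero, mul_zero, Real.cos_zero,
      mul_one] at h1
    rw [smul_cyl, inv_mul_cancel₀ (ho'.pos 0).ne', Real.sin_zero, mul_zero, Real.cos_zero,
      mul_one] at h2
    have h3 := h.height_eq_of_base_eq h1 h2 (base_cyl hn _ _ _ _)
    rw [height_cyl hn, height_cyl hn] at h3
    exact inv_injective h3
  obtain ⟨κ, hκ, hb⟩ := ho.exists_bounds (by omega)
  have hoff : ∀ p ∈ C', 0 < radius p → radius p = polarRadius p * u (polarAngle p) := by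
    intro p hp hr
    have hR := polarRadius_pos_of_height_pos hp.2
    have hA := polarAngle_mem_Ioo hp.2
    rcases hM.arc_or_ray hn (O := Ioo (-(Real.pi / 2)) (Real.pi / 2)) (M := κ) isPreconnected_Ioo
      hΩ (fun x s _ hxs => by
        have hc : 0 < Real.cos s := by
          have := hxs.2; rwa [mem_ofPred_eq, height_cyl hn] at this
        have h1 : Real.sin s ^ 2 < 1 := by nlinarith [Real.sin_sq_add_cos_sq s]
        have h2 := abs_lt.1 ((sq_lt_one_iff_abs_lt_one _).1 h1)
        refine ⟨Real.arcsin (Real.sin s), ⟨Real.neg_pi_div_two_lt_arcsin.2 h2.1,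
          Real.arcsin_lt_pi_div_two.2 h2.2⟩, Real.sin_arcsin h2.1.le h2.2.le, ?_⟩
        rw [Real.cos_arcsin, ← Real.cos_sq', Real.sqrt_sq hc.le])
      (fun p q ho' harc' s => by rw [← (huniq p q ho' harc' s).2]; exact (hb s).2.2) hA
      (div_pos hr hR) ((hM.mem_iff_polar hn hR).1 hp) with ⟨p', q', ho', hx, harc'⟩ | h1
    · rw [(huniq p' q' ho' harc' _).1, hx, mul_div_cancel₀ _ hR.ne']
    · exact (hM.false_of_arc_of_ray hn isOpen_Ioo hΩ ho harc hA h1).elim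
  have hlow : ∀ p ∈ C, p ≠ 0 → κ⁻¹ * polarRadius p ≤ radius p ∧ radius p ≤ κ * polarRadius p := by
    intro p hp hp0
    have hcl := h.mem_closure_interior_radius hn hax h0 hθ hp hp0
    constructor
    · refine le_of_mem_closure hcl (continuous_const.mul continuous_polarRadius).continuousAt
        continuous_radius.continuousAt fun x hx => ?_
      rw [hoff x hx.1 hx.2]
      show κ⁻¹ * polarRadius x ≤ _
      rw [mul_comm]
      exact mul_le_mul_of_nonneg_left (hb _).1 (polarRadius_nonneg x)
    · refine le_of_mem_closure hcl continuous_radius.continuousAt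
        (continuous_const.mul continuous_polarRadius).continuousAt fun x hx => ?_
      rw [hoff x hx.1 hx.2]
      show _ ≤ κ * polarRadius x
      rw [mul_comm κ]
      exact mul_le_mul_of_nonneg_left (hb _).2.1 (polarRadius_nonneg x)
  have hqc : Continuous fun s => cyl n (u s) (Real.sin s) (Real.cos s) :=
    (continuous_cyl n).comp (ho.continuous_fst.prodMk
      (Real.continuous_sin.prodMk Real.continuous_cos))
  have hclosed : ∀ s ∈ Icc (-(Real.pi / 2)) (Real.pi / 2),
      cyl n (u s) (Real.sin s) (Real.cos s) ∈ C := by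
    intro s hs
    rw [← closure_Ioo (by linarith [Real.pi_pos])] at hs
    have := hqc.continuousWithinAt.mem_closure_image hs
    refine h.isClosed.closure_subset (closure_mono ?_ this)
    rintro _ ⟨r, hr, rfl⟩
    exact (harc r hr).1
  have h0C : (0 : Ambient n) ∈ C := by
    obtain ⟨p, hp, -⟩ := h.exists_ne_zero
    simpa using h.smul_mem 0 le_rfl p hp
  ext p
  constructor
  · intro hp
    refine ⟨h.height_nonneg p hp, ?_⟩
    by_cases hp0 : p = 0
    · rw [hp0, polarRadius_eq_zero.2 ⟨rfl, rfl⟩, zero_mul]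
      have := radius_smul hn (le_refl (0 : ℝ)) (0 : Ambient n)
      simpa using this
    obtain ⟨h1, h2⟩ := hlow p hp hp0
    have hR : 0 < polarRadius p := by
      refine (polarRadius_nonneg p).lt_of_ne fun h3 => hp0 ?_
      rw [← h3, mul_zero] at h2
      obtain ⟨h4, h5⟩ := polarRadius_eq_zero.1 h3.symm
      exact eq_zero_of_coordinates hn (le_antisymm h2 (radius_nonneg p)) h4 h5
    have hang : ContinuousAt polarAngle p := by
      refine continuousAt_polarAngle ?_
      rcases (h.height_nonneg p hp).eq_or_lt with h3 | h3
      · exact Or.inr fun h4 => hR.ne' (polarRadius_eq_zero.2 ⟨h4, h3.symm⟩)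
      · exact Or.inl h3
    refine eq_of_mem_closure (h.mem_closure_interior_radius hn hax h0 hθ hp hp0)
      continuous_radius.continuousAt
      (continuous_polarRadius.continuousAt.mul (ho.continuous_fst.continuousAt.comp hang))
      fun x hx => hoff x hx.1 hx.2
  · rintro ⟨hz, hr⟩
    rcases (polarRadius_nonneg p).eq_or_lt with h3 | h3
    · rw [← h3, zero_mul] at hr
      obtain ⟨h4, h5⟩ := polarRadius_eq_zero.1 h3.symm
      rw [eq_zero_of_coordinates hn hr h4 h5]
      exact h0C
    · rw [hA.mem_iff_polar hn h3, hr, mul_div_cancel_left₀ _ h3.ne']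
      exact hclosed _ (abs_le.1 (Complex.abs_arg_le_pi_div_two_iff.2 hz))

theorem cyl_mem_halfCone (hn : 3 ≤ n) {u : ℝ → ℝ} (hu : ∀ s, 0 < u s) {s : ℝ}
    (hs : s ∈ Icc (-(Real.pi / 2)) (Real.pi / 2)) :
    cyl n (u s) (Real.sin s) (Real.cos s) ∈ halfCone n u := by
  refine ⟨?_, ?_⟩
  · rw [height_cyl hn]; exact Real.cos_nonneg_of_mem_Icc hs
  · rw [radius_cyl hn, polarRadius_cyl hn, polarAngle_cyl hn _
      ⟨by linarith [hs.1, Real.pi_pos], by linarith [hs.2, Real.pi_pos]⟩, abs_of_pos (hu s), one_mul]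

/-- The contact angle determines the slope of the arc up to the sign. -/
theorem IsCapillaryMinimalCone.abs_snd_eq (hn : 3 ≤ n) {u v : ℝ → ℝ}
    (h : IsCapillaryMinimalCone n θ (halfCone n u))
    (hA : IsAxiCone (halfCone n u)) (h0 : 0 < θ) (hθ : θ ≤ Real.pi / 2)
    (ho : IsOrbit (n - 2) u v) {s : ℝ} (hs : s ∈ Icc (-(Real.pi / 2)) (Real.pi / 2))
    (hc : Real.cos s = 0) : |v s| = Real.cos θ / Real.sin θ * √(1 + u s ^ 2) := by
  have hsin : Real.sin s ^ 2 = 1 := by have := Real.sin_sq_add_cos_sq s; rw [hc] at this; linarith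
  set q := cyl n (u s) (Real.sin s) (Real.cos s) with hq
  have hqC : q ∈ halfCone n u := cyl_mem_halfCone hn ho.pos hs
  have hq0 : q ≠ 0 := by
    intro h1
    rw [hq, ← cyl_zero, cyl_inj hn] at h1
    exact (ho.pos s).ne' h1.1
  obtain ⟨U, F, hU, hpU, hF, heq, hreg, hang⟩ := h.isMinimal q hqC hq0
  have hz : ∀ᶠ x in 𝓝 q, x ∈ halfCone n u → F x = 0 :=
    Filter.eventually_of_mem (hU.mem_nhds hpU) fun x hxU hxC => (heq.subset ⟨hxC, hxU⟩).2.2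
  have hFd : DifferentiableAt ℝ F q := (hF.contDiffAt (hU.mem_nhds hpU)).differentiableAt (by simp)
  obtain ⟨b, hb⟩ := hA.gradient_arc hn (ho.pos s)
    (uniqueDiffOn_Icc (by linarith [Real.pi_pos]) s hs)
    (ho.hasDerivAt_fst s).hasDerivWithinAt hqC
    (by filter_upwards [self_mem_nhdsWithin] with r hr using cyl_mem_halfCone hn ho.pos hr) hFd hz
  have hg := (hreg q ⟨hqC, hpU⟩).1
  have hb0 : b ≠ 0 := by
    rintro rfl
    exact hg (by rw [hb, zero_smul])
  have ha := hang q ⟨hqC, hpU⟩ (by rw [hq, height_cyl hn, hc])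
  set N := cyl n 1 (-(u s * Real.sin s + v s * Real.cos s))
    (-(u s * Real.cos s - v s * Real.sin s)) with hN
  have hNn : ‖N‖ ^ 2 = 1 + u s ^ 2 + v s ^ 2 := by
    rw [hN, norm_cyl_sq hn, hc]; linear_combination (u s ^ 2 + v s ^ 2) * hsin
  have hNz : height N ^ 2 = v s ^ 2 := by
    rw [hN, height_cyl hn, hc]; linear_combination v s ^ 2 * hsin
  have hNpos : 0 < ‖N‖ := by
    refine (norm_nonneg N).lt_of_ne fun h1 => ?_
    rw [← h1] at hNn
    nlinarith [sq_nonneg (u s), sq_nonneg (v s)]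
  have h1 : |height N| = Real.cos θ * ‖N‖ := by
    rw [unitNormal, hb, norm_smul, height_smul, height_smul, Real.norm_eq_abs] at ha
    simp only [abs_mul, abs_inv, abs_norm, abs_abs] at ha
    rw [← ha]
    have : |b| ≠ 0 := abs_ne_zero.2 hb0
    field_simp
  have h2 : v s ^ 2 = Real.cos θ ^ 2 * (1 + u s ^ 2 + v s ^ 2) := by
    have h3 : height N ^ 2 = Real.cos θ ^ 2 * ‖N‖ ^ 2 := by rw [← sq_abs, h1, mul_pow]
    rwa [hNz, hNn] at h3
  have hsθ : 0 < Real.sin θ := Real.sin_pos_of_pos_of_lt_pi h0 (by linarith [Real.pi_pos])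
  have hcθ : 0 ≤ Real.cos θ := Real.cos_nonneg_of_mem_Icc ⟨by linarith, hθ⟩
  rw [← abs_of_nonneg (mul_nonneg (div_nonneg hcθ hsθ.le) (Real.sqrt_nonneg (1 + u s ^ 2))),
    ← sq_eq_sq_iff_abs_eq_abs, mul_pow, Real.sq_sqrt (by positivity), div_pow,
    div_mul_eq_mul_div, eq_div_iff (by positivity)]
  linear_combination h2 + v s ^ 2 * Real.sin_sq_add_cos_sq θ

theorem IsCapillaryMinimalCone.injOn_graphParam (hn : 3 ≤ n) {u v : ℝ → ℝ}
    (h : IsCapillaryMinimalCone n θ (halfCone n u)) (ho : IsOrbit (n - 2) u v) :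
    InjOn (graphParam u) (Icc (-(Real.pi / 2)) (Real.pi / 2)) := by
  intro s hs t ht hst
  have hl : ∀ r, 0 < √(u r ^ 2 + Real.sin r ^ 2) := fun r => by
    have := ho.pos r
    exact Real.sqrt_pos.2 (by positivity)
  -- the points are normalised such that their projections to `{z = 0}` have norm one
  have hmem : ∀ r ∈ Icc (-(Real.pi / 2)) (Real.pi / 2),
      cyl n (u r / √(u r ^ 2 + Real.sin r ^ 2)) (graphParam u r)
        (Real.cos r / √(u r ^ 2 + Real.sin r ^ 2)) ∈ halfCone n u := by
    intro r hr
    have := h.smul_mem _ (inv_pos.2 (hl r)).le _ (cyl_mem_halfCone hn ho.pos hr)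
    rwa [smul_cyl, ← div_eq_inv_mul, ← div_eq_inv_mul, ← div_eq_inv_mul] at this
  have hone : ∀ r, (u r / √(u r ^ 2 + Real.sin r ^ 2)) ^ 2 + graphParam u r ^ 2 = 1 := by
    intro r
    rw [graphParam, div_pow, div_pow, Real.sq_sqrt (by positivity), ← add_div, div_self]
    have := ho.pos r
    positivity
  have hx : u s / √(u s ^ 2 + Real.sin s ^ 2) = u t / √(u t ^ 2 + Real.sin t ^ 2) := by
    have h1 := hone s
    rw [hst] at h1
    refine (pow_left_inj₀ (div_nonneg (ho.pos s).le (hl s).le)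
      (div_nonneg (ho.pos t).le (hl t).le) two_ne_zero).1 ?_
    linarith [hone t]
  have h2 := hmem s hs
  rw [hst, hx] at h2
  have h3 := h.height_eq_of_base_eq h2 (hmem t ht) (base_cyl hn _ _ _ _)
  rw [height_cyl hn, height_cyl hn] at h3
  unfold graphParam at hst
  -- both points have the same direction, hence the same angle
  have h4 : Real.sin s * √(u t ^ 2 + Real.sin t ^ 2) =
      Real.sin t * √(u s ^ 2 + Real.sin s ^ 2) := by
    rwa [div_eq_div_iff (hl s).ne' (hl t).ne'] at hst
  have h5 : Real.cos s * √(u t ^ 2 + Real.sin t ^ 2) =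
      Real.cos t * √(u s ^ 2 + Real.sin s ^ 2) := by
    rwa [div_eq_div_iff (hl s).ne' (hl t).ne'] at h3
  have h6 : Real.sin s = Real.sin t := by
    have h7 : √(u t ^ 2 + Real.sin t ^ 2) = √(u s ^ 2 + Real.sin s ^ 2) := by
      refine (pow_left_inj₀ (hl t).le (hl s).le two_ne_zero).1 ?_
      have e1 := Real.sin_sq_add_cos_sq s
      have e2 := Real.sin_sq_add_cos_sq t
      have e3 := congrArg (· ^ 2) h4
      have e4 := congrArg (· ^ 2) h5
      simp only [mul_pow] at e3 e4
      linear_combination e3 + e4 - √(u t ^ 2 + Real.sin t ^ 2) ^ 2 * e1 +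
        √(u s ^ 2 + Real.sin s ^ 2) ^ 2 * e2
    rw [h7] at h4
    exact mul_right_cancel₀ (hl s).ne' h4
  exact Real.injOn_sin hs ht h6

/-- The classification of the axisymmetric capillary cones. -/
theorem IsCapillaryMinimalCone.exists_contactOrbit (hn : 3 ≤ n) (h : IsCapillaryMinimalCone n θ C)
    (hax : IsAxisymmetric C) (hflat : ¬ IsFlat C) (h0 : 0 < θ) (hθ : θ ≤ Real.pi / 2) :
    ∃ u v, IsContactOrbit (n - 2) θ u v ∧ C = halfCone n u := by
  obtain ⟨u, v, ho, harc⟩ := h.exists_arc hn hax hflat h0 hθ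
  have hA := h.isAxiCone hax
  have hC := h.eq_halfCone hn hax h0 hθ ho harc
  rw [hC] at h hA
  have hpi : -(Real.pi / 2) ≤ Real.pi / 2 := by linarith [Real.pi_pos]
  have hinj := h.injOn_graphParam hn ho
  have hs1 := ho.snd_nonpos_of_injOn hinj
  have hs2 := (ho.reflect 0).snd_nonpos_of_injOn (by
    intro s hs t ht hst
    have h1 : ∀ r, graphParam (fun s => u (0 - s)) r = -graphParam u (-r) := by
      intro r
      simp only [graphParam, zero_sub, Real.sin_neg, neg_sq]
      ring
    simp only [h1, neg_inj] at hst
    exact neg_injective (hinj ⟨by linarith [hs.2], by linarith [hs.1]⟩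
      ⟨by linarith [ht.2], by linarith [ht.1]⟩ hst))
  simp only [zero_sub] at hs2
  have hk : 0 ≤ Real.cos θ / Real.sin θ :=
    div_nonneg (Real.cos_nonneg_of_mem_Icc ⟨by linarith, hθ⟩)
      (Real.sin_nonneg_of_nonneg_of_le_pi h0.le (by linarith [Real.pi_pos]))
  have e1 := h.abs_snd_eq hn hA h0 hθ ho (s := Real.pi / 2) ⟨hpi, le_rfl⟩ (by simp)
  have e2 := h.abs_snd_eq hn hA h0 hθ ho (s := -(Real.pi / 2)) ⟨le_rfl, hpi⟩ (by simp)
  rw [abs_of_nonpos hs1] at e1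
  rw [abs_of_nonneg (by linarith)] at e2
  have e3 : v (Real.pi / 2) = -(Real.cos θ / Real.sin θ * √(1 + u (Real.pi / 2) ^ 2)) := by linarith
  obtain ⟨h5, h6⟩ := ho.even_of_contact (by omega) hk e3 e2
  exact ⟨u, v, ⟨ho, h5, h6, e3⟩, hC⟩

end Capillary

/-! ### Symmetries of level sets, and cones over hypersurfaces of the sphere -/

section Symmetry

variable {n : ℕ}

theorem gradient_comp_isometry (A : Ambient n ≃ₗᵢ[ℝ] Ambient n) (F : Ambient n → ℝ)
    (q : Ambient n) : gradient (fun p => F (A p)) q = A.symm (gradient F (A q)) := by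
  refine ext_inner_right ℝ fun h => ?_
  rw [inner_gradient, ← A.inner_map_map, A.apply_symm_apply, inner_gradient]
  have := A.toContinuousLinearEquiv.comp_right_fderiv (f := F) (x := q)
  exact congrArg (fun L => L h) this

theorem unitNormal_comp_isometry (A : Ambient n ≃ₗᵢ[ℝ] Ambient n) (F : Ambient n → ℝ)
    (q : Ambient n) : unitNormal (fun p => F (A p)) q = A.symm (unitNormal F (A q)) := by
  rw [unitNormal, unitNormal, gradient_comp_isometry, A.symm.norm_map, map_smul]

theorem meanCurvature_comp_isometry (A : Ambient n ≃ₗᵢ[ℝ] Ambient n) (F : Ambient n → ℝ)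
    (q : Ambient n) : meanCurvature (fun p => F (A p)) q = meanCurvature F (A q) := by
  have h1 : unitNormal (fun p => F (A p)) =
      fun p => A.symm (unitNormal F (A p)) := funext (unitNormal_comp_isometry A F)
  have h2 : fderiv ℝ (unitNormal (fun p => F (A p))) q =
      (A.symm.toContinuousLinearEquiv : Ambient n →L[ℝ] Ambient n) ∘SL
        fderiv ℝ (unitNormal F) (A q) ∘SL (A.toContinuousLinearEquiv : Ambient n →L[ℝ] Ambient n) := by
    rw [h1]
    have e1 := A.toContinuousLinearEquiv.comp_right_fderiv (f := unitNormal F) (x := q)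
    have e2 := A.symm.toContinuousLinearEquiv.comp_fderiv (f := fun p => unitNormal F (A p)) (x := q)
    exact e2.trans (congrArg
      (fun L => (A.symm.toContinuousLinearEquiv : Ambient n →L[ℝ] Ambient n) ∘SL L) e1)
  rw [meanCurvature, h2]
  exact LinearMap.trace_conj' _ A.symm.toLinearEquiv

theorem gradient_comp_smul (F : Ambient n → ℝ) (r : ℝ) (q : Ambient n) :
    gradient (fun p => F (r • p)) q = r • gradient F (r • q) := by
  refine ext_inner_right ℝ fun h => ?_
  rw [inner_gradient, inner_smul_left, inner_gradient, fderiv_comp_smul]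
  rfl

theorem unitNormal_comp_smul (F : Ambient n → ℝ) {r : ℝ} (hr : 0 < r) (q : Ambient n) :
    unitNormal (fun p => F (r • p)) q = unitNormal F (r • q) := by
  rw [unitNormal, unitNormal, gradient_comp_smul, norm_smul, smul_smul, Real.norm_of_nonneg hr.le,
    mul_inv, mul_right_comm, inv_mul_cancel₀ hr.ne', one_mul]

theorem meanCurvature_comp_smul (F : Ambient n → ℝ) {r : ℝ} (hr : 0 < r) (q : Ambient n) :
    meanCurvature (fun p => F (r • p)) q = r * meanCurvature F (r • q) := by
  have h1 : unitNormal (fun p => F (r • p)) = fun p => unitNormal F (r • p) :=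
    funext (unitNormal_comp_smul F hr)
  rw [meanCurvature, h1, fderiv_comp_smul, meanCurvature, ← smul_eq_mul, ← map_smul]
  rfl

/-- A function of `(|x'|, xₙ, z)` which is positively homogeneous of degree zero. -/
structure IsInvariant (F : Ambient n → ℝ) : Prop where
  rot : ∀ p q : Ambient n, ‖q‖ = ‖p‖ → axial q = axial p → height q = height p → F q = F p
  smul : ∀ r : ℝ, 0 < r → ∀ p, F (r • p) = F p

/-- A dilation and an element of `O(n-1)` carry a point to its representative
`(x', xₙ, z) = ((u, 0, …, 0), sin φ, cos φ)`; neither affects the regularity and the minimality of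
the level sets, nor the angle with `{z = 0}`. -/
theorem IsInvariant.exists_transport (hn : 3 ≤ n) {F : Ambient n → ℝ} (hF : IsInvariant F)
    {p : Ambient n} (hp : 0 < polarRadius p) {q : Ambient n}
    (hq : q = cyl n (radius p / polarRadius p) (Real.sin (polarAngle p)) (Real.cos (polarAngle p))) :
    (F p = F q) ∧ (gradient F p = 0 ↔ gradient F q = 0) ∧
      height (unitNormal F p) = height (unitNormal F q) ∧
      (meanCurvature F p = 0 ↔ meanCurvature F q = 0) := by
  have hqp : polarRadius p • q = cyl n (radius p) (axial p) (height p) := by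
    rw [hq, smul_cyl, ← axial_eq, ← height_eq, mul_div_cancel₀ _ hp.ne']
  obtain ⟨A, hA1, hA2, hA⟩ := exists_isometry (p := p) (q := cyl n (radius p) (axial p) (height p))
    (norm_cyl_radius hn p) (axial_cyl hn _ _ _) (height_cyl hn _ _ _)
  have hFA : (fun x => F (A x)) = F := funext fun x => hF.rot _ _ (A.norm_map x) (hA1 x) (hA2 x)
  have hFr : (fun x => F (polarRadius p • x)) = F := funext fun x => hF.smul _ hp x
  have g1 := gradient_comp_isometry A F p
  have g2 := gradient_comp_smul F (polarRadius p) q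
  have n1 := unitNormal_comp_isometry A F p
  have n2 := unitNormal_comp_smul F hp q
  have m1 := meanCurvature_comp_isometry A F p
  have m2 := meanCurvature_comp_smul F hp q
  rw [hFA, hA, ← hqp] at g1 n1 m1
  rw [hFr] at g2 n2 m2
  refine ⟨?_, ?_, ?_, ?_⟩
  · rw [← hF.smul _ hp q, hqp, ← hA]
    exact (congrFun hFA p).symm
  · rw [g1, g2, smul_eq_zero, or_iff_right hp.ne']
    simp
  · rw [n1, n2, ← hA2, A.apply_symm_apply]
  · rw [m1, m2, mul_eq_zero, or_iff_right hp.ne']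

end Symmetry

section Sphere

variable {n : ℕ}

theorem hasFDerivAt_normalize {x : Ambient n} (hx : x ≠ 0) :
    ∃ L : Ambient n →L[ℝ] Ambient n, HasFDerivAt (fun x : Ambient n => ‖x‖⁻¹ • x) L x ∧
      ∀ h, L h = ‖x‖⁻¹ • (h - ⟪‖x‖⁻¹ • x, h⟫ • ‖x‖⁻¹ • x) := by
  have hx' : ‖x‖ ≠ 0 := norm_ne_zero_iff.2 hx
  have h1 : HasFDerivAt (fun x : Ambient n => ‖x‖) (‖x‖⁻¹ • innerSL ℝ x) x := by
    have h2 := (hasStrictFDerivAt_norm_sq x).hasFDerivAt.sqrt (by positivity)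
    simp only [Real.sqrt_sq (norm_nonneg _)] at h2
    refine h2.congr_fderiv ?_
    ext h
    simp
    ring
  have h3 := ((hasDerivAt_inv hx').comp_hasFDerivAt x h1).smul (hasFDerivAt_id x)
  refine ⟨_, h3, fun h => ?_⟩
  have e : ⟪‖x‖⁻¹ • x, h⟫ = ‖x‖⁻¹ * ⟪x, h⟫ := by rw [inner_smul_left]; rfl
  rw [e]
  change ‖x‖⁻¹ • h + ((-(‖x‖ ^ 2)⁻¹) * (‖x‖⁻¹ * ⟪x, h⟫)) • x = _
  rw [smul_sub, sub_eq_add_neg, smul_smul, smul_smul, ← neg_smul]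
  congr 2
  ring

theorem gradient_comp_normalize {F : Ambient n → ℝ} {x : Ambient n} (hx : x ≠ 0)
    (hF : DifferentiableAt ℝ F (‖x‖⁻¹ • x)) :
    gradient (fun x : Ambient n => F (‖x‖⁻¹ • x)) x = ‖x‖⁻¹ • sphereGradient F (‖x‖⁻¹ • x) := by
  obtain ⟨L, hL, hLh⟩ := hasFDerivAt_normalize hx
  refine ext_inner_right ℝ fun h => ?_
  have hc : HasFDerivAt (fun x : Ambient n => F (‖x‖⁻¹ • x)) (fderiv ℝ F (‖x‖⁻¹ • x) ∘SL L) x :=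
    HasFDerivAt.comp (f := fun x : Ambient n => ‖x‖⁻¹ • x) x hF.hasFDerivAt hL
  rw [inner_gradient, hc.fderiv, ContinuousLinearMap.comp_apply,
    ← inner_gradient, hLh, sphereGradient]
  simp only [inner_smul_left, inner_smul_right, inner_sub_left, inner_sub_right, RCLike.conj_to_real]
  ring

theorem unitNormal_comp_normalize {F : Ambient n → ℝ} {x : Ambient n} (hx : x ≠ 0)
    (hF : DifferentiableAt ℝ F (‖x‖⁻¹ • x)) :
    unitNormal (fun x : Ambient n => F (‖x‖⁻¹ • x)) x = sphereNormal F (‖x‖⁻¹ • x) := by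
  have hx' : ‖x‖ ≠ 0 := norm_ne_zero_iff.2 hx
  rw [unitNormal, sphereNormal, gradient_comp_normalize hx hF, norm_smul, smul_smul, norm_inv,
    norm_norm, mul_inv, inv_inv, mul_right_comm, mul_inv_cancel₀ hx', one_mul]

theorem differentiableAt_sphereNormal {F : Ambient n → ℝ} {q : Ambient n}
    (hF : ContDiffAt ℝ 2 F q) (hg : sphereGradient F q ≠ 0) :
    DifferentiableAt ℝ (sphereNormal F) q := by
  have h := differentiableAt_gradient hF
  have h1 : DifferentiableAt ℝ (sphereGradient F) q :=
    h.sub ((h.inner ℝ differentiableAt_id).smul differentiableAt_id)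
  exact ((h1.norm ℝ hg).inv (norm_ne_zero_iff.2 hg)).smul h1

/-- The mean curvature of the cone over a hypersurface of the sphere. -/
theorem meanCurvature_comp_normalize {F : Ambient n → ℝ} {x : Ambient n} (hx : x ≠ 0)
    (hF : ContDiffAt ℝ 2 F (‖x‖⁻¹ • x)) (hg : sphereGradient F (‖x‖⁻¹ • x) ≠ 0) :
    meanCurvature (fun x : Ambient n => F (‖x‖⁻¹ • x)) x =
      ‖x‖⁻¹ * sphereMeanCurvature F (‖x‖⁻¹ • x) := by
  obtain ⟨L, hL, hLh⟩ := hasFDerivAt_normalize hx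
  have hev : unitNormal (fun x : Ambient n => F (‖x‖⁻¹ • x)) =ᶠ[𝓝 x]
      fun x => sphereNormal F (‖x‖⁻¹ • x) := by
    have h1 : ∀ᶠ y in 𝓝 (‖x‖⁻¹ • x), DifferentiableAt ℝ F y :=
      (hF.eventually (by norm_num)).mono fun y hy => hy.differentiableAt (by norm_num)
    filter_upwards [hL.continuousAt.eventually h1, isOpen_ne.mem_nhds hx] with y hy hy0
    exact unitNormal_comp_normalize hy0 hy
  set B := fderiv ℝ (sphereNormal F) (‖x‖⁻¹ • x) with hB
  have hd : HasFDerivAt (fun x : Ambient n => sphereNormal F (‖x‖⁻¹ • x)) (B ∘SL L) x :=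
    HasFDerivAt.comp (f := fun x : Ambient n => ‖x‖⁻¹ • x) x
      (differentiableAt_sphereNormal hF hg).hasFDerivAt hL
  have hlin : (B ∘SL L).toLinearMap = ‖x‖⁻¹ • (B.toLinearMap -
      (innerₛₗ ℝ (‖x‖⁻¹ • x)).smulRight (B (‖x‖⁻¹ • x))) := by
    ext1 h
    change B (L h) = ‖x‖⁻¹ • (B h - ⟪‖x‖⁻¹ • x, h⟫ • B (‖x‖⁻¹ • x))
    rw [hLh, map_smul, map_sub, map_smul]
  rw [meanCurvature, hev.fderiv_eq, hd.fderiv, hlin, map_smul, map_sub, LinearMap.trace_smulRight,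
    sphereMeanCurvature, smul_eq_mul, innerₛₗ_apply_apply, real_inner_comm]

/-- The cone over a subset of the sphere, without its vertex. -/
def coneOver (S : Set (Ambient n)) : Set (Ambient n) := {p | p ≠ 0 ∧ ‖p‖⁻¹ • p ∈ S}

theorem mem_coneOver_iff {S : Set (Ambient n)} {p : Ambient n} (hp : ‖p‖ = 1) :
    p ∈ coneOver S ↔ p ∈ S := by
  have h0 : p ≠ 0 := by
    rintro rfl
    simp at hp
  simp [coneOver, hp, h0]

theorem IsClosedMinimalHypersurface.isMinimalConeIn {S : Set (Ambient n)}
    (h : IsClosedMinimalHypersurface n S) (hax : IsAxisymmetric S) :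
    IsMinimalConeIn {0}ᶜ (coneOver S) where
  rot p hp q h1 h2 h3 := by
    refine ⟨?_, hax.mem_of_eq hp.2 ?_ ?_ ?_⟩
    · rw [← norm_ne_zero_iff, h1]; exact norm_ne_zero_iff.2 hp.1
    · rw [norm_smul, norm_smul, norm_inv, norm_inv, norm_norm, norm_norm, h1]
    · rw [axial_smul, axial_smul, h1, h2]
    · rw [height_smul, height_smul, h1, h3]
  smul r hr p hp := by
    refine ⟨smul_ne_zero hr.ne' hp.1, ?_⟩
    rw [norm_smul, Real.norm_of_nonneg hr.le, smul_smul, mul_inv, mul_right_comm,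
      inv_mul_cancel₀ hr.ne', one_mul]
    exact hp.2
  mem_of_closure p hp hpc := by
    refine ⟨hp, h.isCompact.isClosed.closure_subset ?_⟩
    obtain ⟨L, hL, -⟩ := hasFDerivAt_normalize hp
    refine closure_mono ?_ (hL.continuousAt.continuousWithinAt.mem_closure_image hpc)
    rintro _ ⟨x, hx, rfl⟩
    exact hx.2
  exists_isDefining p hp _ := by
    obtain ⟨U, F, hU, hpU, hF, heq, hreg⟩ := h.isMinimal _ hp.2
    have hc : ContinuousOn (fun x : Ambient n => ‖x‖⁻¹ • x) {0}ᶜ := fun x hx => by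
      obtain ⟨L, hL, -⟩ := hasFDerivAt_normalize hx
      exact hL.continuousAt.continuousWithinAt
    have hFc : ∀ x : Ambient n, ‖x‖⁻¹ • x ∈ U → ContDiffAt ℝ ∞ F (‖x‖⁻¹ • x) := fun x hx =>
      hF.contDiffAt (hU.mem_nhds hx)
    refine ⟨{0}ᶜ ∩ (fun x : Ambient n => ‖x‖⁻¹ • x) ⁻¹' U, fun x => F (‖x‖⁻¹ • x), ⟨hp.1, hpU⟩,
      hc.isOpen_inter_preimage isOpen_compl_singleton hU, ?_, ?_, ?_, ?_⟩
    · rintro x ⟨hx0, hxU⟩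
      have hn : ContDiffAt ℝ ∞ (fun x : Ambient n => ‖x‖⁻¹ • x) x :=
        ((contDiffAt_norm ℝ hx0).inv (norm_ne_zero_iff.2 hx0)).smul contDiffAt_id
      exact (ContDiffAt.comp (f := fun x : Ambient n => ‖x‖⁻¹ • x) x (hFc x hxU) hn).contDiffWithinAt
    · ext q
      constructor
      · rintro ⟨⟨hq0, hqS⟩, -, hqU⟩
        exact ⟨⟨hq0, hqU⟩, (heq.subset ⟨hqS, hqU⟩).2.2⟩
      · rintro ⟨⟨hq0, hqU⟩, hqF⟩
        refine ⟨⟨hq0, (heq.superset ⟨hqU, ?_, hqF⟩).1⟩, hq0, hqU⟩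
        rw [norm_smul, norm_inv, norm_norm, inv_mul_cancel₀ (norm_ne_zero_iff.2 hq0)]
    · rintro q ⟨⟨hq0, hqS⟩, -, hqU⟩
      rw [gradient_comp_normalize hq0 ((hFc q hqU).differentiableAt (by simp))]
      exact smul_ne_zero (inv_ne_zero (norm_ne_zero_iff.2 hq0)) (hreg _ ⟨hqS, hqU⟩).1
    · rintro q ⟨⟨hq0, hqS⟩, -, hqU⟩
      rw [meanCurvature_comp_normalize hq0 ((hFc q hqU).of_le two_le_infty) (hreg _ ⟨hqS, hqU⟩).1,
        (hreg _ ⟨hqS, hqU⟩).2, mul_zero]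

end Sphere

/-! ### Classification of the axisymmetric minimal hypersurfaces of the sphere -/

section SphereClassification

variable {n : ℕ} {C : Set (Ambient n)}

theorem cyl_ne_zero (hn : 3 ≤ n) (x s : ℝ) : cyl n x (Real.sin s) (Real.cos s) ≠ 0 := by
  intro h
  have h1 := polarRadius_cyl hn x s
  rw [h, polarRadius_eq_zero.2 ⟨rfl, rfl⟩] at h1
  exact zero_ne_one h1

/-- An arc in a closed minimal cone closes up after one turn. Otherwise its successive turns would
be pairwise disjoint and would accumulate, and at a limit point the cone would be tangent both to
the limit of the arcs and to the radial direction of `x'`. -/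
theorem IsMinimalConeIn.periodic_of_arc (hn : 3 ≤ n) (hC : IsMinimalConeIn {0}ᶜ C) {u v : ℝ → ℝ}
    (ho : IsOrbit (n - 2) u v) (harc : ∀ s, cyl n (u s) (Real.sin s) (Real.cos s) ∈ C) (s : ℝ) :
    u (s + 2 * Real.pi) = u s := by
  have hΩ : ∀ s ∈ (univ : Set ℝ), ∀ x : ℝ, 0 < x →
      cyl n x (Real.sin s) (Real.cos s) ∈ ({0}ᶜ : Set (Ambient n)) :=
    fun s _ x _ => cyl_ne_zero hn x s
  have harc1 : ∀ s, cyl n (u (s + 2 * Real.pi)) (Real.sin s) (Real.cos s) ∈ C := fun s => by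
    have := harc (s + 2 * Real.pi)
    rwa [Real.sin_add_two_pi, Real.cos_add_two_pi] at this
  by_contra hne
  have hd : ∀ r, u (r + 2 * Real.pi) ≠ u r := fun r hr =>
    hne (hC.eq_of_arc_meet hn isOpen_univ hΩ (ho.shift (2 * Real.pi)) ho (fun s _ => harc1 s)
      (fun s _ => harc s) (mem_univ r) hr s).1
  set x : ℕ → ℝ := fun k => u (k * (2 * Real.pi)) with hx
  have hsucc : ∀ k : ℕ, x (k + 1) = u (k * (2 * Real.pi) + 2 * Real.pi) := fun k => by
    simp only [hx]; congr 1; push_cast; ring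
  have hcont : Continuous fun r => u (r + 2 * Real.pi) - u r :=
    (ho.continuous_fst.comp (continuous_id.add continuous_const)).sub ho.continuous_fst
  have hinj : Function.Injective x := by
    by_cases hs : ∀ r, u r < u (r + 2 * Real.pi)
    · exact (strictMono_nat_of_lt_succ fun k => by rw [hsucc]; exact hs _).injective
    · push Not at hs
      obtain ⟨a, ha⟩ := hs
      refine (strictAnti_nat_of_succ_lt fun k => ?_).injective
      rw [hsucc]
      by_contra hlt
      push Not at hlt
      obtain ⟨r, hr⟩ := mem_range_of_exists_le_of_exists_ge hcont (c := 0)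
        ⟨a, by linarith⟩ ⟨k * (2 * Real.pi), by linarith⟩
      exact hd r (sub_eq_zero.1 hr)
  obtain ⟨κ, hκ, hb⟩ := ho.exists_bounds (by omega)
  obtain ⟨⟨L, w⟩, hLw, φ, hφ, hlim⟩ := (isCompact_Icc (a := κ⁻¹) (b := κ)).prod
    (isCompact_Icc (a := -κ) (b := κ)) |>.tendsto_subseq
    (x := fun k : ℕ => (x k, v (k * (2 * Real.pi)))) fun k =>
      ⟨⟨(hb _).1, (hb _).2.1⟩, abs_le.1 (hb _).2.2⟩
  have hL0 : 0 < L := (inv_pos.2 hκ).trans_le hLw.1.1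
  have hlim1 : Tendsto (fun k => x (φ k)) atTop (𝓝 L) := (continuous_fst.tendsto _).comp hlim
  have hlim2 : Tendsto (fun k => v (φ k * (2 * Real.pi))) atTop (𝓝 w) :=
    (continuous_snd.tendsto _).comp hlim
  have hxC : ∀ k, cyl n (x k) (Real.sin 0) (Real.cos 0) ∈ C := fun k => by
    have := harc (k * (2 * Real.pi))
    rwa [Real.sin_periodic.nat_mul_eq, Real.cos_periodic.nat_mul_eq] at this
  have hcyl : Continuous fun y => cyl n y (Real.sin 0) (Real.cos 0) :=
    (continuous_cyl n).comp (continuous_id.prodMk (continuous_const.prodMk continuous_const))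
  have hq : Tendsto (fun k => cyl n (x (φ k)) (Real.sin 0) (Real.cos 0)) atTop
      (𝓝 (cyl n L (Real.sin 0) (Real.cos 0))) := (hcyl.tendsto L).comp hlim1
  have hqC : cyl n L (Real.sin 0) (Real.cos 0) ∈ C := hC.mem_of_closure _ (hΩ 0 trivial L hL0)
    (mem_closure_of_tendsto hq (Eventually.of_forall fun k => hxC (φ k)))
  obtain ⟨U, F, hU, hF⟩ := hC.exists_isDefining _ hqC (hΩ 0 trivial L hL0)
  have hev := hq.eventually (hF.isOpen.mem_nhds hU)
  have h1 : ⟪gradient F (cyl n L (Real.sin 0) (Real.cos 0)),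
      cyl n w (Real.cos 0) (-Real.sin 0)⟫ = 0 := by
    have ht : Tendsto (fun k => ⟪gradient F (cyl n (x (φ k)) (Real.sin 0) (Real.cos 0)),
        cyl n (v (φ k * (2 * Real.pi))) (Real.cos 0) (-Real.sin 0)⟫) atTop
        (𝓝 ⟪gradient F (cyl n L (Real.sin 0) (Real.cos 0)),
          cyl n w (Real.cos 0) (-Real.sin 0)⟫) := by
      refine ((hF.continuousAt_gradient hU).tendsto.comp hq).inner ?_
      have hc : Continuous fun y => cyl n y (Real.cos 0) (-Real.sin 0) :=
        (continuous_cyl n).comp (continuous_id.prodMk (continuous_const.prodMk continuous_const))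
      exact (hc.tendsto w).comp hlim2
    refine tendsto_nhds_unique (ht.congr' ?_) tendsto_const_nhds
    filter_upwards [hev] with k hk
    have e := hF.inner_arc_eq_zero (u := u) (ho.hasDerivAt_fst (φ k * (2 * Real.pi)))
    rw [Real.sin_periodic.nat_mul_eq, Real.cos_periodic.nat_mul_eq] at e
    exact e hk (Eventually.of_forall harc)
  have h2 : ⟪gradient F (cyl n L (Real.sin 0) (Real.cos 0)), cyl n 1 0 0⟫ = 0 := by
    have hd : HasDerivAt (fun y => cyl n y (Real.sin 0) (Real.cos 0)) (cyl n 1 0 0) L :=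
      HasDerivAt.cyl n (hasDerivAt_id L) (hasDerivAt_const _ _) (hasDerivAt_const _ _)
    have hFd : HasDerivAt (fun y => F (cyl n y (Real.sin 0) (Real.cos 0)))
        (fderiv ℝ F (cyl n L (Real.sin 0) (Real.cos 0)) (cyl n 1 0 0)) L :=
      (hF.differentiableAt hU).hasFDerivAt.comp_hasDerivAt L hd
    rw [inner_gradient]
    by_contra h0
    have h3 : Tendsto (fun k => x (φ k)) atTop (𝓝[≠] L) := by
      refine tendsto_nhdsWithin_iff.2 ⟨hlim1, ?_⟩
      have hfin : {k | x (φ k) = L}.Finite := Set.Subsingleton.finite fun i hi j hj =>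
        hφ.injective (hinj ((show x (φ i) = L from hi).trans (show x (φ j) = L from hj).symm))
      rw [← Nat.cofinite_eq_atTop]
      exact hfin.compl_mem_cofinite
    obtain ⟨k, hk1, hk2⟩ := ((h3.eventually (hFd.eventually_ne h0 (c := 0))).and hev).exists
    exact hk1 ((hF.mem_iff hk2).1 (hxC (φ k)))
  have h3 : ⟪gradient F (cyl n L (Real.sin 0) (Real.cos 0)),
      cyl n (w + 1) (Real.cos 0) (-Real.sin 0)⟫ = 0 := by
    have : cyl n (w + 1) (Real.cos 0) (-Real.sin 0) =
        cyl n w (Real.cos 0) (-Real.sin 0) + cyl n 1 0 0 := by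
      rw [cyl_add, add_zero, add_zero]
    rw [this, inner_add_right, h1, h2, add_zero]
  have := hF.snd_eq hn hC.toIsAxiCone hL0.ne' hqC hU h1 h3
  linarith

theorem IsMinimalConeIn.mem_closure_off_axes (hn : 3 ≤ n) {Ω : Set (Ambient n)}
    (hΩ : IsOpen Ω) (hC : IsMinimalConeIn Ω C)
    {p : Ambient n} (hp : p ∈ C) (hpΩ : p ∈ Ω) :
    p ∈ closure {x | x ∈ C ∧ 0 < radius x ∧ 0 < polarRadius x} := by
  have h1 := hΩ.inter_closure ⟨hpΩ, hC.mem_closure_radius_pos hn hp hpΩ⟩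
  refine closure_minimal ?_ isClosed_closure h1
  rintro x ⟨hxΩ, hxC, hxr⟩
  have hO : IsOpen {x : Ambient n | 0 < radius x} := isOpen_lt continuous_const continuous_radius
  refine closure_mono ?_ (hO.inter_closure ⟨hxr, hC.mem_closure_polarRadius_pos hn hxC hxΩ⟩)
  rintro y ⟨h2, h3, h4⟩
  exact ⟨h3, h2, h4⟩

theorem mem_cliffordTorus_iff (hn : 3 ≤ n) {p : Ambient n} : p ∈ cliffordTorus n ↔
    ‖p‖ = 1 ∧ radius p = √((n - 2 : ℕ) : ℝ) * polarRadius p := by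
  have hm : ((n - 2 : ℕ) : ℝ) = n - 2 := by rw [Nat.cast_sub (by omega)]; norm_num
  have hn' : (3 : ℝ) ≤ n := by exact_mod_cast hn
  have hR : √(axial p ^ 2 + height p ^ 2) = polarRadius p := by
    rw [← polarRadius_sq, Real.sqrt_sq (polarRadius_nonneg p)]
  have h0 : p ∈ cliffordTorus n ↔ radius p = √(((n : ℝ) - 2) / ((n : ℝ) - 1)) ∧
      polarRadius p = √(1 / ((n : ℝ) - 1)) := by rw [← hR]; rfl
  have hN := norm_sq_eq hn p
  have e1 : 0 ≤ ((n : ℝ) - 2) / ((n : ℝ) - 1) := div_nonneg (by linarith) (by linarith)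
  have e2 : 0 ≤ 1 / ((n : ℝ) - 1) := div_nonneg (by linarith) (by linarith)
  have hne : (n : ℝ) - 1 ≠ 0 := by linarith
  rw [h0, hm]
  constructor
  · rintro ⟨h1, h2⟩
    constructor
    · rw [h1, h2, Real.sq_sqrt e1, Real.sq_sqrt e2] at hN
      have : ‖p‖ ^ 2 = 1 := by rw [hN]; field_simp; ring
      exact (pow_eq_one_iff_of_nonneg (norm_nonneg _) two_ne_zero).1 this
    · rw [h1, h2, ← Real.sqrt_mul (by linarith), mul_one_div]
  · rintro ⟨h1, h2⟩
    have h3 : polarRadius p ^ 2 = 1 / ((n : ℝ) - 1) := by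
      rw [h1, h2, mul_pow, Real.sq_sqrt (by linarith)] at hN
      field_simp
      linarith
    have h4 : polarRadius p = √(1 / ((n : ℝ) - 1)) := by
      rw [← h3, Real.sqrt_sq (polarRadius_nonneg p)]
    refine ⟨?_, h4⟩
    rw [h2, h4, ← Real.sqrt_mul (by linarith), mul_one_div]

theorem IsMinimalConeIn.mem_iff_of_arc (hn : 3 ≤ n) (hC : IsMinimalConeIn {0}ᶜ C) {u v : ℝ → ℝ}
    (ho : IsOrbit (n - 2) u v) (harc : ∀ s, cyl n (u s) (Real.sin s) (Real.cos s) ∈ C)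
    {p : Ambient n} (hp : p ≠ 0) : p ∈ C ↔ radius p = √((n - 2 : ℕ) : ℝ) * polarRadius p := by
  have hΩ : ∀ s ∈ (univ : Set ℝ), ∀ x : ℝ, 0 < x →
      cyl n x (Real.sin s) (Real.cos s) ∈ ({0}ᶜ : Set (Ambient n)) :=
    fun s _ x _ => cyl_ne_zero hn x s
  have hconst : ∀ p q, IsOrbit (n - 2) p q → (∀ s, cyl n (p s) (Real.sin s) (Real.cos s) ∈ C) →
      ∀ t, p t = √((n - 2 : ℕ) : ℝ) ∧ q t = 0 := fun p q h h' =>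
    h.eq_const_of_periodic (by omega) (hC.periodic_of_arc hn h h')
  constructor
  · intro hpC
    refine eq_of_mem_closure (g := fun x => √((n - 2 : ℕ) : ℝ) * polarRadius x)
      (hC.mem_closure_off_axes hn isOpen_compl_singleton hpC hp)
      continuous_radius.continuousAt (continuous_const.mul continuous_polarRadius).continuousAt ?_
    rintro x ⟨hx, hr, hR⟩
    rcases hC.arc_or_ray hn (O := univ) (M := 0) isPreconnected_univ hΩ
      (fun _ s _ _ => ⟨s, trivial, rfl, rfl⟩)
      (fun p q h h' s => by rw [(hconst p q h (fun s => h' s trivial) s).2, abs_zero])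
      (mem_univ (polarAngle x)) (div_pos hr hR) ((hC.mem_iff_polar hn hR).1 hx)
      with ⟨p', q', ho', hx, harc'⟩ | h1
    · rw [(hconst p' q' ho' (fun s => harc' s trivial) _).1] at hx
      rw [hx, div_mul_cancel₀ _ hR.ne']
    · exact (hC.false_of_arc_of_ray hn isOpen_univ hΩ ho (fun s _ => harc s) trivial h1).elim
  · intro h
    have hR : 0 < polarRadius p := by
      refine (polarRadius_nonneg p).lt_of_ne fun h3 => hp ?_
      rw [← h3, mul_zero] at h
      obtain ⟨h4, h5⟩ := polarRadius_eq_zero.1 h3.symm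
      exact eq_zero_of_coordinates hn h h4 h5
    rw [hC.mem_iff_polar hn hR, h, mul_div_cancel_right₀ _ hR.ne',
      ← (hconst u v ho harc (polarAngle p)).1]
    exact harc _

/-- A closed minimal cone without arcs is a hyperplane. -/
theorem IsMinimalConeIn.exists_mem_iff_of_no_arc (hn : 3 ≤ n) (hC : IsMinimalConeIn {0}ᶜ C)
    (hne : ∃ p ∈ C, p ≠ 0) (harc : ∀ u v, IsOrbit (n - 2) u v →
      ¬ ∀ s, cyl n (u s) (Real.sin s) (Real.cos s) ∈ C) :
    ∃ φ : ℝ, ∀ p : Ambient n, p ≠ 0 →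
      (p ∈ C ↔ Real.cos φ * axial p + -Real.sin φ * height p = 0) := by
  have hΩ : ∀ s ∈ (univ : Set ℝ), ∀ x : ℝ, 0 < x →
      cyl n x (Real.sin s) (Real.cos s) ∈ ({0}ᶜ : Set (Ambient n)) :=
    fun s _ x _ => cyl_ne_zero hn x s
  have hA := hC.toIsAxiCone
  have hray : ∀ p ∈ C, 0 < radius p → 0 < polarRadius p → ∀ x : ℝ, 0 < x →
      cyl n x (Real.sin (polarAngle p)) (Real.cos (polarAngle p)) ∈ C := by
    intro p hp hr hR
    rcases hC.arc_or_ray hn (O := univ) (M := 0) isPreconnected_univ hΩ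
      (fun _ s _ _ => ⟨s, trivial, rfl, rfl⟩)
      (fun p q h h' s => (harc p q h fun s => h' s trivial).elim)
      (mem_univ (polarAngle p)) (div_pos hr hR) ((hC.mem_iff_polar hn hR).1 hp)
      with ⟨p', q', ho', -, harc'⟩ | h1
    · exact (harc p' q' ho' fun s => harc' s trivial).elim
    · exact h1
  obtain ⟨p₁, hp₁, hp₁0⟩ := hne
  obtain ⟨p₀, hp₀, hr₀, hR₀⟩ := closure_nonempty_iff.1
    ⟨p₁, hC.mem_closure_off_axes hn isOpen_compl_singleton hp₁ hp₁0⟩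
  set φ := polarAngle p₀ with hφ
  have hφray := hray p₀ hp₀ hr₀ hR₀
  have hpole0 : cyl n 1 0 0 ≠ 0 := by
    intro h1
    rw [← cyl_zero, cyl_inj hn] at h1
    exact one_ne_zero h1.1
  have hpole : cyl n 1 0 0 ∈ C := hC.mem_of_closure _ hpole0 (pole_mem_closure hA hφray).1
  obtain ⟨U, F, hU, hF⟩ := hC.exists_isDefining _ hpole hpole0
  have hg0 := hF.gradient_ne_zero _ ⟨hpole, hU⟩
  have hsin : ∀ ψ : ℝ, (∀ x : ℝ, 0 < x → cyl n x (Real.sin ψ) (Real.cos ψ) ∈ C) →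
      Real.sin (ψ - φ) = 0 := fun ψ hψ => hA.sin_sub_eq_zero hn hpole (hF.differentiableAt hU) hg0
    (hF.eventually_eq_zero hU) hψ hφray
  have hsub : ∀ p ∈ C, p ≠ 0 → Real.cos φ * axial p + -Real.sin φ * height p = 0 := by
    intro p hp hp0
    refine eq_of_mem_closure (f := fun p => Real.cos φ * axial p + -Real.sin φ * height p)
      (g := fun _ => (0 : ℝ)) (hC.mem_closure_off_axes hn isOpen_compl_singleton hp hp0)
      ((continuous_const.mul continuous_axial).add
        (continuous_const.mul continuous_height)).continuousAt continuousAt_const ?_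
    rintro x ⟨hx, hr, hR⟩
    have h3 := hsin _ (hray x hx hr hR)
    rw [Real.sin_sub] at h3
    simp only [axial_eq x, height_eq x]
    linear_combination polarRadius x * h3
  -- since the cone is a manifold at the pole, it contains the opposite half-plane too
  obtain ⟨ψ, hψray, hψs, hψc⟩ : ∃ ψ : ℝ,
      (∀ x : ℝ, 0 < x → cyl n x (Real.sin ψ) (Real.cos ψ) ∈ C) ∧
        Real.sin ψ = -Real.sin φ ∧ Real.cos ψ = -Real.cos φ := by
    obtain ⟨a, b, c, hg, ha⟩ := hA.gradient_eq hn one_ne_zero hpole (hF.differentiableAt hU)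
      (hF.eventually_eq_zero hU)
    have ha0 : a = 0 := by linear_combination ha
    have hτ := hA.inner_pole_eq_zero hpole (hF.differentiableAt hU) (hF.eventually_eq_zero hU) hφray
    obtain ⟨δ, s, hδ, hx, -⟩ := hF.exists_near hpole hU
      (τ := cyl n 0 (-Real.sin φ) (-Real.cos φ)) (by
        rw [hg, inner_cyl_cyl hn] at hτ ⊢
        linear_combination -hτ) one_pos
    rw [hg, smul_cyl, smul_cyl, cyl_add, cyl_add, ha0, mul_zero, mul_zero, add_zero, add_zero,
      zero_add, zero_add] at hx
    rw [hg, inner_cyl_cyl hn] at hτ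
    set y := cyl n 1 (δ * -Real.sin φ + s * b) (δ * -Real.cos φ + s * c) with hy
    have hyr : 0 < radius y := by rw [hy, radius_cyl hn]; norm_num
    have hya := axial_eq y
    have hyh := height_eq y
    have hin : polarRadius y * Real.cos (polarAngle y - φ) = -δ := by
      rw [hy, axial_cyl hn] at hya
      rw [hy, height_cyl hn] at hyh
      rw [Real.cos_sub]
      linear_combination -Real.sin φ * hya - Real.cos φ * hyh + s * hτ -
        δ * Real.sin_sq_add_cos_sq φ
    have hyR : 0 < polarRadius y := by
      refine (polarRadius_nonneg y).lt_of_ne fun h0 => ?_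
      rw [← h0] at hin
      linarith
    have hyray := hray y hx hyr hyR
    have h3 := hsin _ hyray
    have h4 : Real.cos (polarAngle y - φ) = -1 := by
      have h5 : Real.cos (polarAngle y - φ) < 0 := by
        by_contra h6
        push Not at h6
        have := mul_nonneg hyR.le h6
        linarith
      rcases Real.sin_eq_zero_iff_cos_eq.1 h3 with h6 | h6
      · linarith
      · exact h6
    refine ⟨polarAngle y, hyray, ?_, ?_⟩
    · have := Real.sin_add (polarAngle y - φ) φ
      rw [sub_add_cancel, h3, h4] at this
      linarith
    · have := Real.cos_add (polarAngle y - φ) φ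
      rw [sub_add_cancel, h3, h4] at this
      linarith
  have hclosed : ∀ ψ : ℝ, (∀ x : ℝ, 0 < x → cyl n x (Real.sin ψ) (Real.cos ψ) ∈ C) →
      ∀ x : ℝ, 0 ≤ x → cyl n x (Real.sin ψ) (Real.cos ψ) ∈ C := by
    intro ψ hψ x hx
    refine hC.mem_of_closure _ (cyl_ne_zero hn x ψ) ?_
    have hc : Continuous fun y => cyl n y (Real.sin ψ) (Real.cos ψ) :=
      (continuous_cyl n).comp (continuous_id.prodMk (continuous_const.prodMk continuous_const))
    rw [← mem_Ici, ← closure_Ioi] at hx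
    refine closure_mono ?_ (hc.continuousWithinAt.mem_closure_image hx)
    rintro _ ⟨y, hy, rfl⟩
    exact hψ y hy
  refine ⟨φ, fun p hp0 => ⟨fun hp => hsub p hp hp0, fun h => ?_⟩⟩
  rcases (polarRadius_nonneg p).eq_or_lt with hR | hR
  · obtain ⟨h1, h2⟩ := polarRadius_eq_zero.1 hR.symm
    rw [← hA.cyl_radius_mem hn, h1, h2]
    have hr : 0 < radius p := (radius_nonneg p).lt_of_ne fun h3 =>
      hp0 (eq_zero_of_coordinates hn h3.symm h1 h2)
    have := hA.smul _ hr _ hpole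
    rwa [smul_cyl, mul_one, mul_zero] at this
  · rw [hA.mem_iff_polar hn hR]
    have hx := div_nonneg (radius_nonneg p) hR.le
    have h3 : Real.sin (polarAngle p - φ) = 0 := by
      rw [axial_eq p, height_eq p] at h
      refine (mul_eq_zero.1 (?_ : polarRadius p * Real.sin (polarAngle p - φ) = 0)).resolve_left hR.ne'
      rw [Real.sin_sub]
      linear_combination h
    have h4 := Real.sin_add (polarAngle p - φ) φ
    have h5 := Real.cos_add (polarAngle p - φ) φ
    rw [sub_add_cancel, h3] at h4 h5
    rcases Real.sin_eq_zero_iff_cos_eq.1 h3 with h6 | h6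
    · rw [show Real.sin (polarAngle p) = Real.sin φ by rw [h4, h6]; ring,
        show Real.cos (polarAngle p) = Real.cos φ by rw [h5, h6]; ring]
      exact hclosed φ hφray _ hx
    · rw [show Real.sin (polarAngle p) = Real.sin ψ by rw [h4, h6, hψs]; ring,
        show Real.cos (polarAngle p) = Real.cos ψ by rw [h5, h6, hψc]; ring]
      exact hclosed ψ hψray _ hx

/-- The classification of the axisymmetric minimal hypersurfaces of the sphere. -/
theorem IsClosedMinimalHypersurface.eq_cliffordTorus_or (hn : 3 ≤ n) {S : Set (Ambient n)}
    (h : IsClosedMinimalHypersurface n S) (hax : IsAxisymmetric S) :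
    S = cliffordTorus n ∨ ∃ a b : ℝ, a ^ 2 + b ^ 2 = 1 ∧ S = equatorialSphere n a b := by
  have hC := h.isMinimalConeIn hax
  have hne0 : ∀ {p : Ambient n}, ‖p‖ = 1 → p ≠ 0 := by
    rintro p hp rfl
    simp at hp
  by_cases harc : ∃ u v, IsOrbit (n - 2) u v ∧
      ∀ s, cyl n (u s) (Real.sin s) (Real.cos s) ∈ coneOver S
  · obtain ⟨u, v, ho, harc⟩ := harc
    left
    ext p
    rw [mem_cliffordTorus_iff hn]
    constructor
    · intro hp
      have h1 := h.norm_eq_one p hp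
      exact ⟨h1, (hC.mem_iff_of_arc hn ho harc (hne0 h1)).1 ((mem_coneOver_iff h1).2 hp)⟩
    · rintro ⟨h1, h2⟩
      exact (mem_coneOver_iff h1).1 ((hC.mem_iff_of_arc hn ho harc (hne0 h1)).2 h2)
  · right
    obtain ⟨p, hp⟩ := h.nonempty
    have hp1 := h.norm_eq_one p hp
    obtain ⟨φ, hφ⟩ := hC.exists_mem_iff_of_no_arc hn
      ⟨p, (mem_coneOver_iff hp1).2 hp, hne0 hp1⟩ fun u v ho h => harc ⟨u, v, ho, h⟩
    refine ⟨Real.cos φ, -Real.sin φ, by rw [neg_sq, Real.cos_sq_add_sin_sq], ?_⟩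
    ext q
    constructor
    · intro hq
      have h1 := h.norm_eq_one q hq
      exact ⟨h1, (hφ q (hne0 h1)).1 ((mem_coneOver_iff h1).2 hq)⟩
    · rintro ⟨h1, h2⟩
      exact (mem_coneOver_iff h1).1 ((hφ q (hne0 h1)).2 h2)

end SphereClassification

/-! ### The cones over the solutions are minimal -/

section Level

variable {n : ℕ}

theorem contDiffAt_radius (hn : 3 ≤ n) {p : Ambient n} (hp : 0 < radius p) :
    ContDiffAt ℝ ∞ (radius : Ambient n → ℝ) p := by
  unfold radius
  refine ContDiffAt.sqrt (by fun_prop) ?_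
  intro h
  have := radius_sq hn p
  rw [radius, h] at hp
  simp at hp

theorem contDiffAt_polarRadius {p : Ambient n} (hp : 0 < polarRadius p) :
    ContDiffAt ℝ ∞ (polarRadius : Ambient n → ℝ) p :=
  ContDiffAt.comp p (contDiffAt_norm ℝ (norm_pos_iff.1 hp)) contDiff_planar.contDiffAt

theorem contDiffAt_polarAngle {p : Ambient n} (hp : 0 < height p ∨ axial p ≠ 0) :
    ContDiffAt ℝ ∞ (polarAngle : Ambient n → ℝ) p := by
  have h1 : ContDiffAt ℝ ∞ Complex.log (planar p) :=
    (Complex.contDiffAt_log (show planar p ∈ Complex.slitPlane from hp)).restrict_scalars ℝ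
  have h2 : ContDiffAt ℝ ∞ (fun x : Ambient n => Complex.reCLM (Complex.log (planar x))) p :=
    Complex.reCLM.contDiff.contDiffAt.comp p (h1.comp p contDiff_planar.contDiffAt)
  have h3 : ContDiffAt ℝ ∞ (fun x : Ambient n => Complex.imCLM (Complex.log (planar x))) p :=
    Complex.imCLM.contDiff.contDiffAt.comp p (h1.comp p contDiff_planar.contDiffAt)
  exact h3.congr_of_eventuallyEq (Eventually.of_forall fun x => (Complex.log_im (planar x)).symm)

/-- The function `|x'| / r - u(φ)`, whose zero set is the cone over the solution `u`. -/
def levelFunction (n : ℕ) (u : ℝ → ℝ) (p : Ambient n) : ℝ :=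
  radius p / polarRadius p - u (polarAngle p)

theorem isInvariant_levelFunction (hn : 3 ≤ n) (u : ℝ → ℝ) : IsInvariant (levelFunction n u) where
  rot p q h1 h2 h3 := by
    have e1 : planar q = planar p := Complex.ext (by rw [re_planar, re_planar, h3])
      (by rw [im_planar, im_planar, h2])
    have e2 : radius q = radius p := by
      refine (pow_left_inj₀ (radius_nonneg q) (radius_nonneg p) two_ne_zero).1 ?_
      rw [radius_sq hn, radius_sq hn, h1, h2, h3]
    simp only [levelFunction, polarRadius, polarAngle, e1, e2]
  smul r hr p := by
    rw [levelFunction, levelFunction, polarAngle_smul hr, polarRadius_smul hr.le,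
      radius_smul hn hr.le, mul_div_mul_left _ _ hr.ne']

theorem contDiffAt_levelFunction (hn : 3 ≤ n) {u : ℝ → ℝ} {p : Ambient n} (hp : 0 < radius p)
    (hR : 0 < polarRadius p) (hu : ContDiffAt ℝ ∞ (fun x : Ambient n => u (polarAngle x)) p) :
    ContDiffAt ℝ ∞ (levelFunction n u) p :=
  ((contDiffAt_radius hn hp).div (contDiffAt_polarRadius hR) hR.ne').sub hu

/-- The zero set of the level function is regular and minimal along the arc. The last two
hypotheses on `u` express that `u` is a smooth function of the angle near `φ`. -/
theorem IsOrbit.regular_levelFunction (hn : 3 ≤ n) {u v : ℝ → ℝ} (ho : IsOrbit (n - 2) u v) {φ : ℝ}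
    (hs : ContDiffAt ℝ ∞ (fun x : Ambient n => u (polarAngle x))
      (cyl n (u φ) (Real.sin φ) (Real.cos φ)))
    (harc : ∀ᶠ s in 𝓝 φ, ∀ x, u (polarAngle (cyl n x (Real.sin s) (Real.cos s))) = u s) :
    (∃ b : ℝ, b ≠ 0 ∧ gradient (levelFunction n u) (cyl n (u φ) (Real.sin φ) (Real.cos φ)) =
      b • cyl n 1 (-(u φ * Real.sin φ + v φ * Real.cos φ))
        (-(u φ * Real.cos φ - v φ * Real.sin φ))) ∧
    meanCurvature (levelFunction n u) (cyl n (u φ) (Real.sin φ) (Real.cos φ)) = 0 := by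
  set F := levelFunction n u with hF
  set q := cyl n (u φ) (Real.sin φ) (Real.cos φ) with hq
  have hI : IsInvariant F := isInvariant_levelFunction hn u
  have hX : IsAxiCone {x : Ambient n | 0 < polarRadius x ∧ F x = 0} := by
    constructor
    · rintro p ⟨h1, h2⟩ q e1 e2 e3
      refine ⟨?_, by rw [hI.rot p q e1 e2 e3]; exact h2⟩
      have e4 : planar q = planar p := Complex.ext (by rw [re_planar, re_planar, e3])
        (by rw [im_planar, im_planar, e2])
      rw [polarRadius, e4]
      exact h1
    · rintro r hr p ⟨h1, h2⟩
      exact ⟨by rw [polarRadius_smul hr.le]; exact mul_pos hr h1, by rw [hI.smul r hr]; exact h2⟩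
  have hFx : ∀ᶠ s in 𝓝 φ, ∀ x, 0 < x → F (cyl n x (Real.sin s) (Real.cos s)) = x - u s := by
    filter_upwards [harc] with s h1 x hx
    rw [hF, levelFunction, radius_cyl hn, polarRadius_cyl hn, h1, div_one, abs_of_pos hx]
  have hmem : ∀ᶠ s in 𝓝 φ, cyl n (u s) (Real.sin s) (Real.cos s) ∈
      {x : Ambient n | 0 < polarRadius x ∧ F x = 0} := by
    filter_upwards [hFx] with s h1
    exact ⟨by rw [polarRadius_cyl hn]; exact one_pos, by rw [h1 _ (ho.pos s), sub_self]⟩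
  have hsm : ContDiffAt ℝ ∞ F q := contDiffAt_levelFunction hn
    (by rw [hq, radius_cyl hn]; exact abs_pos.2 (ho.pos φ).ne')
    (by rw [hq, polarRadius_cyl hn]; exact one_pos) hs
  have hd : DifferentiableAt ℝ F q := hsm.differentiableAt (by simp)
  have hz : ∀ᶠ x in 𝓝 q, x ∈ {x : Ambient n | 0 < polarRadius x ∧ F x = 0} → F x = 0 :=
    Eventually.of_forall fun x hx => hx.2
  obtain ⟨b, hb⟩ := hX.gradient_arc hn (S := univ) (ho.pos φ) uniqueDiffWithinAt_univ
    (ho.hasDerivAt_fst φ).hasDerivWithinAt hmem.self_of_nhds (by rwa [nhdsWithin_univ]) hd hz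
  have hb0 : b ≠ 0 := by
    rintro rfl
    have hline : HasDerivAt (fun x => cyl n x (Real.sin φ) (Real.cos φ)) (cyl n 1 0 0) (u φ) :=
      HasDerivAt.cyl n (hasDerivAt_id (u φ)) (hasDerivAt_const _ _) (hasDerivAt_const _ _)
    have h1 : HasDerivAt (fun x => F (cyl n x (Real.sin φ) (Real.cos φ)))
        (fderiv ℝ F q (cyl n 1 0 0)) (u φ) :=
      HasFDerivAt.comp_hasDerivAt (l := F) (f := fun x => cyl n x (Real.sin φ) (Real.cos φ)) (u φ)
        hd.hasFDerivAt hline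
    have h2 : HasDerivAt (fun x => F (cyl n x (Real.sin φ) (Real.cos φ))) 1 (u φ) := by
      refine ((hasDerivAt_id (u φ)).sub_const (u φ)).congr_of_eventuallyEq ?_
      filter_upwards [lt_mem_nhds (ho.pos φ)] with x hx
      exact hFx.self_of_nhds x hx
    have h3 := h1.unique h2
    rw [← inner_gradient, hb, zero_smul, inner_zero_left] at h3
    exact zero_ne_one h3
  have hg : gradient F q ≠ 0 := by
    rw [hb]
    refine smul_ne_zero hb0 fun h => ?_
    rw [← cyl_zero, cyl_inj hn] at h
    exact one_ne_zero h.1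
  exact ⟨⟨b, hb0, hb⟩, (hX.meanCurvature_eq_zero_iff hn (ho.pos φ)
    (Eventually.of_forall ho.hasDerivAt_fst) (ho.hasDerivAt_snd φ) hmem
    (hsm.of_le two_le_infty) hg hz).2 rfl⟩

/-- The same at an arbitrary point of the cone. -/
theorem IsOrbit.regular_levelFunction_of_eq_zero (hn : 3 ≤ n) {u v : ℝ → ℝ}
    (ho : IsOrbit (n - 2) u v) {p : Ambient n} (hR : 0 < polarRadius p)
    (h0 : levelFunction n u p = 0)
    (hs : ContDiffAt ℝ ∞ (fun x : Ambient n => u (polarAngle x))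
      (cyl n (u (polarAngle p)) (Real.sin (polarAngle p)) (Real.cos (polarAngle p))))
    (harc : ∀ᶠ s in 𝓝 (polarAngle p),
      ∀ x, u (polarAngle (cyl n x (Real.sin s) (Real.cos s))) = u s) :
    gradient (levelFunction n u) p ≠ 0 ∧ meanCurvature (levelFunction n u) p = 0 ∧
      ∃ b : ℝ, b ≠ 0 ∧ height (unitNormal (levelFunction n u) p) =
        height (‖b • cyl n 1
            (-(u (polarAngle p) * Real.sin (polarAngle p) + v (polarAngle p) * Real.cos (polarAngle p)))
            (-(u (polarAngle p) * Real.cos (polarAngle p) - v (polarAngle p) * Real.sin (polarAngle p)))‖⁻¹ •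
          (b • cyl n 1
            (-(u (polarAngle p) * Real.sin (polarAngle p) + v (polarAngle p) * Real.cos (polarAngle p)))
            (-(u (polarAngle p) * Real.cos (polarAngle p) - v (polarAngle p) * Real.sin (polarAngle p))))) := by
  have hx : u (polarAngle p) = radius p / polarRadius p := (sub_eq_zero.1 h0).symm
  obtain ⟨⟨b, hb, hg⟩, hm⟩ := ho.regular_levelFunction hn hs harc
  obtain ⟨-, h1, h2, h3⟩ := (isInvariant_levelFunction hn u).exists_transport hn hR
    (q := cyl n (u (polarAngle p)) (Real.sin (polarAngle p)) (Real.cos (polarAngle p)))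
    (by rw [hx])
  refine ⟨fun h => ?_, h3.2 hm, b, hb, ?_⟩
  · have := h1.1 h
    rw [hg] at this
    rcases smul_eq_zero.1 this with h4 | h4
    · exact hb h4
    · rw [← cyl_zero, cyl_inj hn] at h4
      exact one_ne_zero h4.1
  · rw [h2, unitNormal, hg]

end Level

/-! ### The minimal hypersurfaces of the sphere -/

section SphereExamples

variable {n : ℕ}

/-- On the unit sphere, a function of degree zero has the same normal in the sphere and in the
ambient space. -/
theorem IsInvariant.sphere_eq {F : Ambient n → ℝ} (hF : IsInvariant F) {q : Ambient n}
    (hq : ‖q‖ = 1) (hd : ContDiffAt ℝ 2 F q) (hg : gradient F q ≠ 0) :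
    sphereGradient F q ≠ 0 ∧ sphereMeanCurvature F q = meanCurvature F q := by
  have hq0 : q ≠ 0 := by rintro rfl; simp at hq
  have hinv : ∀ x : Ambient n, x ≠ 0 → F (‖x‖⁻¹ • x) = F x := fun x hx =>
    hF.smul _ (inv_pos.2 (norm_pos_iff.2 hx)) x
  have hevF : ∀ x : Ambient n, x ≠ 0 → (fun x : Ambient n => F (‖x‖⁻¹ • x)) =ᶠ[𝓝 x] F :=
    fun x hx => by
      filter_upwards [isOpen_ne.mem_nhds hx] with y hy using hinv y hy
  have hgr : ∀ x : Ambient n, x ≠ 0 →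
      gradient (fun x : Ambient n => F (‖x‖⁻¹ • x)) x = gradient F x := fun x hx => by
    rw [gradient, gradient, (hevF x hx).fderiv_eq]
  have h1 : ‖q‖⁻¹ • q = q := by rw [hq, inv_one, one_smul]
  have e1 := gradient_comp_normalize (F := F) hq0 (by
    rw [h1]; exact hd.differentiableAt (by norm_num))
  rw [hgr q hq0, h1, hq, inv_one, one_smul] at e1
  have hs : sphereGradient F q ≠ 0 := by rwa [← e1]
  refine ⟨hs, ?_⟩
  have e2 := meanCurvature_comp_normalize (F := F) hq0 (by rwa [h1]) (by rwa [h1])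
  rw [h1, hq, inv_one, one_mul] at e2
  rw [← e2, meanCurvature, meanCurvature]
  have hev : unitNormal (fun x : Ambient n => F (‖x‖⁻¹ • x)) =ᶠ[𝓝 q] unitNormal F := by
    filter_upwards [isOpen_ne.mem_nhds hq0] with y hy
    rw [unitNormal, unitNormal, hgr y hy]
  rw [hev.fderiv_eq]

theorem isAxisymmetric_cliffordTorus (hn : 3 ≤ n) : IsAxisymmetric (cliffordTorus n) := by
  refine isAxisymmetric_of_mem_of_eq fun p hp q h1 h2 h3 => ?_
  rw [mem_cliffordTorus_iff hn] at hp ⊢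
  have e1 : radius q = radius p := by
    refine (pow_left_inj₀ (radius_nonneg q) (radius_nonneg p) two_ne_zero).1 ?_
    rw [radius_sq hn, radius_sq hn, h1, h2, h3]
  have e2 : polarRadius q = polarRadius p := by
    refine (pow_left_inj₀ (polarRadius_nonneg q) (polarRadius_nonneg p) two_ne_zero).1 ?_
    rw [polarRadius_sq, polarRadius_sq, h2, h3]
  rw [h1, e1, e2]
  exact hp

theorem isClosedMinimalHypersurface_cliffordTorus (hn : 3 ≤ n) :
    IsClosedMinimalHypersurface n (cliffordTorus n) := by
  have ho := isOrbit_const (m := n - 2) (by omega)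
  set c := √((n - 2 : ℕ) : ℝ) with hc
  have hc0 : 0 < c := ho.pos 0
  have hmem : ∀ p : Ambient n, p ∈ cliffordTorus n ↔ ‖p‖ = 1 ∧ radius p = c * polarRadius p :=
    fun p => mem_cliffordTorus_iff hn
  have hclosed : IsClosed (cliffordTorus n) := by
    have : cliffordTorus n = {p : Ambient n | ‖p‖ = 1} ∩ {p | radius p = c * polarRadius p} :=
      Set.ext hmem
    rw [this]
    exact (isClosed_eq continuous_norm continuous_const).inter
      (isClosed_eq continuous_radius (continuous_const.mul continuous_polarRadius))
  have hpos : ∀ p ∈ cliffordTorus n, 0 < radius p ∧ 0 < polarRadius p := by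
    intro p hp
    obtain ⟨h1, h2⟩ := (hmem p).1 hp
    have hR : 0 < polarRadius p := by
      refine (polarRadius_nonneg p).lt_of_ne fun h3 => ?_
      have := norm_sq_eq hn p
      rw [h1, h2, ← h3] at this
      norm_num at this
    exact ⟨by rw [h2]; exact mul_pos hc0 hR, hR⟩
  have hO : IsOpen {p : Ambient n | 0 < radius p ∧ 0 < polarRadius p} :=
    (isOpen_lt continuous_const continuous_radius).inter
      (isOpen_lt continuous_const continuous_polarRadius)
  have hsm : ∀ p : Ambient n, 0 < radius p ∧ 0 < polarRadius p →
      ContDiffAt ℝ ∞ (levelFunction n fun _ => c) p := fun p hp =>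
    contDiffAt_levelFunction hn hp.1 hp.2 contDiffAt_const
  refine ⟨?_, ?_, fun p hp => ((hmem p).1 hp).1, fun p hp =>
    ⟨_, levelFunction n fun _ => c, hO, hpos p hp, fun q hq => (hsm q hq).contDiffWithinAt, ?_, ?_⟩⟩
  · refine (isCompact_sphere (0 : Ambient n) 1).of_isClosed_subset hclosed fun p hp => ?_
    rw [mem_sphere_zero_iff_norm]
    exact ((hmem p).1 hp).1
  · refine ⟨(√(1 + c ^ 2))⁻¹ • cyl n c (Real.sin 0) (Real.cos 0), (hmem _).2 ⟨?_, ?_⟩⟩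
    · have h1 : ‖cyl n c (Real.sin 0) (Real.cos 0)‖ = √(1 + c ^ 2) := by
        rw [← Real.sqrt_sq (norm_nonneg (cyl n c _ _)), norm_cyl_sq hn]
        congr 1
        simp
        ring
      rw [norm_smul, norm_inv, Real.norm_of_nonneg (Real.sqrt_nonneg _), h1, inv_mul_cancel₀]
      exact (Real.sqrt_pos.2 (by positivity)).ne'
    · rw [radius_smul hn (by positivity), polarRadius_smul (by positivity), radius_cyl hn,
        polarRadius_cyl hn, abs_of_pos hc0]
      ring
  · ext q
    constructor
    · rintro ⟨hq, hqU⟩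
      obtain ⟨h1, h2⟩ := (hmem q).1 hq
      refine ⟨hqU, h1, ?_⟩
      rw [levelFunction, h2, mul_div_cancel_right₀ _ hqU.2.ne', sub_self]
    · rintro ⟨hqU, h1, h2⟩
      refine ⟨(hmem q).2 ⟨h1, ?_⟩, hqU⟩
      rw [levelFunction, sub_eq_zero, div_eq_iff hqU.2.ne'] at h2
      exact h2
  · rintro q ⟨hq, hqU⟩
    obtain ⟨h1, h2⟩ := (hmem q).1 hq
    obtain ⟨h3, h4, -⟩ := ho.regular_levelFunction_of_eq_zero hn hqU.2
      (by rw [levelFunction, h2, mul_div_cancel_right₀ _ hqU.2.ne', sub_self])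
      contDiffAt_const (Eventually.of_forall fun _ _ => rfl)
    obtain ⟨h5, h6⟩ := (isInvariant_levelFunction hn fun _ => c).sphere_eq h1
      ((hsm q hqU).of_le two_le_infty) h3
    exact ⟨h5, h6.trans h4⟩

theorem isAxisymmetric_equatorialSphere (a b : ℝ) : IsAxisymmetric (equatorialSphere n a b) :=
  isAxisymmetric_of_mem_of_eq fun p hp q h1 h2 h3 =>
    ⟨h1.trans hp.1, by rw [h2, h3]; exact hp.2⟩

theorem isClosedMinimalHypersurface_equatorialSphere (hn : 3 ≤ n) {a b : ℝ}
    (hab : a ^ 2 + b ^ 2 = 1) : IsClosedMinimalHypersurface n (equatorialSphere n a b) := by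
  set w : Ambient n := cyl n 0 a b with hw
  have hw1 : ‖w‖ = 1 := by
    refine (pow_eq_one_iff_of_nonneg (norm_nonneg _) two_ne_zero).1 ?_
    rw [hw, norm_cyl_sq hn]
    linear_combination hab
  have hin : ∀ p : Ambient n, a * axial p + b * height p = ⟪w, p⟫ := fun p => by
    rw [hw, inner_cyl]; ring
  have hmem : ∀ p : Ambient n, p ∈ equatorialSphere n a b ↔ ‖p‖ = 1 ∧ ⟪w, p⟫ = 0 := fun p => by
    rw [← hin]; rfl
  have hcl : IsClosed (equatorialSphere n a b) := by
    have : equatorialSphere n a b = {p : Ambient n | ‖p‖ = 1} ∩ {p | ⟪w, p⟫ = 0} := Set.ext hmem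
    rw [this]
    exact (isClosed_eq continuous_norm continuous_const).inter
      (isClosed_eq (continuous_const.inner continuous_id) continuous_const)
  have hgrad : ∀ q : Ambient n, gradient (fun p => ⟪w, p⟫) q = w := fun q => by
    refine ext_inner_right ℝ fun h => ?_
    rw [inner_gradient]
    exact congrArg (fun L => L h) (innerSL ℝ w).fderiv
  have hsg : ∀ q : Ambient n, sphereGradient (fun p => ⟪w, p⟫) q = w - ⟪w, q⟫ • q := fun q => by
    rw [sphereGradient, hgrad]
  refine ⟨(isCompact_sphere (0 : Ambient n) 1).of_isClosed_subset hcl fun p hp => by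
    rw [mem_sphere_zero_iff_norm]; exact hp.1, ⟨cyl n 1 0 0, (hmem _).2 ⟨?_, ?_⟩⟩,
    fun p hp => hp.1, fun p _ => ⟨univ, fun p => ⟪w, p⟫, isOpen_univ, trivial, ?_, ?_, ?_⟩⟩
  · refine (pow_eq_one_iff_of_nonneg (norm_nonneg _) two_ne_zero).1 ?_
    rw [norm_cyl_sq hn]; norm_num
  · rw [hw, inner_cyl_cyl hn]; ring
  · exact (contDiff_const.inner ℝ contDiff_id).contDiffOn
  · ext q
    simp only [inter_univ, hmem, mem_univ, true_and]
    rfl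
  · rintro q ⟨hq, -⟩
    obtain ⟨hq1, hq2⟩ := (hmem q).1 hq
    have hs : sphereGradient (fun p => ⟪w, p⟫) q = w := by rw [hsg, hq2, zero_smul, sub_zero]
    have hw0 : w ≠ 0 := by
      intro h
      rw [h, norm_zero] at hw1
      exact zero_ne_one hw1
    refine ⟨by rwa [hs], ?_⟩
    -- the normal has norm `√(1 - ⟪w, x⟫²)` at the points `x` of the sphere; along the equatorial
    -- sphere it is constant to first order up to the position vector
    set N : Ambient n → Ambient n := fun x => w - ⟪w, x⟫ • x with hN
    have hNd : HasFDerivAt N (-(innerSL ℝ w).smulRight q) q := by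
      have h1 := (((innerSL ℝ w).hasFDerivAt (x := q)).smul (hasFDerivAt_id q)).const_sub w
      refine h1.congr_fderiv ?_
      ext1 h
      change -(⟪w, q⟫ • h + ⟪w, h⟫ • q) = -(⟪w, h⟫ • q)
      rw [hq2, zero_smul, zero_add]
    have hNq : N q = w := by simp [hN, hq2]
    have hnorm : HasFDerivAt (fun x => ‖N x‖⁻¹) (0 : Ambient n →L[ℝ] ℝ) q := by
      have h2 := hNd.norm_sq
      have h3 : 2 • (innerSL ℝ (N q)) ∘SL (-(innerSL ℝ w).smulRight q) = 0 := by
        ext1 h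
        change 2 • ⟪N q, -(⟪w, h⟫ • q)⟫ = (0 : ℝ)
        rw [hNq, inner_neg_right, inner_smul_right, hq2, mul_zero, neg_zero, smul_zero]
      rw [h3] at h2
      have h4 := h2.sqrt (by rw [hNq, hw1]; norm_num)
      simp only [Real.sqrt_sq (norm_nonneg _), smul_zero] at h4
      have h5 := (hasDerivAt_inv (x := ‖N q‖) (by rw [hNq, hw1]; norm_num)).comp_hasFDerivAt q h4
      rwa [smul_zero] at h5
    have hfd : HasFDerivAt (sphereNormal fun p => ⟪w, p⟫) (-(innerSL ℝ w).smulRight q) q := by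
      have h1 := hnorm.smul hNd
      have h2 : (fun x => ‖N x‖⁻¹ • N x) = sphereNormal fun p => ⟪w, p⟫ := by
        funext x
        rw [sphereNormal, hsg]
      change HasFDerivAt (fun x => ‖N x‖⁻¹ • N x) _ q at h1
      rw [h2] at h1
      refine h1.congr_fderiv ?_
      rw [hNq, hw1, inv_one, one_smul]
      ext h
      simp
    rw [sphereMeanCurvature, hfd.fderiv]
    have htr : LinearMap.trace ℝ (Ambient n) (-(innerSL ℝ w).smulRight q :
        Ambient n →L[ℝ] Ambient n).toLinearMap = 0 := by
      have : (-(innerSL ℝ w).smulRight q : Ambient n →L[ℝ] Ambient n).toLinearMap =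
          -((innerₛₗ ℝ w).smulRight q) := rfl
      rw [this, map_neg, LinearMap.trace_smulRight, innerₛₗ_apply_apply, hq2, neg_zero]
    rw [htr]
    simp [hq2]

end SphereExamples

/-! ### From the polar equation to the profile -/

section Profile

/-- The coordinate `z / |x|` along an arc. -/
def graphHeight (u : ℝ → ℝ) (s : ℝ) : ℝ := Real.cos s / √(u s ^ 2 + Real.sin s ^ 2)

/-- The derivative of the profile in terms of the polar equation. -/
def graphSlope (u v : ℝ → ℝ) (s : ℝ) : ℝ := -(velZ u v s / (u s * gradZ u v s))

theorem halfCone_eq_profileCone {n : ℕ} (hn : 3 ≤ n) {u f : ℝ → ℝ} {T : ℝ} (hu : ∀ s, 0 < u s)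
    (hmaps : ∀ s ∈ Icc (-(Real.pi / 2)) (Real.pi / 2), graphParam u s ∈ Icc (-T) T)
    (hsurj : ∀ t ∈ Icc (-T) T, ∃ s ∈ Icc (-(Real.pi / 2)) (Real.pi / 2), graphParam u s = t)
    (hf : ∀ s ∈ Icc (-(Real.pi / 2)) (Real.pi / 2), f (graphParam u s) = graphHeight u s) :
    halfCone n u = profileCone n T f := by
  have hw : ∀ s, 0 < √(u s ^ 2 + Real.sin s ^ 2) := fun s => by
    have := hu s
    exact Real.sqrt_pos.2 (by positivity)
  have hw2 : ∀ s, √(u s ^ 2 + Real.sin s ^ 2) ^ 2 = u s ^ 2 + Real.sin s ^ 2 := fun s =>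
    Real.sq_sqrt (by positivity)
  ext p
  have hB := norm_base_sq hn p
  constructor
  · rintro ⟨hz, hr⟩
    set s := polarAngle p with hs
    have hsI : s ∈ Icc (-(Real.pi / 2)) (Real.pi / 2) :=
      abs_le.1 (Complex.abs_arg_le_pi_div_two_iff.2 hz)
    have ha := axial_eq p
    have hh := height_eq p
    rw [← hs] at ha hh
    have hBw : ‖base p‖ = polarRadius p * √(u s ^ 2 + Real.sin s ^ 2) := by
      refine (pow_left_inj₀ (norm_nonneg _) (mul_nonneg (polarRadius_nonneg p) (hw s).le)
        two_ne_zero).1 ?_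
      rw [hB, hr, ha, mul_pow _ √_, hw2]
      ring
    rcases (polarRadius_nonneg p).eq_or_lt with hR | hR
    · rw [← hR, zero_mul] at hBw ha hh
      refine ⟨?_, ?_⟩
      · rw [ha, hBw]; simp
      · rw [hh, hBw]; simp
    · have hB0 : 0 < ‖base p‖ := by rw [hBw]; exact mul_pos hR (hw s)
      have ht : axial p / ‖base p‖ = graphParam u s := by
        rw [ha, hBw, graphParam, mul_div_mul_left _ _ hR.ne']
      refine ⟨?_, ?_⟩
      · have := abs_le.2 (hmaps s hsI)
        rwa [← ht, abs_div, abs_norm, div_le_iff₀ hB0] at this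
      · rw [ht, hf s hsI, hBw, hh, graphHeight]
        have := (hw s).ne'
        field_simp
  · rintro ⟨hT, hz⟩
    rcases (norm_nonneg (base p)).eq_or_lt with hB0 | hB0
    · rw [← hB0] at hB hz
      have h1 : radius p = 0 := by nlinarith [sq_nonneg (radius p), sq_nonneg (axial p)]
      have h2 : axial p = 0 := by nlinarith [sq_nonneg (radius p), sq_nonneg (axial p)]
      rw [zero_mul] at hz
      exact ⟨hz.ge, by rw [h1, polarRadius_eq_zero.2 ⟨h2, hz⟩, zero_mul]⟩
    · have htI : axial p / ‖base p‖ ∈ Icc (-T) T := by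
        rw [mem_Icc, ← abs_le, abs_div, abs_norm, div_le_iff₀ hB0]
        exact hT
      obtain ⟨s, hsI, hs⟩ := hsurj _ htI
      have hR : 0 < ‖base p‖ / √(u s ^ 2 + Real.sin s ^ 2) := div_pos hB0 (hw s)
      set R := ‖base p‖ / √(u s ^ 2 + Real.sin s ^ 2) with hRdef
      have ha : axial p = R * Real.sin s := by
        rw [graphParam, eq_div_iff hB0.ne'] at hs
        rw [← hs, hRdef]; ring
      have hh : height p = R * Real.cos s := by
        rw [hz, ← hs, hf s hsI, graphHeight, hRdef]; ring
      have hpl : planar p = planar (R • cyl n 0 (Real.sin s) (Real.cos s)) :=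
        Complex.ext (by rw [re_planar, re_planar, height_smul, height_cyl hn, hh])
          (by rw [im_planar, im_planar, axial_smul, axial_cyl hn, ha])
      have h1 : polarRadius p = R := by
        have : polarRadius p = polarRadius (R • cyl n 0 (Real.sin s) (Real.cos s)) := by
          rw [polarRadius, hpl, polarRadius]
        rw [this, polarRadius_smul hR.le, polarRadius_cyl hn, mul_one]
      have h2 : polarAngle p = s := by
        have : polarAngle p = polarAngle (R • cyl n 0 (Real.sin s) (Real.cos s)) := by
          rw [polarAngle, hpl, polarAngle]
        rw [this, polarAngle_smul hR, polarAngle_cyl hn _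
          ⟨by linarith [hsI.1, Real.pi_pos], by linarith [hsI.2, Real.pi_pos]⟩]
      refine ⟨by rw [hh]; exact mul_nonneg hR.le (Real.cos_nonneg_of_mem_Icc hsI), ?_⟩
      rw [h1, h2]
      refine (pow_left_inj₀ (radius_nonneg p) (mul_nonneg hR.le (hu s).le) two_ne_zero).1 ?_
      have h3 : ‖base p‖ = R * √(u s ^ 2 + Real.sin s ^ 2) := by
        rw [hRdef, div_mul_cancel₀ _ (hw s).ne']
      rw [h3, mul_pow, hw2, ha] at hB
      linear_combination -hB

theorem IsOrbit.hasDerivAt_graphHeight {m : ℕ} {u v : ℝ → ℝ} (h : IsOrbit m u v) (s : ℝ) :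
    HasDerivAt (graphHeight u)
      (-velZ u v s / ((u s ^ 2 + Real.sin s ^ 2) * √(u s ^ 2 + Real.sin s ^ 2))) s := by
  have hu := h.pos s
  have hpos : 0 < u s ^ 2 + Real.sin s ^ 2 := by positivity
  have hsq : √(u s ^ 2 + Real.sin s ^ 2) ^ 2 = u s ^ 2 + Real.sin s ^ 2 := Real.sq_sqrt hpos.le
  have hsp : 0 < √(u s ^ 2 + Real.sin s ^ 2) := Real.sqrt_pos.2 hpos
  have h1 := (((h.hasDerivAt_fst s).fun_pow 2).fun_add ((Real.hasDerivAt_sin s).fun_pow 2)).sqrt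
    hpos.ne'
  refine ((Real.hasDerivAt_cos s).fun_div h1 hsp.ne').congr_deriv ?_
  rw [hsq]
  unfold velZ
  norm_num
  field_simp
  rw [hsq]
  have hsc := Real.sin_sq_add_cos_sq s
  linear_combination (-Real.sin s) * hsc

/-- The profile equation, in terms of the polar equation. -/
theorem IsOrbit.hasDerivAt_graphSlope {m : ℕ} {u v : ℝ → ℝ} (h : IsOrbit m u v) {s : ℝ}
    (hz : gradZ u v s ≠ 0) : HasDerivAt (graphSlope u v)
      (-((m + 1) / u s ^ 2 + m * velZ u v s ^ 2 / (u s ^ 2 * gradZ u v s ^ 2 * (1 + u s ^ 2)))) s := by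
  have hu := h.pos s
  have ha : HasDerivAt (fun s => 1 + u s ^ 2) (2 * u s * v s) s := by
    simpa using ((h.hasDerivAt_fst s).fun_pow 2).const_add 1
  have hb := (h.hasDerivAt_fst s).fun_mul (h.hasDerivAt_snd s)
  have hv : HasDerivAt (velZ u v) _ s :=
    (ha.fun_mul (Real.hasDerivAt_sin s)).fun_add (hb.fun_mul (Real.hasDerivAt_cos s))
  have hd := (h.hasDerivAt_fst s).fun_mul (h.hasDerivAt_gradZ s)
  refine (hv.fun_div hd (mul_ne_zero hu.ne' hz)).fun_neg.congr_deriv ?_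
  have hne2 : (1 + u s ^ 2) ≠ 0 := by positivity
  have hV : velZ u v s = (1 + u s ^ 2) * Real.sin s + u s * v s * Real.cos s := rfl
  have hZ : gradZ u v s = u s * Real.cos s - v s * Real.sin s := rfl
  unfold force
  field_simp
  rw [hV, hZ]
  ring

/-- The intercept `f - t f'` of the tangent line of the profile, in terms of the polar equation. -/
theorem graphHeight_sub_mul_graphSlope {u v : ℝ → ℝ} {s : ℝ} (hu : 0 < u s) (hz : gradZ u v s ≠ 0) :
    graphHeight u s - graphParam u s * graphSlope u v s =
      √(u s ^ 2 + Real.sin s ^ 2) / (u s * gradZ u v s) := by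
  have hpos : 0 < u s ^ 2 + Real.sin s ^ 2 := by positivity
  have hsq : √(u s ^ 2 + Real.sin s ^ 2) ^ 2 = u s ^ 2 + Real.sin s ^ 2 := Real.sq_sqrt hpos.le
  have hw := (Real.sqrt_pos.2 hpos).ne'
  unfold graphHeight graphParam graphSlope
  field_simp
  rw [hsq]
  have hV : velZ u v s = (1 + u s ^ 2) * Real.sin s + u s * v s * Real.cos s := rfl
  have hZ : gradZ u v s = u s * Real.cos s - v s * Real.sin s := rfl
  rw [hV, hZ]
  linear_combination u s ^ 2 * Real.sin_sq_add_cos_sq s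

theorem one_sub_graphParam_sq {u : ℝ → ℝ} {s : ℝ} (hu : 0 < u s) :
    1 - graphParam u s ^ 2 = u s ^ 2 / (u s ^ 2 + Real.sin s ^ 2) := by
  have hpos : 0 < u s ^ 2 + Real.sin s ^ 2 := by positivity
  rw [graphParam, div_pow, Real.sq_sqrt hpos.le]
  field_simp
  ring

theorem one_add_graphHeight_sq {u : ℝ → ℝ} {s : ℝ} (hu : 0 < u s) :
    1 + graphHeight u s ^ 2 = (1 + u s ^ 2) / (u s ^ 2 + Real.sin s ^ 2) := by
  have hpos : 0 < u s ^ 2 + Real.sin s ^ 2 := by positivity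
  rw [graphHeight, div_pow, Real.sq_sqrt hpos.le]
  field_simp
  linear_combination Real.sin_sq_add_cos_sq s

/-- The angle under which a profile meets `{z = 0}`. -/
theorem IsOrbit.tendsto_arctan {m : ℕ} {u v : ℝ → ℝ} (h : IsOrbit m u v) {f σ : ℝ → ℝ}
    {l : Filter ℝ} (hσ : Tendsto σ l (𝓝 (Real.pi / 2)))
    (hev : ∀ᶠ t in l, 0 < gradZ u v (σ t) ∧ graphParam u (σ t) = t ∧
      deriv f t = graphSlope u v (σ t)) :
    Tendsto (fun t => Real.arctan (√(1 - t ^ 2) * |deriv f t|)) l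
      (𝓝 (Real.pi / 2 - Real.arctan (-v (Real.pi / 2) / √(1 + u (Real.pi / 2) ^ 2)))) := by
  set k : ℝ → ℝ := fun s =>
    Real.pi / 2 - Real.arctan (√(u s ^ 2 + Real.sin s ^ 2) * gradZ u v s / velZ u v s) with hk
  have hue := h.pos (Real.pi / 2)
  have hV : velZ u v (Real.pi / 2) = 1 + u (Real.pi / 2) ^ 2 := by simp [velZ]
  have hZ : gradZ u v (Real.pi / 2) = -v (Real.pi / 2) := by simp [gradZ]
  have hVpos : 0 < velZ u v (Real.pi / 2) := by rw [hV]; positivity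
  have hVc := h.continuous_velZ
  have hZc : Continuous (gradZ u v) :=
    continuous_iff_continuousAt.2 fun s => (h.hasDerivAt_gradZ s).continuousAt
  have hkc : ContinuousAt k (Real.pi / 2) := by
    refine continuousAt_const.sub (Real.continuous_arctan.continuousAt.comp
      (ContinuousAt.div ?_ hVc.continuousAt hVpos.ne'))
    have := h.continuous_fst
    fun_prop
  have hkv : k (Real.pi / 2) =
      Real.pi / 2 - Real.arctan (-v (Real.pi / 2) / √(1 + u (Real.pi / 2) ^ 2)) := by
    simp only [hk]
    rw [hV, hZ, Real.sin_pi_div_two, one_pow, add_comm (u _ ^ 2)]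
    have hs : √(1 + u (Real.pi / 2) ^ 2) ^ 2 = 1 + u (Real.pi / 2) ^ 2 :=
      Real.sq_sqrt (by positivity)
    have hs0 : √(1 + u (Real.pi / 2) ^ 2) ≠ 0 := (Real.sqrt_pos.2 (by positivity)).ne'
    congr 2
    rw [div_eq_div_iff (by positivity) hs0]
    linear_combination (-v (Real.pi / 2)) * hs
  rw [← hkv]
  refine (hkc.tendsto.comp hσ).congr' ?_
  filter_upwards [hev, (hVc.continuousAt.tendsto.comp hσ).eventually (lt_mem_nhds hVpos)]
    with t ⟨h1, h2, h3⟩ h4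
  have h4' : 0 < velZ u v (σ t) := h4
  have hu := h.pos (σ t)
  have hpos : 0 < u (σ t) ^ 2 + Real.sin (σ t) ^ 2 := by positivity
  have hw := Real.sqrt_pos.2 hpos
  have h5 : √(1 - t ^ 2) * |deriv f t| =
      (√(u (σ t) ^ 2 + Real.sin (σ t) ^ 2) * gradZ u v (σ t) / velZ u v (σ t))⁻¹ := by
    rw [h3, ← h2, one_sub_graphParam_sq hu, Real.sqrt_div (sq_nonneg _), Real.sqrt_sq hu.le, h2,
      graphSlope, abs_neg, abs_of_pos (by positivity)]
    field_simp
  rw [h5, Real.arctan_inv_of_pos (by positivity)]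
  rfl

theorem arctan_eq_iff {θ x : ℝ} (h0 : 0 < θ) (hθ : θ ≤ Real.pi / 2) :
    Real.pi / 2 - Real.arctan x = θ ↔ x = Real.cos θ / Real.sin θ := by
  have h1 : Real.cos θ / Real.sin θ = Real.tan (Real.pi / 2 - θ) := by
    rw [Real.tan_pi_div_two_sub, Real.tan_eq_sin_div_cos, inv_div]
  rw [h1]
  constructor
  · rintro rfl
    rw [sub_sub_cancel, Real.tan_arctan]
  · rintro rfl
    rw [Real.arctan_tan (by linarith [Real.pi_pos]) (by linarith), sub_sub_cancel]

theorem IsOrbit.strictAntiOn_gradZ {m : ℕ} (hm : 1 ≤ m) {u v : ℝ → ℝ} (h : IsOrbit m u v) :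
    StrictAntiOn (gradZ u v) (Icc 0 (Real.pi / 2)) := by
  have hZc : Continuous (gradZ u v) :=
    continuous_iff_continuousAt.2 fun s => (h.hasDerivAt_gradZ s).continuousAt
  refine strictAntiOn_of_deriv_neg (convex_Icc _ _) hZc.continuousOn fun r hr => ?_
  rw [interior_Icc] at hr
  rw [(h.hasDerivAt_gradZ r).deriv, neg_lt_zero]
  exact mul_pos (Real.sin_pos_of_pos_of_lt_pi hr.1 (by linarith [hr.2, Real.pi_pos]))
    (force_pos hm (h.pos r) _)

theorem IsContactOrbit.gradZ_pos {m : ℕ} (hm : 1 ≤ m) {θ : ℝ} {u v : ℝ → ℝ}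
    (h : IsContactOrbit m θ u v) (h0 : 0 < θ) (hθ : θ ≤ Real.pi / 2) {s : ℝ}
    (hs : s ∈ Ioo (-(Real.pi / 2)) (Real.pi / 2)) : 0 < gradZ u v s := by
  have ho := h.toIsOrbit
  have hv : v (Real.pi / 2) ≤ 0 := by
    rw [h.contact, neg_nonpos]
    exact mul_nonneg (div_nonneg (Real.cos_nonneg_of_mem_Icc ⟨by linarith, hθ⟩)
      (Real.sin_nonneg_of_nonneg_of_le_pi h0.le (by linarith [Real.pi_pos]))) (Real.sqrt_nonneg _)
  have hsymm : ∀ r, gradZ u v (-r) = gradZ u v r := fun r => by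
    obtain ⟨h1, h2⟩ := ho.symm_of_snd_eq_zero h.snd_zero r
    rw [mul_zero, zero_sub] at h1 h2
    rw [gradZ, gradZ, h1, Real.cos_neg, Real.sin_neg, ← h2]
    ring
  have hend : gradZ u v (Real.pi / 2) = -v (Real.pi / 2) := by simp [gradZ]
  have key : ∀ r, 0 ≤ r → r < Real.pi / 2 → 0 < gradZ u v r := fun r h1 h2 => by
    have := ho.strictAntiOn_gradZ hm ⟨h1, h2.le⟩ ⟨by linarith, le_rfl⟩ h2
    rw [hend] at this
    linarith
  rcases le_total 0 s with h1 | h1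
  · exact key s h1 hs.2
  · rw [← hsymm]
    exact key (-s) (by linarith) (by linarith [hs.1])

/-- A function defined by its composition with a continuous function on a compact set is
continuous. -/
theorem IsCompact.continuousOn_of_comp {X Y Z : Type*} [TopologicalSpace X] [TopologicalSpace Y]
    [T2Space Y] [TopologicalSpace Z] {K : Set X} (hK : IsCompact K) {g : X → Y} {k : X → Z}
    {f : Y → Z} (hg : ContinuousOn g K) (hk : ContinuousOn k K) (h : ∀ x ∈ K, f (g x) = k x) :
    ContinuousOn f (g '' K) := by
  rw [continuousOn_iff_isClosed]
  intro A hA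
  obtain ⟨B, hB, hBA⟩ := continuousOn_iff_isClosed.1 hk A hA
  refine ⟨g '' (k ⁻¹' A ∩ K), IsCompact.isClosed ?_, ?_⟩
  · rw [hBA]
    exact (hK.inter_left hB).image_of_continuousOn (hg.mono inter_subset_right)
  · ext y
    constructor
    · rintro ⟨hy, x, hx, rfl⟩
      exact ⟨⟨x, ⟨by rw [mem_preimage, ← h x hx]; exact hy, hx⟩, rfl⟩, x, hx, rfl⟩
    · rintro ⟨⟨x, ⟨hxA, hx⟩, rfl⟩, -⟩
      exact ⟨by rw [mem_preimage, h x hx]; exact hxA, x, hx, rfl⟩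

/-- The cone over a solution with the contact angle `θ` is the axisymmetric cone. -/
theorem IsContactOrbit.exists_profile {n : ℕ} (hn : 3 ≤ n) {θ : ℝ} {u v : ℝ → ℝ}
    (h : IsContactOrbit (n - 2) θ u v) (h0 : 0 < θ) (hθ : θ ≤ Real.pi / 2) :
    ∃ T f, IsAxisymmetricProfile n θ T f ∧ halfCone n u = profileCone n T f := by
  have ho := h.toIsOrbit
  have hpi : 0 < Real.pi / 2 := by positivity
  set c := Real.pi / 2 with hc
  have hm : ((n - 2 : ℕ) : ℝ) = n - 2 := by rw [Nat.cast_sub (by omega)]; norm_num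
  have hZ : ∀ s ∈ Ioo (-c) c, 0 < gradZ u v s := fun s hs => h.gradZ_pos (by omega) h0 hθ hs
  have hr : ∀ s, 0 < u s ^ 2 + Real.sin s ^ 2 := fun s => by
    have := ho.pos s
    positivity
  set g := graphParam u with hg
  have hgd : ∀ s, HasDerivAt g _ s := ho.hasDerivAt_graphParam
  have hgc : Continuous g := continuous_iff_continuousAt.2 fun s => (hgd s).continuousAt
  have hgpos : ∀ s ∈ Ioo (-c) c, 0 < u s * gradZ u v s /
      ((u s ^ 2 + Real.sin s ^ 2) * √(u s ^ 2 + Real.sin s ^ 2)) := fun s hs =>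
    div_pos (mul_pos (ho.pos s) (hZ s hs)) (mul_pos (hr s) (Real.sqrt_pos.2 (hr s)))
  have hmono : StrictMonoOn g (Icc (-c) c) := by
    refine strictMonoOn_of_deriv_pos (convex_Icc _ _) hgc.continuousOn fun s hs => ?_
    rw [interior_Icc] at hs
    rw [(hgd s).deriv]
    exact hgpos s hs
  have hsymm : ∀ r, g (-r) = -g r := fun r => by
    obtain ⟨h1, -⟩ := ho.symm_of_snd_eq_zero h.snd_zero r
    rw [mul_zero, zero_sub] at h1
    simp only [hg, graphParam, h1, Real.sin_neg, neg_sq, neg_div]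
  set T := g c with hT
  have hgl : g (-c) = -T := hsymm c
  have hmemc : c ∈ Icc (-c) c := ⟨by linarith, le_rfl⟩
  have hmemc' : -c ∈ Icc (-c) c := ⟨le_rfl, by linarith⟩
  have himg : g '' Icc (-c) c = Icc (-T) T := by
    refine Subset.antisymm ?_ ?_
    · rintro _ ⟨s, hs, rfl⟩
      exact ⟨by rw [← hgl]; exact hmono.monotoneOn hmemc' hs hs.1,
        hmono.monotoneOn hs hmemc hs.2⟩
    · rw [← hgl]
      exact intermediate_value_Icc (by linarith) hgc.continuousOn
  set σ := Function.invFunOn g (Icc (-c) c) with hσ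
  have hσg : ∀ s ∈ Icc (-c) c, σ (g s) = s := fun s hs => hmono.injOn.leftInvOn_invFunOn hs
  set f : ℝ → ℝ := fun t => graphHeight u (σ t) with hf
  have hfg : ∀ s ∈ Icc (-c) c, f (g s) = graphHeight u s := fun s hs => by rw [hf]; simp only [hσg s hs]
  have hkc : Continuous (graphHeight u) :=
    continuous_iff_continuousAt.2 fun s => (ho.hasDerivAt_graphHeight s).continuousAt
  have hfc : ContinuousOn f (Icc (-T) T) := by
    rw [← himg]
    exact isCompact_Icc.continuousOn_of_comp hgc.continuousOn hkc.continuousOn hfg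
  have hσc : ContinuousOn σ (Icc (-T) T) := by
    rw [← himg]
    exact isCompact_Icc.continuousOn_of_comp hgc.continuousOn continuousOn_id hσg
  have hpre : ∀ t ∈ Ioo (-T) T, ∃ s ∈ Ioo (-c) c, g s = t := by
    intro t ht
    obtain ⟨s, hs, rfl⟩ := himg.superset (Ioo_subset_Icc_self ht)
    refine ⟨s, ⟨hs.1.lt_of_ne ?_, hs.2.lt_of_ne ?_⟩, rfl⟩
    · rintro rfl
      rw [hgl] at ht
      exact lt_irrefl _ ht.1
    · rintro rfl
      exact lt_irrefl _ ht.2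
  -- by the inverse function theorem the profile is smooth in the interior
  have hsm : ∀ s ∈ Ioo (-c) c, ContDiffAt ℝ ∞ f (g s) := by
    intro s hs
    have hu := ho.contDiff.1
    have hws : ContDiff ℝ ∞ fun s => √(u s ^ 2 + Real.sin s ^ 2) :=
      ((hu.pow 2).add (Real.contDiff_sin.pow 2)).sqrt fun s => (hr s).ne'
    have hgs : ContDiff ℝ ∞ g :=
      Real.contDiff_sin.div hws fun s => (Real.sqrt_pos.2 (hr s)).ne'
    have hks : ContDiff ℝ ∞ (graphHeight u) :=
      Real.contDiff_cos.div hws fun s => (Real.sqrt_pos.2 (hr s)).ne'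
    set G : ℝ × ℝ → ℝ := fun x => g x.2 - x.1 with hG
    have hGs : ContDiff ℝ ∞ G := (hgs.comp contDiff_snd).sub contDiff_fst
    obtain ⟨ψ, hψ0, hψs, hψ⟩ := exists_implicit (G := G) (a := g s) (b := s) hGs.contDiffAt
      (by simp [hG]) (by
        have h1 : HasFDerivAt G (fderiv ℝ G (g s, s)) (g s, s) :=
          (hGs.differentiable (by simp) _).hasFDerivAt
        have h2 : HasDerivAt (fun r : ℝ => ((g s, r) : ℝ × ℝ)) (0, 1) s :=
          (hasDerivAt_const s (g s)).prodMk (hasDerivAt_id s)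
        have h3 : HasDerivAt (fun r => g r - g s) _ s := h1.comp_hasDerivAt s h2
        rw [h3.unique ((hgd s).sub_const (g s))]
        exact (hgpos s hs).ne')
    refine (hks.contDiffAt.comp (g s) hψs).congr_of_eventuallyEq ?_
    have hψI : ∀ᶠ t in 𝓝 (g s), ψ t ∈ Ioo (-c) c :=
      hψs.continuousAt.eventually (by rw [hψ0]; exact Ioo_mem_nhds hs.1 hs.2)
    filter_upwards [hψ, hψI] with t ht htI
    have : g (ψ t) = t := sub_eq_zero.1 ht
    rw [Function.comp_apply, ← hfg _ (Ioo_subset_Icc_self htI), this]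
  have hIoo : ∀ s ∈ Ioo (-c) c, ∀ᶠ r in 𝓝 s, r ∈ Ioo (-c) c := fun s hs => Ioo_mem_nhds hs.1 hs.2
  have hd1 : ∀ s ∈ Ioo (-c) c, deriv f (g s) = graphSlope u v s := by
    intro s hs
    have e1 : HasDerivAt (fun r => f (g r)) (deriv f (g s) * _) s :=
      ((hsm s hs).differentiableAt (by simp)).hasDerivAt.comp s (hgd s)
    have e2 : HasDerivAt (fun r => f (g r)) _ s := (ho.hasDerivAt_graphHeight s).congr_of_eventuallyEq
      ((hIoo s hs).mono fun r hr => hfg r (Ioo_subset_Icc_self hr))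
    have e3 := e1.unique e2
    have hZs := (hZ s hs).ne'
    have hus := (ho.pos s).ne'
    have hrs := (hr s).ne'
    have hws := (Real.sqrt_pos.2 (hr s)).ne'
    rw [graphSlope]
    field_simp at e3 ⊢
    linear_combination e3
  have hd2 : ∀ s ∈ Ioo (-c) c, deriv (deriv f) (g s) * (u s * gradZ u v s /
      ((u s ^ 2 + Real.sin s ^ 2) * √(u s ^ 2 + Real.sin s ^ 2))) =
      -((((n - 2 : ℕ) : ℝ) + 1) / u s ^ 2 +
        ((n - 2 : ℕ) : ℝ) * velZ u v s ^ 2 / (u s ^ 2 * gradZ u v s ^ 2 * (1 + u s ^ 2))) := by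
    intro s hs
    have e0 : ContDiffAt ℝ 1 (deriv f) (g s) :=
      (((hsm s hs).of_le two_le_infty).fderiv_right (m := 1) (by norm_num)).clm_apply contDiffAt_const
    have e1 : HasDerivAt (fun r => deriv f (g r)) (deriv (deriv f) (g s) * _) s :=
      (e0.differentiableAt (by norm_num)).hasDerivAt.comp s (hgd s)
    have e2 := (ho.hasDerivAt_graphSlope (hZ s hs).ne').congr_of_eventuallyEq
      ((hIoo s hs).mono fun r hr => hd1 r hr)
    exact e1.unique e2
  have hTpos : 0 < T := by
    have : g 0 = 0 := by simp [hg, graphParam]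
    rw [← this]
    exact hmono ⟨by linarith, hpi.le⟩ hmemc hpi
  refine ⟨T, f, ⟨hTpos, ?_, hfc, ?_, ?_, ?_, ?_, ?_, ?_, ?_⟩, ?_⟩
  · have h1 := one_sub_graphParam_sq (ho.pos c)
    have h2 : 0 < u c ^ 2 / (u c ^ 2 + Real.sin c ^ 2) :=
      div_pos (pow_pos (ho.pos c) 2) (hr c)
    change 1 - T ^ 2 = _ at h1
    nlinarith
  · intro t ht
    obtain ⟨s, hs, rfl⟩ := hpre t ht
    exact (hsm s hs).contDiffWithinAt
  · intro t ht
    obtain ⟨s, hs, rfl⟩ := hpre t ht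
    rw [hfg s (Ioo_subset_Icc_self hs)]
    exact div_pos (Real.cos_pos_of_mem_Ioo hs) (Real.sqrt_pos.2 (hr s))
  · have : g 0 = 0 := by simp [hg, graphParam]
    have e := hd1 0 ⟨by linarith, hpi⟩
    rw [this] at e
    rw [e, graphSlope, velZ, h.snd_zero]
    simp
  · intro t ht
    obtain ⟨s, hs, rfl⟩ := hpre t ht
    have hZs := (hZ s hs).ne'
    have hus := (ho.pos s).ne'
    have hrs := (hr s).ne'
    have hws := (Real.sqrt_pos.2 (hr s)).ne'
    have hw2 := Real.sq_sqrt (hr s).le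
    have hu1 : 1 + u s ^ 2 ≠ 0 := by positivity
    have e2 := hd2 s hs
    rw [hm] at e2
    have e3 : deriv (deriv f) (g s) = -((((n : ℝ) - 2) + 1) / u s ^ 2 +
        ((n : ℝ) - 2) * velZ u v s ^ 2 / (u s ^ 2 * gradZ u v s ^ 2 * (1 + u s ^ 2))) *
        ((u s ^ 2 + Real.sin s ^ 2) * √(u s ^ 2 + Real.sin s ^ 2)) / (u s * gradZ u v s) := by
      rw [← e2]
      field_simp
    rw [e3, hd1 s hs, hfg s (Ioo_subset_Icc_self hs), one_add_graphHeight_sq (ho.pos s),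
      graphHeight_sub_mul_graphSlope (ho.pos s) hZs, one_sub_graphParam_sq (ho.pos s), graphSlope]
    field_simp
    ring
  · rw [← hgl, hfg _ hmemc', graphHeight, Real.cos_neg, hc, Real.cos_pi_div_two, zero_div]
  · rw [hT, hfg _ hmemc, graphHeight, hc, Real.cos_pi_div_two, zero_div]
  · have hlim : Tendsto σ (𝓝[<] T) (𝓝 c) := by
      have h1 : Tendsto σ (𝓝[Icc (-T) T] T) (𝓝 (σ T)) := hσc T ⟨by linarith, le_rfl⟩
      rw [hT, hσg c hmemc] at h1
      refine h1.mono_left ?_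
      rw [← nhdsWithin_Ioo_eq_nhdsLT (show -g c < g c by rw [← hT]; linarith)]
      exact nhdsWithin_mono _ Ioo_subset_Icc_self
    have := ho.tendsto_arctan (f := f) hlim (by
      filter_upwards [Ioo_mem_nhdsLT (show -T < T by linarith)] with t ht
      obtain ⟨s, hs, rfl⟩ := hpre t ht
      rw [hσg s (Ioo_subset_Icc_self hs)]
      exact ⟨hZ s hs, rfl, hd1 s hs⟩)
    rwa [(arctan_eq_iff h0 hθ).2 ?_] at this
    have hs : √(1 + u (Real.pi / 2) ^ 2) ≠ 0 := (Real.sqrt_pos.2 (by positivity)).ne'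
    rw [h.contact, neg_neg, mul_div_cancel_right₀ _ hs]
  · refine halfCone_eq_profileCone hn ho.pos (fun s hs => himg.subset (mem_image_of_mem _ hs))
      (fun t ht => ?_) hfg
    obtain ⟨s, hs, hst⟩ := himg.superset ht
    exact ⟨s, hs, hst⟩

end Profile

/-! ### From the profile to the polar equation -/

section FromProfile

/-- `profileAngle f t` is the polar angle of the point of the profile with parameter `t`. -/
def profileAngle (f : ℝ → ℝ) (t : ℝ) : ℝ := Real.arctan (t / f t)

/-- The ratio `|x'| / r` at the point of the profile with parameter `t`. -/
def profileRatio (f : ℝ → ℝ) (t : ℝ) : ℝ := √((1 - t ^ 2) / (t ^ 2 + f t ^ 2))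

/-- The derivative of `profileRatio` with respect to `profileAngle`. -/
def profileRatioDeriv (f : ℝ → ℝ) (t : ℝ) : ℝ :=
  -((t * (1 + f t ^ 2) + f t * deriv f t * (1 - t ^ 2)) /
    ((t ^ 2 + f t ^ 2) * (f t - t * deriv f t))) / profileRatio f t

variable {n : ℕ} {θ T : ℝ} {f : ℝ → ℝ}

theorem IsAxisymmetricProfile.hasDerivAt (h : IsAxisymmetricProfile n θ T f) {t : ℝ}
    (ht : t ∈ Ioo (-T) T) : HasDerivAt f (deriv f t) t :=
  ((h.contDiffOn.contDiffAt (Ioo_mem_nhds ht.1 ht.2)).differentiableAt (by simp)).hasDerivAt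

theorem IsAxisymmetricProfile.contDiffAt_deriv (h : IsAxisymmetricProfile n θ T f) {t : ℝ}
    (ht : t ∈ Ioo (-T) T) : ContDiffAt ℝ 1 (deriv f) t :=
  (((h.contDiffOn.contDiffAt (Ioo_mem_nhds ht.1 ht.2)).of_le two_le_infty).fderiv_right (m := 1)
    (by norm_num)).clm_apply contDiffAt_const

/-- The coefficient of `f - t f'` in the profile equation. -/
def profileCoeff (n : ℕ) (f : ℝ → ℝ) (t : ℝ) : ℝ :=
  ((n : ℝ) - 1) / (1 - t ^ 2) + ((n : ℝ) - 2) * (deriv f t) ^ 2 / (1 + f t ^ 2)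

theorem IsAxisymmetricProfile.hasDerivAt_deriv (h : IsAxisymmetricProfile n θ T f) {t : ℝ}
    (ht : t ∈ Ioo (-T) T) :
    HasDerivAt (deriv f) (-((f t - t * deriv f t) * profileCoeff n f t)) t := by
  have h1 := ((h.contDiffAt_deriv ht).differentiableAt (by norm_num)).hasDerivAt
  have h2 := h.equation t ht
  rwa [show deriv (deriv f) t = -((f t - t * deriv f t) * profileCoeff n f t) by
    rw [profileCoeff]; linarith] at h1

theorem IsAxisymmetricProfile.hasDerivAt_sub (h : IsAxisymmetricProfile n θ T f) {t : ℝ}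
    (ht : t ∈ Ioo (-T) T) : HasDerivAt (fun t => f t - t * deriv f t)
      (t * profileCoeff n f t * (f t - t * deriv f t)) t := by
  refine ((h.hasDerivAt ht).fun_sub ((hasDerivAt_id t).fun_mul (h.hasDerivAt_deriv ht))).congr_deriv ?_
  simp only [id]
  ring

theorem IsAxisymmetricProfile.sq_lt_one (h : IsAxisymmetricProfile n θ T f) {t : ℝ}
    (ht : t ∈ Ioo (-T) T) : 0 < 1 - t ^ 2 := by
  have := h.T_lt_one
  nlinarith [ht.1, ht.2]

/-- The tangent lines of the profile do not pass through the origin: the function `f - t f'`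
satisfies a linear equation of first order and is positive for `t = 0`. -/
theorem IsAxisymmetricProfile.sub_pos (h : IsAxisymmetricProfile n θ T f) {t : ℝ}
    (ht : t ∈ Ioo (-T) T) : 0 < f t - t * deriv f t := by
  have h0T : (0 : ℝ) ∈ Ioo (-T) T := ⟨by linarith [h.T_pos], h.T_pos⟩
  have h0 : 0 < f 0 - 0 * deriv f 0 := by rw [zero_mul, sub_zero]; exact h.pos 0 h0T
  have hcont : ContinuousOn (fun t => f t - t * deriv f t) (Ioo (-T) T) := fun t ht =>
    (h.hasDerivAt_sub ht).continuousAt.continuousWithinAt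
  have hne : ∀ t ∈ Ioo (-T) T, f t - t * deriv f t ≠ 0 := by
    intro t ht hz
    have hsub : Icc (min 0 t) (max 0 t) ⊆ Ioo (-T) T := fun r hr =>
      ⟨(lt_min h0T.1 ht.1).trans_le hr.1, hr.2.trans_lt (max_lt h0T.2 ht.2)⟩
    have hc : ContinuousOn (fun t => t * profileCoeff n f t) (Icc (min 0 t) (max 0 t)) := by
      intro r hr
      have h1 := (h.sq_lt_one (hsub hr)).ne'
      have h2 : 1 + f r ^ 2 ≠ 0 := by positivity
      have h3 := (h.hasDerivAt (hsub hr)).continuousAt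
      have h4 := (h.hasDerivAt_deriv (hsub hr)).continuousAt
      have h5 : ContinuousAt (fun t : ℝ => ((n : ℝ) - 1) / (1 - t ^ 2)) r :=
        ContinuousAt.div (by fun_prop) (by fun_prop) h1
      have h6 : ContinuousAt (fun t => ((n : ℝ) - 2) * (deriv f t) ^ 2 / (1 + f t ^ 2)) r :=
        ContinuousAt.div (by fun_prop) (by fun_prop) h2
      exact ContinuousAt.continuousWithinAt (continuousAt_id.mul (h5.add h6))
    obtain ⟨K, hK⟩ := isCompact_Icc.exists_bound_of_continuousOn hc
    have heq := ode_eqOn_Icc (v := fun t y => t * profileCoeff n f t * y) (s := univ)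
      (K := K.toNNReal) (t₀ := t) (g := fun _ => (0 : ℝ))
      (fun r hr => LipschitzOnWith.of_dist_le_mul fun x _ y _ => by
        have h5 := hK r hr
        rw [Real.dist_eq, Real.dist_eq, ← mul_sub, abs_mul,
          Real.coe_toNNReal _ ((norm_nonneg _).trans h5)]
        exact mul_le_mul_of_nonneg_right h5 (abs_nonneg _))
      ⟨min_le_right _ _, le_max_right _ _⟩
      (fun r hr => (h.hasDerivAt_sub (hsub hr)).hasDerivWithinAt) (fun _ _ => trivial)
      (fun r _ => by simpa using hasDerivWithinAt_const r _ (0 : ℝ)) (fun _ _ => trivial) hz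
    have := heq ⟨min_le_left _ _, le_max_left _ _⟩
    exact h0.ne' this
  by_contra hlt
  push Not at hlt
  obtain ⟨r, hr, hr0⟩ := isPreconnected_Ioo.intermediate_value ht h0T hcont ⟨hlt, h0.le⟩
  exact hne r hr hr0

theorem IsAxisymmetricProfile.hasDerivAt_profileAngle (h : IsAxisymmetricProfile n θ T f) {t : ℝ}
    (ht : t ∈ Ioo (-T) T) : HasDerivAt (profileAngle f)
      ((f t - t * deriv f t) / (t ^ 2 + f t ^ 2)) t := by
  have hf := h.pos t ht
  refine ((hasDerivAt_id t).fun_div (h.hasDerivAt ht) hf.ne').arctan.congr_deriv ?_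
  have : 0 < t ^ 2 + f t ^ 2 := by positivity
  simp only [id]
  field_simp
  ring

theorem IsAxisymmetricProfile.profileRatio_pos (h : IsAxisymmetricProfile n θ T f) {t : ℝ}
    (ht : t ∈ Ioo (-T) T) : 0 < profileRatio f t := by
  have := h.pos t ht
  exact Real.sqrt_pos.2 (div_pos (h.sq_lt_one ht) (by positivity))

theorem IsAxisymmetricProfile.profileRatio_sq (h : IsAxisymmetricProfile n θ T f) {t : ℝ}
    (ht : t ∈ Ioo (-T) T) : profileRatio f t ^ 2 = (1 - t ^ 2) / (t ^ 2 + f t ^ 2) := by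
  have := h.pos t ht
  exact Real.sq_sqrt (div_nonneg (h.sq_lt_one ht).le (by positivity))

theorem IsAxisymmetricProfile.hasDerivAt_profileRatio (h : IsAxisymmetricProfile n θ T f) {t : ℝ}
    (ht : t ∈ Ioo (-T) T) : HasDerivAt (profileRatio f)
      ((f t - t * deriv f t) / (t ^ 2 + f t ^ 2) * profileRatioDeriv f t) t := by
  have hf := h.pos t ht
  have h1 := h.sq_lt_one ht
  have h2 : 0 < t ^ 2 + f t ^ 2 := by positivity
  have h3 := (h.sub_pos ht).ne'
  have h4 := (h.profileRatio_pos ht).ne'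
  have ha : HasDerivAt (fun t : ℝ => 1 - t ^ 2) (-(2 * t)) t := by
    simpa using ((hasDerivAt_id t).fun_pow 2).const_sub 1
  have hb : HasDerivAt (fun t : ℝ => t ^ 2 + f t ^ 2) (2 * t + 2 * f t * deriv f t) t := by
    simpa using ((hasDerivAt_id t).fun_pow 2).fun_add ((h.hasDerivAt ht).fun_pow 2)
  refine ((ha.fun_div hb h2.ne').sqrt (div_pos h1 h2).ne').congr_deriv ?_
  change _ / (2 * profileRatio f t) = _
  rw [profileRatioDeriv]
  field_simp
  ring

theorem IsAxisymmetricProfile.hasDerivAt_profileRatioDeriv (hn : 3 ≤ n)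
    (h : IsAxisymmetricProfile n θ T f) {t : ℝ} (ht : t ∈ Ioo (-T) T) :
    HasDerivAt (profileRatioDeriv f) ((f t - t * deriv f t) / (t ^ 2 + f t ^ 2) *
      (force (n - 2) (profileRatio f t) (profileRatioDeriv f t) - profileRatio f t)) t := by
  have hf := h.pos t ht
  have h1 := (h.sq_lt_one ht).ne'
  have h2 : t ^ 2 + f t ^ 2 ≠ 0 := by positivity
  have h3 := (h.sub_pos ht).ne'
  have h4 := (h.profileRatio_pos ht).ne'
  have h5 : 1 + f t ^ 2 ≠ 0 := by positivity
  have hm : ((n - 2 : ℕ) : ℝ) = n - 2 := by rw [Nat.cast_sub (by omega)]; norm_num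
  have ha : HasDerivAt (fun t : ℝ => 1 - t ^ 2) (-(2 * t)) t := by
    simpa using ((hasDerivAt_id t).fun_pow 2).const_sub 1
  have hb : HasDerivAt (fun t : ℝ => t ^ 2 + f t ^ 2) (2 * t + 2 * f t * deriv f t) t := by
    simpa using ((hasDerivAt_id t).fun_pow 2).fun_add ((h.hasDerivAt ht).fun_pow 2)
  have hc : HasDerivAt (fun t : ℝ => 1 + f t ^ 2) (2 * f t * deriv f t) t := by
    simpa using ((h.hasDerivAt ht).fun_pow 2).const_add 1
  have hnum := ((hasDerivAt_id t).fun_mul hc).fun_add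
    (((h.hasDerivAt ht).fun_mul (h.hasDerivAt_deriv ht)).fun_mul ha)
  have hden := hb.fun_mul (h.hasDerivAt_sub ht)
  have hW := (hnum.fun_div hden (mul_ne_zero h2 h3)).fun_neg
  refine (hW.fun_div (h.hasDerivAt_profileRatio ht) h4).congr_deriv ?_
  have hU2 := h.profileRatio_sq ht
  simp only [id]
  rw [force, hm, profileRatioDeriv, profileCoeff]
  set U := profileRatio f t with hU
  set F := f t
  set G := deriv f t
  set W := -((t * (1 + F ^ 2) + F * G * (1 - t ^ 2)) / ((t ^ 2 + F ^ 2) * (F - t * G))) with hWdef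
  set μ := F - t * G with hμ
  set ρ := t ^ 2 + F ^ 2 with hρ
  generalize hW' : -(_ / (ρ * μ) ^ 2) = W'
  have hU1 : 1 + U ^ 2 ≠ 0 := by positivity
  have key : W' - μ / ρ * (W ^ 2 / U ^ 2) =
      μ / ρ * (((n : ℝ) - 2) * (1 + W ^ 2 / U ^ 2 / (1 + U ^ 2)) - U ^ 2) := by
    rw [← hW', hWdef, hU2]
    have h7 : 1 + (1 - t ^ 2) / ρ = (1 + F ^ 2) / ρ := by
      rw [hρ]; field_simp; ring
    rw [h7]
    field_simp
    rw [hμ, hρ]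
    ring
  have e1 : (W' * U - W * (μ / ρ * (W / U))) / U ^ 2 =
      (W' - μ / ρ * (W ^ 2 / U ^ 2)) / U := by
    field_simp
  rw [e1, key]
  field_simp

theorem IsAxisymmetricProfile.tendsto_profileAngle (h : IsAxisymmetricProfile n θ T f) :
    Tendsto (profileAngle f) (𝓝[<] T) (𝓝 (Real.pi / 2)) ∧
      Tendsto (profileAngle f) (𝓝[>] (-T)) (𝓝 (-(Real.pi / 2))) := by
  have hT : -T < T := by linarith [h.T_pos]
  constructor
  · have h1 : Tendsto f (𝓝[<] T) (𝓝[>] 0) := by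
      refine tendsto_nhdsWithin_iff.2 ⟨?_, ?_⟩
      · have h2 := h.continuousOn T ⟨hT.le, le_rfl⟩
        rw [ContinuousWithinAt, h.right_zero] at h2
        refine h2.mono_left ?_
        rw [← nhdsWithin_Ioo_eq_nhdsLT hT]
        exact nhdsWithin_mono _ Ioo_subset_Icc_self
      · filter_upwards [Ioo_mem_nhdsLT hT] with t ht using h.pos t ht
    have h3 : Tendsto (fun t : ℝ => t) (𝓝[<] T) (𝓝 T) := tendsto_id.mono_left nhdsWithin_le_nhds
    exact (Real.tendsto_arctan_atTop.mono_right nhdsWithin_le_nhds).comp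
      (h3.pos_mul_atTop h.T_pos (tendsto_inv_nhdsGT_zero.comp h1))
  · have h1 : Tendsto f (𝓝[>] (-T)) (𝓝[>] 0) := by
      refine tendsto_nhdsWithin_iff.2 ⟨?_, ?_⟩
      · have h2 := h.continuousOn (-T) ⟨le_rfl, hT.le⟩
        rw [ContinuousWithinAt, h.left_zero] at h2
        refine h2.mono_left ?_
        rw [← nhdsWithin_Ioo_eq_nhdsGT hT]
        exact nhdsWithin_mono _ Ioo_subset_Icc_self
      · filter_upwards [Ioo_mem_nhdsGT hT] with t ht using h.pos t ht
    have h3 : Tendsto (fun t : ℝ => t) (𝓝[>] (-T)) (𝓝 (-T)) :=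
      tendsto_id.mono_left nhdsWithin_le_nhds
    exact (Real.tendsto_arctan_atBot.mono_right nhdsWithin_le_nhds).comp
      (h3.neg_mul_atTop (by linarith [h.T_pos]) (tendsto_inv_nhdsGT_zero.comp h1))

/-- The profile is determined by the solution of the polar equation with the same initial values. -/
theorem IsAxisymmetricProfile.exists_contactOrbit (hn : 3 ≤ n) (h : IsAxisymmetricProfile n θ T f)
    (h0 : 0 < θ) (hθ : θ ≤ Real.pi / 2) :
    ∃ u v, IsContactOrbit (n - 2) θ u v ∧ halfCone n u = profileCone n T f := by
  have hT : -T < T := by linarith [h.T_pos]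
  have h0T : (0 : ℝ) ∈ Ioo (-T) T := ⟨by linarith [h.T_pos], h.T_pos⟩
  obtain ⟨u, v, ho, hu0, hv0⟩ := exists_isOrbit (m := n - 2) (by omega) 0
    (h.profileRatio_pos h0T) (profileRatioDeriv f 0)
  set φ := profileAngle f with hφ
  have hφ0 : φ 0 = 0 := by simp [hφ, profileAngle]
  have hφd : ∀ t ∈ Ioo (-T) T, HasDerivAt φ _ t := fun t ht => h.hasDerivAt_profileAngle ht
  have hspeed : ∀ t ∈ Ioo (-T) T, 0 < (f t - t * deriv f t) / (t ^ 2 + f t ^ 2) := fun t ht => by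
    have := h.pos t ht
    exact div_pos (h.sub_pos ht) (by positivity)
  have heq : ∀ t ∈ Ioo (-T) T, profileRatio f t = u (φ t) ∧ profileRatioDeriv f t = v (φ t) := by
    intro t ht
    have hsub : Icc (min 0 t) (max 0 t) ⊆ Ioo (-T) T := fun r hr =>
      ⟨(lt_min h0T.1 ht.1).trans_le hr.1, hr.2.trans_lt (max_lt h0T.2 ht.2)⟩
    refine orbit_eqOn_Icc_of_speed (n - 2) (a := min 0 t) (b := max 0 t) (t₀ := 0)
      ⟨min_le_left _ _, le_max_left _ _⟩
      (σ := fun t => (f t - t * deriv f t) / (t ^ 2 + f t ^ 2)) ?_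
      (fun r hr => h.profileRatio_pos (hsub hr)) (fun r _ => ho.pos (φ r))
      (fun r hr => (h.hasDerivAt_profileRatio (hsub hr)).hasDerivWithinAt)
      (fun r hr => (h.hasDerivAt_profileRatioDeriv hn (hsub hr)).hasDerivWithinAt)
      (p := fun t => u (φ t)) (q := fun t => v (φ t)) (fun r hr => ?_) (fun r hr => ?_)
      (by simp only [hφ0, hu0]) (by simp only [hφ0, hv0]) t ⟨min_le_right _ _, le_max_right _ _⟩
    · intro r hr
      have h1 := h.pos r (hsub hr)
      have h2 := (h.hasDerivAt_sub (hsub hr)).continuousAt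
      have h3 := (h.hasDerivAt (hsub hr)).continuousAt
      exact (h2.div (f := fun t => f t - t * deriv f t) (g := fun t => t ^ 2 + f t ^ 2)
        (by fun_prop) (by positivity)).continuousWithinAt
    · rw [mul_comm]
      exact ((ho.hasDerivAt_fst (φ r)).comp r (hφd r (hsub hr))).hasDerivWithinAt
    · rw [mul_comm]
      exact ((ho.hasDerivAt_snd (φ r)).comp r (hφd r (hsub hr))).hasDerivWithinAt
  have hv00 : v 0 = 0 := by
    rw [hv0, profileRatioDeriv, h.deriv_zero]
    simp
  have hr : ∀ s, 0 < u s ^ 2 + Real.sin s ^ 2 := fun s => by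
    have := ho.pos s
    positivity
  have hsc : ∀ t ∈ Ioo (-T) T, Real.sin (φ t) = t / √(t ^ 2 + f t ^ 2) ∧
      Real.cos (φ t) = f t / √(t ^ 2 + f t ^ 2) := by
    intro t ht
    have hf := h.pos t ht
    have h1 : √(1 + (t / f t) ^ 2) = √(t ^ 2 + f t ^ 2) / f t := by
      rw [← Real.sqrt_sq hf.le, ← Real.sqrt_div (by positivity), Real.sqrt_sq hf.le]
      congr 1
      field_simp
      ring
    have h2 : √(t ^ 2 + f t ^ 2) ≠ 0 := (Real.sqrt_pos.2 (by positivity)).ne'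
    simp only [hφ, profileAngle, Real.sin_arctan, Real.cos_arctan, h1]
    constructor <;> field_simp
  have hgh : ∀ t ∈ Ioo (-T) T, graphParam u (φ t) = t ∧ graphHeight u (φ t) = f t := by
    intro t ht
    have hf := h.pos t ht
    have hρ : 0 < t ^ 2 + f t ^ 2 := by positivity
    have h1 : √(u (φ t) ^ 2 + Real.sin (φ t) ^ 2) = 1 / √(t ^ 2 + f t ^ 2) := by
      rw [← (heq t ht).1, h.profileRatio_sq ht, (hsc t ht).1, div_pow, Real.sq_sqrt hρ.le, ← add_div,
        sub_add_cancel, Real.sqrt_div zero_le_one, Real.sqrt_one]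
    have h2 : √(t ^ 2 + f t ^ 2) ≠ 0 := (Real.sqrt_pos.2 hρ).ne'
    rw [graphParam, graphHeight, h1, (hsc t ht).1, (hsc t ht).2]
    constructor <;> field_simp
  have hslope : ∀ t ∈ Ioo (-T) T, 0 < gradZ u v (φ t) ∧ graphParam u (φ t) = t ∧
      deriv f t = graphSlope u v (φ t) := by
    intro t ht
    have hI := Ioo_mem_nhds ht.1 ht.2
    have e1 := (((ho.hasDerivAt_graphParam (φ t)).comp t (hφd t ht)).congr_of_eventuallyEq
      (f₁ := id) (Filter.eventually_of_mem hI fun r hr => ((hgh r hr).1).symm)).unique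
      (hasDerivAt_id t)
    have e2 := (((ho.hasDerivAt_graphHeight (φ t)).comp t (hφd t ht)).congr_of_eventuallyEq
      (f₁ := f) (Filter.eventually_of_mem hI fun r hr => ((hgh r hr).2).symm)).unique
      (h.hasDerivAt ht)
    have hsp := hspeed t ht
    set w := (f t - t * deriv f t) / (t ^ 2 + f t ^ 2)
    have hus := ho.pos (φ t)
    have hrs := hr (φ t)
    have hws := Real.sqrt_pos.2 hrs
    have hZ : 0 < gradZ u v (φ t) := by
      by_contra hle
      push Not at hle
      have : u (φ t) * gradZ u v (φ t) / ((u (φ t) ^ 2 + Real.sin (φ t) ^ 2) *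
          √(u (φ t) ^ 2 + Real.sin (φ t) ^ 2)) * w ≤ 0 :=
        mul_nonpos_of_nonpos_of_nonneg (div_nonpos_of_nonpos_of_nonneg
          (mul_nonpos_of_nonneg_of_nonpos hus.le hle) (mul_pos hrs hws).le) hsp.le
      linarith
    refine ⟨hZ, (hgh t ht).1, ?_⟩
    rw [graphSlope, ← e2]
    rw [div_mul_eq_mul_div, div_eq_iff (mul_pos hrs hws).ne', one_mul] at e1
    rw [← e1]
    have hw0 := hsp.ne'
    field_simp
  obtain ⟨hlim1, hlim2⟩ := h.tendsto_profileAngle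
  have hgc : Continuous (graphParam u) :=
    continuous_iff_continuousAt.2 fun s => (ho.hasDerivAt_graphParam s).continuousAt
  have hend1 : graphParam u (Real.pi / 2) = T := by
    refine tendsto_nhds_unique ((hgc.tendsto _).comp hlim1)
      ((tendsto_id.mono_left nhdsWithin_le_nhds).congr' ?_)
    filter_upwards [Ioo_mem_nhdsLT hT] with t ht using ((hgh t ht).1).symm
  have hend2 : graphParam u (-(Real.pi / 2)) = -T := by
    refine tendsto_nhds_unique ((hgc.tendsto _).comp hlim2)
      ((tendsto_id.mono_left nhdsWithin_le_nhds).congr' ?_)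
    filter_upwards [Ioo_mem_nhdsGT hT] with t ht using ((hgh t ht).1).symm
  have hsurj : ∀ s ∈ Ioo (-(Real.pi / 2)) (Real.pi / 2), ∃ t ∈ Ioo (-T) T, φ t = s := by
    intro s hs
    obtain ⟨a, ha, haI⟩ := ((hlim2.eventually (gt_mem_nhds hs.1)).and (Ioo_mem_nhdsGT hT)).exists
    obtain ⟨b, hb, hbI⟩ := ((hlim1.eventually (lt_mem_nhds hs.2)).and (Ioo_mem_nhdsLT hT)).exists
    exact isPreconnected_Ioo.intermediate_value haI hbI
      (fun t ht => (hφd t ht).continuousAt.continuousWithinAt) ⟨ha.le, hb.le⟩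
  have hcontact : v (Real.pi / 2) =
      -(Real.cos θ / Real.sin θ * √(1 + u (Real.pi / 2) ^ 2)) := by
    have h1 := ho.tendsto_arctan (f := f) hlim1 (by
      filter_upwards [Ioo_mem_nhdsLT hT] with t ht using hslope t ht)
    have h2 := (arctan_eq_iff h0 hθ).1 (tendsto_nhds_unique h1 h.angle)
    rw [div_eq_iff (Real.sqrt_pos.2 (by positivity)).ne'] at h2
    linarith
  obtain ⟨hs1, hs2⟩ := ho.symm_of_snd_eq_zero hv00 (Real.pi / 2)
  rw [mul_zero, zero_sub] at hs1 hs2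
  obtain ⟨-, hle⟩ := ho.even_of_contact (by omega)
    (div_nonneg (Real.cos_nonneg_of_mem_Icc ⟨by linarith, hθ⟩)
      (Real.sin_nonneg_of_nonneg_of_le_pi h0.le (by linarith [Real.pi_pos]))) hcontact
    (by rw [hs1]; linarith)
  have hcases : ∀ s ∈ Icc (-(Real.pi / 2)) (Real.pi / 2),
      graphParam u s ∈ Icc (-T) T ∧ f (graphParam u s) = graphHeight u s := by
    intro s hs
    rcases hs.1.eq_or_lt with h1 | h1
    · rw [← h1, hend2, h.left_zero, graphHeight, Real.cos_neg, Real.cos_pi_div_two, zero_div]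
      exact ⟨⟨le_rfl, hT.le⟩, rfl⟩
    rcases hs.2.eq_or_lt with h2 | h2
    · rw [h2, hend1, h.right_zero, graphHeight, Real.cos_pi_div_two, zero_div]
      exact ⟨⟨hT.le, le_rfl⟩, rfl⟩
    obtain ⟨t, ht, rfl⟩ := hsurj s ⟨h1, h2⟩
    rw [(hgh t ht).1, (hgh t ht).2]
    exact ⟨Ioo_subset_Icc_self ht, rfl⟩
  refine ⟨u, v, ⟨ho, hv00, hle, hcontact⟩, halfCone_eq_profileCone hn ho.pos
    (fun s hs => (hcases s hs).1) (fun t ht => ?_) fun s hs => (hcases s hs).2⟩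
  have hpi : -(Real.pi / 2) ≤ Real.pi / 2 := by linarith [Real.pi_pos]
  rcases ht.1.eq_or_lt with h1 | h1
  · exact ⟨_, ⟨le_rfl, hpi⟩, by rw [hend2, h1]⟩
  rcases ht.2.eq_or_lt with h2 | h2
  · exact ⟨_, ⟨hpi, le_rfl⟩, by rw [hend1, h2]⟩
  exact ⟨φ t, ⟨(Real.neg_pi_div_two_lt_arctan _).le, (Real.arctan_lt_pi_div_two _).le⟩,
    (hgh t ⟨h1, h2⟩).1⟩

end FromProfile

/-! ### The cones over the solutions are capillary cones -/

section ContactCone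

variable {n : ℕ} {θ : ℝ} {u v : ℝ → ℝ}

theorem isAxiCone_halfCone (hn : 3 ≤ n) (u : ℝ → ℝ) : IsAxiCone (halfCone n u) where
  rot p hp q h1 h2 h3 := by
    have e1 : planar q = planar p := Complex.ext (by rw [re_planar, re_planar, h3])
      (by rw [im_planar, im_planar, h2])
    have e2 : radius q = radius p := by
      refine (pow_left_inj₀ (radius_nonneg q) (radius_nonneg p) two_ne_zero).1 ?_
      rw [radius_sq hn, radius_sq hn, h1, h2, h3]
    refine ⟨by rw [h3]; exact hp.1, ?_⟩
    rw [polarRadius, polarAngle, e1, e2]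
    exact hp.2
  smul r hr p hp := by
    refine ⟨by rw [height_smul]; exact mul_nonneg hr.le hp.1, ?_⟩
    rw [radius_smul hn hr.le, polarRadius_smul hr.le, polarAngle_smul hr, hp.2, mul_assoc]

theorem isAxisymmetric_halfCone (hn : 3 ≤ n) (u : ℝ → ℝ) : IsAxisymmetric (halfCone n u) :=
  isAxisymmetric_of_mem_of_eq (isAxiCone_halfCone hn u).rot

theorem zero_mem_halfCone (hn : 3 ≤ n) (u : ℝ → ℝ) : (0 : Ambient n) ∈ halfCone n u := by
  refine ⟨le_rfl, ?_⟩
  rw [polarRadius_eq_zero.2 ⟨rfl, rfl⟩, zero_mul]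
  simpa using radius_smul hn (le_refl (0 : ℝ)) (0 : Ambient n)

theorem polarRadius_pos_of_mem_halfCone (hn : 3 ≤ n) {p : Ambient n} (hp : p ∈ halfCone n u)
    (hp0 : p ≠ 0) : 0 < polarRadius p := by
  refine (polarRadius_nonneg p).lt_of_ne fun h1 => hp0 ?_
  obtain ⟨h2, h3⟩ := polarRadius_eq_zero.1 h1.symm
  refine eq_zero_of_coordinates hn ?_ h2 h3
  rw [hp.2, ← h1, zero_mul]

theorem height_pos_or_axial_ne_zero {p : Ambient n} (hz : 0 ≤ height p) (hR : 0 < polarRadius p) :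
    0 < height p ∨ axial p ≠ 0 :=
  hz.eq_or_lt.symm.imp_right fun h1 h2 => hR.ne' (polarRadius_eq_zero.2 ⟨h2, h1.symm⟩)

theorem polarAngle_mem_Icc {p : Ambient n} (hz : 0 ≤ height p) :
    polarAngle p ∈ Icc (-(Real.pi / 2)) (Real.pi / 2) :=
  abs_le.1 (Complex.abs_arg_le_pi_div_two_iff.2 hz)

theorem IsOrbit.isClosed_halfCone {m : ℕ} (hm : 1 ≤ m) (ho : IsOrbit m u v) :
    IsClosed (halfCone n u) := by
  obtain ⟨κ, -, hb⟩ := ho.exists_bounds hm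
  have hcl : IsClosed {p : Ambient n | 0 ≤ height p} := isClosed_le continuous_const continuous_height
  have hc : ContinuousOn (fun p : Ambient n => radius p - polarRadius p * u (polarAngle p))
      {p | 0 ≤ height p} := by
    intro p hp
    refine (continuous_radius.continuousAt.sub ?_).continuousWithinAt
    rcases (polarRadius_nonneg p).eq_or_lt with h1 | h1
    · -- at the axis `r = 0` the angle is discontinuous, but `u` is bounded
      rw [ContinuousAt, ← h1, zero_mul]
      refine squeeze_zero (g := fun x => polarRadius x * κ)
        (fun x => mul_nonneg (polarRadius_nonneg x) (ho.pos _).le)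
        (fun x => mul_le_mul_of_nonneg_left (hb _).2.1 (polarRadius_nonneg x)) ?_
      have h2 := (continuous_polarRadius.tendsto p).mul_const κ
      rwa [← h1, zero_mul] at h2
    · exact continuous_polarRadius.continuousAt.mul (ho.continuous_fst.continuousAt.comp
        (continuousAt_polarAngle (height_pos_or_axial_ne_zero hp h1)))
  have := hc.preimage_isClosed_of_isClosed hcl (isClosed_singleton (x := (0 : ℝ)))
  convert this using 1
  ext p
  rw [mem_inter_iff, mem_preimage, mem_singleton_iff, sub_eq_zero]
  rfl

theorem IsContactOrbit.snd_sq (h : IsContactOrbit (n - 2) θ u v) (h0 : 0 < θ)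
    (hθ : θ ≤ Real.pi / 2) {s : ℝ} (hs : s ∈ Icc (-(Real.pi / 2)) (Real.pi / 2))
    (hc : Real.cos s = 0) : v s ^ 2 = Real.cos θ ^ 2 * (1 + u s ^ 2 + v s ^ 2) := by
  have hsθ : 0 < Real.sin θ := Real.sin_pos_of_pos_of_lt_pi h0 (by linarith [Real.pi_pos])
  have key : v (Real.pi / 2) ^ 2 =
      Real.cos θ ^ 2 * (1 + u (Real.pi / 2) ^ 2 + v (Real.pi / 2) ^ 2) := by
    have h1 : v (Real.pi / 2) ^ 2 * Real.sin θ ^ 2 =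
        Real.cos θ ^ 2 * (1 + u (Real.pi / 2) ^ 2) := by
      rw [h.contact, neg_sq, mul_pow, Real.sq_sqrt (by positivity), div_pow]
      field_simp
    linear_combination h1 - v (Real.pi / 2) ^ 2 * Real.sin_sq_add_cos_sq θ
  have hs' : s = Real.pi / 2 ∨ s = -(Real.pi / 2) := by
    by_contra! h1
    exact (Real.cos_pos_of_mem_Ioo ⟨lt_of_le_of_ne hs.1 h1.2.symm, lt_of_le_of_ne hs.2 h1.1⟩).ne' hc
  rcases hs' with rfl | rfl
  · exact key
  · obtain ⟨h1, h2⟩ := h.toIsOrbit.symm_of_snd_eq_zero h.snd_zero (Real.pi / 2)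
    rw [mul_zero, zero_sub] at h1 h2
    rw [h1, ← neg_sq (v (-(Real.pi / 2))), h2]
    exact key

theorem IsContactOrbit.isCapillaryMinimalCone (hn : 3 ≤ n) (h : IsContactOrbit (n - 2) θ u v)
    (h0 : 0 < θ) (hθ : θ ≤ Real.pi / 2) : IsCapillaryMinimalCone n θ (halfCone n u) where
  isClosed := h.toIsOrbit.isClosed_halfCone (by omega)
  exists_ne_zero := ⟨_, cyl_mem_halfCone hn h.pos (s := 0)
    ⟨by linarith [Real.pi_pos], by linarith [Real.pi_pos]⟩, cyl_ne_zero hn _ _⟩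
  smul_mem r hr p hp := by
    rcases hr.eq_or_lt with rfl | hr
    · rw [zero_smul]
      exact zero_mem_halfCone hn u
    · exact (isAxiCone_halfCone hn u).smul r hr p hp
  height_nonneg p hp := hp.1
  isGraph := by
    obtain ⟨T, f, -, hC⟩ := h.exists_profile hn h0 hθ
    exact ⟨{x | |x ⟨n - 1, by omega⟩| ≤ T * ‖x‖}, fun x => ‖x‖ * f (x ⟨n - 1, by omega⟩ / ‖x‖), hC⟩
  isMinimal := by
    have ho := h.toIsOrbit
    set U : Set (Ambient n) := {p | 0 < radius p ∧ (0 < height p ∨ axial p ≠ 0)} with hU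
    have hUo : IsOpen U := (isOpen_lt continuous_const continuous_radius).inter
      ((isOpen_lt continuous_const continuous_height).union
        (isOpen_ne_fun continuous_axial continuous_const))
    have hRU : ∀ p ∈ U, 0 < polarRadius p := fun p hp =>
      (polarRadius_nonneg p).lt_of_ne fun h1 => by
        obtain ⟨h2, h3⟩ := polarRadius_eq_zero.1 h1.symm
        rcases hp.2 with h4 | h4
        · exact h4.ne' h3
        · exact h4 h2
    have hang : ∀ p : Ambient n, 0 < height p ∨ axial p ≠ 0 →
        ContDiffAt ℝ ∞ (fun x : Ambient n => u (polarAngle x)) p := fun p hp =>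
      ho.contDiff.1.contDiffAt.comp p (contDiffAt_polarAngle hp)
    have hlev : ∀ q ∈ U, radius q = polarRadius q * u (polarAngle q) ↔ levelFunction n u q = 0 :=
      fun q hq => by
        rw [levelFunction, sub_eq_zero, div_eq_iff (hRU q hq).ne', mul_comm]
    have hreg : ∀ q ∈ halfCone n u ∩ U, _ := fun q hq =>
      ho.regular_levelFunction_of_eq_zero hn (hRU q hq.2) ((hlev q hq.2).1 hq.1.2)
        (by
          refine hang _ ?_
          rw [height_cyl hn, axial_cyl hn]
          by_contra! h1
          have h2 := Real.cos_nonneg_of_mem_Icc (polarAngle_mem_Icc hq.1.1)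
          nlinarith [Real.sin_sq_add_cos_sq (polarAngle q), h1.1, h1.2])
        (by
          have hI := polarAngle_mem_Icc hq.1.1
          filter_upwards [Ioo_mem_nhds (show -Real.pi < polarAngle q by linarith [hI.1, Real.pi_pos])
            (show polarAngle q < Real.pi by linarith [hI.2, Real.pi_pos])] with s hs x
          rw [polarAngle_cyl hn x ⟨hs.1, hs.2.le⟩])
    intro p hp hp0
    have hRp := polarRadius_pos_of_mem_halfCone hn hp hp0
    refine ⟨U, levelFunction n u, hUo, ⟨?_, height_pos_or_axial_ne_zero hp.1 hRp⟩,
      fun q hq => (contDiffAt_levelFunction hn hq.1 (hRU q hq) (hang q hq.2)).contDiffWithinAt, ?_,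
      fun q hq => ⟨(hreg q hq).1, (hreg q hq).2.1⟩, fun q hq hqz => ?_⟩
    · rw [hp.2]
      exact mul_pos hRp (ho.pos _)
    · ext q
      exact ⟨fun hq => ⟨hq.2, hq.1.1, (hlev q hq.2).1 hq.1.2⟩,
        fun hq => ⟨⟨hq.2.1, (hlev q hq.1).2 hq.2.2⟩, hq.1⟩⟩
    · obtain ⟨-, -, b, hb, hN⟩ := hreg q hq
      set φ := polarAngle q with hφ
      have hc : Real.cos φ = 0 := by
        have h1 := height_eq q
        rw [hqz] at h1
        exact (mul_eq_zero.1 h1.symm).resolve_left (hRU q hq.2).ne'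
      have hsin : Real.sin φ ^ 2 = 1 := by
        have := Real.sin_sq_add_cos_sq φ; rw [hc] at this; linarith
      rw [hN]
      set N := cyl n 1 (-(u φ * Real.sin φ + v φ * Real.cos φ))
        (-(u φ * Real.cos φ - v φ * Real.sin φ)) with hNdef
      have hNn : ‖N‖ ^ 2 = 1 + u φ ^ 2 + v φ ^ 2 := by
        rw [hNdef, norm_cyl_sq hn, hc]; linear_combination (u φ ^ 2 + v φ ^ 2) * hsin
      have hNz : height N ^ 2 = v φ ^ 2 := by
        rw [hNdef, height_cyl hn, hc]; linear_combination v φ ^ 2 * hsin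
      have hNpos : 0 < ‖N‖ := by
        refine (norm_nonneg N).lt_of_ne fun h1 => ?_
        rw [← h1] at hNn
        nlinarith [sq_nonneg (u φ), sq_nonneg (v φ)]
      have hcθ : 0 ≤ Real.cos θ := Real.cos_nonneg_of_mem_Icc ⟨by linarith, hθ⟩
      have h1 : |height N| = Real.cos θ * ‖N‖ := by
        refine (pow_left_inj₀ (abs_nonneg _) (by positivity) two_ne_zero).1 ?_
        rw [sq_abs, mul_pow, hNz, hNn]
        exact h.snd_sq h0 hθ (polarAngle_mem_Icc hq.1.1) hc
      rw [norm_smul, height_smul, height_smul, Real.norm_eq_abs]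
      simp only [abs_mul, abs_inv, abs_norm, abs_abs]
      rw [h1]
      have : |b| ≠ 0 := abs_ne_zero.2 hb
      field_simp

/-- A vector normal to the cone is proportional to the normal vector at each of the angles `0` and
`π / 2`, and these two normals are not parallel. -/
theorem IsOrbit.not_isFlat_halfCone (hn : 3 ≤ n) (ho : IsOrbit (n - 2) u v) :
    ¬ IsFlat (halfCone n u) := by
  rintro ⟨w, hw0, hw⟩
  have hpi := Real.pi_pos
  have hg : ∀ x : Ambient n, gradient (fun y : Ambient n => ⟪w, y⟫) x = w := fun x =>
    (hasGradientAt_iff_hasFDerivAt.2 ((InnerProductSpace.toDual ℝ (Ambient n) w).hasFDerivAt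
      (x := x))).gradient
  have key : ∀ s ∈ Icc (-(Real.pi / 2)) (Real.pi / 2),
      ∃ b : ℝ, w = b • cyl n 1 (-(gradY u v s)) (-(gradZ u v s)) := by
    intro s hs
    obtain ⟨b, hb⟩ := (isAxiCone_halfCone hn u).gradient_arc hn (F := fun y : Ambient n => ⟪w, y⟫)
      (ho.pos s) (uniqueDiffOn_Icc (by linarith) s hs) (ho.hasDerivAt_fst s).hasDerivWithinAt
      (cyl_mem_halfCone hn ho.pos hs)
      (by filter_upwards [self_mem_nhdsWithin] with r hr using cyl_mem_halfCone hn ho.pos hr)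
      ((InnerProductSpace.toDual ℝ (Ambient n) w).differentiableAt) (Eventually.of_forall hw)
    exact ⟨b, by rw [← hg (cyl n (u s) (Real.sin s) (Real.cos s)), hb]; rfl⟩
  obtain ⟨b, hb⟩ := key 0 ⟨by linarith, by linarith⟩
  obtain ⟨c, hc⟩ := key (Real.pi / 2) ⟨by linarith, le_rfl⟩
  have h1 := hb.symm.trans hc
  rw [smul_cyl, smul_cyl, cyl_inj hn, mul_one, mul_one] at h1
  obtain ⟨rfl, -, h2⟩ := h1
  have h3 := ho.strictAntiOn_gradZ (by omega) ⟨le_rfl, by linarith⟩ ⟨by linarith, le_rfl⟩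
    (show (0 : ℝ) < Real.pi / 2 by linarith)
  have h4 : b = 0 := by
    by_contra h5
    exact h3.ne (neg_injective (mul_left_cancel₀ h5 h2)).symm
  exact hw0 (by rw [hb, h4, zero_smul])

theorem isAxisymmetricCone_iff (hn : 3 ≤ n) (h0 : 0 < θ) (hθ : θ ≤ Real.pi / 2)
    {C : Set (Ambient n)} :
    IsAxisymmetricCone n θ C ↔ ∃ u v, IsContactOrbit (n - 2) θ u v ∧ C = halfCone n u := by
  constructor
  · rintro ⟨T, f, hf, rfl⟩
    obtain ⟨u, v, h, hC⟩ := hf.exists_contactOrbit hn h0 hθ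
    exact ⟨u, v, h, hC.symm⟩
  · rintro ⟨u, v, h, rfl⟩
    exact h.exists_profile hn h0 hθ

end ContactCone

end CapillaryCone

end

theorem theorem1p5 (n : ℕ) (hn : 3 ≤ n) :
    (∀ θ : ℝ, 0 < θ → θ ≤ Real.pi / 2 →
      (∃! C : Set (Ambient n), IsAxisymmetricCone n θ C) ∧
      ∀ C : Set (Ambient n),
        (IsCapillaryMinimalCone n θ C ∧ IsAxisymmetric C ∧ ¬ IsFlat C) ↔
          IsAxisymmetricCone n θ C) ∧
    (∀ S : Set (Ambient n),
      (IsClosedMinimalHypersurface n S ∧ IsAxisymmetric S) ↔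
        (S = cliffordTorus n ∨
          ∃ a b : ℝ, a ^ 2 + b ^ 2 = 1 ∧ S = equatorialSphere n a b)) := by
  refine ⟨fun θ h0 hθ => ⟨?_, fun C => ?_⟩, fun S => ⟨fun ⟨h, hax⟩ =>
    h.eq_cliffordTorus_or hn hax, ?_⟩⟩
  · obtain ⟨u, v, h⟩ := exists_isContactOrbit (m := n - 2) (by omega) h0 hθ
    refine ⟨halfCone n u, (isAxisymmetricCone_iff hn h0 hθ).2 ⟨u, v, h, rfl⟩, fun C hC => ?_⟩
    obtain ⟨p, q, h', rfl⟩ := (isAxisymmetricCone_iff hn h0 hθ).1 hC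
    rw [(h'.eq (by omega) h).1]
  · rw [isAxisymmetricCone_iff hn h0 hθ]
    constructor
    · rintro ⟨h, hax, hflat⟩
      exact h.exists_contactOrbit hn hax hflat h0 hθ
    · rintro ⟨u, v, h, rfl⟩
      exact ⟨h.isCapillaryMinimalCone hn h0 hθ, isAxisymmetric_halfCone hn u,
        h.toIsOrbit.not_isFlat_halfCone hn⟩
  · rintro (rfl | ⟨a, b, hab, rfl⟩)
    · exact ⟨isClosedMinimalHypersurface_cliffordTorus hn, isAxisymmetric_cliffordTorus hn⟩
    · exact ⟨isClosedMinimalHypersurface_equatorialSphere hn hab,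
        isAxisymmetric_equatorialSphere a b⟩
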